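/- Let $(M^\circ,g)$ be an asymptotically conic manifold of dimension $n$: $M^\circ$ is the interior of a compact manifold $M$ with boundary, $x$ is a boundary defining function, and in a collar $[0,\epsilon)_x\times\partial M$ one has $g=dx^2/x^4+h(x)/x^2$ with $h(x)$ a family of metrics on $\partial M$, smooth up to $x=0$. Let $g_b=x^2g$, and for $k_0>0$ let $M^2_{k,\mathrm{sc}}$ be the space obtained from $[0,k_0]_k\times M\times M$ by blowing up $\{0\}\times\partial M\times\partial M$ (new face $\mathrm{bf}_0$), then $\{0\}\times M\times\partial M$ (face $\mathrm{rb}_0$), $\{0\}\times\partial M\times M$ (face $\mathrm{lb}_0$) and $[0,k_0]\times\partial M\times\partial M$ (face $\mathrm{bf}$), and finally the intersection of the lifted diagonal with $\mathrm{bf}$ (face $\mathrm{sc}$). The lifts of $\{k=0\}$, $[0,k_0]\times\partial M\times M$ and $[0,k_0]\times M\times\partial M$ are $\mathrm{zf}$, $\mathrm{lb}$ and $\mathrm{rb}$. Write $\rho_{\mathrm f}$ for a boundary defining function of the face $\mathrm f$, and $\Delta_{k,\mathrm{sc}}$ for the lifted diagonal. An index set is a set $E\subset\mathbb C\times\mathbb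 N_0$ with finitely many elements in each half-plane $\operatorname{Re}\beta\le s$, such that $(\beta,j)\in E$ implies $(\beta+1,j)\in E$ and, if $j>0$, $(\beta,j-1)\in E$. For $q\in\mathbb R$, $E\ge q$ means that every $(\beta,j)\in E$ has $\operatorname{Re}\beta\ge q$, with $j=0$ if $\operatorname{Re}\beta=q$; $E>q$ means $E\ge q+\varepsilon$ for some $\varepsilon>0$. The index set $\{(q+i,0):i\in\mathbb N_0\}$ is denoted $q$. For $m<0$ and real $a_{\mathrm{bf}_0},a_{\mathrm{zf}},a_{\mathrm{sc}}$, and an index family $\mathcal A=(\mathcal A_{\mathrm f})_{\mathrm f}$ on the eight faces with $\mathcal A_{\mathrm{lb}}=\mathcal A_{\mathrm{rb}}=\mathcal A_{\mathrm{bf}}=\emptyset$ and with $\mathcal A_{\mathrm{bf}_0},\mathcal A_{\mathrm{zf}},\mathcal A_{\mathrm{sc}}$ containing the index sets $a_{\mathrm{bf}_0},a_{\mathrm{zf}},a_{\mathrm{sc}}$ respectively, let $\Psi_{k,\mathrm{sc}}^{m,(a_{\mathrm{bf}_0},a_{\mathrm{zf}},a_{\mathrm{sc}}),\mathcal A}$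 be the class of half-density kernels $K\otimes|dg_b\,dg_b'\,dk/k|^{1/2}$ with $K=K_1+K_2$, where $\rho_{\mathrm{bf}_0}^{-a_{\mathrm{bf}_0}}\rho_{\mathrm{zf}}^{-a_{\mathrm{zf}}}\rho_{\mathrm{sc}}^{n-a_{\mathrm{sc}}}K_1$ is supported near $\Delta_{k,\mathrm{sc}}$ and conormal to it with symbol of order $m$, uniformly up to the boundary, and $\rho_{\mathrm{sc}}^{n}K_2$ is smooth in the interior of $M^2_{k,\mathrm{sc}}$ and polyhomogeneous conormal at the boundary with index family $\mathcal A$. For $k\in(0,k_0)$ such a kernel defines the operator $$A(k)f(z)=\int_{M^\circ}K(k,z,z')\,(x(z)\,x(z'))^{n/2}f(z')\,dg(z').$$ **Proposition.** Let $\alpha>0$, $0<\beta<n$, $a\in\mathbb R$, and let $A=A(k)\in\Psi_{k,\mathrm{sc}}^{-1,(a,0,0),\mathcal A}$, where $$\mathcal A_{\mathrm{lb}}=\mathcal A_{\mathrm{rb}}=\mathcal A_{\mathrm{bf}}=\emptyset,\quad \mathcal A_{\mathrm{bf}_0}>-1,\quad \mathcal A_{\mathrm{sc}}\ge0,\quad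 \mathcal A_{\mathrm{zf}}>-1,\quad \mathcal A_{\mathrm{rb}_0}\ge\tfrac n2-1-\alpha,\quad \mathcal A_{\mathrm{lb}_0}\ge\tfrac n2-1-\beta .$$ (Since $\mathcal A_{\mathrm{bf}_0}$ contains the index set $a$, this forces $a>-1$.) Then for $$\frac n{n-\beta}<p<\frac n\alpha$$ the operator $\int_0^{k_0}A(k)\,dk$ is bounded on $L^p(M^\circ,dg)$: there is a constant $C$ such that for every $f\in L^p(M^\circ,dg)$ the integral $\int_0^{k_0}A(k)f(z)\,dk$ converges absolutely (as an integral over $(k,z')$) for almost every $z$, and its $L^p$ norm is at most $C\|f\|_{L^p}$. -/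

import Mathlib

open scoped Manifold ContDiff

noncomputable section

namespace LowEnergy

/-! ## Index sets -/

/-- An index set: a set of exponents `(β, j)`, standing for the terms `ρ ^ β * (log ρ) ^ j`. -/
structure IndexSet where
  carrier : Set (ℂ × ℕ)
  finite_re_le : ∀ s : ℝ, {e | e ∈ carrier ∧ e.1.re ≤ s}.Finite
  add_one_mem : ∀ β j, (β, j) ∈ carrier → (β + 1, j) ∈ carrier
  pred_mem : ∀ β j, (β, j + 1) ∈ carrier → (β, j) ∈ carrier

namespace IndexSet

/-- The index set `{(q + i, 0) : i = 0, 1, 2, …}`, written `q` for short. -/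
def ofReal (q : ℝ) : IndexSet where
  carrier := {e | ∃ i : ℕ, e = (((q + i : ℝ) : ℂ), 0)}
  finite_re_le := by
    intro s
    refine ((Set.finite_le_nat ⌈s - q⌉₊).image (fun i : ℕ => (((q + i : ℝ) : ℂ), 0))).subset ?_
    rintro e ⟨⟨i, rfl⟩, hs⟩
    refine ⟨i, ?_, rfl⟩
    simp only [Complex.ofReal_re] at hs
    have h1 : (i : ℝ) ≤ ⌈s - q⌉₊ := le_trans (by linarith) (Nat.le_ceil _)
    exact_mod_cast h1
  add_one_mem := by
    rintro β j ⟨i, h⟩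
    simp only [Prod.mk.injEq] at h
    obtain ⟨rfl, rfl⟩ := h
    exact ⟨i + 1, by push_cast; simp [add_assoc]⟩
  pred_mem := by
    rintro β j ⟨i, h⟩
    simp at h

/-- The translate `{(β + c, j) : (β, j) ∈ E}`: a function has index set `E.shift c` exactly when
it is `ρ ^ c` times a function with index set `E`. -/
def shift (E : IndexSet) (c : ℝ) : IndexSet where
  carrier := {e | (e.1 - (c : ℂ), e.2) ∈ E.carrier}
  finite_re_le := by
    intro s
    refine ((E.finite_re_le (s - c)).image (fun e => (e.1 + (c : ℂ), e.2))).subset ?_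
    rintro e ⟨he, hs⟩
    refine ⟨(e.1 - (c : ℂ), e.2), ⟨he, ?_⟩, by simp⟩
    simpa using hs
  add_one_mem := by
    intro β j h
    have := E.add_one_mem _ _ h
    simpa [sub_add_eq_add_sub] using this
  pred_mem := by
    intro β j h
    exact E.pred_mem _ _ h

/-- `E ≥ q`: every `(β, j) ∈ E` has `Re β ≥ q`, and `j = 0` if `Re β = q`. -/
def Ge (E : IndexSet) (q : ℝ) : Prop :=
  ∀ e ∈ E.carrier, q ≤ e.1.re ∧ (e.1.re = q → e.2 = 0)

/-- `E > q`: there is `ε > 0` with `E ≥ q + ε`. -/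
def Gt (E : IndexSet) (q : ℝ) : Prop := ∃ ε > 0, E.Ge (q + ε)

end IndexSet

/-! ## Asymptotically conic manifolds -/

/-- The model space `ℝ × ℝ ^ d` of an `n`-dimensional manifold, `n = d + 1`. -/
abbrev Model (d : ℕ) := ℝ × EuclideanSpace ℝ (Fin d)

/-- The standard basis of `ℝ × ℝ ^ d`. -/
def modelBasis (d : ℕ) : Fin (d + 1) → Model d :=
  Fin.cons (1, 0) (fun i => (0, EuclideanSpace.single i 1))

/-- The differential of a real function, applied to a tangent vector. -/
def scalarDiff {d : ℕ} {X : Type*} [TopologicalSpace X] [ChartedSpace (Model d) X]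
    (f : X → ℝ) (z : X) (v : TangentSpace 𝓘(ℝ, Model d) z) : ℝ :=
  mfderiv 𝓘(ℝ, Model d) 𝓘(ℝ, ℝ) f z v

/-- An asymptotically conic manifold `(X, g)` of dimension `n = d + 1`.  `X` is the interior of the
compact manifold with boundary `M = X ∪ ({0} × S)`, whose smooth structure at the boundary `S` is
the one given by the collar `[0, ε) × S`; `x` is a boundary defining function.  In the collar,
`g = dx² / x⁴ + h(x) / x²`, where `h` is a family of metrics on `S`, smooth up to `x = 0`.
`S` need not be connected, so `X` may have several ends. -/
structure AsymptoticallyConic (d : ℕ) (X S : Type*)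
    [TopologicalSpace X] [ChartedSpace (Model d) X] [IsManifold 𝓘(ℝ, Model d) ∞ X]
    [TopologicalSpace S] [ChartedSpace (EuclideanSpace ℝ (Fin d)) S]
    [IsManifold 𝓘(ℝ, EuclideanSpace ℝ (Fin d)) ∞ S] where
  g : Bundle.ContMDiffRiemannianMetric 𝓘(ℝ, Model d) ∞ (Model d)
    (fun z : X => TangentSpace 𝓘(ℝ, Model d) z)
  x : X → ℝ
  x_pos : ∀ z, 0 < x z
  x_smooth : ContMDiff 𝓘(ℝ, Model d) 𝓘(ℝ, ℝ) ∞ x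
  ε : ℝ
  ε_pos : 0 < ε
  /-- The collar, as the map `z ↦ (x, y)` onto `(0, ε) × S`. -/
  collar : OpenPartialHomeomorph X (ℝ × S)
  collar_target : collar.target = Set.Ioo 0 ε ×ˢ Set.univ
  collar_fst : ∀ z ∈ collar.source, (collar z).1 = x z
  collar_smooth : ContMDiffOn 𝓘(ℝ, Model d) (𝓘(ℝ, ℝ).prod 𝓘(ℝ, EuclideanSpace ℝ (Fin d))) ∞
    collar collar.source
  collar_symm_smooth : ContMDiffOn (𝓘(ℝ, ℝ).prod 𝓘(ℝ, EuclideanSpace ℝ (Fin d))) 𝓘(ℝ, Model d) ∞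
    collar.symm collar.target
  isCompact_core : ∀ r ∈ Set.Ioo 0 ε, IsCompact {z | z ∈ collar.source → r ≤ x z}
  h : ℝ → (y : S) → TangentSpace 𝓘(ℝ, EuclideanSpace ℝ (Fin d)) y →L[ℝ]
    TangentSpace 𝓘(ℝ, EuclideanSpace ℝ (Fin d)) y →L[ℝ] ℝ
  h_symm : ∀ t ∈ Set.Ico 0 ε, ∀ y v w, h t y v w = h t y w v
  h_pos : ∀ t ∈ Set.Ico 0 ε, ∀ y v, v ≠ 0 → 0 < h t y v v
  h_smooth : ∀ ψ ∈ IsManifold.maximalAtlas 𝓘(ℝ, EuclideanSpace ℝ (Fin d)) ∞ S, ∀ i j : Fin d,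
    ContDiffOn ℝ ∞ (fun q : ℝ × EuclideanSpace ℝ (Fin d) => h q.1 (ψ.symm q.2)
      (mfderiv 𝓘(ℝ, EuclideanSpace ℝ (Fin d)) 𝓘(ℝ, EuclideanSpace ℝ (Fin d)) ψ.symm q.2
        (EuclideanSpace.single i 1 : EuclideanSpace ℝ (Fin d)))
      (mfderiv 𝓘(ℝ, EuclideanSpace ℝ (Fin d)) 𝓘(ℝ, EuclideanSpace ℝ (Fin d)) ψ.symm q.2
        (EuclideanSpace.single j 1 : EuclideanSpace ℝ (Fin d))))
      (Set.Ico 0 ε ×ˢ ψ.target)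
  metric_eq : ∀ z ∈ collar.source, ∀ v w : TangentSpace 𝓘(ℝ, Model d) z,
    g.inner z v w =
      scalarDiff x z v * scalarDiff x z w / x z ^ 4
        + h (x z) (collar z).2
          (mfderiv 𝓘(ℝ, Model d) 𝓘(ℝ, EuclideanSpace ℝ (Fin d)) (fun z' => (collar z').2) z v)
          (mfderiv 𝓘(ℝ, Model d) 𝓘(ℝ, EuclideanSpace ℝ (Fin d)) (fun z' => (collar z').2) z w)
          / x z ^ 2

/-! ## Boundary hypersurfaces of the blown-up space

The space `M²_{k,sc}` is obtained from `[0, k₀] × M × M` by blowing up `{0} × ∂M × ∂M`, then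
`{0} × M × ∂M`, `{0} × ∂M × M` and `[0, k₀] × ∂M × ∂M`, and then the boundary at `bf` of the lifted
diagonal.  Kernels on it are functions on its interior, `(0, k₀) × X × X`; conditions at its
boundary are uniform conditions in coordinates adapted to it. -/

/-- The boundary hypersurfaces of `M²_{k,sc}`. -/
inductive Face
  | zf | bf0 | lb0 | rb0 | lb | rb | bf | sc
  deriving DecidableEq

instance : Fintype Face where
  elems := {.zf, .bf0, .lb0, .rb0, .lb, .rb, .bf, .sc}
  complete := by intro H; cases H <;> simp

/-- Boundary defining functions of the hypersurfaces, in terms of `k`, `x`, `x'` and a boundary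
defining function `σ` of `sc`.  All but that of `bf` are the usual ones of the total blow-up of the
corner `k = x = x' = 0`; the function `(x + x') / (k + x + x')` lifts to the product of those of
`bf` and `sc`. -/
def rho (σ k x x' : ℝ) : Face → ℝ
  | .zf => k * (k + x + x') / ((k + x) * (k + x'))
  | .bf0 => k + x + x'
  | .lb0 => (k + x) / (k + x + x')
  | .rb0 => (k + x') / (k + x + x')
  | .lb => x * (k + x + x') / ((k + x) * (x + x'))
  | .rb => x' * (k + x + x') / ((k + x') * (x + x'))
  | .bf => (x + x') / (k + x + x') / σ
  | .sc => σ

/-- Uniform bounds for the derivatives of all orders of `G` on `R`: the `N`-th derivative in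
directions `ξ₁, …, ξ_N` is at most `C_N * W * |ξ₁| ⋯ |ξ_N|`, where the length `|ξ| = len p ξ` of
a vector may depend on the point `p`. -/
def DerivBound {E : Type*} [NormedAddCommGroup E] [NormedSpace ℝ E]
    (G : E → ℂ) (R : Set E) (W : E → ℝ) (len : E → E → ℝ) : Prop :=
  ∀ N : ℕ, ∃ C : ℝ, ∀ p ∈ R, ∀ ξ : Fin N → E,
    ‖iteratedFDeriv ℝ N G p ξ‖ ≤ C * W p * ∏ i, len p (ξ i)

/-- The operator `∏ (V - z)` over the entries `(z, j)` of the list `l`, applied to `F`, where `V` is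
a vector field. -/
def applyFactors {E : Type*} [NormedAddCommGroup E] [NormedSpace ℝ E]
    (V : E → E) (l : List (ℂ × ℕ)) (F : E → ℂ) : E → ℂ :=
  l.foldr (fun e G p => fderiv ℝ G p (V p) - e.1 * G p) F

/-- Points `(log k, u, v)` of a logarithmic coordinate system on the interior. -/
abbrev Pt (d : ℕ) := ℝ × Model d × Model d

/-- A coordinate system on part of the interior of `M²_{k,sc}`, with coordinates
`p = (log k, u, v)`; `left p` and `right p` are the two points of `X`, `region` is the
part on which uniform estimates are made, `scSize` is comparable to a boundary defining function
of `sc`, and `eL`, `eR` are the vector fields `x ∂_x`, `x' ∂_{x'}` (where these make sense). -/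
structure BlowupCoords (d : ℕ) (X : Type*) where
  left : Pt d → X
  right : Pt d → X
  region : Set (Pt d)
  scSize : Pt d → ℝ
  eL : Pt d
  eR : Pt d

namespace BlowupCoords

variable {d : ℕ} {X : Type*}

/-- A vector field of the form `ρ_H ∂_{ρ_H}` near the hypersurface `H`.  Here `(1, 0, 0)` is
`k ∂_k`.  At `sc`, the centre of the blow-up is `x / k = 0`, `v = 0`, and the field is
`(x/k) ∂_{x/k} + v ∂_v`. -/
def vectorField (c : BlowupCoords d X) : Face → Pt d → Pt d
  | .zf, _ => (1, 0, 0)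
  | .lb, _ => c.eL
  | .rb, _ => c.eR
  | .lb0, _ => (1, 0, 0) + c.eL
  | .rb0, _ => (1, 0, 0) + c.eR
  | .bf, _ => c.eL + c.eR
  | .bf0, _ => (1, 0, 0) + c.eL + c.eR
  | .sc, p => c.eL + c.eR + (0, 0, p.2.2)

/-- The boundary defining functions in these coordinates. -/
def bdf (c : BlowupCoords d X) (x : X → ℝ) (p : Pt d) : Face → ℝ :=
  rho (c.scSize p) (Real.exp p.1) (x (c.left p)) (x (c.right p))

/-- A kernel in these coordinates. -/
def pull (c : BlowupCoords d X) (K : ℝ → X → X → ℂ) (p : Pt d) : ℂ :=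
  K (Real.exp p.1) (c.left p) (c.right p)

/-- `G` is conormal with weights `w` on `R`: after applying any number of vector fields tangent to
the boundary it is `O(∏ ρ_H ^ w_H)`.  These vector fields are spanned by `∂_{log k}`, `∂_u` and
`ρ_sc ∂_v`. -/
def ConormalBound (c : BlowupCoords d X) (x : X → ℝ) (G : Pt d → ℂ) (R : Set (Pt d))
    (w : Face → ℝ) : Prop :=
  DerivBound G R (fun p => ∏ H, c.bdf x p H ^ w H)
    (fun p ξ => ‖ξ.1‖ + ‖ξ.2.1‖ + ‖ξ.2.2‖ / c.scSize p)

/-- Polyhomogeneity in these coordinates with index family `𝓔`, with fixed weights `w`: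
the kernel is smooth in the interior, conormal at the boundary, and for each hypersurface `H` and
each real `s`, the product of the `V_H - z` over `(z, j) ∈ 𝓔 H` with `Re z ≤ s`, applied to the
kernel, is, near `H`, of order `s` at `H`, with unchanged weights at the other hypersurfaces
(all of this in the conormal sense). -/
def IsPhg (c : BlowupCoords d X) (x : X → ℝ) (𝓔 : Face → IndexSet) (w : Face → ℝ)
    (K : ℝ → X → X → ℂ) : Prop :=
  (∀ p ∈ c.region, ContDiffAt ℝ ∞ (c.pull K) p) ∧
  c.ConormalBound x (c.pull K) c.region w ∧
  ∀ (H : Face) (s : ℝ) (l : List (ℂ × ℕ)), l.Nodup →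
    (∀ e, e ∈ l ↔ e ∈ (𝓔 H).carrier ∧ e.1.re ≤ s) →
    ∃ δ > 0, c.ConormalBound x (applyFactors (c.vectorField H) l (c.pull K))
      {p | p ∈ c.region ∧ c.bdf x p H < δ} (Function.update w H s)

end BlowupCoords

namespace AsymptoticallyConic

variable {d : ℕ} {X S : Type*}
  [TopologicalSpace X] [ChartedSpace (Model d) X] [IsManifold 𝓘(ℝ, Model d) ∞ X]
  [TopologicalSpace S] [ChartedSpace (EuclideanSpace ℝ (Fin d)) S]
  [IsManifold 𝓘(ℝ, EuclideanSpace ℝ (Fin d)) ∞ S]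

/-! ### Riemannian measure -/

/-- The Riemannian density `√det(g_ij)` in a chart. -/
def chartDensity (G : AsymptoticallyConic d X S) (φ : OpenPartialHomeomorph X (Model d))
    (u : Model d) : ℝ :=
  Real.sqrt (Matrix.det (Matrix.of fun i j : Fin (d + 1) =>
    G.g.inner (φ.symm u)
      (mfderiv 𝓘(ℝ, Model d) 𝓘(ℝ, Model d) φ.symm u (modelBasis d i))
      (mfderiv 𝓘(ℝ, Model d) 𝓘(ℝ, Model d) φ.symm u (modelBasis d j))))

/-- The Riemannian measure of the domain of a chart. -/
def chartVolume [MeasurableSpace X] (G : AsymptoticallyConic d X S)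
    (φ : OpenPartialHomeomorph X (Model d)) : MeasureTheory.Measure X :=
  ((MeasureTheory.volume.restrict φ.target).withDensity
    (fun u => ENNReal.ofReal (G.chartDensity φ u))).map φ.symm

/-- The Riemannian measure `dg`.  The measures `chartVolume` agree where chart domains overlap, so
that their supremum is the measure which restricts to each of them. -/
def vol [MeasurableSpace X] (G : AsymptoticallyConic d X S) : MeasureTheory.Measure X :=
  ⨆ φ : IsManifold.maximalAtlas 𝓘(ℝ, Model d) ∞ X, G.chartVolume φ.1

/-! ### Coordinates -/

/-- The coordinates `(log x, ψ(y))` in the collar, for a chart `ψ` of `S`. -/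
def collarChart (G : AsymptoticallyConic d X S)
    (ψ : OpenPartialHomeomorph S (EuclideanSpace ℝ (Fin d))) :
    OpenPartialHomeomorph X (Model d) :=
  G.collar.trans (Real.expPartialHomeomorph.symm.prod ψ)

/-- The part `x ≤ r`, `y ∈ L` of the collar. -/
def collarSet (G : AsymptoticallyConic d X S) (r : ℝ) (L : Set S) : Set X :=
  {z | z ∈ G.collar.source ∧ G.x z ≤ r ∧ (G.collar z).2 ∈ L}

/-- A chart of `X` together with a subset of its domain which is the interior part of a compact
subset of `M`: a compact subset of the domain of any chart of `X`, or the part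
`x ≤ r`, `y ∈ L` of the domain of a collar chart, with `L` a compact subset of the domain of a chart
of `S`. -/
inductive IsPiece (G : AsymptoticallyConic d X S) :
    OpenPartialHomeomorph X (Model d) → Set X → Prop
  | interior (φ : OpenPartialHomeomorph X (Model d)) (P : Set X)
      (hφ : φ ∈ IsManifold.maximalAtlas 𝓘(ℝ, Model d) ∞ X)
      (hP : IsCompact P) (hPφ : P ⊆ φ.source) : IsPiece G φ P
  | collar (ψ : OpenPartialHomeomorph S (EuclideanSpace ℝ (Fin d))) (L : Set S) (r : ℝ)
      (hψ : ψ ∈ IsManifold.maximalAtlas 𝓘(ℝ, EuclideanSpace ℝ (Fin d)) ∞ S)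
      (hL : IsCompact L) (hLψ : L ⊆ ψ.source) (hr : r ∈ Set.Ioo 0 G.ε) :
      IsPiece G (G.collarChart ψ) (G.collarSet r L)

/-- Coordinates `(log k, u, u')` over a product `P × P'`, to be used away from `sc`. -/
def sepCoords (k₀ : ℝ) (φ : OpenPartialHomeomorph X (Model d)) (P : Set X)
    (φ' : OpenPartialHomeomorph X (Model d)) (P' : Set X) : BlowupCoords d X where
  left p := φ.symm p.2.1
  right p := φ'.symm p.2.2
  region := {p | p.1 < Real.log k₀ ∧ p.2.1 ∈ φ '' P ∧ p.2.2 ∈ φ' '' P'}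
  scSize _ := 1
  eL := (0, (1, 0), 0)
  eR := (0, 0, (1, 0))

/-- Coordinates `(log k, u, u' - u)` over a product `P × P`, where `φ` is a collar chart,
`u = (log x, ψ(y))` and `u' = (log x', ψ(y'))`.  The centre of the last blow-up is
`(x + x') / (k + x + x') = 0`, `u' - u = 0`. -/
def diagCoords (G : AsymptoticallyConic d X S) (k₀ : ℝ)
    (φ : OpenPartialHomeomorph X (Model d)) (P : Set X) : BlowupCoords d X where
  left p := φ.symm p.2.1
  right p := φ.symm (p.2.1 + p.2.2)
  region := {p | p.1 < Real.log k₀ ∧ p.2.1 ∈ φ '' P ∧ p.2.1 + p.2.2 ∈ φ '' P}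
  scSize p :=
    min 1 ((G.x (φ.symm p.2.1) + G.x (φ.symm (p.2.1 + p.2.2)))
      / (Real.exp p.1 + G.x (φ.symm p.2.1) + G.x (φ.symm (p.2.1 + p.2.2))) + ‖p.2.2‖)
  eL := (0, (1, 0), (-1, 0))
  eR := (0, 0, (1, 0))

/-- `K` is smooth in the interior of `M²_{k,sc}` and polyhomogeneous conormal at the boundary with
index family `𝓔`.  Here `M × M` is covered by products of pieces over which only the diagonal
coordinates are needed, or whose closures are disjoint at the boundary of the diagonal. -/
def IsPolyhomogeneous (G : AsymptoticallyConic d X S) (k₀ : ℝ) (𝓔 : Face → IndexSet)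
    (K : ℝ → X → X → ℂ) : Prop :=
  ∃ w : Face → ℝ,
    (∀ φ P φ' P', G.IsPiece φ P → G.IsPiece φ' P' →
      (IsCompact P ∨ IsCompact P' ∨ Disjoint P P') →
      (sepCoords k₀ φ P φ' P').IsPhg G.x 𝓔 w K) ∧
    (∀ ψ ∈ IsManifold.maximalAtlas 𝓘(ℝ, EuclideanSpace ℝ (Fin d)) ∞ S, ∀ L : Set S,
      IsCompact L → L ⊆ ψ.source → ∀ r ∈ Set.Ioo 0 G.ε,
      (G.diagCoords k₀ (G.collarChart ψ) (G.collarSet r L)).IsPhg G.x 𝓔 w K)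

/-! ### Conormality at the lifted diagonal -/

/-- `K = weight * U(b, W)` in coordinates `b = base k z` along the lifted diagonal and
`W = fib k z z'` across it, defined for `z, z'` in the open set `D`, where `U` is conormal of order
`m` to `W = 0`, uniformly in `b`: its Fourier transform in `W` is a symbol of order `m`.
The kernel vanishes outside `Q`.  (For orders `m < 0`, which is all that is used,
such a `U` is an integrable function of `W`, smooth for `W ≠ 0`.) -/
def IsConormalPiece (k₀ m : ℝ) (D : Set X) (Q : Set (ℝ × X × X))
    (base : ℝ → X → ℝ × Model d) (fib : ℝ → X → X → Model d) (weight : ℝ → X → ℝ)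
    (K : ℝ → X → X → ℂ) : Prop :=
  ∃ (U : ℝ × Model d → Model d → ℂ) (B : Set (ℝ × Model d)) (a : (ℝ × Model d) × Model d → ℂ),
    B = {b | ∃ k ∈ Set.Ioo 0 k₀, ∃ z ∈ D, base k z = b} ∧
    ContDiffOn ℝ ∞ (fun q : (ℝ × Model d) × Model d => U q.1 q.2) (B ×ˢ {0}ᶜ) ∧
    (∀ b ∈ B, MeasureTheory.Integrable (U b)) ∧
    (∀ b ∈ B, ∀ ξ : Model d, a (b, ξ) =
      ∫ W : Model d,
        Complex.exp (-Complex.I * ((W.1 * ξ.1 + inner ℝ W.2 ξ.2 : ℝ) : ℂ)) * U b W) ∧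
    ContDiffOn ℝ ∞ a (B ×ˢ Set.univ) ∧
    DerivBound a (B ×ˢ Set.univ) (fun q => (1 + ‖q.2‖) ^ m)
      (fun q η => ‖η.1‖ + ‖η.2‖ / (1 + ‖q.2‖)) ∧
    (∀ k ∈ Set.Ioo 0 k₀, ∀ z ∈ D, ∀ W, W ≠ 0 → U (base k z) W ≠ 0 →
      ∃ z' ∈ D, fib k z z' = W ∧ (k, z, z') ∈ Q) ∧
    (∀ k ∈ Set.Ioo 0 k₀, ∀ z z', z ≠ z' →
      (z ∈ D → z' ∈ D → K k z z' = (weight k z : ℂ) * U (base k z) (fib k z z')) ∧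
      (¬ (z ∈ D ∧ z' ∈ D) → K k z z' = 0))

/-- A kernel supported in one of three kinds of coordinate neighbourhoods of points of the lifted
diagonal, and equal there to
`ρ_bf0 ^ abf0 * ρ_zf ^ azf * ρ_sc ^ (asc - n)` times a distribution conormal of order `m`. -/
inductive IsConormalLocal (G : AsymptoticallyConic d X S) (k₀ m abf0 azf asc : ℝ) :
    (ℝ → X → X → ℂ) → Prop
  /-- Over the interior of `M`: coordinates `k` and `u = φ(z)` along, `u' - u` across. -/
  | interior (K : ℝ → X → X → ℂ) (φ : OpenPartialHomeomorph X (Model d)) (P : Set X)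
      (hφ : φ ∈ IsManifold.maximalAtlas 𝓘(ℝ, Model d) ∞ X)
      (hP : IsCompact P) (hPφ : P ⊆ φ.source)
      (hK : IsConormalPiece k₀ m φ.source {q | q.2.1 ∈ P ∧ q.2.2 ∈ P}
        (fun k z => (k, φ z)) (fun _ z z' => φ z' - φ z) (fun k _ => k ^ azf) K) :
      IsConormalLocal G k₀ m abf0 azf asc K
  /-- Near `zf ∩ bf0`: coordinates `k / x`, `x`, `ψ(y)` along, and
  `(log (x' / x), ψ(y') - ψ(y))` across. -/
  | nearZf (K : ℝ → X → X → ℂ) (ψ : OpenPartialHomeomorph S (EuclideanSpace ℝ (Fin d)))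
      (L : Set S) (r c R : ℝ)
      (hψ : ψ ∈ IsManifold.maximalAtlas 𝓘(ℝ, EuclideanSpace ℝ (Fin d)) ∞ S)
      (hL : IsCompact L) (hLψ : L ⊆ ψ.source) (hr : r ∈ Set.Ioo 0 G.ε)
      (hK : IsConormalPiece k₀ m (G.collarChart ψ).source
        {q | q.2.1 ∈ G.collarSet r L ∧ q.2.2 ∈ G.collarSet r L ∧ q.1 ≤ c * G.x q.2.1 ∧
          ‖G.collarChart ψ q.2.2 - G.collarChart ψ q.2.1‖ ≤ R}
        (fun k z => (k / G.x z, G.x z, ψ (G.collar z).2))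
        (fun _ z z' => G.collarChart ψ z' - G.collarChart ψ z)
        (fun k z => G.x z ^ abf0 * (k / G.x z) ^ azf) K) :
      IsConormalLocal G k₀ m abf0 azf asc K
  /-- Near `sc`: coordinates `x / k`, `k`, `ψ(y)` along, and
  `(k / x) * (log (x' / x), ψ(y') - ψ(y))` across. -/
  | nearSc (K : ℝ → X → X → ℂ) (ψ : OpenPartialHomeomorph S (EuclideanSpace ℝ (Fin d)))
      (L : Set S) (r c R : ℝ)
      (hψ : ψ ∈ IsManifold.maximalAtlas 𝓘(ℝ, EuclideanSpace ℝ (Fin d)) ∞ S)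
      (hL : IsCompact L) (hLψ : L ⊆ ψ.source) (hr : r ∈ Set.Ioo 0 G.ε)
      (hK : IsConormalPiece k₀ m (G.collarChart ψ).source
        {q | q.2.1 ∈ G.collarSet r L ∧ q.2.2 ∈ G.collarSet r L ∧ G.x q.2.1 ≤ c * q.1 ∧
          ‖(q.1 / G.x q.2.1) • (G.collarChart ψ q.2.2 - G.collarChart ψ q.2.1)‖ ≤ R}
        (fun k z => (G.x z / k, k, ψ (G.collar z).2))
        (fun k z z' => (k / G.x z) • (G.collarChart ψ z' - G.collarChart ψ z))
        (fun k z => k ^ abf0 * (G.x z / k) ^ (asc - ((d : ℝ) + 1))) K) :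
      IsConormalLocal G k₀ m abf0 azf asc K

/-- A kernel supported near the lifted diagonal and conormal to it of order `m`, uniformly up to
the boundary, times `ρ_bf0 ^ abf0 * ρ_zf ^ azf * ρ_sc ^ (asc - n)`: a finite sum of local ones. -/
def IsConormalAtDiagonal (G : AsymptoticallyConic d X S) (k₀ m abf0 azf asc : ℝ)
    (K : ℝ → X → X → ℂ) : Prop :=
  ∃ l : List (ℝ → X → X → ℂ), (∀ κ ∈ l, G.IsConormalLocal k₀ m abf0 azf asc κ) ∧
    ∀ k z z', K k z z' = (l.map fun κ => κ k z z').sum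

/-! ### The calculus -/

/-- The class `Ψ_k^{m, (abf0, azf, asc); 𝓔}(M)` (for `m < 0`).  The half-density kernel is
`K ⊗ |dg_b dg_b' dk/k|^{1/2}`, `g_b = x² g`, and `K` is given off the diagonal.
As `|dg_b dg_b' dk/k|^{1/2}` is `ρ_sc ^ (n/2)` times a b-half-density on `M²_{k,sc}`, the
normalization by which the half-density kernel times `ρ_sc ^ (n/2)` has index set `𝓔 sc` at `sc`
means that `K` has index set `𝓔 sc - n` there. -/
def IsInCalculus (G : AsymptoticallyConic d X S) (k₀ m abf0 azf asc : ℝ) (𝓔 : Face → IndexSet)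
    (K : ℝ → X → X → ℂ) : Prop :=
  (𝓔 .bf).carrier = ∅ ∧ (𝓔 .lb).carrier = ∅ ∧ (𝓔 .rb).carrier = ∅ ∧
  (IndexSet.ofReal abf0).carrier ⊆ (𝓔 .bf0).carrier ∧
  (IndexSet.ofReal azf).carrier ⊆ (𝓔 .zf).carrier ∧
  (IndexSet.ofReal asc).carrier ⊆ (𝓔 .sc).carrier ∧
  ∃ K₁ K₂ : ℝ → X → X → ℂ,
    G.IsConormalAtDiagonal k₀ m abf0 azf asc K₁ ∧
    G.IsPolyhomogeneous k₀ (Function.update 𝓔 .sc ((𝓔 .sc).shift (-((d : ℝ) + 1)))) K₂ ∧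
    ∀ k ∈ Set.Ioo 0 k₀, ∀ z z', z ≠ z' → K k z z' = K₁ k z z' + K₂ k z z'

/-- The kernel of the operator with respect to `|dg dg'|^{1/2}` instead of `|dg_b dg_b'|^{1/2}`:
`|dg_b dg_b'|^{1/2} = (x x')^{n/2} |dg dg'|^{1/2}`. -/
def scKernel (G : AsymptoticallyConic d X S) (K : ℝ → X → X → ℂ) (k : ℝ) (z z' : X) : ℂ :=
  (((G.x z * G.x z') ^ (((d : ℝ) + 1) / 2) : ℝ) : ℂ) * K k z z'

/-- The operator `A(k)`, acting on functions by `A(k) (f |dg|^{1/2}) = (A(k) f) |dg|^{1/2}`. -/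
def op [MeasurableSpace X] (G : AsymptoticallyConic d X S) (K : ℝ → X → X → ℂ) (k : ℝ)
    (f : X → ℂ) (z : X) : ℂ :=
  ∫ z', G.scKernel K k z z' * f z' ∂G.vol

end AsymptoticallyConic

end LowEnergy

end

set_option linter.unusedSectionVars false

/-! ### Scalar equations along lines, and directional derivatives that commute with them. -/

noncomputable section
namespace LowEnergy

/-! ## First-order equations along flow lines -/

/-! Write n = d + 1. The theorem is a Schur test, applied to the kernel after its absolute value has
been integrated over k. With e = n/p and the weight x^(n/(pq)), q the conjugate exponent, the test
asks for bounds of the integrals of |K| (x/x')^s over rows and columns, with s = n/2 - e and the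
measure x^n dg, which near infinity is comparable to d(log x) dy. It is enough to bound these
integrals for fixed k by C k^(τ-1) with some τ > 0, because k^(τ-1) is integrable at 0. These are
the bounds `SchurBound`; `lintegral_rpow_le_of_schur` and `IsSchurKernel.exists_eLpNorm_le` turn
them into the conclusion.

The polyhomogeneous part K₂. Away from `sc` the orders at the faces give |K₂| ≤ C k^(τ-1)
(x/(x+x'))^lam (x'/(x+x'))^mu, where lam is just below n/2 - β and mu just below n/2 - α. After
multiplication by (x/x')^s this decays exponentially in |log x - log x'| exactly when lam + s > 0
and mu - s > 0, that is, when α < n/p < n - β; this is the range of p. Near `sc` the bound is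
k^(τ-1) (k/x)^n (1 + (k/x)|v|)^(-n-1), with v the difference of the coordinates (log x, y), and its
integral in v is independent of k/x. The critical case `𝓐 .sc ≥ 0` is needed here without any loss.

To reach these pointwise bounds, polyhomogeneity has to be converted into orders: it says that a
product of factors V - z, over the exponents z of real part at most s, raises the order at a face to
s. Each factor is a first-order equation along the flow of V. It is integrated from a point near the
face outwards to a fixed distance, where the order at that face no longer matters
(`FlowsOut.invert_factor`). The weights at the other faces deteriorate by an arbitrarily small
amount, by interpolation (`improve_of_flowsOut`, `improve_of_empty`). At `sc` the leading exponents
carry no logarithms and are therefore distinct, and partial fractions remove them together, without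
loss at `sc` (`ScFlowsOut.improve`).

The conormal part K₁. A symbol of order -1 has a transform bounded by |W|^(-d) (1 + 3π/|W|)^(1/2)
(`norm_le_of_symbol`), which is locally integrable in dimension d + 1. The substitution W = Λ(φ(z')
- φ(z)), with Λ = 1 or Λ = k/x, then gives rows and columns of size k^(τ-1) (`SchurBound.of_diag`).
-/

theorem norm_le_of_hasDerivAt_sub {g h : ℝ → ℂ} {z : ℂ} {T M e : ℝ} (hT : 0 ≤ T)
    (hg : ∀ t ∈ Set.Icc 0 T, HasDerivAt g (z * g t + h t) t)
    (hh : ∀ t ∈ Set.Icc 0 T, ‖h t‖ ≤ M * Real.exp (e * t)) (he : e ≠ z.re) :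
    ‖g 0‖ ≤ Real.exp (-(z.re * T)) * ‖g T‖
      + M * ((Real.exp ((e - z.re) * T) - 1) / (e - z.re)) := by
  have he' : e - z.re ≠ 0 := sub_ne_zero.mpr he
  -- Integrating factor: f' = exp(-zt) h has norm at most M exp((e - Re z) t), and the comparison
  -- function `B` below is the integral of this from 0.
  set f : ℝ → ℂ := fun t => Complex.exp (-(z * t)) * g t with hf
  have hder : ∀ t ∈ Set.Icc 0 T, HasDerivAt f (Complex.exp (-(z * t)) * h t) t := by
    intro t ht
    have h1 : HasDerivAt (fun t : ℝ => Complex.exp (-(z * t))) (Complex.exp (-(z * t)) * (-z)) t := by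
      have : HasDerivAt (fun t : ℝ => -(z * (t : ℂ))) (-z) t := by
        have := (Complex.ofRealCLM.hasDerivAt (x := t)).const_mul z
        exact this.neg.congr_deriv (by simp)
      exact this.cexp
    have h2 := h1.mul (hg t ht)
    exact h2.congr_deriv (by ring)
  have hnorm : ∀ t : ℝ, ‖Complex.exp (-(z * t))‖ = Real.exp (-(z.re * t)) := by
    intro t
    rw [Complex.norm_exp]
    simp
  have key := image_norm_le_of_norm_deriv_right_le_deriv_boundary (f := fun t => f t - f 0)
    (f' := fun t => Complex.exp (-(z * t)) * h t) (a := 0) (b := T)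
    (B := fun t => M * ((Real.exp ((e - z.re) * t) - 1) / (e - z.re)))
    (B' := fun t => M * Real.exp ((e - z.re) * t))
    (fun t ht => ((hder t ht).continuousAt.sub continuousAt_const).continuousWithinAt)
    (fun t ht => ((hder t (Set.Ico_subset_Icc_self ht)).sub_const _).hasDerivWithinAt)
    (by simp)
    (by
      intro t
      have h1 : HasDerivAt (fun t : ℝ => Real.exp ((e - z.re) * t))
          (Real.exp ((e - z.re) * t) * (e - z.re)) t := by
        have := ((hasDerivAt_id t).const_mul (e - z.re)).exp
        simpa using this
      have h2 := ((h1.sub_const 1).div_const (e - z.re)).const_mul M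
      exact h2.congr_deriv (by field_simp))
    (by
      intro t ht
      rw [norm_mul, hnorm]
      calc _ ≤ Real.exp (-(z.re * t)) * (M * Real.exp (e * t)) := by
            gcongr
            exact hh t (Set.Ico_subset_Icc_self ht)
        _ = M * Real.exp ((e - z.re) * t) := by
            rw [show (e - z.re) * t = -(z.re * t) + e * t by ring, Real.exp_add]; ring)
    (Set.right_mem_Icc.mpr hT)
  have h0 : g 0 = f 0 := by simp [hf]
  have hfT : ‖f T‖ = Real.exp (-(z.re * T)) * ‖g T‖ := by rw [hf]; simp only [norm_mul, hnorm]
  rw [h0, ← hfT]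
  calc ‖f 0‖ = ‖f T - (f T - f 0)‖ := by rw [sub_sub_cancel]
    _ ≤ ‖f T‖ + ‖f T - f 0‖ := norm_sub_le _ _
    _ ≤ _ := by gcongr

/-- The case of a source that is small compared with the homogeneous solution at the far end. -/
theorem norm_le_of_hasDerivAt_sub_of_lt {g h : ℝ → ℂ} {z : ℂ} {T M e : ℝ} (hT : 0 ≤ T)
    (hg : ∀ t ∈ Set.Icc 0 T, HasDerivAt g (z * g t + h t) t)
    (hh : ∀ t ∈ Set.Icc 0 T, ‖h t‖ ≤ M * Real.exp (e * t)) (he : e < z.re) (hM : 0 ≤ M) :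
    ‖g 0‖ ≤ Real.exp (-(z.re * T)) * ‖g T‖ + M / (z.re - e) := by
  refine (norm_le_of_hasDerivAt_sub hT hg hh he.ne).trans ?_
  have h1 : 0 < z.re - e := sub_pos.mpr he
  have h2 : (Real.exp ((e - z.re) * T) - 1) / (e - z.re) ≤ 1 / (z.re - e) := by
    rw [← neg_div_neg_eq, neg_sub, neg_sub]
    gcongr
    linarith [Real.exp_pos ((e - z.re) * T)]
  calc _ ≤ Real.exp (-(z.re * T)) * ‖g T‖ + M * (1 / (z.re - e)) := by gcongr
    _ = _ := by ring

/-- The source is now of higher order than the homogeneous solution, so the homogeneous rate exp(-Re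
z T) governs the bound at 0. This case occurs only at `sc`, where the exponent to be removed is the
target order itself. -/
theorem norm_le_of_hasDerivAt_sub_of_gt {g h : ℝ → ℂ} {z : ℂ} {T M e : ℝ} (hT : 0 ≤ T)
    (hg : ∀ t ∈ Set.Icc 0 T, HasDerivAt g (z * g t + h t) t)
    (hh : ∀ t ∈ Set.Icc 0 T, ‖h t‖ ≤ M * Real.exp (e * t)) (he : z.re < e) (hM : 0 ≤ M) :
    ‖g 0‖ ≤ Real.exp (-(z.re * T)) * (‖g T‖ + M * Real.exp (e * T) / (e - z.re)) := by
  refine (norm_le_of_hasDerivAt_sub hT hg hh he.ne').trans ?_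
  have h1 : 0 < e - z.re := sub_pos.mpr he
  have h2 : (Real.exp ((e - z.re) * T) - 1) / (e - z.re)
      ≤ Real.exp ((e - z.re) * T) / (e - z.re) := by
    gcongr
    linarith
  calc _ ≤ Real.exp (-(z.re * T)) * ‖g T‖ + M * (Real.exp ((e - z.re) * T) / (e - z.re)) := by
        gcongr
    _ = _ := by
        rw [show (e - z.re) * T = -(z.re * T) + e * T by ring, Real.exp_add]; ring

/-! ## Derivatives of directional derivatives -/

section Deriv

variable {E : Type*} [NormedAddCommGroup E] [NormedSpace ℝ E]

theorem iteratedFDeriv_fderiv_apply {F : E → ℂ} {p : E} {N : ℕ}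
    (hF : ContDiffAt ℝ (N + 1 : ℕ) F p) (V : E) (ξ : Fin N → E) :
    iteratedFDeriv ℝ N (fun q => fderiv ℝ F q V) p ξ
      = iteratedFDeriv ℝ (N + 1) F p (Fin.snoc ξ V) := by
  have h1 : ContDiffAt ℝ N (fderiv ℝ F) p := hF.fderiv_right (by norm_cast)
  have := (ContinuousLinearMap.apply ℝ ℂ V).iteratedFDeriv_comp_left h1 (i := N) le_rfl
  rw [iteratedFDeriv_succ_apply_right]
  simp only [Fin.init_snoc, Fin.snoc_last]
  exact congrArg (fun A => A ξ) this

theorem fderiv_iteratedFDeriv_apply {F : E → ℂ} {N : ℕ} {p : E}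
    (hF : ContDiffAt ℝ (N + 1 : ℕ) F p) (V : E) (ξ : Fin N → E) :
    fderiv ℝ (fun q => iteratedFDeriv ℝ N F q ξ) p V
      = fderiv ℝ (iteratedFDeriv ℝ N F) p V ξ := by
  have h := hF.differentiableAt_iteratedFDeriv (m := N) (by exact_mod_cast Nat.lt_succ_self N)
  have := ((ContinuousMultilinearMap.apply ℝ (fun _ : Fin N => E) ℂ ξ).hasFDerivAt.comp p
    h.hasFDerivAt).fderiv
  have h2 : (fun q => iteratedFDeriv ℝ N F q ξ)
    = (ContinuousMultilinearMap.apply ℝ (fun _ : Fin N => E) ℂ ξ) ∘ iteratedFDeriv ℝ N F := rfl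
  rw [h2, this]
  rfl

theorem contDiffAt_iteratedFDeriv_apply {F : E → ℂ} {N m : ℕ} {p : E}
    (hF : ContDiffAt ℝ (m + N : ℕ) F p) (ξ : Fin N → E) :
    ContDiffAt ℝ m (fun q => iteratedFDeriv ℝ N F q ξ) p :=
  (ContinuousMultilinearMap.apply ℝ (fun _ : Fin N => E) ℂ ξ).contDiff.contDiffAt.comp p
    (hF.iteratedFDeriv_right (by norm_cast))

theorem fderiv_fderiv_apply_comm {F : E → ℂ} {p : E} (hF : ContDiffAt ℝ 2 F p) (V W : E) :
    fderiv ℝ (fun q => fderiv ℝ F q V) p W = fderiv ℝ (fun q => fderiv ℝ F q W) p V := by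
  have h1 : DifferentiableAt ℝ (fderiv ℝ F) p :=
    (hF.fderiv_right (m := 1) (by norm_num)).differentiableAt (by norm_num)
  have key : ∀ V W : E, fderiv ℝ (fun q => fderiv ℝ F q V) p W = fderiv ℝ (fderiv ℝ F) p W V := by
    intro V W
    have h3 := ((ContinuousLinearMap.apply ℝ ℂ V).hasFDerivAt.comp p h1.hasFDerivAt).fderiv
    have h2 : (fun q => fderiv ℝ F q V) = (ContinuousLinearMap.apply ℝ ℂ V) ∘ fderiv ℝ F := rfl
    rw [h2, h3]
    rfl
  rw [key, key]
  exact (hF.isSymmSndFDerivAt (by simp)) _ _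

/-- Symmetry of the second derivative moves the constant direction V past one direction at a time.
-/
theorem fderiv_iteratedFDeriv_eq {N : ℕ} : ∀ {F : E → ℂ} {p : E},
    ContDiffAt ℝ (N + 2 : ℕ) F p → ∀ (V : E) (ξ : Fin N → E),
    fderiv ℝ (fun q => iteratedFDeriv ℝ N F q ξ) p V
      = iteratedFDeriv ℝ N (fun q => fderiv ℝ F q V) p ξ := by
  induction N with
  | zero =>
    intro F p hF V ξ
    simp
  | succ N ih =>
    intro F p hF V ξ
    have hev : ∀ᶠ q in nhds p, ContDiffAt ℝ (N + 3 : ℕ) F q := by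
      exact hF.eventually (ne_of_lt (WithTop.coe_lt_coe.mpr (ENat.natCast_lt_top _)))
    have hle : ∀ {m : ℕ} {q : E}, m ≤ N + 3 → ContDiffAt ℝ (N + 3 : ℕ) F q →
        ContDiffAt ℝ m F q := fun hm hq => hq.of_le (by exact_mod_cast hm)
    have h1 : (fun q => iteratedFDeriv ℝ (N + 1) F q ξ)
        =ᶠ[nhds p] fun q => fderiv ℝ (fun q => iteratedFDeriv ℝ N F q (Fin.tail ξ)) q (ξ 0) := by
      filter_upwards [hev] with q hq
      rw [fderiv_iteratedFDeriv_apply (hle (by omega) hq), iteratedFDeriv_succ_apply_left]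
    rw [h1.fderiv_eq, fderiv_fderiv_apply_comm]
    · have h2 : (fun q => fderiv ℝ (fun q => iteratedFDeriv ℝ N F q (Fin.tail ξ)) q V)
          =ᶠ[nhds p] fun q => iteratedFDeriv ℝ N (fun q => fderiv ℝ F q V) q (Fin.tail ξ) := by
        filter_upwards [hev] with q hq
        exact ih (hle (by omega) hq) V _
      rw [h2.fderiv_eq, iteratedFDeriv_succ_apply_left, fderiv_iteratedFDeriv_apply]
      have h3 : ContDiffAt ℝ (N + 1 : ℕ) (fderiv ℝ F) p :=
        (hle (m := N + 2) (by omega) hF).fderiv_right (by norm_cast)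
      exact (ContinuousLinearMap.apply ℝ ℂ V).contDiff.contDiffAt.comp p h3
    · exact contDiffAt_iteratedFDeriv_apply (m := 2) (hle (by omega) hF) _

theorem ContDiffAt.fderiv_apply_affine {F : E → ℂ} {p : E} (hF : ContDiffAt ℝ ∞ F p)
    {V : E → E} (hV : ContDiff ℝ ∞ V) (z : ℂ) :
    ContDiffAt ℝ ∞ (fun q => fderiv ℝ F q (V q) - z * F q) p :=
  ((hF.fderiv_right (m := ∞) (by simp)).clm_apply hV.contDiffAt).sub (contDiffAt_const.mul hF)

theorem ContDiffAt.applyFactors {F : E → ℂ} {p : E} (hF : ContDiffAt ℝ ∞ F p)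
    {V : E → E} (hV : ContDiff ℝ ∞ V) (l : List (ℂ × ℕ)) :
    ContDiffAt ℝ ∞ (applyFactors V l F) p := by
  induction l with
  | nil => exact hF
  | cons e l ih => exact ContDiffAt.fderiv_apply_affine ih hV e.1

theorem iteratedFDeriv_factor {F : E → ℂ} {p : E} (hF : ContDiffAt ℝ ∞ F p) (V : E) (z : ℂ)
    {N : ℕ} (ξ : Fin N → E) :
    iteratedFDeriv ℝ N (fun q => fderiv ℝ F q V - z * F q) p ξ
      = iteratedFDeriv ℝ (N + 1) F p (Fin.snoc ξ V) - z * iteratedFDeriv ℝ N F p ξ := by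
  have hle : ∀ m : ℕ, ContDiffAt ℝ m F p := fun m => hF.of_le (by exact_mod_cast le_top)
  rw [← iteratedFDeriv_fderiv_apply (hle (N + 1))]
  have h1 : ContDiffAt ℝ N (fun q => fderiv ℝ F q V) p :=
    (ContinuousLinearMap.apply ℝ ℂ V).contDiff.contDiffAt.comp p
      ((hle (N + 1)).fderiv_right (by norm_cast))
  have h2 : ContDiffAt ℝ N (fun q => z • F q) p := (hle N).const_smul z
  have h3 : (fun q => fderiv ℝ F q V - z * F q) = (fun q => fderiv ℝ F q V) - fun q => z • F q := by
    ext; simp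
  rw [h3, iteratedFDeriv_sub_apply h1 h2, iteratedFDeriv_const_smul_apply' (hle N)]
  simp

/-- For a constant field V, the operator V - z commutes with all directional derivatives. Hence each
component of the N-th derivative of F solves the same scalar equation along the line as F, and
orders can be improved for all derivatives at once. -/
theorem hasDerivAt_iteratedFDeriv_line {F : E → ℂ} {p V : E} {t : ℝ}
    (hF : ContDiffAt ℝ ∞ F (p + t • V)) (z : ℂ) {N : ℕ} (ξ : Fin N → E) :
    HasDerivAt (fun t : ℝ => iteratedFDeriv ℝ N F (p + t • V) ξ)
      (z * iteratedFDeriv ℝ N F (p + t • V) ξ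
        + iteratedFDeriv ℝ N (fun q => fderiv ℝ F q V - z * F q) (p + t • V) ξ) t := by
  have hle : ∀ m : ℕ, ContDiffAt ℝ m F (p + t • V) := fun m => hF.of_le (by exact_mod_cast le_top)
  have h1 : HasDerivAt (fun t : ℝ => p + t • V) V t := by
    simpa using ((hasDerivAt_id t).smul_const V).const_add p
  have h2 := contDiffAt_iteratedFDeriv_apply (m := 1) (N := N) (hle _) ξ
  have h3 := (h2.differentiableAt (by simp)).hasFDerivAt.comp_hasDerivAt t h1
  refine h3.congr_deriv ?_
  rw [fderiv_iteratedFDeriv_eq (hle _), iteratedFDeriv_factor hF, iteratedFDeriv_fderiv_apply (hle _)]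
  ring

end Deriv

end LowEnergy
end

/-! ### Weighted derivative bounds, and raising the order at one face. -/

noncomputable section
namespace LowEnergy

/-! ## Comparability -/

/-- `a` and `b` agree up to the factor `C`. -/
def Comparable (C a b : ℝ) : Prop := a ≤ C * b ∧ b ≤ C * a

namespace Comparable

theorem symm {C a b : ℝ} (h : Comparable C a b) : Comparable C b a := ⟨h.2, h.1⟩

theorem refl {C a : ℝ} (hC : 1 ≤ C) (ha : 0 ≤ a) : Comparable C a a :=
  ⟨le_mul_of_one_le_left ha hC, le_mul_of_one_le_left ha hC⟩

theorem mono {C C' a b : ℝ} (h : Comparable C a b) (hC : C ≤ C') (ha : 0 ≤ a) (hb : 0 ≤ b) :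
    Comparable C' a b :=
  ⟨h.1.trans (by gcongr), h.2.trans (by gcongr)⟩

theorem trans {C C' a b e : ℝ} (h : Comparable C a b) (h' : Comparable C' b e) (hC : 0 ≤ C)
    (hC' : 0 ≤ C') : Comparable (C * C') a e := by
  refine ⟨h.1.trans ?_, h'.2.trans ?_⟩
  · calc C * b ≤ C * (C' * e) := by gcongr; exact h'.1
      _ = _ := by ring
  · calc C' * b ≤ C' * (C * a) := by gcongr; exact h.2
      _ = _ := by ring

theorem mul {C C' a b a' b' : ℝ} (h : Comparable C a b) (h' : Comparable C' a' b') (ha : 0 ≤ a)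
    (hb : 0 ≤ b) (ha' : 0 ≤ a') (hb' : 0 ≤ b') : Comparable (C * C') (a * a') (b * b') := by
  have e1 : C * C' * (b * b') = (C * b) * (C' * b') := by ring
  have e2 : C * C' * (a * a') = (C * a) * (C' * a') := by ring
  exact ⟨e1 ▸ mul_le_mul h.1 h'.1 ha' (ha.trans h.1), e2 ▸ mul_le_mul h.2 h'.2 hb' (hb.trans h.2)⟩

theorem inv {C a b : ℝ} (h : Comparable C a b) (ha : 0 < a) (hb : 0 < b) :
    Comparable C a⁻¹ b⁻¹ := by
  constructor
  · rw [← div_eq_mul_inv, le_div_iff₀ hb, inv_mul_eq_div, div_le_iff₀ ha]; exact h.2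
  · rw [← div_eq_mul_inv, le_div_iff₀ ha, inv_mul_eq_div, div_le_iff₀ hb]; exact h.1

theorem div {C C' a b a' b' : ℝ} (h : Comparable C a b) (h' : Comparable C' a' b') (ha : 0 ≤ a)
    (hb : 0 ≤ b) (ha' : 0 < a') (hb' : 0 < b') : Comparable (C * C') (a / a') (b / b') := by
  rw [div_eq_mul_inv, div_eq_mul_inv]
  exact h.mul (h'.inv ha' hb') ha hb (inv_nonneg.mpr ha'.le) (inv_nonneg.mpr hb'.le)

theorem mul_left {C a b t : ℝ} (h : Comparable C a b) (ht : 0 ≤ t) :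
    Comparable C (t * a) (t * b) :=
  ⟨by nlinarith [mul_le_mul_of_nonneg_left h.1 ht], by nlinarith [mul_le_mul_of_nonneg_left h.2 ht]⟩

theorem rpow_le {C a b : ℝ} (h : Comparable C a b) (hC : 0 < C) (ha : 0 < a) (hb : 0 < b) (w : ℝ) :
    a ^ w ≤ C ^ |w| * b ^ w := by
  rcases le_total 0 w with hw | hw
  · rw [abs_of_nonneg hw, ← Real.mul_rpow hC.le hb.le]
    exact Real.rpow_le_rpow ha.le h.1 hw
  · rw [abs_of_nonpos hw]
    have h1 : (C * a) ^ w ≤ b ^ w := Real.rpow_le_rpow_of_nonpos hb h.2 hw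
    rw [Real.mul_rpow hC.le ha.le] at h1
    calc a ^ w = C ^ (-w) * (C ^ w * a ^ w) := by
          rw [← mul_assoc, ← Real.rpow_add hC]; simp
      _ ≤ _ := by gcongr

end Comparable

/-! ## Operations on bounds -/

section DerivBound

variable {E : Type*} [NormedAddCommGroup E] [NormedSpace ℝ E] {G : E → ℂ} {R R' : Set E}
  {W W' : E → ℝ} {len : E → E → ℝ}

theorem DerivBound.exists_nonneg (h : DerivBound G R W len) (hlen : ∀ p ∈ R, ∀ ξ, 0 ≤ len p ξ)
    (hW : ∀ p ∈ R, 0 ≤ W p) (N : ℕ) : ∃ C : ℝ, 0 ≤ C ∧ ∀ p ∈ R, ∀ ξ : Fin N → E,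
    ‖iteratedFDeriv ℝ N G p ξ‖ ≤ C * W p * ∏ i, len p (ξ i) := by
  obtain ⟨C, hC⟩ := h N
  refine ⟨|C|, abs_nonneg _, fun p hp ξ => (hC p hp ξ).trans ?_⟩
  have := hW p hp
  have : 0 ≤ ∏ i, len p (ξ i) := Finset.prod_nonneg fun i _ => hlen p hp _
  gcongr
  exact le_abs_self C

theorem DerivBound.subset (h : DerivBound G R W len) (hR : R' ⊆ R) : DerivBound G R' W len :=
  fun N => (h N).imp fun _ hC p hp => hC p (hR hp)

theorem DerivBound.mono_weight (h : DerivBound G R W len) (hlen : ∀ p ∈ R, ∀ ξ, 0 ≤ len p ξ)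
    (hW : ∀ p ∈ R, 0 ≤ W p) {K : ℝ} (hWW' : ∀ p ∈ R, W p ≤ K * W' p) :
    DerivBound G R W' len := by
  intro N
  obtain ⟨C, hC0, hC⟩ := h.exists_nonneg hlen hW N
  refine ⟨C * K, fun p hp ξ => (hC p hp ξ).trans ?_⟩
  have : 0 ≤ ∏ i, len p (ξ i) := Finset.prod_nonneg fun i _ => hlen p hp _
  rw [mul_assoc C K]
  gcongr
  exact hWW' p hp

theorem DerivBound.union (h : DerivBound G R W len) (h' : DerivBound G R' W len)
    (hlen : ∀ p ∈ R ∪ R', ∀ ξ, 0 ≤ len p ξ) (hW : ∀ p ∈ R ∪ R', 0 ≤ W p) :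
    DerivBound G (R ∪ R') W len := by
  intro N
  obtain ⟨C, hC0, hC⟩ := h.exists_nonneg (fun p hp => hlen p (.inl hp)) (fun p hp => hW p (.inl hp)) N
  obtain ⟨C', hC0', hC'⟩ :=
    h'.exists_nonneg (fun p hp => hlen p (.inr hp)) (fun p hp => hW p (.inr hp)) N
  refine ⟨max C C', fun p hp ξ => ?_⟩
  have h1 : 0 ≤ ∏ i, len p (ξ i) := Finset.prod_nonneg fun i _ => hlen p hp _
  have h2 := hW p hp
  rcases hp with hp | hp
  · refine (hC p hp ξ).trans ?_
    gcongr
    exact le_max_left _ _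
  · refine (hC' p hp ξ).trans ?_
    gcongr
    exact le_max_right _ _

theorem le_rpow_mul_rpow_of_le {a A B θ : ℝ} (ha : 0 ≤ a) (hA : a ≤ A) (hB : a ≤ B)
    (h0 : 0 ≤ θ) (h1 : θ ≤ 1) : a ≤ A ^ θ * B ^ (1 - θ) := by
  rcases ha.eq_or_lt with rfl | ha'
  · positivity
  calc a = a ^ θ * a ^ (1 - θ) := by rw [← Real.rpow_add ha']; simp
    _ ≤ _ := by
      have : 0 ≤ 1 - θ := by linarith
      have : 0 ≤ A := ha.trans hA
      gcongr

/-- What lies below two bounds lies below their weighted geometric mean. This trades a small part of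
the weights at most faces for a large order at a single one. -/
theorem DerivBound.interpolate (h : DerivBound G R W len) (h' : DerivBound G R W' len)
    (hlen : ∀ p ∈ R, ∀ ξ, 0 ≤ len p ξ) (hW : ∀ p ∈ R, 0 ≤ W p) (hW' : ∀ p ∈ R, 0 ≤ W' p)
    {θ : ℝ} (h0 : 0 ≤ θ) (h1 : θ ≤ 1) :
    DerivBound G R (fun p => W p ^ θ * W' p ^ (1 - θ)) len := by
  intro N
  obtain ⟨C, hC0, hC⟩ := h.exists_nonneg hlen hW N
  obtain ⟨C', hC0', hC'⟩ := h'.exists_nonneg hlen hW' N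
  refine ⟨max C C', fun p hp ξ => ?_⟩
  have hL : 0 ≤ ∏ i, len p (ξ i) := Finset.prod_nonneg fun i _ => hlen p hp _
  have hM : 0 ≤ max C C' := hC0.trans (le_max_left _ _)
  have e1 := (hC p hp ξ).trans (show _ ≤ (max C C' * ∏ i, len p (ξ i)) * W p by
    have := hW p hp
    rw [mul_right_comm]; gcongr; exact le_max_left _ _)
  have e2 := (hC' p hp ξ).trans (show _ ≤ (max C C' * ∏ i, len p (ξ i)) * W' p by
    have := hW' p hp
    rw [mul_right_comm]; gcongr; exact le_max_right _ _)
  have h2 : min (W p) (W' p) ≤ W p ^ θ * W' p ^ (1 - θ) :=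
    le_rpow_mul_rpow_of_le (le_min (hW p hp) (hW' p hp)) (min_le_left _ _) (min_le_right _ _) h0 h1
  calc _ ≤ (max C C' * ∏ i, len p (ξ i)) * min (W p) (W' p) := by
        rcases min_choice (W p) (W' p) with hm | hm <;> rw [hm] <;> assumption
    _ ≤ (max C C' * ∏ i, len p (ξ i)) * (W p ^ θ * W' p ^ (1 - θ)) := by gcongr
    _ = _ := by ring

/-- Applying V - z uses up one more derivative, in a direction of bounded length, and so costs
nothing in the weight. -/
theorem DerivBound.factor (h : DerivBound G R W len) (hG : ∀ p ∈ R, ContDiffAt ℝ ∞ G p)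
    (hlen : ∀ p ∈ R, ∀ ξ, 0 ≤ len p ξ) (hW : ∀ p ∈ R, 0 ≤ W p) {V : E} {K : ℝ}
    (hV : ∀ p ∈ R, len p V ≤ K) (z : ℂ) :
    DerivBound (fun q => fderiv ℝ G q V - z * G q) R W len := by
  intro N
  obtain ⟨C, hC0, hC⟩ := h.exists_nonneg hlen hW N
  obtain ⟨C', hC0', hC'⟩ := h.exists_nonneg hlen hW (N + 1)
  refine ⟨C' * K + ‖z‖ * C, fun p hp ξ => ?_⟩
  have hL : 0 ≤ ∏ i, len p (ξ i) := Finset.prod_nonneg fun i _ => hlen p hp _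
  have h2 := hW p hp
  rw [iteratedFDeriv_factor (hG p hp)]
  have e1 := hC' p hp (Fin.snoc ξ V)
  rw [Fin.prod_univ_castSucc] at e1
  simp only [Fin.snoc_castSucc, Fin.snoc_last] at e1
  calc _ ≤ ‖iteratedFDeriv ℝ (N + 1) G p (Fin.snoc ξ V)‖ + ‖z * iteratedFDeriv ℝ N G p ξ‖ :=
        norm_sub_le _ _
    _ ≤ C' * W p * ((∏ i, len p (ξ i)) * K) + ‖z‖ * (C * W p * ∏ i, len p (ξ i)) := by
        rw [norm_mul]
        gcongr
        · refine e1.trans ?_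
          gcongr
          exact hV p hp
        · exact hC p hp ξ
    _ = _ := by ring

theorem DerivBound.applyFactors (h : DerivBound G R W len) (hG : ∀ p ∈ R, ContDiffAt ℝ ∞ G p)
    (hlen : ∀ p ∈ R, ∀ ξ, 0 ≤ len p ξ) (hW : ∀ p ∈ R, 0 ≤ W p) {V : E} {K : ℝ}
    (hV : ∀ p ∈ R, len p V ≤ K) (l : List (ℂ × ℕ)) :
    DerivBound (applyFactors (fun _ => V) l G) R W len := by
  induction l with
  | nil => exact h
  | cons e l ih =>
    exact ih.factor (fun p hp => ContDiffAt.applyFactors (hG p hp) contDiff_const l) hlen hW hV e.1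

end DerivBound

/-! ## Weights -/

theorem rpow_le_of_le_of_le {b M w w' : ℝ} (hb : 0 < b) (hM : b ≤ M) (hw : w' ≤ w) :
    b ^ w ≤ M ^ (w - w') * b ^ w' := by
  calc b ^ w = b ^ (w - w') * b ^ w' := by rw [← Real.rpow_add hb]; simp
    _ ≤ _ := by
      have : 0 ≤ w - w' := by linarith
      gcongr

theorem rpow_le_of_mem_Icc {b δ M : ℝ} (w w' : ℝ) (hδ : 0 < δ) (hb : δ ≤ b) (hM : b ≤ M) :
    b ^ w ≤ (M ^ (w - w') + δ ^ (w - w')) * b ^ w' := by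
  have hb0 := hδ.trans_le hb
  have hM0 := hb0.trans_le hM
  calc b ^ w = b ^ (w - w') * b ^ w' := by rw [← Real.rpow_add hb0]; simp
    _ ≤ _ := by
      gcongr
      rcases le_total 0 (w - w') with h | h
      · exact (Real.rpow_le_rpow hb0.le hM h).trans (le_add_of_nonneg_right (by positivity))
      · exact (Real.rpow_le_rpow_of_nonpos hδ hb h).trans (le_add_of_nonneg_left (by positivity))

namespace BlowupCoords

variable {d : ℕ} {X : Type*} (c : BlowupCoords d X) (x : X → ℝ)

/-- The product of powers of the boundary defining functions. -/
def weight (w : Face → ℝ) (p : Pt d) : ℝ := ∏ H, c.bdf x p H ^ w H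

/-- The length for which `∂_{log k}`, `∂_u` and `ρ_sc ∂_v` are unit vectors. -/
def len (p ξ : Pt d) : ℝ := ‖ξ.1‖ + ‖ξ.2.1‖ + ‖ξ.2.2‖ / c.scSize p

/-- The boundary defining functions are positive and at most `M` on the region. -/
def BdfLE (M : ℝ) : Prop :=
  ∀ p ∈ c.region, 0 < c.scSize p ∧ ∀ H, 0 < c.bdf x p H ∧ c.bdf x p H ≤ M

variable {c x} {M : ℝ}

theorem BdfLE.weight_pos (h : c.BdfLE x M) (w : Face → ℝ) {p : Pt d} (hp : p ∈ c.region) :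
    0 < c.weight x w p :=
  Finset.prod_pos fun H _ => Real.rpow_pos_of_pos ((h p hp).2 H).1 _

theorem BdfLE.len_nonneg (h : c.BdfLE x M) {p : Pt d} (hp : p ∈ c.region) (ξ : Pt d) :
    0 ≤ c.len p ξ := by
  have := (h p hp).1
  unfold len
  positivity

/-- Since the defining functions are bounded above, an exponent may be lowered; where a defining
function is also bounded below, its exponent may be changed at will. -/
theorem BdfLE.exists_weight_le (h : c.BdfLE x M) {R : Set (Pt d)} (hR : R ⊆ c.region)
    {w w' : Face → ℝ}
    (hw : ∀ H, w' H ≤ w H ∨ ∃ δ > 0, ∀ p ∈ R, δ ≤ c.bdf x p H) :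
    ∃ K : ℝ, 0 ≤ K ∧ ∀ p ∈ R, c.weight x w p ≤ K * c.weight x w' p := by
  have : ∀ H, ∃ K : ℝ, 0 ≤ K ∧ ∀ p ∈ R, c.bdf x p H ^ w H ≤ K * c.bdf x p H ^ w' H := by
    intro H
    rcases hw H with hw | ⟨δ, hδ, hw⟩
    · refine ⟨|M| ^ (w H - w' H), by positivity, fun p hp => ?_⟩
      have := (h p (hR hp)).2 H
      exact rpow_le_of_le_of_le this.1 (this.2.trans (le_abs_self M)) hw
    · refine ⟨|M| ^ (w H - w' H) + δ ^ (w H - w' H), by positivity, fun p hp => ?_⟩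
      have := (h p (hR hp)).2 H
      exact rpow_le_of_mem_Icc _ _ hδ (hw p hp) (this.2.trans (le_abs_self M))
  choose K hK0 hK using this
  refine ⟨∏ H, K H, Finset.prod_nonneg fun H _ => hK0 H, fun p hp => ?_⟩
  unfold weight
  rw [← Finset.prod_mul_distrib]
  exact Finset.prod_le_prod
    (fun H _ => (Real.rpow_pos_of_pos ((h p (hR hp)).2 H).1 _).le) fun H _ => hK H p hp

theorem BdfLE.conormalBound_mono (h : c.BdfLE x M) {R : Set (Pt d)} (hR : R ⊆ c.region)
    {G : Pt d → ℂ} {w w' : Face → ℝ} (hG : c.ConormalBound x G R w)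
    (hw : ∀ H, w' H ≤ w H ∨ ∃ δ > 0, ∀ p ∈ R, δ ≤ c.bdf x p H) : c.ConormalBound x G R w' := by
  obtain ⟨K, -, hK⟩ := h.exists_weight_le hR hw
  exact hG.mono_weight (fun p hp => h.len_nonneg (hR hp)) (fun p hp => (h.weight_pos w (hR hp)).le) hK

theorem BdfLE.conormalBound_interpolate (h : c.BdfLE x M) {R : Set (Pt d)} (hR : R ⊆ c.region)
    {G : Pt d → ℂ} {w w' w'' : Face → ℝ} (hG : c.ConormalBound x G R w)
    (hG' : c.ConormalBound x G R w') {θ : ℝ} (h0 : 0 ≤ θ) (h1 : θ ≤ 1)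
    (hw : ∀ H, w'' H ≤ θ * w H + (1 - θ) * w' H) : c.ConormalBound x G R w'' := by
  have key : c.ConormalBound x G R (fun H => θ * w H + (1 - θ) * w' H) := by
    refine (hG.interpolate hG' (fun p hp => h.len_nonneg (hR hp))
      (fun p hp => (h.weight_pos w (hR hp)).le) (fun p hp => (h.weight_pos w' (hR hp)).le)
      h0 h1).mono_weight (fun p hp => h.len_nonneg (hR hp)) (fun p hp => ?_)
      (K := 1) (fun p hp => ?_)
    · exact mul_nonneg (Real.rpow_nonneg (h.weight_pos w (hR hp)).le _)
        (Real.rpow_nonneg (h.weight_pos w' (hR hp)).le _)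
    · have hp' := (h p (hR hp)).2
      rw [one_mul, ← Real.finsetProd_rpow _ _ (fun H _ => Real.rpow_nonneg (hp' H).1.le _),
        ← Real.finsetProd_rpow _ _ (fun H _ => Real.rpow_nonneg (hp' H).1.le _),
        ← Finset.prod_mul_distrib]
      refine le_of_eq (Finset.prod_congr rfl fun H _ => ?_)
      rw [← Real.rpow_mul (hp' H).1.le, ← Real.rpow_mul (hp' H).1.le, ← Real.rpow_add (hp' H).1]
      ring_nf
  exact h.conormalBound_mono hR key fun H => .inl (hw H)

/-- Interpolation with a bound of high order at one hypersurface. -/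
theorem exists_interpolation (w₀ w₁ : Face → ℝ) (H : Face) (e : ℝ) {ε : ℝ} (hε : 0 < ε) :
    ∃ θ s : ℝ, 0 < θ ∧ θ ≤ 1 ∧ e ≤ θ * s + (1 - θ) * w₁ H ∧
      ∀ H', w₁ H' - ε ≤ θ * w₀ H' + (1 - θ) * w₁ H' := by
  set B := 1 + ∑ H', |w₀ H' - w₁ H'| with hB
  have hBpos : 0 < B := by positivity
  set θ := min 1 (ε / B) with hθ
  have hθ0 : 0 < θ := by positivity
  refine ⟨θ, (e - (1 - θ) * w₁ H) / θ, hθ0, min_le_left _ _, by field_simp; simp, fun H' => ?_⟩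
  have h1 : |w₀ H' - w₁ H'| ≤ B := by
    have := Finset.single_le_sum (f := fun H' => |w₀ H' - w₁ H'|) (fun i _ => abs_nonneg _)
      (Finset.mem_univ H')
    linarith
  have h2 : θ * |w₀ H' - w₁ H'| ≤ ε := by
    calc _ ≤ ε / B * B := by
          gcongr
          exact min_le_right _ _
      _ = ε := by field_simp
  nlinarith [neg_abs_le (w₀ H' - w₁ H')]

/-! ## Improving the weight at one hypersurface -/

/-- The property of polyhomogeneity at a single hypersurface. -/
def PhgAt (c : BlowupCoords d X) (x : X → ℝ) (w : Face → ℝ) (E : IndexSet) (G : Pt d → ℂ)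
    (H : Face) : Prop :=
  ∀ (s : ℝ) (l : List (ℂ × ℕ)), l.Nodup → (∀ e, e ∈ l ↔ e ∈ E.carrier ∧ e.1.re ≤ s) →
    ∃ δ > 0, c.ConormalBound x (applyFactors (c.vectorField H) l G)
      {p | p ∈ c.region ∧ c.bdf x p H < δ} (Function.update w H s)

/-- Without exponents there is no factor to invert: polyhomogeneity gives every order s at H
directly, but with the original weights w₀ elsewhere. Interpolation with the current bound keeps the
gains already contained in w₁, up to ε. -/
theorem BdfLE.improve_of_empty (h : c.BdfLE x M) {G : Pt d → ℂ} {w₀ w₁ : Face → ℝ} {E : IndexSet}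
    {H : Face} (hE : E.carrier = ∅) (hG : c.PhgAt x w₀ E G H)
    (hG₁ : c.ConormalBound x G c.region w₁) (e : ℝ) {ε : ℝ} (hε : 0 < ε) :
    c.ConormalBound x G c.region (Function.update (fun H' => w₁ H' - ε) H e) := by
  obtain ⟨θ, s, hθ0, hθ1, hs, hθ⟩ := exists_interpolation w₀ w₁ H e hε
  obtain ⟨δ, hδ, hb⟩ := hG s [] List.nodup_nil (by simp [hE])
  have hsub : {p | p ∈ c.region ∧ c.bdf x p H < δ} ⊆ c.region := fun p hp => hp.1
  have hnear : c.ConormalBound x G {p | p ∈ c.region ∧ c.bdf x p H < δ}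
      (Function.update (fun H' => w₁ H' - ε) H e) := by
    refine h.conormalBound_interpolate hsub hb (DerivBound.subset hG₁ hsub) hθ0.le hθ1 fun H' => ?_
    by_cases hH : H' = H
    · subst hH; simpa using hs
    · simpa [Function.update_of_ne hH] using hθ H'
  have hfar : c.ConormalBound x G {p | p ∈ c.region ∧ δ ≤ c.bdf x p H}
      (Function.update (fun H' => w₁ H' - ε) H e) := by
    refine h.conormalBound_mono (fun p hp => hp.1) (DerivBound.subset hG₁ fun p hp => hp.1)
      fun H' => ?_
    by_cases hH : H' = H
    · subst hH; exact .inr ⟨δ, hδ, fun p hp => hp.2⟩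
    · left; simp [Function.update_of_ne hH, hε.le]
  refine (DerivBound.union hnear hfar ?_ ?_).subset ?_
  · rintro p (hp | hp) <;> exact h.len_nonneg hp.1
  · rintro p (hp | hp) <;> exact (h.weight_pos _ hp.1).le
  · intro p hp
    rcases lt_or_ge (c.bdf x p H) δ with h1 | h1
    exacts [.inl ⟨hp, h1⟩, .inr ⟨hp, h1⟩]

/-- The flow of the constant field `V`, from a point close to `H`, stays in the region until the
distance to `H` is of size `δ`, and does not change the distances to other hypersurfaces. -/
structure FlowsOut (c : BlowupCoords d X) (x : X → ℝ) (H : Face) (V : Pt d) (m : Pt d → ℝ)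
    (δ C : ℝ) : Prop where
  delta_pos : 0 < δ
  one_le : 1 ≤ C
  pos : ∀ p ∈ c.region, 0 < m p
  far : ∀ η > 0, ∀ p ∈ c.region, η ≤ m p → η / (1 + η) ≤ c.bdf x p H
  near : ∀ p ∈ c.region, m p ≤ δ → Comparable C (c.bdf x p H) (m p)
  mem : ∀ p ∈ c.region, ∀ t : ℝ, 0 ≤ t → Real.exp t * m p ≤ δ → p + t • V ∈ c.region
  exp_mul : ∀ p ∈ c.region, ∀ t : ℝ, 0 ≤ t → Real.exp t * m p ≤ δ →
    m (p + t • V) = Real.exp t * m p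
  bdf : ∀ p ∈ c.region, ∀ t : ℝ, 0 ≤ t → Real.exp t * m p ≤ δ → ∀ H' ≠ H,
    Comparable C (c.bdf x (p + t • V) H') (c.bdf x p H')
  len_le : ∀ p ∈ c.region, ∀ t : ℝ, 0 ≤ t → Real.exp t * m p ≤ δ →
    ∀ ξ, c.len (p + t • V) ξ ≤ C * c.len p ξ
  len_field : ∀ p ∈ c.region, m p ≤ δ → c.len p V ≤ C

namespace FlowsOut

variable {H : Face} {V : Pt d} {m : Pt d → ℝ} {δ C : ℝ}

theorem mono_delta (hf : c.FlowsOut x H V m δ C) {δ' : ℝ} (h0 : 0 < δ') (h1 : δ' ≤ δ) :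
    c.FlowsOut x H V m δ' C where
  delta_pos := h0
  one_le := hf.one_le
  pos := hf.pos
  far := hf.far
  near p hp h := hf.near p hp (h.trans h1)
  mem p hp t ht h := hf.mem p hp t ht (h.trans h1)
  exp_mul p hp t ht h := hf.exp_mul p hp t ht (h.trans h1)
  bdf p hp t ht h := hf.bdf p hp t ht (h.trans h1)
  len_le p hp t ht h := hf.len_le p hp t ht (h.trans h1)
  len_field p hp h := hf.len_field p hp (h.trans h1)

/-- Along the flow only ρ_H changes by an unbounded factor, and it grows like exp t because it is
comparable to the exactly homogeneous `m`. -/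
theorem weight_le (hf : c.FlowsOut x H V m δ C) (h : c.BdfLE x M) (w : Face → ℝ) :
    ∃ K : ℝ, 0 ≤ K ∧ ∀ p ∈ c.region, ∀ t : ℝ, 0 ≤ t → Real.exp t * m p ≤ δ →
      c.weight x w (p + t • V) ≤ K * (Real.exp (w H * t) * c.weight x w p) := by
  have hC : 0 < C := by linarith [hf.one_le]
  refine ⟨∏ H', (C * C) ^ |w H'|, by positivity, fun p hp t ht hm => ?_⟩
  have hq := hf.mem p hp t ht hm
  have hmp : m p ≤ δ := by
    refine le_trans ?_ hm
    exact le_mul_of_one_le_left (hf.pos p hp).le (Real.one_le_exp ht)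
  have hfac : ∀ H', c.bdf x (p + t • V) H' ^ w H' ≤ (C * C) ^ |w H'| *
      ((if H' = H then Real.exp (w H * t) else 1) * c.bdf x p H' ^ w H') := by
    intro H'
    have b1 := ((h _ hq).2 H').1
    have b2 := ((h _ hp).2 H').1
    split_ifs with hH
    · subst hH
      have e1 := hf.near _ hq (by rw [hf.exp_mul p hp t ht hm]; exact hm)
      rw [hf.exp_mul p hp t ht hm] at e1
      have e2 := e1.trans ((hf.near p hp hmp).symm.mul_left (Real.exp_pos t).le) hC.le hC.le
      have := e2.rpow_le (by positivity) b1 (by positivity) (w H')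
      rwa [Real.mul_rpow (Real.exp_pos t).le b2.le, ← Real.exp_mul, mul_comm t] at this
    · rw [one_mul]
      refine ((hf.bdf p hp t ht hm H' hH).mono ?_ b1.le b2.le).rpow_le (by positivity) b1 b2 _
      exact le_mul_of_one_le_left hC.le hf.one_le
  unfold weight
  calc _ ≤ ∏ H', (C * C) ^ |w H'| *
      ((if H' = H then Real.exp (w H * t) else 1) * c.bdf x p H' ^ w H') :=
        Finset.prod_le_prod (fun H' _ => Real.rpow_nonneg ((h _ hq).2 H').1.le _)
          fun H' _ => hfac H'
    _ = _ := by
        rw [Finset.prod_mul_distrib, Finset.prod_mul_distrib, Finset.prod_ite_eq']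
        simp

/-- Inverting one factor `V - z`. -/
theorem invert_factor (hf : c.FlowsOut x H V m δ C) (h : c.BdfLE x M) {w₁ w₂ : Face → ℝ}
    (hw : ∀ H' ≠ H, w₂ H' ≤ w₁ H') {F : Pt d → ℂ}
    (hF : ∀ p ∈ c.region, ContDiffAt ℝ ∞ F p) (hF₁ : c.ConormalBound x F {p | p ∈ c.region ∧ m p ≤ δ} w₁) {z : ℂ}
    (hz : w₂ H < z.re)
    (hF₂ : c.ConormalBound x (fun q => fderiv ℝ F q V - z * F q)
      {p | p ∈ c.region ∧ m p ≤ δ} w₂) :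
    c.ConormalBound x F {p | p ∈ c.region ∧ m p ≤ δ} w₂ := by
  have hC : 0 < C := by linarith [hf.one_le]
  intro N
  obtain ⟨K, hK0, hK⟩ := hf.weight_le h w₂
  obtain ⟨C₁, hC₁0, hC₁⟩ := DerivBound.exists_nonneg hF₁ (fun p hp => h.len_nonneg hp.1)
    (fun p hp => (h.weight_pos w₁ hp.1).le) N
  obtain ⟨C₂, hC₂0, hC₂⟩ := DerivBound.exists_nonneg hF₂ (fun p hp => h.len_nonneg hp.1)
    (fun p hp => (h.weight_pos w₂ hp.1).le) N
  -- Where `m ≥ δ` the order at H is irrelevant, so there the a priori weights w₁ may be replaced by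
  -- w₂.
  obtain ⟨K', hK'0, hK'⟩ := h.exists_weight_le (R := {p | p ∈ c.region ∧ δ ≤ m p})
    (fun p hp => hp.1) (w := w₁) (w' := w₂) (by
      intro H'
      by_cases hH : H' = H
      · subst hH
        exact .inr ⟨_, div_pos hf.delta_pos (add_pos one_pos hf.delta_pos),
          fun p hp => hf.far δ hf.delta_pos p hp.1 hp.2⟩
      · exact .inl (hw H' hH))
  refine ⟨C₁ * K' * K * C ^ N + C₂ * K * C ^ N / (z.re - w₂ H), ?_⟩
  rintro p ⟨hp, hmp⟩ ξ
  have hm0 := hf.pos p hp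
  -- The time at which the flow from p reaches distance exactly δ, where the bound of the previous
  -- step holds.
  set T := Real.log (δ / m p) with hT
  have hexp : Real.exp T = δ / m p := Real.exp_log (div_pos hf.delta_pos hm0)
  have hT0 : 0 ≤ T := Real.log_nonneg (by rwa [le_div_iff₀ hm0, one_mul])
  have hle : ∀ t ∈ Set.Icc 0 T, Real.exp t * m p ≤ δ := by
    intro t ht
    calc _ ≤ Real.exp T * m p := by gcongr; exact ht.2
      _ = δ := by rw [hexp]; field_simp
  have hL : ∀ t ∈ Set.Icc 0 T, ∏ i, c.len (p + t • V) (ξ i) ≤ C ^ N * ∏ i, c.len p (ξ i) := by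
    intro t ht
    calc _ ≤ ∏ i : Fin N, C * c.len p (ξ i) := Finset.prod_le_prod
          (fun i _ => h.len_nonneg (hf.mem p hp t ht.1 (hle t ht)) _)
          fun i _ => hf.len_le p hp t ht.1 (hle t ht) _
      _ = _ := by rw [Finset.prod_mul_distrib]; simp
  have hL0 : 0 ≤ ∏ i, c.len p (ξ i) := Finset.prod_nonneg fun i _ => h.len_nonneg hp _
  have hW0 := h.weight_pos w₂ hp
  have key := norm_le_of_hasDerivAt_sub_of_lt (T := T) (z := z) (e := w₂ H)
    (g := fun t : ℝ => iteratedFDeriv ℝ N F (p + t • V) ξ)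
    (h := fun t : ℝ => iteratedFDeriv ℝ N (fun q => fderiv ℝ F q V - z * F q) (p + t • V) ξ)
    (M := C₂ * K * C ^ N * c.weight x w₂ p * ∏ i, c.len p (ξ i)) hT0
    (fun t ht => hasDerivAt_iteratedFDeriv_line (hF _ (hf.mem p hp t ht.1 (hle t ht))) z ξ)
    (by
      intro t ht
      have hq := hf.mem p hp t ht.1 (hle t ht)
      refine (hC₂ _ ⟨hq, ?_⟩ ξ).trans ?_
      · rw [hf.exp_mul p hp t ht.1 (hle t ht)]; exact hle t ht
      · calc _ ≤ C₂ * (K * (Real.exp (w₂ H * t) * c.weight x w₂ p)) *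
              (C ^ N * ∏ i, c.len p (ξ i)) := by
              gcongr
              · exact Finset.prod_nonneg fun i _ => h.len_nonneg hq _
              · exact hK p hp t ht.1 (hle t ht)
              · exact hL t ht
          _ = _ := by ring)
    hz (by positivity)
  have hTmem : T ∈ Set.Icc 0 T := Set.right_mem_Icc.mpr hT0
  have hqT := hf.mem p hp T hT0 (hle T hTmem)
  have hmT : m (p + T • V) = δ := by
    rw [hf.exp_mul p hp T hT0 (hle T hTmem), hexp]; field_simp
  -- The weight at the end point exceeds that at p by exp(w₂ H T), and this is absorbed by exp(-Re z
  -- T) because w₂ H < Re z.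
  have hend : Real.exp (-(z.re * T)) * ‖iteratedFDeriv ℝ N F (p + T • V) ξ‖
      ≤ C₁ * K' * K * C ^ N * c.weight x w₂ p * ∏ i, c.len p (ξ i) := by
    calc _ ≤ Real.exp (-(z.re * T)) * (C₁ * (K' * (K * (Real.exp (w₂ H * T) * c.weight x w₂ p))) *
              (C ^ N * ∏ i, c.len p (ξ i))) := by
          gcongr
          refine (hC₁ _ ⟨hqT, hmT.le⟩ ξ).trans ?_
          gcongr
          · exact Finset.prod_nonneg fun i _ => h.len_nonneg hqT _
          · refine (hK' _ ⟨hqT, hmT.ge⟩).trans ?_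
            gcongr
            exact hK p hp T hT0 (hle T hTmem)
          · exact hL T hTmem
      _ = Real.exp ((w₂ H - z.re) * T) *
            (C₁ * K' * K * C ^ N * c.weight x w₂ p * ∏ i, c.len p (ξ i)) := by
          rw [show (w₂ H - z.re) * T = -(z.re * T) + w₂ H * T by ring, Real.exp_add]; ring
      _ ≤ 1 * (C₁ * K' * K * C ^ N * c.weight x w₂ p * ∏ i, c.len p (ξ i)) := by
          gcongr
          rw [Real.exp_le_one_iff]
          exact mul_nonpos_of_nonpos_of_nonneg (by linarith) hT0
      _ = _ := one_mul _
  simp only [zero_smul, add_zero] at key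
  refine (key.trans (add_le_add_left hend _)).trans (le_of_eq ?_)
  change _ = _ * c.weight x w₂ p * ∏ i, c.len p (ξ i)
  ring

end FlowsOut

/-- Finitely many factors raise the order at H to a large s. Interpolation turns this into order e
at H and almost w₁ elsewhere, and then the factors are inverted one by one; as every exponent has
real part above e, no inversion lowers the order e. -/
theorem BdfLE.improve_of_flowsOut (h : c.BdfLE x M) {G : Pt d → ℂ} {w₀ w₁ : Face → ℝ}
    {E : IndexSet} {H : Face} {V : Pt d} {m : Pt d → ℝ} {δ₀ C : ℝ}
    (hV : c.vectorField H = fun _ => V) (hf : c.FlowsOut x H V m δ₀ C)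
    (hsm : ∀ p ∈ c.region, ContDiffAt ℝ ∞ G p) (hG : c.PhgAt x w₀ E G H)
    (hG₁ : c.ConormalBound x G c.region w₁) {e : ℝ} (he : ∀ z ∈ E.carrier, e < z.1.re)
    {ε : ℝ} (hε : 0 < ε) :
    c.ConormalBound x G c.region (Function.update (fun H' => w₁ H' - ε) H e) := by
  set w₂ := Function.update (fun H' => w₁ H' - ε) H e with hw₂
  have hw₂H : w₂ H = e := by simp [hw₂]
  have hw₂' : ∀ H' ≠ H, w₂ H' = w₁ H' - ε := fun H' hH => by simp [hw₂, Function.update_of_ne hH]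
  have hC : 0 < C := by linarith [hf.one_le]
  obtain ⟨θ, s, hθ0, hθ1, hs, hθ⟩ := exists_interpolation w₀ w₁ H e hε
  set l := (E.finite_re_le s).toFinset.toList with hl
  have hmem : ∀ e, e ∈ l ↔ e ∈ E.carrier ∧ e.1.re ≤ s := by intro e; simp [hl]
  obtain ⟨δ, hδ, hb⟩ := hG s l (Finset.nodup_toList _) hmem
  rw [hV] at hb
  set δ' := min δ₀ (δ / (2 * C)) with hδ'
  have hδ'0 : 0 < δ' := lt_min hf.delta_pos (by positivity)
  replace hf := hf.mono_delta hδ'0 (min_le_left _ _)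
  -- Polyhomogeneity is stated near `ρ_H = 0` and the flow in terms of `m`; the factor 2C in δ'
  -- passes from one to the other.
  have hsub : {p | p ∈ c.region ∧ m p ≤ δ'} ⊆ {p | p ∈ c.region ∧ c.bdf x p H < δ} := by
    rintro p ⟨hp, hm⟩
    refine ⟨hp, (hf.near p hp hm).1.trans_lt ?_⟩
    calc C * m p ≤ C * (δ / (2 * C)) := by gcongr; exact hm.trans (min_le_right _ _)
      _ = δ / 2 := by field_simp
      _ < δ := by linarith
  have hall : ∀ l', c.ConormalBound x (applyFactors (fun _ => V) l' G)
      {p | p ∈ c.region ∧ m p ≤ δ'} w₁ := fun l' =>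
    DerivBound.applyFactors (DerivBound.subset hG₁ fun p hp => hp.1) (fun p hp => hsm p hp.1)
      (fun p hp => h.len_nonneg hp.1) (fun p hp => (h.weight_pos _ hp.1).le)
      (fun p hp => hf.len_field p hp.1 hp.2) l'
  have hnear : ∀ l', (∀ e ∈ l', w₂ H < e.1.re) →
      c.ConormalBound x (applyFactors (fun _ => V) l' G) {p | p ∈ c.region ∧ m p ≤ δ'} w₂ →
      c.ConormalBound x G {p | p ∈ c.region ∧ m p ≤ δ'} w₂ := by
    intro l' hl' hb'
    induction l' with
    | nil => exact hb'
    | cons a l' ih =>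
      refine ih (fun e he => hl' e (List.mem_cons_of_mem _ he)) ?_
      exact hf.invert_factor h (w₁ := w₁) (fun H' hH => by rw [hw₂' H' hH]; linarith)
        (fun p hp => ContDiffAt.applyFactors (hsm p hp) contDiff_const l') (hall l')
        (hl' a List.mem_cons_self) hb'
  have hb₂ : c.ConormalBound x (applyFactors (fun _ => V) l G) {p | p ∈ c.region ∧ m p ≤ δ'} w₂ := by
    refine h.conormalBound_interpolate (fun p hp => hp.1) (DerivBound.subset hb hsub)
      (hall l) hθ0.le hθ1 fun H' => ?_
    by_cases hH : H' = H
    · subst hH; simpa [hw₂H] using hs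
    · rw [hw₂' H' hH]; simpa [Function.update_of_ne hH] using hθ H'
  have hnear' := hnear l (fun a ha => by rw [hw₂H]; exact he a ((hmem a).1 ha).1) hb₂
  have hfar : c.ConormalBound x G {p | p ∈ c.region ∧ δ' ≤ m p} w₂ := by
    refine h.conormalBound_mono (fun p hp => hp.1) (DerivBound.subset hG₁ fun p hp => hp.1)
      fun H' => ?_
    by_cases hH : H' = H
    · subst hH
      exact .inr ⟨_, div_pos hδ'0 (add_pos one_pos hδ'0), fun p hp => hf.far δ' hδ'0 p hp.1 hp.2⟩
    · left; rw [hw₂' H' hH]; linarith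
  refine (DerivBound.union hnear' hfar ?_ ?_).subset ?_
  · rintro p (hp | hp) <;> exact h.len_nonneg hp.1
  · rintro p (hp | hp) <;> exact (h.weight_pos _ hp.1).le
  · intro p hp
    rcases le_total (m p) δ' with h1 | h1
    exacts [.inl ⟨hp, h1⟩, .inr ⟨hp, h1⟩]

end BlowupCoords
end LowEnergy
end

/-! ### Outward flows at `zf`, `bf0`, `lb0` and `rb0`. -/

noncomputable section
namespace LowEnergy

/-! ## Boundary defining functions along flows -/

section Rho

variable {σ k x x' : ℝ}

theorem rho_pos (hσ : 0 < σ) (hk : 0 < k) (hx : 0 < x) (hx' : 0 < x') (H : Face) :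
    0 < rho σ k x x' H := by
  cases H <;> simp only [rho] <;> positivity

theorem rho_le (hσ : 0 < σ) (hk : 0 < k) (hx : 0 < x) (hx' : 0 < x') (hσ1 : σ ≤ 1)
    (hσq : (x + x') / (k + x + x') ≤ σ) (H : Face) :
    rho σ k x x' H ≤ max 1 (k + x + x') := by
  cases H with
  | bf0 => exact le_max_right _ _
  | sc => exact hσ1.trans (le_max_left _ _)
  | bf => exact le_trans ((div_le_one hσ).2 hσq) (le_max_left _ _)
  | _ =>
    refine le_trans ?_ (le_max_left _ _)
    simp only [rho]
    rw [div_le_one (by positivity)]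
    nlinarith [mul_pos hk hx, mul_pos hk hx', mul_pos hx hx']

/-- How the boundary defining functions change, when the sums they are made of are scaled. -/
theorem rho_comparable {B σ₁ k₁ x₁ x₁' f₁ f₂ f₃ f₄ f₅ f₆ f₇ f₈ : ℝ} (hB : 1 ≤ B)
    (hσ : 0 < σ) (hk : 0 < k) (hx : 0 < x) (hx' : 0 < x')
    (hσ₁ : 0 < σ₁) (hk₁ : 0 < k₁) (hx₁ : 0 < x₁) (hx₁' : 0 < x₁')
    (p₁ : 0 < f₁) (p₂ : 0 < f₂) (p₃ : 0 < f₃) (p₄ : 0 < f₄) (p₅ : 0 < f₅) (p₆ : 0 < f₆)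
    (p₇ : 0 < f₇) (p₈ : 0 < f₈)
    (h₁ : Comparable B k₁ (f₁ * k)) (h₂ : Comparable B x₁ (f₂ * x))
    (h₃ : Comparable B x₁' (f₃ * x')) (h₄ : Comparable B (k₁ + x₁) (f₄ * (k + x)))
    (h₅ : Comparable B (k₁ + x₁') (f₅ * (k + x'))) (h₆ : Comparable B (x₁ + x₁') (f₆ * (x + x')))
    (h₇ : Comparable B (k₁ + x₁ + x₁') (f₇ * (k + x + x'))) (h₈ : Comparable B σ₁ (f₈ * σ))
    (H : Face) :
    Comparable (B ^ 4) (rho σ₁ k₁ x₁ x₁' H)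
      ((match H with
          | .zf => f₁ * f₇ / (f₄ * f₅)
          | .bf0 => f₇
          | .lb0 => f₄ / f₇
          | .rb0 => f₅ / f₇
          | .lb => f₂ * f₇ / (f₄ * f₆)
          | .rb => f₃ * f₇ / (f₅ * f₆)
          | .bf => f₆ / f₇ / f₈
          | .sc => f₈) * rho σ k x x' H) := by
  have b1 : B ≤ B ^ 4 := le_self_pow₀ hB (by norm_num)
  have b2 : B * B ≤ B ^ 4 := by
    calc B * B = B ^ 2 := by ring
      _ ≤ B ^ 4 := pow_le_pow_right₀ hB (by norm_num)
  have b3 : B * B * B ≤ B ^ 4 := by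
    calc B * B * B = B ^ 3 := by ring
      _ ≤ B ^ 4 := pow_le_pow_right₀ hB (by norm_num)
  have b4 : B * B * (B * B) ≤ B ^ 4 := by
    calc B * B * (B * B) = B ^ 4 := by ring
      _ ≤ B ^ 4 := le_rfl
  cases H with
  | zf =>
    have := (((h₁.mul h₇ (by positivity) (by positivity) (by positivity) (by positivity)).div
      (h₄.mul h₅ (by positivity) (by positivity) (by positivity) (by positivity)) (by positivity)
      (by positivity) (by positivity) (by positivity)).mono b4 (by positivity) (by positivity))
    convert! this using 1
    simp only [rho]; field_simp
  | bf0 =>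
    have := h₇.mono b1 (by positivity) (by positivity)
    convert! this using 1
  | lb0 =>
    have := (h₄.div h₇ (by positivity) (by positivity) (by positivity) (by positivity)).mono b2
      (by positivity) (by positivity)
    convert! this using 1
    simp only [rho]; field_simp
  | rb0 =>
    have := (h₅.div h₇ (by positivity) (by positivity) (by positivity) (by positivity)).mono b2
      (by positivity) (by positivity)
    convert! this using 1
    simp only [rho]; field_simp
  | lb =>
    have := (((h₂.mul h₇ (by positivity) (by positivity) (by positivity) (by positivity)).div
      (h₄.mul h₆ (by positivity) (by positivity) (by positivity) (by positivity)) (by positivity)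
      (by positivity) (by positivity) (by positivity)).mono b4 (by positivity) (by positivity))
    convert! this using 1
    simp only [rho]; field_simp
  | rb =>
    have := (((h₃.mul h₇ (by positivity) (by positivity) (by positivity) (by positivity)).div
      (h₅.mul h₆ (by positivity) (by positivity) (by positivity) (by positivity)) (by positivity)
      (by positivity) (by positivity) (by positivity)).mono b4 (by positivity) (by positivity))
    convert! this using 1
    simp only [rho]; field_simp
  | bf =>
    have := (((h₆.div h₇ (by positivity) (by positivity) (by positivity) (by positivity)).div
      h₈ (by positivity) (by positivity) (by positivity) (by positivity)).mono b3
      (by positivity) (by positivity))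
    convert! this using 1
    simp only [rho]; field_simp
  | sc =>
    have := h₈.mono b1 (by positivity) (by positivity)
    convert! this using 1

end Rho

namespace BlowupCoords

variable {d : ℕ} {X : Type*}

/-- The distance to `bf ∪ sc`. -/
def scRatio (c : BlowupCoords d X) (x : X → ℝ) (p : Pt d) : ℝ :=
  (x (c.left p) + x (c.right p)) / (Real.exp p.1 + x (c.left p) + x (c.right p))

/-- The field `k ∂_k`, plus `x ∂_x` if `a`, plus `x' ∂_{x'}` if `b`. -/
def field (c : BlowupCoords d X) (a b : Bool) : Pt d :=
  (1, 0, 0) + (if a then c.eL else 0) + (if b then c.eR else 0)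

/-- Translations along `k ∂_k`, `x ∂_x` and `x' ∂_{x'}` stay in the region as long as `k`, `x`, `x'`
are small. -/
structure Movable (c : BlowupCoords d X) (x : X → ℝ) (k₀ r₀ X₀ : ℝ) (ν : Pt d → ℝ) : Prop where
  k₀_pos : 0 < k₀
  r₀_pos : 0 < r₀
  lt_k₀ : ∀ p ∈ c.region, Real.exp p.1 < k₀
  left_pos : ∀ p, 0 < x (c.left p)
  right_pos : ∀ p, 0 < x (c.right p)
  left_le : ∀ p ∈ c.region, x (c.left p) ≤ X₀
  right_le : ∀ p ∈ c.region, x (c.right p) ≤ X₀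
  nu_nonneg : ∀ p, 0 ≤ ν p
  scSize_eq : ∀ p, c.scSize p = min 1 (c.scRatio x p + ν p)
  norm_field_le : ∀ p ∈ c.region, ‖(c.eL + c.eR).2.2‖ ≤ c.scSize p
  move : ∀ a b : Bool, ∀ p ∈ c.region, ∀ t : ℝ, 0 ≤ t → Real.exp t * Real.exp p.1 < k₀ →
    (a = true → Real.exp t * x (c.left p) ≤ r₀) → (b = true → Real.exp t * x (c.right p) ≤ r₀) →
    p + t • c.field a b ∈ c.region ∧
    x (c.left (p + t • c.field a b)) = (if a then Real.exp t else 1) * x (c.left p) ∧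
    x (c.right (p + t • c.field a b)) = (if b then Real.exp t else 1) * x (c.right p) ∧
    (p + t • c.field a b).1 = p.1 + t ∧ (a = b → a = true → ν (p + t • c.field a b) = ν p)

namespace Movable

variable {c : BlowupCoords d X} {x : X → ℝ} {k₀ r₀ X₀ : ℝ} {ν : Pt d → ℝ}

theorem scRatio_pos (h : c.Movable x k₀ r₀ X₀ ν) (p : Pt d) : 0 < c.scRatio x p := by
  have := h.left_pos p
  have := h.right_pos p
  unfold scRatio
  positivity

theorem scRatio_le_one (h : c.Movable x k₀ r₀ X₀ ν) (p : Pt d) : c.scRatio x p ≤ 1 := by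
  have := h.left_pos p
  have := h.right_pos p
  unfold scRatio
  rw [div_le_one (by positivity)]
  linarith [Real.exp_pos p.1]

theorem scSize_pos (h : c.Movable x k₀ r₀ X₀ ν) (p : Pt d) : 0 < c.scSize p := by
  rw [h.scSize_eq]
  exact lt_min one_pos (add_pos_of_pos_of_nonneg (h.scRatio_pos p) (h.nu_nonneg p))

theorem scSize_le_one (h : c.Movable x k₀ r₀ X₀ ν) (p : Pt d) : c.scSize p ≤ 1 := by
  rw [h.scSize_eq]
  exact min_le_left _ _

theorem scRatio_le_scSize (h : c.Movable x k₀ r₀ X₀ ν) (p : Pt d) : c.scRatio x p ≤ c.scSize p := by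
  rw [h.scSize_eq]
  exact le_min (h.scRatio_le_one p) (le_add_of_nonneg_right (h.nu_nonneg p))

theorem bdfLE (h : c.Movable x k₀ r₀ X₀ ν) : c.BdfLE x (max 1 (k₀ + X₀ + X₀)) := by
  intro p hp
  refine ⟨h.scSize_pos p, fun H => ⟨rho_pos (h.scSize_pos p) (Real.exp_pos _) (h.left_pos p)
    (h.right_pos p) H, (rho_le (h.scSize_pos p) (Real.exp_pos _) (h.left_pos p)
    (h.right_pos p) (h.scSize_le_one p) (h.scRatio_le_scSize p) H).trans ?_⟩⟩
  gcongr
  · exact (h.lt_k₀ p hp).le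
  · exact h.left_le p hp
  · exact h.right_le p hp

/-- The exactly homogeneous version of the boundary defining function. -/
def dist (c : BlowupCoords d X) (x : X → ℝ) (a b : Bool) (p : Pt d) : ℝ :=
  let k := Real.exp p.1
  let y := x (c.left p)
  let y' := x (c.right p)
  match a, b with
  | true, true => k + y + y'
  | true, false => (k + y) / y'
  | false, true => (k + y') / y
  | false, false => k / y + k / y'

/-- The hypersurface which the flow of `c.field a b` leaves. -/
def fieldFace : Bool → Bool → Face
  | true, true => .bf0
  | true, false => .lb0
  | false, true => .rb0
  | false, false => .zf

theorem comparable_of_half_le {s t : ℝ} (hs : 1 / 2 ≤ s) (hs' : s ≤ 1) (ht : 1 / 2 ≤ t)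
    (ht' : t ≤ 1) : Comparable 2 s t := ⟨by linarith, by linarith⟩

theorem half_le_scSize (h : c.Movable x k₀ r₀ X₀ ν) {p : Pt d}
    (hp : Real.exp p.1 ≤ x (c.left p) + x (c.right p)) : 1 / 2 ≤ c.scSize p := by
  refine le_trans ?_ (h.scRatio_le_scSize p)
  unfold scRatio
  have := h.left_pos p
  have := h.right_pos p
  have := Real.exp_pos p.1
  rw [le_div_iff₀ (by positivity)]
  linarith

/-- Near `zf`, `lb0` and `rb0` one is away from `sc`: with k ≤ x + x' the function `scSize` lies
between 1/2 and 1, so it cannot vary much along the flow. -/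
theorem dist_bounds (h : c.Movable x k₀ r₀ X₀ ν) (a b : Bool) {δ : ℝ} (hδ1 : δ ≤ 1) {p : Pt d}
    (hp : dist c x a b p ≤ δ) (hab : ¬ (a = true ∧ b = true)) :
    Real.exp p.1 ≤ x (c.left p) + x (c.right p) := by
  have h1 := h.left_pos p
  have h2 := h.right_pos p
  have h3 := Real.exp_pos p.1
  cases a <;> cases b <;> simp only [dist] at hp <;> simp at hab
  · have : 0 < Real.exp p.1 / x (c.right p) := by positivity
    have h4 : Real.exp p.1 / x (c.left p) ≤ 1 := by linarith
    rw [div_le_one h1] at h4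
    linarith
  · rw [div_le_iff₀ h1] at hp
    nlinarith
  · rw [div_le_iff₀ h2] at hp
    nlinarith

/-- The homogeneous distance can be large where the defining function stays bounded, hence the form
η / (1 + η). -/
theorem dist_far (h : c.Movable x k₀ r₀ X₀ ν) (a b : Bool) {η : ℝ} (hη : 0 < η) {p : Pt d}
    (hp : η ≤ dist c x a b p) : η / (1 + η) ≤ c.bdf x p (fieldFace a b) := by
  have h1 := h.left_pos p
  have h2 := h.right_pos p
  have h3 := Real.exp_pos p.1
  unfold bdf
  cases a <;> cases b <;> simp only [dist, fieldFace, rho] at hp ⊢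
  · rw [div_le_div_iff₀ (by positivity) (by positivity)]
    rw [div_add_div _ _ h1.ne' h2.ne', le_div_iff₀ (by positivity)] at hp
    nlinarith [mul_pos h3 h1, mul_pos h3 h2, mul_pos h3 h3]
  · rw [div_le_div_iff₀ (by positivity) (by positivity)]
    rw [le_div_iff₀ h1] at hp
    nlinarith
  · rw [div_le_div_iff₀ (by positivity) (by positivity)]
    rw [le_div_iff₀ h2] at hp
    nlinarith
  · refine le_trans ?_ hp
    exact div_le_self hη.le (by linarith)

theorem dist_near (h : c.Movable x k₀ r₀ X₀ ν) (a b : Bool) {p : Pt d}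
    (hp : dist c x a b p ≤ 1) : Comparable 3 (c.bdf x p (fieldFace a b)) (dist c x a b p) := by
  have h1 := h.left_pos p
  have h2 := h.right_pos p
  have h3 := Real.exp_pos p.1
  unfold bdf
  cases a <;> cases b <;> simp only [dist, fieldFace, rho] at hp ⊢
  · have h4 : Real.exp p.1 / x (c.left p) ≤ 1 := by
      have : 0 < Real.exp p.1 / x (c.right p) := by positivity
      linarith
    have h5 : Real.exp p.1 / x (c.right p) ≤ 1 := by
      have : 0 < Real.exp p.1 / x (c.left p) := by positivity
      linarith
    rw [div_le_one h1] at h4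
    rw [div_le_one h2] at h5
    rw [div_add_div _ _ h1.ne' h2.ne', div_le_one (by positivity)] at hp
    rw [div_add_div _ _ h1.ne' h2.ne']
    generalize Real.exp p.1 = k at *
    generalize x (c.left p) = y at *
    generalize x (c.right p) = y' at *
    constructor
    · rw [div_le_iff₀ (by positivity), ← mul_div_assoc, div_mul_eq_mul_div,
        le_div_iff₀ (by positivity)]
      have e1 : k * (k + y + y') ≤ 3 * (k * y' + y * k) := by nlinarith
      have e2 : y * y' ≤ (k + y) * (k + y') := by nlinarith [mul_pos h3 h1, mul_pos h3 h2]
      exact mul_le_mul e1 e2 (by positivity) (by positivity)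
    · rw [div_le_iff₀ (by positivity), ← mul_div_assoc, div_mul_eq_mul_div,
        le_div_iff₀ (by positivity)]
      have e1 : k * y' + y * k ≤ k * (k + y + y') := by nlinarith
      have e2 : (k + y) * (k + y') ≤ 3 * (y * y') := by
        nlinarith [mul_le_mul h4 h5 h3.le h1.le]
      calc _ ≤ (k * (k + y + y')) * (3 * (y * y')) :=
            mul_le_mul e1 e2 (by positivity) (by positivity)
        _ = _ := by ring
  · rw [div_le_one h1] at hp
    constructor
    · rw [div_le_iff₀ (by positivity), ← mul_div_assoc, div_mul_eq_mul_div,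
        le_div_iff₀ (by positivity)]
      nlinarith
    · rw [div_le_iff₀ (by positivity), ← mul_div_assoc, div_mul_eq_mul_div,
        le_div_iff₀ (by positivity)]
      nlinarith
  · rw [div_le_one h2] at hp
    constructor
    · rw [div_le_iff₀ (by positivity), ← mul_div_assoc, div_mul_eq_mul_div,
        le_div_iff₀ (by positivity)]
      nlinarith
    · rw [div_le_iff₀ (by positivity), ← mul_div_assoc, div_mul_eq_mul_div,
        le_div_iff₀ (by positivity)]
      nlinarith
  · exact Comparable.refl (by norm_num) (by positivity)

theorem dist_pos (h : c.Movable x k₀ r₀ X₀ ν) (a b : Bool) (p : Pt d) : 0 < dist c x a b p := by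
  have h1 := h.left_pos p
  have h2 := h.right_pos p
  cases a <;> cases b <;> simp only [dist] <;> positivity

/-- The flow line is within the scope of `Movable.move`. -/
theorem move_of_dist_le (h : c.Movable x k₀ r₀ X₀ ν) (a b : Bool) {δ : ℝ} (hδ : 0 < δ)
    (hδr : δ ≤ r₀) (hδk : δ < k₀) (hδr' : δ * X₀ ≤ r₀) (hδk' : δ * X₀ < k₀)
    {p : Pt d} (hp : p ∈ c.region) {t : ℝ} (hpt : Real.exp t * dist c x a b p ≤ δ) :
    Real.exp t * Real.exp p.1 < k₀ ∧ (a = true → Real.exp t * x (c.left p) ≤ r₀) ∧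
      (b = true → Real.exp t * x (c.right p) ≤ r₀) := by
  have h1 := h.left_pos p
  have h2 := h.right_pos p
  have h3 := Real.exp_pos p.1
  have h4 := Real.exp_pos t
  have h5 := mul_pos h4 h3
  have h6 := mul_pos h4 h1
  have h7 := mul_pos h4 h2
  have e1 : δ * x (c.left p) ≤ δ * X₀ := by gcongr; exact h.left_le p hp
  have e2 : δ * x (c.right p) ≤ δ * X₀ := by gcongr; exact h.right_le p hp
  cases a <;> cases b <;> simp only [dist] at hpt <;> simp
  · have : Real.exp t * Real.exp p.1 ≤ δ * x (c.left p) := by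
      rw [← div_le_iff₀ h1, mul_div_assoc]
      refine le_trans ?_ hpt
      rw [mul_add]
      exact le_add_of_nonneg_right (by positivity)
    linarith
  · rw [← mul_div_assoc, div_le_iff₀ h1, mul_add] at hpt
    constructor <;> linarith
  · rw [← mul_div_assoc, div_le_iff₀ h2, mul_add] at hpt
    constructor <;> linarith
  · rw [mul_add, mul_add] at hpt
    refine ⟨?_, ?_, ?_⟩ <;> linarith

/-- The sums which the boundary defining functions are made of, along the flow. -/
theorem comparable_flow (h : c.Movable x k₀ r₀ X₀ ν) (a b : Bool) {δ : ℝ} (hδ : 0 < δ)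
    (hδ1 : δ ≤ 1) (hδr : δ ≤ r₀) (hδk : δ < k₀) (hδr' : δ * X₀ ≤ r₀) (hδk' : δ * X₀ < k₀)
    {p : Pt d} (hp : p ∈ c.region) {t : ℝ} (ht : 0 ≤ t) (hpt : Real.exp t * dist c x a b p ≤ δ) :
    Comparable 2 (c.scSize (p + t • c.field a b)) (c.scSize p) ∧
    ∀ H ≠ fieldFace a b, Comparable (2 ^ 4) (c.bdf x (p + t • c.field a b) H) (c.bdf x p H) := by
  obtain ⟨m1, m2, m3⟩ := h.move_of_dist_le a b hδ hδr hδk hδr' hδk' hp hpt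
  obtain ⟨-, hl, hr, hk, hν⟩ := h.move a b p hp t ht m1 m2 m3
  set q := p + t • c.field a b with hq
  have hkk : Real.exp q.1 = Real.exp t * Real.exp p.1 := by rw [hk, Real.exp_add, mul_comm]
  have g1 := h.left_pos p
  have g2 := h.right_pos p
  have g3 := Real.exp_pos p.1
  have g4 := Real.one_le_exp ht
  have g5 : dist c x a b p ≤ δ :=
    (le_mul_of_one_le_left (h.dist_pos a b p).le g4).trans hpt
  have hσ : Comparable 2 (c.scSize q) (c.scSize p) := by
    by_cases hab : a = true ∧ b = true
    · obtain ⟨rfl, rfl⟩ := hab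
      simp only [if_true] at hl hr
      have : c.scSize q = c.scSize p := by
        rw [h.scSize_eq, h.scSize_eq, hν rfl rfl]
        congr 2
        unfold scRatio
        rw [hl, hr, hkk, ← mul_add, ← mul_add, ← mul_add, mul_div_mul_left _ _ (Real.exp_pos t).ne']
      rw [this]
      exact Comparable.refl one_le_two (h.scSize_pos p).le
    · refine comparable_of_half_le (h.half_le_scSize ?_) (h.scSize_le_one _)
        (h.half_le_scSize ?_) (h.scSize_le_one _)
      · rw [hkk, hl, hr]
        have := (mul_le_mul_of_nonneg_left (h.dist_bounds a b hδ1 g5 hab) (Real.exp_pos t).le)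
        cases a <;> cases b <;> simp at hab
        · simp only [dist] at hpt
          have : Real.exp t * (Real.exp p.1 / x (c.left p)) ≤ 1 := by
            have := mul_pos (Real.exp_pos t) (div_pos g3 g2)
            linarith [mul_add (Real.exp t) (Real.exp p.1 / x (c.left p))
              (Real.exp p.1 / x (c.right p))]
          rw [← mul_div_assoc, div_le_one g1] at this
          simp
          linarith
        · simp only [dist] at hpt
          rw [← mul_div_assoc, div_le_iff₀ g1, mul_add] at hpt
          simp
          nlinarith [mul_pos (Real.exp_pos t) g2]
        · simp only [dist] at hpt
          rw [← mul_div_assoc, div_le_iff₀ g2, mul_add] at hpt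
          simp
          nlinarith [mul_pos (Real.exp_pos t) g1]
      · exact h.dist_bounds a b hδ1 g5 hab
  refine ⟨hσ, fun H hH => ?_⟩
  have B1 : (1 : ℝ) ≤ 2 := one_le_two
  have s0 := h.scSize_pos p
  have s1 := h.scSize_pos q
  have g6 := h.left_pos q
  have g7 := h.right_pos q
  have g8 := Real.exp_pos q.1
  have g9 := Real.exp_pos t
  have r : ∀ {s : ℝ}, 0 < s → Comparable 2 s s := fun hs => Comparable.refl B1 hs.le
  unfold bdf
  generalize c.scSize p = σ at *
  generalize c.scSize q = σ₁ at *
  generalize Real.exp q.1 = k₁ at *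
  generalize x (c.left q) = y₁ at *
  generalize x (c.right q) = y₁' at *
  simp only [dist] at hpt
  generalize Real.exp p.1 = k at *
  generalize x (c.left p) = y at *
  generalize x (c.right p) = y' at *
  generalize Real.exp t = lam at *
  subst hkk hl hr
  -- The variables that the flow does not scale dominate those that it does, since exp t times the
  -- distance stays below 1. So each sum is scaled, up to a factor 2, either by exp t or by 1: by
  -- exp t precisely when all its terms are. The f_i record this, and they cancel in every defining
  -- function except that of the face being left.
  cases a <;> cases b <;> simp only [Bool.false_eq_true, if_true, if_false, one_mul, fieldFace]
    at hpt hH g6 g7 ⊢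
  · have e1 : lam * k ≤ y := by
      have h1 : lam * (k / y) ≤ 1 := by
        have := mul_pos g9 (div_pos g3 g2)
        linarith [mul_add lam (k / y) (k / y')]
      rwa [← mul_div_assoc, div_le_one g1] at h1
    have e2 : lam * k ≤ y' := by
      have h1 : lam * (k / y') ≤ 1 := by
        have := mul_pos g9 (div_pos g3 g1)
        linarith [mul_add lam (k / y) (k / y')]
      rwa [← mul_div_assoc, div_le_one g2] at h1
    have e3 : k ≤ lam * k := le_mul_of_one_le_left g3.le g4
    have := rho_comparable (f₁ := lam) (f₂ := 1) (f₃ := 1) (f₄ := 1) (f₅ := 1) (f₆ := 1) (f₇ := 1)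
      (f₈ := 1) B1 s0 g3 g1 g2 s1 g8 g6 g7 g9 one_pos one_pos one_pos one_pos one_pos one_pos
      one_pos (r (by positivity)) (by rw [one_mul]; exact r g1) (by rw [one_mul]; exact r g2)
      (by constructor <;> linarith) (by constructor <;> linarith) (by constructor <;> linarith)
      (by constructor <;> linarith) (by simpa using hσ) H
    cases H <;> simp at this hH ⊢ <;> exact this
  · have e1 : lam * k + lam * y' ≤ y := by
      rw [← mul_div_assoc, div_le_iff₀ g1, mul_add] at hpt
      nlinarith
    have e3 : k ≤ lam * k := le_mul_of_one_le_left g3.le g4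
    have e4 : y' ≤ lam * y' := le_mul_of_one_le_left g2.le g4
    have := rho_comparable (f₁ := lam) (f₂ := 1) (f₃ := lam) (f₄ := 1) (f₅ := lam) (f₆ := 1)
      (f₇ := 1) (f₈ := 1) B1 s0 g3 g1 g2 s1 g8 g6 g7 g9 one_pos g9 one_pos g9 one_pos one_pos
      one_pos (r (by positivity)) (by rw [one_mul]; exact r g1) (r (by positivity))
      (by constructor <;> linarith) (by constructor <;> linarith) (by constructor <;> linarith)
      (by constructor <;> linarith) (by simpa using hσ) H
    cases H <;> simp [g9.ne'] at this hH ⊢ <;> exact this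
  · have e1 : lam * k + lam * y ≤ y' := by
      rw [← mul_div_assoc, div_le_iff₀ g2, mul_add] at hpt
      nlinarith
    have e3 : k ≤ lam * k := le_mul_of_one_le_left g3.le g4
    have e4 : y ≤ lam * y := le_mul_of_one_le_left g1.le g4
    have := rho_comparable (f₁ := lam) (f₂ := lam) (f₃ := 1) (f₄ := lam) (f₅ := 1) (f₆ := 1)
      (f₇ := 1) (f₈ := 1) B1 s0 g3 g1 g2 s1 g8 g6 g7 g9 g9 one_pos g9 one_pos one_pos one_pos
      one_pos (r (by positivity)) (r (by positivity)) (by rw [one_mul]; exact r g2)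
      (by constructor <;> linarith) (by constructor <;> linarith) (by constructor <;> linarith)
      (by constructor <;> linarith) (by simpa using hσ) H
    cases H <;> simp [g9.ne'] at this hH ⊢ <;> exact this
  · have := rho_comparable (f₁ := lam) (f₂ := lam) (f₃ := lam) (f₄ := lam) (f₅ := lam) (f₆ := lam)
      (f₇ := lam) (f₈ := 1) B1 s0 g3 g1 g2 s1 g8 g6 g7 g9 g9 g9 g9 g9 g9 g9
      one_pos (r (by positivity)) (r (by positivity)) (r (by positivity))
      (by rw [mul_add]; exact r (by positivity)) (by rw [mul_add]; exact r (by positivity))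
      (by rw [mul_add]; exact r (by positivity))
      (by rw [mul_add, mul_add]; exact r (by positivity)) (by simpa using hσ) H
    cases H <;> simp [g9.ne'] at this hH ⊢ <;> exact this

theorem dist_move (h : c.Movable x k₀ r₀ X₀ ν) (a b : Bool) {δ : ℝ} (hδ : 0 < δ)
    (hδr : δ ≤ r₀) (hδk : δ < k₀) (hδr' : δ * X₀ ≤ r₀) (hδk' : δ * X₀ < k₀)
    {p : Pt d} (hp : p ∈ c.region) {t : ℝ} (ht : 0 ≤ t) (hpt : Real.exp t * dist c x a b p ≤ δ) :
    dist c x a b (p + t • c.field a b) = Real.exp t * dist c x a b p := by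
  obtain ⟨m1, m2, m3⟩ := h.move_of_dist_le a b hδ hδr hδk hδr' hδk' hp hpt
  obtain ⟨-, hl, hr, hk, -⟩ := h.move a b p hp t ht m1 m2 m3
  unfold dist
  rw [hl, hr, hk, Real.exp_add]
  cases a <;> cases b <;> simp <;> ring

theorem len_field_le (h : c.Movable x k₀ r₀ X₀ ν) (a b : Bool) {δ : ℝ} (hδ1 : δ ≤ 1)
    {p : Pt d} (hp : p ∈ c.region) (hpt : dist c x a b p ≤ δ) :
    c.len p (c.field a b) ≤ 16 + ‖c.field a b‖ + ‖c.field a b‖ + 2 * ‖c.field a b‖ := by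
  have e1 : ‖(c.field a b).1‖ ≤ ‖c.field a b‖ := norm_fst_le _
  have e2 : ‖(c.field a b).2.1‖ ≤ ‖c.field a b‖ := (norm_fst_le _).trans (norm_snd_le _)
  have e3 : ‖(c.field a b).2.2‖ ≤ ‖c.field a b‖ := (norm_snd_le _).trans (norm_snd_le _)
  have hs := h.scSize_pos p
  have e0 := norm_nonneg (c.field a b)
  have : ‖(c.field a b).2.2‖ / c.scSize p ≤ 16 + 2 * ‖c.field a b‖ := by
    by_cases hab : a = true ∧ b = true
    · obtain ⟨rfl, rfl⟩ := hab
      have : ‖(c.field true true).2.2‖ / c.scSize p ≤ 1 := by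
        rw [div_le_one hs]
        simpa [field] using h.norm_field_le p hp
      linarith
    · have := h.half_le_scSize (h.dist_bounds a b hδ1 hpt hab)
      rw [div_le_iff₀ hs]
      nlinarith
  unfold len
  linarith

theorem exists_flowsOut (h : c.Movable x k₀ r₀ X₀ ν) (a b : Bool) :
    ∃ δ C : ℝ, c.FlowsOut x (fieldFace a b) (c.field a b) (dist c x a b) δ C := by
  have hk := h.k₀_pos
  have hr := h.r₀_pos
  have hX : 0 < 1 + |X₀| := by positivity
  -- At `bf0` the distance bounds the scaled variables themselves; at the other faces it is a
  -- quotient by x or x', which are at most X₀, and the scaled variables are bounded by δ X₀. Both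
  -- must stay within r₀ and k₀.
  set δ := min (min 1 r₀) (min (k₀ / 2) (min (r₀ / (1 + |X₀|)) (k₀ / (1 + |X₀|) / 2))) with hδ
  have hδ0 : 0 < δ := by positivity
  have hδ1 : δ ≤ 1 := (min_le_left _ _).trans (min_le_left _ _)
  have hδr : δ ≤ r₀ := (min_le_left _ _).trans (min_le_right _ _)
  have hδk : δ < k₀ := ((min_le_right _ _).trans (min_le_left _ _)).trans_lt (by linarith)
  have hXle : δ * X₀ ≤ δ * (1 + |X₀|) := by
    gcongr
    linarith [le_abs_self X₀]
  have hδr' : δ * X₀ ≤ r₀ := by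
    refine hXle.trans ?_
    rw [← le_div_iff₀ hX]
    exact ((min_le_right _ _).trans (min_le_right _ _)).trans (min_le_left _ _)
  have hδk' : δ * X₀ < k₀ := by
    refine hXle.trans_lt ?_
    rw [← lt_div_iff₀ hX]
    refine (((min_le_right _ _).trans (min_le_right _ _)).trans (min_le_right _ _)).trans_lt ?_
    exact half_lt_self (by positivity)
  have hC16 : (2 : ℝ) ^ 4 ≤ 16 + ‖c.field a b‖ + ‖c.field a b‖ + 2 * ‖c.field a b‖ := by
    have := norm_nonneg (c.field a b)
    norm_num
    linarith
  refine ⟨δ, 16 + ‖c.field a b‖ + ‖c.field a b‖ + 2 * ‖c.field a b‖, hδ0, ?_, ?_, ?_, ?_, ?_, ?_,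
    ?_, ?_, ?_⟩
  · linarith [hC16]
  · exact fun p _ => h.dist_pos a b p
  · exact fun η hη p _ hpη => h.dist_far a b hη hpη
  · intro p hp hpδ
    have hb := ((h.bdfLE p hp).2 (fieldFace a b)).1
    exact (h.dist_near a b (hpδ.trans hδ1)).mono (by linarith) hb.le (h.dist_pos a b p).le
  · intro p hp t ht hpt
    obtain ⟨m1, m2, m3⟩ := h.move_of_dist_le a b hδ0 hδr hδk hδr' hδk' hp hpt
    exact (h.move a b p hp t ht m1 m2 m3).1
  · exact fun p hp t ht hpt => h.dist_move a b hδ0 hδr hδk hδr' hδk' hp ht hpt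
  · intro p hp t ht hpt H hH
    obtain ⟨m1, m2, m3⟩ := h.move_of_dist_le a b hδ0 hδr hδk hδr' hδk' hp hpt
    have hq := (h.move a b p hp t ht m1 m2 m3).1
    exact ((h.comparable_flow a b hδ0 hδ1 hδr hδk hδr' hδk' hp ht hpt).2 H hH).mono hC16
      ((h.bdfLE _ hq).2 H).1.le ((h.bdfLE p hp).2 H).1.le
  · intro p hp t ht hpt ξ
    have hs := (h.comparable_flow a b hδ0 hδ1 hδr hδk hδr' hδk' hp ht hpt).1
    have s0 := h.scSize_pos p
    have s1 := h.scSize_pos (p + t • c.field a b)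
    have : ‖ξ.2.2‖ / c.scSize (p + t • c.field a b) ≤ 2 * (‖ξ.2.2‖ / c.scSize p) := by
      rw [div_le_iff₀ s1]
      calc ‖ξ.2.2‖ = (‖ξ.2.2‖ / c.scSize p) * c.scSize p := by field_simp
        _ ≤ (‖ξ.2.2‖ / c.scSize p) * (2 * c.scSize (p + t • c.field a b)) := by
            gcongr
            exact hs.2
        _ = _ := by ring
    have h2 : c.len (p + t • c.field a b) ξ ≤ 2 * c.len p ξ := by
      unfold len
      linarith [norm_nonneg ξ.1, norm_nonneg ξ.2.1]
    refine h2.trans ?_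
    have := h.bdfLE.len_nonneg hp ξ
    gcongr
    linarith
  · exact fun p hp hpt => h.len_field_le a b hδ1 hp hpt

end Movable
end BlowupCoords
end LowEnergy
end

/-! ### From orders at the faces to an explicit size. -/

noncomputable section
namespace LowEnergy

/-! ## Size of products of boundary defining functions -/

theorem Face.prod_univ {M : Type*} [CommMonoid M] (f : Face → M) :
    ∏ H, f H = f .zf * f .bf0 * f .lb0 * f .rb0 * f .lb * f .rb * f .bf * f .sc := by
  have : (Finset.univ : Finset Face) = {.zf, .bf0, .lb0, .rb0, .lb, .rb, .bf, .sc} := rfl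
  rw [this]
  simp [Finset.prod_insert, mul_assoc]

/-- Orders at the hypersurfaces: `τ - 1` at `zf` and `bf0`, `lam + τ - 1` at `lb0`, `mu + τ - 1` at
`rb0`, `s` at `sc`, and `N` at the others. -/
def orders (τ lam mu N s : ℝ) : Face → ℝ
  | .zf => τ - 1
  | .bf0 => τ - 1
  | .lb0 => lam + (τ - 1)
  | .rb0 => mu + (τ - 1)
  | .lb => N
  | .rb => N
  | .bf => N
  | .sc => s

/-- For lam ≥ 0 the extra factors B and q make up for A being larger than r; for lam ≤ 0 already
A^lam ≤ r^lam. It is applied with A = (k+x)/(k+x+x'), r = x/(x+x') and B the defining function of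
`lb`, and to the mirror image at `rb`. -/
theorem rpow_mul_rpow_mul_rpow_le {A B q r lam N : ℝ} (hA : 0 < A) (hB : 0 < B) (hq : 0 < q)
    (hB1 : B ≤ 1) (hq1 : q ≤ 1) (hr : 0 < r) (hrA : r ≤ A) (hABq : A * B * q ≤ r)
    (hN : |lam| ≤ N) : A ^ lam * B ^ N * q ^ |lam| ≤ r ^ lam := by
  rcases le_total 0 lam with h | h
  · rw [abs_of_nonneg h] at hN ⊢
    calc A ^ lam * B ^ N * q ^ lam ≤ A ^ lam * B ^ lam * q ^ lam := by
          gcongr ?_ * ?_ * ?_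
          exact Real.rpow_le_rpow_of_exponent_ge hB hB1 hN
      _ = (A * B * q) ^ lam := by
          rw [Real.mul_rpow (by positivity) hq.le, Real.mul_rpow hA.le hB.le]
      _ ≤ r ^ lam := Real.rpow_le_rpow (by positivity) hABq h
  · have h1 : A ^ lam ≤ r ^ lam := Real.rpow_le_rpow_of_nonpos hr hrA h
    have h2 : B ^ N ≤ 1 := Real.rpow_le_one hB.le hB1 ((abs_nonneg _).trans hN)
    have h3 : q ^ |lam| ≤ 1 := Real.rpow_le_one hq.le hq1 (abs_nonneg _)
    calc A ^ lam * B ^ N * q ^ |lam| ≤ r ^ lam * 1 * 1 := by gcongr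
      _ = _ := by ring

section Prod

variable {σ k x x' τ lam mu N s : ℝ}

/-- k is the product of the defining functions of `zf`, `bf0`, `lb0` and `rb0`, so the common order
τ - 1 at these four faces is k^(τ-1). -/
theorem prod_rho_eq (hσ : 0 < σ) (hk : 0 < k) (hx : 0 < x) (hx' : 0 < x') :
    ∏ H, rho σ k x x' H ^ orders τ lam mu N s H =
      k ^ (τ - 1) * (((k + x) / (k + x + x')) ^ lam * ((k + x') / (k + x + x')) ^ mu *
        (x * (k + x + x') / ((k + x) * (x + x'))) ^ N *
        (x' * (k + x + x') / ((k + x') * (x + x'))) ^ N *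
        ((x + x') / (k + x + x')) ^ N * σ ^ (s - N)) := by
  rw [Face.prod_univ]
  simp only [rho, orders]
  rw [Real.rpow_add (by positivity : 0 < (k + x) / (k + x + x')),
    Real.rpow_add (by positivity : 0 < (k + x') / (k + x + x')),
    Real.div_rpow (by positivity) hσ.le N, Real.rpow_sub hσ s N]
  have : k ^ (τ - 1) = (k * (k + x + x') / ((k + x) * (k + x'))) ^ (τ - 1) *
      (k + x + x') ^ (τ - 1) * ((k + x) / (k + x + x')) ^ (τ - 1) *
      ((k + x') / (k + x + x')) ^ (τ - 1) := by
    rw [← Real.mul_rpow (by positivity) (by positivity),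
      ← Real.mul_rpow (by positivity) (by positivity),
      ← Real.mul_rpow (by positivity) (by positivity)]
    congr 1
    field_simp
  rw [this]
  ring

/-- The high order at `lb` and `rb` replaces k + x and k + x' by x and x' in the ratios. Both
replacements also use up powers of (x+x')/(k+x+x'), which comes with exponent N from `bf`; hence N ≥
|lam| + |mu|. -/
theorem prod_rho_le (hσ : 0 < σ) (hk : 0 < k) (hx : 0 < x) (hx' : 0 < x')
    (hN : |lam| + |mu| ≤ N) :
    ∏ H, rho σ k x x' H ^ orders τ lam mu N s H ≤
      k ^ (τ - 1) * ((x / (x + x')) ^ lam * (x' / (x + x')) ^ mu) * σ ^ (s - N) := by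
  rw [prod_rho_eq hσ hk hx hx']
  have q0 : 0 < (x + x') / (k + x + x') := by positivity
  have q1 : (x + x') / (k + x + x') ≤ 1 := by
    rw [div_le_one (by positivity)]; linarith
  have h1 := rpow_mul_rpow_mul_rpow_le (A := (k + x) / (k + x + x'))
    (B := x * (k + x + x') / ((k + x) * (x + x'))) (q := (x + x') / (k + x + x'))
    (r := x / (x + x')) (lam := lam) (N := N) (by positivity) (by positivity) q0
    (by rw [div_le_one (by positivity)]; nlinarith [mul_pos hk hx']) q1 (by positivity)
    (by rw [div_le_div_iff₀ (by positivity) (by positivity)]; nlinarith [mul_pos hk hx'])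
    (by
      have : (k + x) / (k + x + x') * (x * (k + x + x') / ((k + x) * (x + x'))) *
          ((x + x') / (k + x + x')) = x / (k + x + x') := by field_simp
      rw [this]
      gcongr; linarith) (by linarith [abs_nonneg mu])
  have h2 := rpow_mul_rpow_mul_rpow_le (A := (k + x') / (k + x + x'))
    (B := x' * (k + x + x') / ((k + x') * (x + x'))) (q := (x + x') / (k + x + x'))
    (r := x' / (x + x')) (lam := mu) (N := N) (by positivity) (by positivity) q0
    (by rw [div_le_one (by positivity)]; nlinarith [mul_pos hk hx]) q1 (by positivity)
    (by rw [div_le_div_iff₀ (by positivity) (by positivity)]; nlinarith [mul_pos hk hx])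
    (by
      have : (k + x') / (k + x + x') * (x' * (k + x + x') / ((k + x') * (x + x'))) *
          ((x + x') / (k + x + x')) = x' / (k + x + x') := by field_simp
      rw [this]
      gcongr; linarith) (by linarith [abs_nonneg lam])
  have h3 : ((x + x') / (k + x + x')) ^ N ≤
      ((x + x') / (k + x + x')) ^ |lam| * ((x + x') / (k + x + x')) ^ |mu| := by
    rw [← Real.rpow_add q0]
    exact Real.rpow_le_rpow_of_exponent_ge q0 q1 hN
  rw [mul_assoc (k ^ (τ - 1)) (_ * _)]
  refine mul_le_mul_of_nonneg_left (mul_le_mul_of_nonneg_right ?_ (by positivity)) (by positivity)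
  calc _ ≤ ((k + x) / (k + x + x')) ^ lam * ((k + x') / (k + x + x')) ^ mu *
        (x * (k + x + x') / ((k + x) * (x + x'))) ^ N *
        (x' * (k + x + x') / ((k + x') * (x + x'))) ^ N *
        (((x + x') / (k + x + x')) ^ |lam| * ((x + x') / (k + x + x')) ^ |mu|) :=
        mul_le_mul_of_nonneg_left h3 (by positivity)
    _ = (_ * _ * _) * (_ * _ * _) := by ring
    _ ≤ _ := mul_le_mul h1 h2 (by positivity) (by positivity)

theorem rpow_le_two_rpow_abs {t : ℝ} (ht : 1 / 2 ≤ t) (ht1 : t ≤ 1) (w : ℝ) :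
    t ^ w ≤ 2 ^ |w| := by
  have h : Comparable 2 t 1 := ⟨by linarith, by linarith⟩
  simpa using h.rpow_le two_pos (by linarith) one_pos w

/-- For x + x' ≤ k, the part that contains `sc`, the ratios at `lb0` and `rb0` are at least 1/2 and
may be dropped, which leaves the whole decay at `bf` for the integral across the diagonal. -/
theorem prod_rho_le_of_add_le (hσ : 0 < σ) (hk : 0 < k) (hx : 0 < x) (hx' : 0 < x')
    (hN : 0 ≤ N) (hxk : x + x' ≤ k) :
    ∏ H, rho σ k x x' H ^ orders τ lam mu N s H ≤
      2 ^ |lam| * 2 ^ |mu| * k ^ (τ - 1) * (((x + x') / (k + x + x')) ^ N * σ ^ (s - N)) := by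
  rw [prod_rho_eq hσ hk hx hx']
  have h1 : ((k + x) / (k + x + x')) ^ lam ≤ 2 ^ |lam| := by
    apply rpow_le_two_rpow_abs
    · rw [div_le_div_iff₀ (by positivity) (by positivity)]; linarith
    · rw [div_le_one (by positivity)]; linarith
  have h2 : ((k + x') / (k + x + x')) ^ mu ≤ 2 ^ |mu| := by
    apply rpow_le_two_rpow_abs
    · rw [div_le_div_iff₀ (by positivity) (by positivity)]; linarith
    · rw [div_le_one (by positivity)]; linarith
  have h3 : (x * (k + x + x') / ((k + x) * (x + x'))) ^ N ≤ 1 :=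
    Real.rpow_le_one (by positivity)
      (by rw [div_le_one (by positivity)]; nlinarith [mul_pos hk hx']) hN
  have h4 : (x' * (k + x + x') / ((k + x') * (x + x'))) ^ N ≤ 1 :=
    Real.rpow_le_one (by positivity)
      (by rw [div_le_one (by positivity)]; nlinarith [mul_pos hk hx]) hN
  calc _ ≤ k ^ (τ - 1) * (2 ^ |lam| * 2 ^ |mu| * 1 * 1 *
        ((x + x') / (k + x + x')) ^ N * σ ^ (s - N)) := by gcongr
    _ = _ := by ring

end Prod

namespace BlowupCoords

variable {d : ℕ} {X : Type*} {c : BlowupCoords d X} {x : X → ℝ}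

theorem vectorField_fieldFace (a b : Bool) :
    c.vectorField (Movable.fieldFace a b) = fun _ => c.field a b := by
  funext p
  cases a <;> cases b <;> simp [Movable.fieldFace, vectorField, field]

/-- The weight of `G` at the hypersurface `H` can be improved to `e`. -/
def Improvable (c : BlowupCoords d X) (x : X → ℝ) (G : Pt d → ℂ) (H : Face) (e : ℝ) : Prop :=
  ∀ w : Face → ℝ, c.ConormalBound x G c.region w → ∀ ε > 0,
    c.ConormalBound x G c.region (Function.update (fun H' => w H' - ε) H e)

/-- Each improvement spoils the others a little; halving the admissible loss at every face keeps the
total below ε. -/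
theorem exists_weights_of_improvable {G : Pt d → ℂ} {w : Face → ℝ}
    (hG : c.ConormalBound x G c.region w) (e : Face → ℝ) (l : List Face)
    (hl : ∀ H ∈ l, c.Improvable x G H (e H)) : ∀ ε > 0,
    ∃ w', c.ConormalBound x G c.region w' ∧ ∀ H ∈ l, e H - ε ≤ w' H := by
  induction l with
  | nil => exact fun ε _ => ⟨w, hG, by simp⟩
  | cons H l ih =>
    intro ε hε
    obtain ⟨w', hw', hle⟩ := ih (fun H' h => hl H' (List.mem_cons_of_mem _ h)) (ε / 2) (half_pos hε)
    refine ⟨_, hl H List.mem_cons_self w' hw' (ε / 2) (half_pos hε), fun H' hH' => ?_⟩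
    by_cases h : H' = H
    · subst h; simp [hε.le]
    · rw [Function.update_of_ne h]
      have := hle H' ((List.mem_cons.1 hH').resolve_left h)
      linarith

theorem IsPhg.phgAt {𝓔 : Face → IndexSet} {w : Face → ℝ} {K : ℝ → X → X → ℂ}
    (hK : c.IsPhg x 𝓔 w K) (H : Face) : c.PhgAt x w (𝓔 H) (c.pull K) H := hK.2.2 H

/-- Flows treat `zf`, `bf0`, `lb0` and `rb0`; empty index sets treat `lb`, `rb` and `bf`. The weight
at `sc` stays uncontrolled here: either one is away from `sc`, or `ScFlowsOut.improve` follows. -/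
theorem Movable.exists_weights {k₀ r₀ X₀ : ℝ} {ν : Pt d → ℝ} (h : c.Movable x k₀ r₀ X₀ ν)
    {𝓔 : Face → IndexSet} {w : Face → ℝ} {K : ℝ → X → X → ℂ} (hK : c.IsPhg x 𝓔 w K)
    (hlb : (𝓔 .lb).carrier = ∅) (hrb : (𝓔 .rb).carrier = ∅) (hbf : (𝓔 .bf).carrier = ∅)
    {e : Face → ℝ} (he : ∀ H ≠ Face.sc, ∀ z ∈ (𝓔 H).carrier, e H < z.1.re) {ε : ℝ} (hε : 0 < ε) :
    ∃ w', c.ConormalBound x (c.pull K) c.region w' ∧ ∀ H ≠ Face.sc, e H - ε ≤ w' H := by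
  have hflow : ∀ a b, c.Improvable x (c.pull K) (Movable.fieldFace a b)
      (e (Movable.fieldFace a b)) := by
    intro a b w₁ hw₁ ε hε
    obtain ⟨δ, C, hf⟩ := h.exists_flowsOut a b
    exact h.bdfLE.improve_of_flowsOut (vectorField_fieldFace a b) hf hK.1 (hK.phgAt _) hw₁
      (he _ (by cases a <;> cases b <;> simp [Movable.fieldFace])) hε
  have hempty : ∀ H, (𝓔 H).carrier = ∅ → c.Improvable x (c.pull K) H (e H) :=
    fun H hH w₁ hw₁ ε hε => h.bdfLE.improve_of_empty hH (hK.phgAt H) hw₁ _ hε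
  obtain ⟨w', hw', hle⟩ := exists_weights_of_improvable hK.2.1 e
    [.zf, .bf0, .lb0, .rb0, .lb, .rb, .bf] (by
      intro H hH
      simp only [List.mem_cons, List.not_mem_nil, or_false] at hH
      rcases hH with rfl | rfl | rfl | rfl | rfl | rfl | rfl
      exacts [hflow false false, hflow true true, hflow true false, hflow false true,
        hempty _ hlb, hempty _ hrb, hempty _ hbf]) ε hε
  refine ⟨w', hw', fun H hH => hle H ?_⟩
  cases H <;> simp at hH ⊢

end BlowupCoords
end LowEnergy
end

/-! ### Products of first-order operators with the non-constant field at `sc`. -/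

noncomputable section
namespace LowEnergy

/-! ## Euler fields -/

section Euler

variable {E : Type*} [NormedAddCommGroup E] [NormedSpace ℝ E] {G : E → ℂ} {A : E} {B : E →L[ℝ] E}

/-- The term `D^j F (B p, …, B p)` in the expansion of products of first-order operators. -/
def eulerTerm (B : E →L[ℝ] E) (j : ℕ) (F : E → ℂ) (p : E) : ℂ :=
  iteratedFDeriv ℝ j F p fun _ => B p

/-- Differentiating F gives the A-derivative and one more argument B p. Differentiating one of the j
arguments gives B(A + B p) = B p, that is, the same term again. -/
theorem hasFDerivAt_eulerTerm {F : E → ℂ} {p : E} {j : ℕ} (hF : ContDiffAt ℝ (j + 2 : ℕ) F p)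
    (hA : B A = 0) (hB : ∀ q, B (B q) = B q) :
    DifferentiableAt ℝ (eulerTerm B j F) p ∧
    fderiv ℝ (eulerTerm B j F) p (A + B p) = eulerTerm B j (fun q => fderiv ℝ F q A) p +
      eulerTerm B (j + 1) F p + j * eulerTerm B j F p := by
  have h1 : ContDiffAt ℝ (j + 1 : ℕ) F p := hF.of_le (by exact_mod_cast Nat.le_succ _)
  have h2 := (h1.differentiableAt_iteratedFDeriv (m := j)
    (by exact_mod_cast Nat.lt_succ_self j)).hasFDerivAt
  have h3 := h2.continuousMultilinearMap_apply (g := fun _ : Fin j => fun q => B q)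
    (g' := fun _ => B) (fun _ => B.hasFDerivAt)
  refine ⟨h3.differentiableAt, ?_⟩
  have h4 : fderiv ℝ (eulerTerm B j F) p = _ := h3.fderiv
  have hBA : B (A + B p) = B p := by rw [map_add, hA, hB, zero_add]
  rw [h4]
  simp only [add_apply, ContinuousLinearMap.coe_comp, Function.comp_apply,
    ContinuousMultilinearMap.apply_apply, sum_apply,
    ContinuousMultilinearMap.toContinuousLinearMap_apply, hBA, Function.update_eq_self,
    Finset.sum_const, Finset.card_univ, Fintype.card_fin, nsmul_eq_mul]
  congr 1
  rw [map_add, add_apply, ← fderiv_iteratedFDeriv_apply h1,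
    fderiv_iteratedFDeriv_eq hF]
  congr 1

theorem applyFactors_append (V : E → E) (l l' : List (ℂ × ℕ)) (F : E → ℂ) :
    applyFactors V (l ++ l') F = applyFactors V l (applyFactors V l' F) := by
  simp [applyFactors]

theorem applyFactors_cons (V : E → E) (e : ℂ × ℕ) (l : List (ℂ × ℕ)) (F : E → ℂ) :
    applyFactors V (e :: l) F =
      fun p => fderiv ℝ (applyFactors V l F) p (V p) - e.1 * applyFactors V l F p := rfl

theorem applyFactors_congr {V : E → E} {F F' : E → ℂ} {p : E} (h : F =ᶠ[nhds p] F')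
    (l : List (ℂ × ℕ)) : applyFactors V l F =ᶠ[nhds p] applyFactors V l F' := by
  induction l with
  | nil => exact h
  | cons e l ih =>
    filter_upwards [ih, ih.fderiv (𝕜 := ℝ)] with q h1 h2
    rw [applyFactors_cons, applyFactors_cons]
    simp only [h1, h2]

/-- Both sides are V² - (a + b) V + ab applied to F; V need not be constant. -/
theorem applyFactors_comm {V : E → E} (hV : ContDiff ℝ ∞ V) {F : E → ℂ} {p : E}
    (hF : ContDiffAt ℝ ∞ F p) (a b : ℂ × ℕ) :
    applyFactors V [a, b] F =ᶠ[nhds p] applyFactors V [b, a] F := by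
  have key : ∀ a b : ℂ × ℕ, applyFactors V [a, b] F =ᶠ[nhds p] fun q =>
      fderiv ℝ (fun q => fderiv ℝ F q (V q)) q (V q) - (a.1 + b.1) * fderiv ℝ F q (V q) +
        a.1 * b.1 * F q := by
    intro a b
    have h1 : ContDiffAt ℝ ∞ (fun q => fderiv ℝ F q (V q)) p :=
      (hF.fderiv_right (m := ∞) (by simp)).clm_apply hV.contDiffAt
    have h2 : ∀ᶠ q in nhds p, ContDiffAt ℝ 1 F q :=
      (hF.of_le (by exact_mod_cast le_top)).eventually (by simp)
    have h3 : ∀ᶠ q in nhds p, ContDiffAt ℝ 1 (fun q => fderiv ℝ F q (V q)) q :=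
      (h1.of_le (by exact_mod_cast le_top)).eventually (by simp)
    filter_upwards [h2, h3] with q h2 h3
    simp only [applyFactors_cons]
    have e1 := (h3.differentiableAt (by simp)).hasFDerivAt.sub
      ((h2.differentiableAt (by simp)).hasFDerivAt.const_mul b.1)
    have e2 : fderiv ℝ (fun q => fderiv ℝ F q (V q) - b.1 * F q) q = _ := e1.fderiv
    change fderiv ℝ (fun q => fderiv ℝ F q (V q) - b.1 * F q) q (V q) -
      a.1 * (fderiv ℝ F q (V q) - b.1 * F q) = _
    rw [e2]
    simp
    ring
  filter_upwards [key a b, key b a] with q h1 h2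
  rw [h1, h2]
  ring

/-- A triple (c, i, j) stands for c times the j-th derivative of A^i G in the direction B p repeated
j times. Derivative bounds hold for directions frozen at a point, whereas the field at `sc` varies
with the point; the expansion reduces products of such fields to frozen directions. -/
theorem exists_eulerTerm_expansion (G : E → ℂ) (hA : B A = 0) (hB : ∀ q, B (B q) = B q)
    (l : List (ℂ × ℕ)) :
    ∃ L : List (ℂ × ℕ × ℕ), ∀ p, ContDiffAt ℝ ∞ G p →
      applyFactors (fun q => A + B q) l G =ᶠ[nhds p] fun q => (L.map fun e => e.1 *
        eulerTerm B e.2.2 (applyFactors (fun _ => A) (List.replicate e.2.1 (0, 0)) G) q).sum := by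
  induction l with
  | nil =>
    refine ⟨[(1, 0, 0)], fun p _ => ?_⟩
    simp [eulerTerm, applyFactors]
  | cons a l ih =>
    obtain ⟨L, hL⟩ := ih
    refine ⟨L.flatMap fun e => [(e.1, e.2.1 + 1, e.2.2), (e.1, e.2.1, e.2.2 + 1),
      (e.1 * (e.2.2 - a.1), e.2.1, e.2.2)], fun p hp => ?_⟩
    have hsm : ∀ i, ContDiffAt ℝ ∞ (applyFactors (fun _ => A) (List.replicate i (0, 0)) G) p :=
      fun i => ContDiffAt.applyFactors hp contDiff_const _
    have hev : ∀ᶠ q in nhds p, ∀ e ∈ L, ContDiffAt ℝ (e.2.2 + 2 : ℕ)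
        (applyFactors (fun _ => A) (List.replicate e.2.1 (0, 0)) G) q := by
      refine (Filter.eventually_all_finite (List.finite_toSet L)).2 fun e _ => ?_
      exact ((hsm e.2.1).of_le (m := (e.2.2 + 2 : ℕ)) (WithTop.coe_le_coe.mpr le_top)).eventually
        (ne_of_lt (WithTop.coe_lt_coe.mpr (ENat.natCast_lt_top _)))
    filter_upwards [hL p hp, (hL p hp).fderiv (𝕜 := ℝ), hev] with q h1 h2 h3
    simp only [applyFactors_cons, h1, h2]
    clear h1 h2 hL
    have key : ∀ L : List (ℂ × ℕ × ℕ), (∀ e ∈ L, ContDiffAt ℝ (e.2.2 + 2 : ℕ)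
        (applyFactors (fun _ => A) (List.replicate e.2.1 (0, 0)) G) q) →
        DifferentiableAt ℝ (fun q => (L.map fun e => e.1 * eulerTerm B e.2.2
          (applyFactors (fun _ => A) (List.replicate e.2.1 (0, 0)) G) q).sum) q ∧
        fderiv ℝ (fun q => (L.map fun e => e.1 * eulerTerm B e.2.2
          (applyFactors (fun _ => A) (List.replicate e.2.1 (0, 0)) G) q).sum) q (A + B q) -
          a.1 * (L.map fun e => e.1 * eulerTerm B e.2.2
          (applyFactors (fun _ => A) (List.replicate e.2.1 (0, 0)) G) q).sum =
        ((L.flatMap fun e => [(e.1, e.2.1 + 1, e.2.2), (e.1, e.2.1, e.2.2 + 1),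
          (e.1 * (e.2.2 - a.1), e.2.1, e.2.2)]).map fun e => e.1 * eulerTerm B e.2.2
          (applyFactors (fun _ => A) (List.replicate e.2.1 (0, 0)) G) q).sum := by
      intro L hL
      induction L with
      | nil => simp
      | cons e L ih =>
        obtain ⟨i1, i2⟩ := ih fun e he => hL e (List.mem_cons_of_mem _ he)
        obtain ⟨d1, d2⟩ := hasFDerivAt_eulerTerm (B := B) (hL e List.mem_cons_self) hA hB
        simp only [List.map_cons, List.sum_cons, List.flatMap_cons, List.map_append,
          List.sum_append]
        have d3 := d1.const_mul e.1
        refine ⟨d3.add i1, ?_⟩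
        rw [← i2, fderiv_fun_add d3 i1, add_apply, fderiv_const_mul d1]
        simp only [smul_apply, smul_eq_mul, d2, List.map_nil, List.sum_nil]
        have : (fun q => fderiv ℝ (applyFactors (fun _ => A) (List.replicate e.2.1 (0, 0)) G) q A)
            = applyFactors (fun _ => A) (List.replicate (e.2.1 + 1) (0, 0)) G := by
          rw [List.replicate_succ, applyFactors_cons]
          simp
        rw [this]
        ring
    exact (key L h3).2

theorem exists_norm_applyFactors_le {R : Set E} {W : E → ℝ} {len : E → E → ℝ}
    (h : DerivBound G R W len) (hG : ∀ p ∈ R, ContDiffAt ℝ ∞ G p)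
    (hlen : ∀ p ∈ R, ∀ ξ, 0 ≤ len p ξ) (hW : ∀ p ∈ R, 0 ≤ W p) (hA : B A = 0)
    (hB : ∀ q, B (B q) = B q) {K : ℝ} (hKA : ∀ p ∈ R, len p A ≤ K)
    (hKB : ∀ p ∈ R, len p (B p) ≤ K) (l : List (ℂ × ℕ)) :
    ∃ C : ℝ, 0 ≤ C ∧ ∀ p ∈ R, ‖applyFactors (fun q => A + B q) l G p‖ ≤ C * W p := by
  obtain ⟨L, hL⟩ := exists_eulerTerm_expansion G hA hB l
  have key : ∀ L : List (ℂ × ℕ × ℕ), ∃ C : ℝ, 0 ≤ C ∧ ∀ p ∈ R, ‖(L.map fun e => e.1 *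
      eulerTerm B e.2.2 (applyFactors (fun _ => A) (List.replicate e.2.1 (0, 0)) G) p).sum‖
        ≤ C * W p := by
    intro L
    induction L with
    | nil => exact ⟨0, le_rfl, by simp⟩
    | cons e L ih =>
      obtain ⟨C, hC0, hC⟩ := ih
      obtain ⟨C', hC'0, hC'⟩ := (h.applyFactors hG hlen hW hKA
        (List.replicate e.2.1 (0, 0))).exists_nonneg hlen hW e.2.2
      refine ⟨‖e.1‖ * (C' * |K| ^ e.2.2) + C, by positivity, fun p hp => ?_⟩
      have hWp := hW p hp
      rw [List.map_cons, List.sum_cons, add_mul]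
      refine (norm_add_le _ _).trans (add_le_add ?_ (hC p hp))
      rw [norm_mul, mul_assoc]
      gcongr
      refine (hC' p hp _).trans ?_
      rw [Finset.prod_const, Finset.card_univ, Fintype.card_fin, mul_right_comm]
      have := hlen p hp (B p)
      gcongr
      exact (hKB p hp).trans (le_abs_self K)
  obtain ⟨C, hC0, hC⟩ := key L
  exact ⟨C, hC0, fun p hp => (hL p (hG p hp)).eq_of_nhds ▸ hC p hp⟩

end Euler
end LowEnergy
end

/-! ### The sharp order at `sc`. -/

noncomputable section
namespace LowEnergy
namespace BlowupCoords

variable {d : ℕ} {X : Type*} {c : BlowupCoords d X} {x : X → ℝ} {M : ℝ}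

/-! ## The weight at `sc` -/

/-- The projection to the last component. -/
def fibreProj (d : ℕ) : Pt d →L[ℝ] Pt d :=
  (ContinuousLinearMap.inr ℝ ℝ (Model d × Model d)).comp
    ((ContinuousLinearMap.inr ℝ (Model d) (Model d)).comp
      ((ContinuousLinearMap.snd ℝ (Model d) (Model d)).comp
        (ContinuousLinearMap.snd ℝ ℝ (Model d × Model d))))

@[simp] theorem fibreProj_apply (p : Pt d) : fibreProj d p = (0, 0, p.2.2) := rfl

/-- The flow of the vector field at `sc`. -/
def scFlow (c : BlowupCoords d X) (t : ℝ) (p : Pt d) : Pt d :=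
  p + t • (c.eL + c.eR) + (Real.exp t - 1) • (0, 0, p.2.2)

theorem scFlow_zero (p : Pt d) : c.scFlow 0 p = p := by simp [scFlow]

theorem hasDerivAt_scFlow (h0 : (c.eL + c.eR).2.2 = 0) (p : Pt d) (t : ℝ) :
    HasDerivAt (fun t => c.scFlow t p) (c.vectorField .sc (c.scFlow t p)) t := by
  have h1 : HasDerivAt (fun t : ℝ => p + t • (c.eL + c.eR)) (c.eL + c.eR) t := by
    simpa using ((hasDerivAt_id t).smul_const (c.eL + c.eR)).const_add p
  have h2 : HasDerivAt (fun t : ℝ => (Real.exp t - 1) • ((0, 0, p.2.2) : Pt d))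
      (Real.exp t • ((0, 0, p.2.2) : Pt d)) t :=
    ((Real.hasDerivAt_exp t).sub_const 1).smul_const _
  refine (h1.add h2).congr_deriv ?_
  have h3 : (c.scFlow t p).2.2 = Real.exp t • p.2.2 := by
    simp only [Prod.snd_add] at h0
    simp only [scFlow, Prod.snd_add, Prod.smul_snd, h0]
    module
  simp only [vectorField, h3]
  simp

theorem contDiff_vectorField_sc : ContDiff ℝ ∞ (c.vectorField .sc) := by
  have : c.vectorField .sc = fun q => (c.eL + c.eR) + fibreProj d q := rfl
  rw [this]
  exact contDiff_const.add (fibreProj d).contDiff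

/-- The flow at `sc`, from a point of `R`, stays in `R` until the distance `m` to `sc` is of size
`δ`, and does not change the distances to other hypersurfaces. -/
structure ScFlowsOut (c : BlowupCoords d X) (x : X → ℝ) (R : Set (Pt d)) (m : Pt d → ℝ)
    (δ C : ℝ) : Prop where
  delta_pos : 0 < δ
  one_le : 1 ≤ C
  subset : R ⊆ c.region
  field_eq : (c.eL + c.eR).2.2 = 0
  pos : ∀ p ∈ R, 0 < m p
  le_delta : ∀ p ∈ R, m p ≤ δ
  near : ∀ p ∈ R, Comparable C (c.bdf x p .sc) (m p)
  mem : ∀ p ∈ R, ∀ t : ℝ, 0 ≤ t → Real.exp t * m p ≤ δ → c.scFlow t p ∈ R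
  exp_mul : ∀ p ∈ R, ∀ t : ℝ, 0 ≤ t → Real.exp t * m p ≤ δ →
    m (c.scFlow t p) = Real.exp t * m p
  bdf : ∀ p ∈ R, ∀ t : ℝ, 0 ≤ t → Real.exp t * m p ≤ δ → ∀ H ≠ Face.sc,
    Comparable C (c.bdf x (c.scFlow t p) H) (c.bdf x p H)
  norm_le : ∀ p ∈ R, ‖p.2.2‖ / c.scSize p ≤ C

namespace ScFlowsOut

variable {R : Set (Pt d)} {m : Pt d → ℝ} {δ C : ℝ}

theorem mono_delta (hf : c.ScFlowsOut x R m δ C) {δ' : ℝ} (h0 : 0 < δ') (h1 : δ' ≤ δ) :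
    c.ScFlowsOut x {p | p ∈ R ∧ m p ≤ δ'} m δ' C where
  delta_pos := h0
  one_le := hf.one_le
  subset := fun p hp => hf.subset hp.1
  field_eq := hf.field_eq
  pos p hp := hf.pos p hp.1
  le_delta p hp := hp.2
  near p hp := hf.near p hp.1
  mem p hp t ht h := ⟨hf.mem p hp.1 t ht (h.trans h1), by
    rwa [hf.exp_mul p hp.1 t ht (h.trans h1)]⟩
  exp_mul p hp t ht h := hf.exp_mul p hp.1 t ht (h.trans h1)
  bdf p hp t ht h := hf.bdf p hp.1 t ht (h.trans h1)
  norm_le p hp := hf.norm_le p hp.1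

theorem weight_le (hf : c.ScFlowsOut x R m δ C) (h : c.BdfLE x M) (w : Face → ℝ) :
    ∃ K : ℝ, 0 ≤ K ∧ ∀ p ∈ R, ∀ t : ℝ, 0 ≤ t → Real.exp t * m p ≤ δ →
      c.weight x w (c.scFlow t p) ≤ K * (Real.exp (w .sc * t) * c.weight x w p) := by
  have hC : 0 < C := by linarith [hf.one_le]
  refine ⟨∏ H, (C * C) ^ |w H|, by positivity, fun p hp t ht hm => ?_⟩
  have hq := hf.mem p hp t ht hm
  have hfac : ∀ H, c.bdf x (c.scFlow t p) H ^ w H ≤ (C * C) ^ |w H| *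
      ((if H = .sc then Real.exp (w .sc * t) else 1) * c.bdf x p H ^ w H) := by
    intro H
    have b1 := ((h _ (hf.subset hq)).2 H).1
    have b2 := ((h _ (hf.subset hp)).2 H).1
    split_ifs with hH
    · subst hH
      have e1 := hf.near _ hq
      rw [hf.exp_mul p hp t ht hm] at e1
      have e2 := e1.trans ((hf.near p hp).symm.mul_left (Real.exp_pos t).le) hC.le hC.le
      have := e2.rpow_le (by positivity) b1 (by positivity) (w .sc)
      rwa [Real.mul_rpow (Real.exp_pos t).le b2.le, ← Real.exp_mul, mul_comm t] at this
    · rw [one_mul]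
      refine ((hf.bdf p hp t ht hm H hH).mono ?_ b1.le b2.le).rpow_le (by positivity) b1 b2 _
      exact le_mul_of_one_le_left hC.le hf.one_le
  unfold weight
  calc _ ≤ ∏ H, (C * C) ^ |w H| *
      ((if H = .sc then Real.exp (w .sc * t) else 1) * c.bdf x p H ^ w H) :=
        Finset.prod_le_prod (fun H _ => Real.rpow_nonneg ((h _ (hf.subset hq)).2 H).1.le _)
          fun H _ => hfac H
    _ = _ := by
        rw [Finset.prod_mul_distrib, Finset.prod_mul_distrib, Finset.prod_ite_eq']
        simp

/-- `F = O(∏ ρ_H ^ w_H)` on `R`. -/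
def SupBound (c : BlowupCoords d X) (x : X → ℝ) (R : Set (Pt d)) (F : Pt d → ℂ) (w : Face → ℝ) :
    Prop :=
  ∃ C : ℝ, 0 ≤ C ∧ ∀ p ∈ R, ‖F p‖ ≤ C * c.weight x w p

theorem SupBound.mono (h : c.BdfLE x M) (hR : R ⊆ c.region) {F : Pt d → ℂ} {w w' : Face → ℝ}
    (hF : SupBound c x R F w)
    (hw : ∀ H, w' H ≤ w H ∨ ∃ δ > 0, ∀ p ∈ R, δ ≤ c.bdf x p H) : SupBound c x R F w' := by
  obtain ⟨C, hC0, hC⟩ := hF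
  obtain ⟨K, hK0, hK⟩ := h.exists_weight_le hR hw
  refine ⟨C * K, by positivity, fun p hp => (hC p hp).trans ?_⟩
  rw [mul_assoc]
  gcongr
  exact hK p hp

theorem SupBound.interpolate (h : c.BdfLE x M) (hR : R ⊆ c.region) {F : Pt d → ℂ}
    {w w' w'' : Face → ℝ} (hF : SupBound c x R F w) (hF' : SupBound c x R F w') {θ : ℝ}
    (h0 : 0 ≤ θ) (h1 : θ ≤ 1) (hw : ∀ H, w'' H ≤ θ * w H + (1 - θ) * w' H) :
    SupBound c x R F w'' := by
  obtain ⟨C, hC0, hC⟩ := hF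
  obtain ⟨C', hC'0, hC'⟩ := hF'
  have key : SupBound c x R F (fun H => θ * w H + (1 - θ) * w' H) := by
    refine ⟨C ^ θ * C' ^ (1 - θ), by positivity, fun p hp => ?_⟩
    have hp' := (h p (hR hp)).2
    refine (le_rpow_mul_rpow_of_le (norm_nonneg _) (hC p hp) (hC' p hp) h0 h1).trans
      (le_of_eq ?_)
    rw [Real.mul_rpow hC0 (h.weight_pos w (hR hp)).le,
      Real.mul_rpow hC'0 (h.weight_pos w' (hR hp)).le]
    have : c.weight x (fun H => θ * w H + (1 - θ) * w' H) p =
        c.weight x w p ^ θ * c.weight x w' p ^ (1 - θ) := by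
      unfold weight
      rw [← Real.finsetProd_rpow _ _ (fun H _ => Real.rpow_nonneg (hp' H).1.le _),
        ← Real.finsetProd_rpow _ _ (fun H _ => Real.rpow_nonneg (hp' H).1.le _),
        ← Finset.prod_mul_distrib]
      refine Finset.prod_congr rfl fun H _ => ?_
      rw [← Real.rpow_mul (hp' H).1.le, ← Real.rpow_mul (hp' H).1.le, ← Real.rpow_add (hp' H).1]
      ring_nf
    rw [this]
    ring
  exact key.mono h hR fun H => .inl (hw H)

theorem SupBound.sub_smul {F F' : Pt d → ℂ} {w : Face → ℝ}
    (hF : SupBound c x R F w) (hF' : SupBound c x R F' w) (a : ℂ) :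
    SupBound c x R (fun p => a * (F p - F' p)) w := by
  obtain ⟨C, hC0, hC⟩ := hF
  obtain ⟨C', hC'0, hC'⟩ := hF'
  refine ⟨‖a‖ * (C + C'), by positivity, fun p hp => ?_⟩
  rw [norm_mul, mul_assoc, add_mul]
  gcongr
  exact (norm_sub_le _ _).trans (add_le_add (hC p hp) (hC' p hp))

/-- Inverting one factor `V - z`. -/
theorem invert_factor (hf : c.ScFlowsOut x R m δ C) (h : c.BdfLE x M) {w₁ w₂ w₃ : Face → ℝ}
    (hw : ∀ H ≠ Face.sc, w₂ H ≤ w₁ H) {F : Pt d → ℂ}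
    (hF : ∀ p ∈ c.region, ContDiffAt ℝ ∞ F p) (hF₁ : SupBound c x R F w₁) {z : ℂ}
    (hz : w₂ .sc ≠ z.re) (hw₃ : ∀ H ≠ Face.sc, w₃ H = w₂ H) (hw₃' : w₃ .sc = min (w₂ .sc) z.re)
    (hF₂ : SupBound c x R (fun q => fderiv ℝ F q (c.vectorField .sc q) - z * F q) w₂) :
    SupBound c x R F w₃ := by
  have hC : 0 < C := by linarith [hf.one_le]
  obtain ⟨K, hK0, hK⟩ := hf.weight_le h w₂
  obtain ⟨C₁, hC₁0, hC₁⟩ := hF₁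
  obtain ⟨C₂, hC₂0, hC₂⟩ := hF₂
  obtain ⟨K', hK'0, hK'⟩ := h.exists_weight_le (R := {p | p ∈ R ∧ δ ≤ m p})
    (fun p hp => hf.subset hp.1) (w := w₁) (w' := w₂) (by
      intro H
      by_cases hH : H = .sc
      · subst hH
        refine .inr ⟨δ / C, div_pos hf.delta_pos hC, fun p hp => ?_⟩
        rw [div_le_iff₀ hC, mul_comm]
        exact hp.2.trans (hf.near p hp.1).2
      · exact .inl (hw H hH))
  -- If Re z is below the order of the source, the homogeneous solution decides: the flow produces
  -- the power m^(Re z - w₂ sc), which lowers the order at `sc` to Re z. Otherwise nothing has to be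
  -- shown, hence the disjunction.
  have hw23 : ∃ K'' : ℝ, 0 ≤ K'' ∧ ∀ p ∈ R, c.weight x w₂ p * (m p) ^ (z.re - w₂ .sc) ≤
      K'' * c.weight x w₃ p ∨ w₂ .sc < z.re := by
    by_cases hlt : w₂ .sc < z.re
    · exact ⟨0, le_rfl, fun _ _ => .inr hlt⟩
    refine ⟨C ^ |z.re - w₂ .sc|, by positivity, fun p hp => .inl ?_⟩
    have hbp := fun H => ((h p (hf.subset hp)).2 H).1
    have e1 := (hf.near p hp).symm.rpow_le hC (hf.pos p hp) (hbp .sc) (z.re - w₂ .sc)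
    have e2 : c.weight x w₃ p = c.weight x w₂ p * c.bdf x p .sc ^ (z.re - w₂ .sc) := by
      have : w₃ = fun H => w₂ H + if H = Face.sc then z.re - w₂ .sc else 0 := by
        funext H
        split_ifs with hH
        · rw [hH, hw₃', min_eq_right (not_lt.1 hlt)]; ring
        · rw [hw₃ H hH, add_zero]
      rw [this]
      unfold weight
      simp_rw [Real.rpow_add (hbp _)]
      rw [Finset.prod_mul_distrib]
      congr 1
      rw [Finset.prod_eq_single Face.sc]
      · simp
      · intro H _ hH; simp [hH]
      · simp
    rw [e2]
    calc _ ≤ c.weight x w₂ p * (C ^ |z.re - w₂ .sc| * c.bdf x p .sc ^ (z.re - w₂ .sc)) := by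
          have := h.weight_pos w₂ (hf.subset hp)
          gcongr
      _ = _ := by ring
  obtain ⟨K'', hK''0, hK''⟩ := hw23
  have hsm : ∀ p ∈ R, ∀ t, 0 ≤ t → Real.exp t * m p ≤ δ →
      HasDerivAt (fun t => F (c.scFlow t p)) (z * F (c.scFlow t p) +
        (fderiv ℝ F (c.scFlow t p) (c.vectorField .sc (c.scFlow t p)) - z * F (c.scFlow t p))) t := by
    intro p hp t ht hle
    have h1 := ((hF _ (hf.subset (hf.mem p hp t ht hle))).differentiableAt
      (by simp)).hasFDerivAt.comp_hasDerivAt t (hasDerivAt_scFlow hf.field_eq p t)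
    exact h1.congr_deriv (by ring)
  have hmain : ∀ p ∈ R, ‖F p‖ ≤ (C₁ * K' * K + C₂ * K / |z.re - w₂ .sc|) * c.weight x w₂ p *
      (if w₂ .sc < z.re then 1 else (δ ^ (w₂ .sc - z.re) * (m p) ^ (z.re - w₂ .sc))) := by
    intro p hp
    have hm0 := hf.pos p hp
    set T := Real.log (δ / m p) with hT
    have hexp : Real.exp T = δ / m p := Real.exp_log (div_pos hf.delta_pos hm0)
    have hT0 : 0 ≤ T := Real.log_nonneg (by
      rw [le_div_iff₀ hm0, one_mul]; exact hf.le_delta p hp)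
    have hle : ∀ t ∈ Set.Icc 0 T, Real.exp t * m p ≤ δ := by
      intro t ht
      calc _ ≤ Real.exp T * m p := by gcongr; exact ht.2
        _ = δ := by rw [hexp]; field_simp
    have hW0 := h.weight_pos w₂ (hf.subset hp)
    have hTmem : T ∈ Set.Icc 0 T := Set.right_mem_Icc.mpr hT0
    have hqT := hf.mem p hp T hT0 (hle T hTmem)
    have hmT : m (c.scFlow T p) = δ := by
      rw [hf.exp_mul p hp T hT0 (hle T hTmem), hexp]; field_simp
    have hend : ‖F (c.scFlow T p)‖ ≤ C₁ * K' * K * c.weight x w₂ p * Real.exp (w₂ .sc * T) := by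
      calc _ ≤ C₁ * (K' * (K * (Real.exp (w₂ .sc * T) * c.weight x w₂ p))) := by
            refine (hC₁ _ hqT).trans ?_
            gcongr
            refine (hK' _ ⟨hqT, hmT.ge⟩).trans ?_
            gcongr
            exact hK p hp T hT0 (hle T hTmem)
        _ = _ := by ring
    have hsrc : ∀ t ∈ Set.Icc 0 T, ‖fderiv ℝ F (c.scFlow t p) (c.vectorField .sc (c.scFlow t p)) -
        z * F (c.scFlow t p)‖ ≤ C₂ * K * c.weight x w₂ p * Real.exp (w₂ .sc * t) := by
      intro t ht
      refine (hC₂ _ (hf.mem p hp t ht.1 (hle t ht))).trans ?_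
      calc _ ≤ C₂ * (K * (Real.exp (w₂ .sc * t) * c.weight x w₂ p)) := by
            gcongr; exact hK p hp t ht.1 (hle t ht)
        _ = _ := by ring
    have hder := fun t (ht : t ∈ Set.Icc 0 T) => hsm p hp t ht.1 (hle t ht)
    split_ifs with hlt
    · have key := norm_le_of_hasDerivAt_sub_of_lt hT0 hder hsrc hlt (by positivity)
      simp only [scFlow_zero] at key
      refine key.trans ?_
      rw [abs_of_pos (sub_pos.2 hlt), mul_one, add_mul]
      refine add_le_add ?_ (le_of_eq (by ring))
      calc _ ≤ Real.exp (-(z.re * T)) * (C₁ * K' * K * c.weight x w₂ p * Real.exp (w₂ .sc * T)) := by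
            gcongr
        _ = Real.exp ((w₂ .sc - z.re) * T) * (C₁ * K' * K * c.weight x w₂ p) := by
            rw [show (w₂ .sc - z.re) * T = -(z.re * T) + w₂ .sc * T by ring, Real.exp_add]; ring
        _ ≤ 1 * (C₁ * K' * K * c.weight x w₂ p) := by
            gcongr
            rw [Real.exp_le_one_iff]
            exact mul_nonpos_of_nonpos_of_nonneg (by linarith) hT0
        _ = _ := one_mul _
    · have hgt : z.re < w₂ .sc := lt_of_le_of_ne (not_lt.1 hlt) (Ne.symm hz)
      have key := norm_le_of_hasDerivAt_sub_of_gt hT0 hder hsrc hgt (by positivity)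
      simp only [scFlow_zero] at key
      refine key.trans ?_
      -- Here exp T = δ / m, so the ratio of the two exponential rates is a power of m.
      have e1 : Real.exp (-(z.re * T)) * Real.exp (w₂ .sc * T) =
          δ ^ (w₂ .sc - z.re) * (m p) ^ (z.re - w₂ .sc) := by
        rw [← Real.exp_add, show -(z.re * T) + w₂ .sc * T = T * (w₂ .sc - z.re) by ring,
          Real.exp_mul, hexp, Real.div_rpow hf.delta_pos.le hm0.le, ← neg_sub (w₂ .sc) z.re,
          Real.rpow_neg hm0.le]
        rfl
      rw [← e1, abs_sub_comm, abs_of_pos (sub_pos.2 hgt)]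
      calc _ ≤ Real.exp (-(z.re * T)) * (C₁ * K' * K * c.weight x w₂ p * Real.exp (w₂ .sc * T) +
            C₂ * K * c.weight x w₂ p * Real.exp (w₂ .sc * T) / (w₂ .sc - z.re)) := by gcongr
        _ = _ := by ring
  by_cases hlt : w₂ .sc < z.re
  · have : w₃ = w₂ := by
      funext H
      by_cases hH : H = .sc
      · rw [hH, hw₃', min_eq_left hlt.le]
      · exact hw₃ H hH
    rw [this]
    refine ⟨C₁ * K' * K + C₂ * K / |z.re - w₂ .sc|, by positivity,
      fun p hp => (hmain p hp).trans (le_of_eq ?_)⟩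
    rw [if_pos hlt, mul_one]
  · refine ⟨(C₁ * K' * K + C₂ * K / |z.re - w₂ .sc|) * δ ^ (w₂ .sc - z.re) * K'', ?_,
      fun p hp => (hmain p hp).trans ?_⟩
    · have := hf.delta_pos
      positivity
    · have := hf.delta_pos
      rw [if_neg hlt]
      calc _ = (C₁ * K' * K + C₂ * K / |z.re - w₂ .sc|) * δ ^ (w₂ .sc - z.re) *
            (c.weight x w₂ p * (m p) ^ (z.re - w₂ .sc)) := by ring
        _ ≤ (C₁ * K' * K + C₂ * K / |z.re - w₂ .sc|) * δ ^ (w₂ .sc - z.re) *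
            (K'' * c.weight x w₃ p) := by
            exact mul_le_mul_of_nonneg_left ((hK'' p hp).resolve_right hlt) (by positivity)
        _ = _ := by ring

theorem min_update_sc (w : Face → ℝ) (e : ℝ) :
    (∀ H ≠ Face.sc, Function.update w .sc e H = w H) ∧ Function.update w .sc e .sc = e :=
  ⟨fun _ hH => Function.update_of_ne hH _ _, Function.update_self _ _ _⟩

/-- Inverting factors whose exponents have real part larger than the weight. -/
theorem invert_factors (hf : c.ScFlowsOut x R m δ C) (h : c.BdfLE x M) {w₁ w₂ : Face → ℝ}
    (hw : ∀ H ≠ Face.sc, w₂ H ≤ w₁ H) {F : Pt d → ℂ} (hF : ∀ p ∈ c.region, ContDiffAt ℝ ∞ F p)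
    (hF₁ : ∀ l, SupBound c x R (applyFactors (c.vectorField .sc) l F) w₁) :
    ∀ l : List (ℂ × ℕ), (∀ e ∈ l, w₂ .sc < e.1.re) →
      SupBound c x R (applyFactors (c.vectorField .sc) l F) w₂ → SupBound c x R F w₂ := by
  intro l hl hb
  induction l with
  | nil => exact hb
  | cons a l ih =>
    have ha := hl a List.mem_cons_self
    refine ih (fun e he => hl e (List.mem_cons_of_mem _ he)) ?_
    exact hf.invert_factor h hw
      (fun p hp => ContDiffAt.applyFactors (hF p hp) contDiff_vectorField_sc l) (hF₁ l) ha.ne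
      (fun _ _ => rfl) (min_eq_left ha.le).symm hb

/-- Inverting factors with distinct exponents of the same real part, without loss. -/
theorem invert_distinct_factors (hf : c.ScFlowsOut x R m δ C) (h : c.BdfLE x M)
    {w₁ w₂ : Face → ℝ} (hw : ∀ H ≠ Face.sc, w₂ H ≤ w₁ H) {s : ℝ} (hs : s < w₂ .sc) (n : ℕ) :
    ∀ (l : List (ℂ × ℕ)) (F : Pt d → ℂ), l.length = n → (∀ e ∈ l, e.1.re = s) →
      (l.map Prod.fst).Nodup → (∀ p ∈ c.region, ContDiffAt ℝ ∞ F p) →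
      (∀ l, SupBound c x R (applyFactors (c.vectorField .sc) l F) w₁) →
      SupBound c x R (applyFactors (c.vectorField .sc) l F) w₂ →
      SupBound c x R F (Function.update w₂ .sc s) := by
  induction n with
  | zero =>
    intro l F hl _ _ _ _ hb
    rw [List.length_eq_zero_iff.1 hl] at hb
    refine SupBound.mono h hf.subset hb fun H => .inl ?_
    by_cases hH : H = .sc
    · subst hH; simpa using hs.le
    · simp [Function.update_of_ne hH]
  | succ n ih =>
    intro l F hl hre hnd hF hF₁ hb
    obtain ⟨l, a, rfl⟩ : ∃ l' a, l = l' ++ [a] := by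
      rcases List.eq_nil_or_concat l with rfl | ⟨l', a, rfl⟩
      · simp at hl
      · exact ⟨l', a, by simp⟩
    have hsm : ∀ l', ∀ p ∈ c.region,
        ContDiffAt ℝ ∞ (applyFactors (c.vectorField .sc) l' F) p :=
      fun l' p hp => ContDiffAt.applyFactors (hF p hp) contDiff_vectorField_sc l'
    have hbd : ∀ l' l'', SupBound c x R
        (applyFactors (c.vectorField .sc) l'' (applyFactors (c.vectorField .sc) l' F)) w₁ := by
      intro l' l''
      rw [← applyFactors_append]
      exact hF₁ _
    rcases List.eq_nil_or_concat l with rfl | ⟨l', b, rfl⟩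
    · have ha := hre a (by simp)
      exact hf.invert_factor h hw hF (hF₁ []) (by rw [ha]; exact hs.ne')
        (min_update_sc _ _).1 (by rw [(min_update_sc _ _).2, ha, min_eq_right hs.le]) hb
    · rw [List.concat_eq_append] at hl hre hnd hb
      have ha := hre a (by simp)
      -- The last two factors of the list are a and b. Inverting a and then b separately would at
      -- the second step meet a source of the critical order s, and so a logarithm; a combination of
      -- (V - a)F and (V - b)F avoids this.
      have hab : a.1 ≠ b.1 := by
        simp only [List.map_append, List.map_cons, List.map_nil, List.append_assoc,
          List.nodup_append, List.cons_append, List.nil_append] at hnd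
        have := hnd.2.1
        simp at this
        exact fun h => this h.symm
      have hlen : ∀ e : ℂ × ℕ, (l' ++ [e]).length = n := by
        intro e
        simpa using hl
      have hnd' : ∀ e ∈ [a, b], ((l' ++ [e]).map Prod.fst).Nodup := by
        simp only [List.map_append, List.map_cons, List.map_nil, List.append_assoc,
          List.cons_append, List.nil_append] at hnd ⊢
        have h1 : (l'.map Prod.fst ++ [b.1]).Nodup :=
          hnd.sublist (List.Sublist.append_left (by simp) _)
        have h2 : (l'.map Prod.fst ++ [a.1]).Nodup :=
          hnd.sublist (List.Sublist.append_left (by simp) _)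
        intro e he
        simp only [List.mem_cons, List.not_mem_nil, or_false] at he
        rcases he with rfl | rfl
        exacts [h2, h1]
      -- Both (V - a)F and (V - b)F are brought to order w₂ by one factor fewer, so both have order
      -- s by induction. As a ≠ b, F is their difference divided by b - a.
      have hA := ih (l' ++ [b]) (applyFactors (c.vectorField .sc) [a] F) (hlen b)
        (fun e he => hre e (List.mem_append_left _ he)) (hnd' b (by simp)) (hsm [a]) (hbd [a])
        (by rwa [← applyFactors_append])
      have hB := ih (l' ++ [a]) (applyFactors (c.vectorField .sc) [b] F) (hlen a)
        (fun e he => by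
          rcases List.mem_append.1 he with he | he
          · exact hre e (by simp [he])
          · rw [List.mem_singleton.1 he]; exact ha) (hnd' a (by simp)) (hsm [b]) (hbd [b]) (by
          obtain ⟨C', h0, hC'⟩ := hb
          refine ⟨C', h0, fun p hp => ?_⟩
          have e1 := (applyFactors_congr (V := c.vectorField .sc) (applyFactors_comm
            (V := c.vectorField .sc) contDiff_vectorField_sc (hF p (hf.subset hp)) a b)
            l').eq_of_nhds
          rw [← applyFactors_append] at e1 ⊢
          simp only [List.append_assoc, List.cons_append, List.nil_append] at e1 ⊢
          rw [e1, ← applyFactors_append]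
          have := hC' p hp
          rwa [List.append_assoc] at this)
      have hAB := SupBound.sub_smul hA hB (1 / (b.1 - a.1))
      obtain ⟨C', h0, hC'⟩ := hAB
      refine ⟨C', h0, fun p hp => ?_⟩
      have e1 : F p = 1 / (b.1 - a.1) * (applyFactors (c.vectorField .sc) [a] F p -
          applyFactors (c.vectorField .sc) [b] F p) := by
        have : b.1 - a.1 ≠ 0 := sub_ne_zero.2 hab.symm
        simp only [applyFactors, List.foldr_cons, List.foldr_nil]
        field_simp
        ring
      rw [e1]
      exact hC' p hp

/-- The weight at `sc` is the leading order there, without loss if there are no logarithms. -/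
theorem improve (hf : c.ScFlowsOut x R m δ C) (h : c.BdfLE x M) {G : Pt d → ℂ}
    {w₀ w₁ : Face → ℝ} {E : IndexSet} {s : ℝ} (hE : E.Ge s)
    (hsm : ∀ p ∈ c.region, ContDiffAt ℝ ∞ G p) (hG : c.PhgAt x w₀ E G .sc)
    (hG₁ : c.ConormalBound x G c.region w₁) {ε : ℝ} (hε : 0 < ε) :
    SupBound c x R G (Function.update (fun H => w₁ H - ε) .sc s) := by
  have hC : 0 < C := by linarith [hf.one_le]
  -- Only finitely many exponents have real part at most s + 1, which leaves a gap above s. An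
  -- intermediate order e in the gap separates the exponents that are inverted with room to spare
  -- from the critical ones.
  obtain ⟨e, he, hgap⟩ : ∃ e, s < e ∧ ∀ z ∈ E.carrier, z.1.re = s ∨ e < z.1.re := by
    have hfin : ((fun z : ℂ × ℕ => z.1.re) '' {z | z ∈ E.carrier ∧ z.1.re ≤ s + 1} \ {s}).Finite :=
      ((E.finite_re_le (s + 1)).image _).subset Set.sdiff_subset
    have hnhds : ∀ᶠ e in nhdsWithin s (Set.Ioi s), ∀ r ∈ (fun z : ℂ × ℕ => z.1.re) ''
        {z | z ∈ E.carrier ∧ z.1.re ≤ s + 1} \ {s}, e < r := by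
      refine (Filter.eventually_all_finite hfin).2 fun r hr => ?_
      obtain ⟨⟨z, hz, rfl⟩, hzs⟩ := hr
      exact nhdsWithin_le_nhds (eventually_lt_nhds (lt_of_le_of_ne (hE z hz.1).1 (Ne.symm hzs)))
    have hnhds' : ∀ᶠ e in nhdsWithin s (Set.Ioi s), e < s + 1 :=
      nhdsWithin_le_nhds (eventually_lt_nhds (by linarith))
    obtain ⟨e, ⟨h1, h2⟩, h3⟩ := ((hnhds.and hnhds').and self_mem_nhdsWithin).exists
    refine ⟨e, h3, fun z hz => ?_⟩
    by_cases hzs : z.1.re = s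
    · exact .inl hzs
    · right
      by_cases hz1 : z.1.re ≤ s + 1
      · exact h1 _ ⟨⟨z, ⟨hz, hz1⟩, rfl⟩, hzs⟩
      · linarith
  set w₂ := Function.update (fun H => w₁ H - ε) .sc e with hw₂
  have hw₂s : w₂ .sc = e := by simp [hw₂]
  have hw₂' : ∀ H ≠ Face.sc, w₂ H = w₁ H - ε := fun H hH => by simp [hw₂, Function.update_of_ne hH]
  have hw₂le : ∀ H ≠ Face.sc, w₂ H ≤ w₁ H := fun H hH => by rw [hw₂' H hH]; linarith
  have hgoal : Function.update (fun H => w₁ H - ε) .sc s = Function.update w₂ .sc s := by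
    rw [hw₂, Function.update_idem]
  rw [hgoal]
  obtain ⟨θ, S, hθ0, hθ1, hS, hθ⟩ := exists_interpolation w₀ w₁ Face.sc e hε
  set L := (E.finite_re_le S).toFinset with hL
  -- In l₁ ++ l₂ the non-critical factors are applied last and hence inverted first, which brings
  -- the critical product to order e.
  set l₁ := (L.filter fun z => ¬ z.1.re = s).toList with hl₁
  set l₂ := (L.filter fun z => z.1.re = s).toList with hl₂
  have hmem : ∀ z, z ∈ l₁ ++ l₂ ↔ z ∈ E.carrier ∧ z.1.re ≤ S := by
    intro z
    simp only [hl₁, hl₂, hL, List.mem_append, Finset.mem_toList, Finset.mem_filter,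
      Set.Finite.mem_toFinset, Set.mem_ofPred_eq]
    tauto
  have hnd : (l₁ ++ l₂).Nodup := by
    refine List.Nodup.append (Finset.nodup_toList _) (Finset.nodup_toList _) ?_
    intro z hz1 hz2
    simp only [hl₁, hl₂, Finset.mem_toList, Finset.mem_filter] at hz1 hz2
    exact hz1.2 hz2.2
  obtain ⟨η, hη, hb⟩ := hG S (l₁ ++ l₂) hnd hmem
  set δ' := min δ (η / (2 * C)) with hδ'
  have hδ'0 : 0 < δ' := lt_min hf.delta_pos (by positivity)
  have hf' := hf.mono_delta hδ'0 (min_le_left _ _)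
  set R' := {p | p ∈ R ∧ m p ≤ δ'} with hR'
  have hfield : c.vectorField .sc = fun q => (c.eL + c.eR) + fibreProj d q := rfl
  have hall : ∀ l, SupBound c x R (applyFactors (c.vectorField .sc) l G) w₁ := by
    intro l
    rw [hfield]
    refine exists_norm_applyFactors_le (len := c.len) (DerivBound.subset hG₁ hf.subset)
      (fun p hp => hsm p (hf.subset hp)) (fun p hp => h.len_nonneg (hf.subset hp))
      (fun p hp => (h.weight_pos w₁ (hf.subset hp)).le) ?_ ?_
      (K := ‖c.eL + c.eR‖ + ‖c.eL + c.eR‖ + C) ?_ ?_ l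
    · rw [fibreProj_apply, hf.field_eq]; rfl
    · intro q; simp
    · intro p hp
      unfold len
      rw [hf.field_eq, norm_zero, zero_div, add_zero]
      have e1 : ‖(c.eL + c.eR).1‖ ≤ ‖c.eL + c.eR‖ := norm_fst_le _
      have e2 : ‖(c.eL + c.eR).2.1‖ ≤ ‖c.eL + c.eR‖ := (norm_fst_le _).trans (norm_snd_le _)
      linarith
    · intro p hp
      have := hf.norm_le p hp
      unfold len
      simp only [fibreProj_apply, norm_zero, zero_add]
      linarith [norm_nonneg (c.eL + c.eR)]
  have hall' : ∀ l, SupBound c x R' (applyFactors (c.vectorField .sc) l G) w₁ := fun l => by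
    obtain ⟨C', h0, hC'⟩ := hall l
    exact ⟨C', h0, fun p hp => hC' p hp.1⟩
  have hnear₀ : SupBound c x R' (applyFactors (c.vectorField .sc) (l₁ ++ l₂) G)
      (Function.update w₀ .sc S) := by
    obtain ⟨C', hC'0, hC'⟩ := DerivBound.exists_nonneg hb (fun p hp => h.len_nonneg hp.1)
      (fun p hp => (h.weight_pos _ hp.1).le) 0
    refine ⟨C', hC'0, fun p hp => ?_⟩
    have := hC' p ⟨hf.subset hp.1, ?_⟩ Fin.elim0
    · simpa [weight] using this
    · refine (hf.near p hp.1).1.trans_lt ?_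
      calc C * m p ≤ C * (η / (2 * C)) := by gcongr; exact hp.2.trans (min_le_right _ _)
        _ = η / 2 := by field_simp
        _ < η := by linarith
  have hnear₁ : SupBound c x R' (applyFactors (c.vectorField .sc) (l₁ ++ l₂) G) w₂ := by
    refine SupBound.interpolate h hf'.subset hnear₀ (hall' _) hθ0.le hθ1 fun H => ?_
    by_cases hH : H = .sc
    · subst hH; simpa [hw₂s] using hS
    · rw [hw₂' H hH]; simpa [Function.update_of_ne hH] using hθ H
  rw [applyFactors_append] at hnear₁
  have hnear₂ := hf'.invert_factors h hw₂le
    (fun p hp => ContDiffAt.applyFactors (hsm p hp) contDiff_vectorField_sc l₂)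
    (fun l => by rw [← applyFactors_append]; exact hall' _) l₁ (by
      intro z hz
      have h1 := (hmem z).1 (List.mem_append_left _ hz)
      simp only [hl₁, Finset.mem_toList, Finset.mem_filter] at hz
      rw [hw₂s]
      exact (hgap z h1.1).resolve_left hz.2) hnear₁
  have hcrit : ∀ z ∈ l₂, z ∈ E.carrier ∧ z.1.re = s := by
    intro z hz
    have h1 := (hmem z).1 (List.mem_append_right _ hz)
    simp only [hl₂, Finset.mem_toList, Finset.mem_filter] at hz
    exact ⟨h1.1, hz.2⟩
  -- `E.Ge s` excludes logarithms at real part s, so critical entries of the list differ in their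
  -- complex exponents and not merely in j.
  have hnear := hf'.invert_distinct_factors h hw₂le (by rw [hw₂s]; exact he) l₂.length l₂ G rfl
    (fun z hz => (hcrit z hz).2)
    (List.Nodup.map_on (fun z hz z' hz' hzz => by
      have e1 := (hE z (hcrit z hz).1).2 (hcrit z hz).2
      have e2 := (hE z' (hcrit z' hz').1).2 (hcrit z' hz').2
      exact Prod.ext hzz (e1.trans e2.symm)) (Finset.nodup_toList _)) hsm hall' hnear₂
  have hfar : SupBound c x {p | p ∈ R ∧ δ' ≤ m p} G (Function.update w₂ .sc s) := by
    obtain ⟨C', h0, hC'⟩ := hall []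
    refine SupBound.mono h (fun p hp => hf.subset hp.1) (w := w₁) ⟨C', h0, fun p hp => hC' p hp.1⟩
      fun H => ?_
    by_cases hH : H = .sc
    · subst hH
      refine .inr ⟨δ' / C, div_pos hδ'0 hC, fun p hp => ?_⟩
      rw [div_le_iff₀ hC, mul_comm]
      exact hp.2.trans (hf.near p hp.1).2
    · rw [Function.update_of_ne hH]
      exact .inl (hw₂le H hH)
  obtain ⟨C₁, h₁, hC₁⟩ := hnear
  obtain ⟨C₂, h₂, hC₂⟩ := hfar
  refine ⟨C₁ + C₂, by positivity, fun p hp => ?_⟩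
  have := h.weight_pos (Function.update w₂ .sc s) (hf.subset hp)
  rcases le_total (m p) δ' with h1 | h1
  · refine (hC₁ p ⟨hp, h1⟩).trans ?_
    gcongr
    linarith
  · refine (hC₂ p ⟨hp, h1⟩).trans ?_
    gcongr
    linarith

end ScFlowsOut
end BlowupCoords
end LowEnergy
end

/-! ### The flows in charts of the manifold. -/

noncomputable section
namespace LowEnergy
namespace AsymptoticallyConic

variable {d : ℕ} {X S : Type*}
  [TopologicalSpace X] [ChartedSpace (Model d) X] [IsManifold 𝓘(ℝ, Model d) ∞ X]
  [TopologicalSpace S] [ChartedSpace (EuclideanSpace ℝ (Fin d)) S]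
  [IsManifold 𝓘(ℝ, EuclideanSpace ℝ (Fin d)) ∞ S]
  {G : AsymptoticallyConic d X S} {ψ : OpenPartialHomeomorph S (EuclideanSpace ℝ (Fin d))}

/-! ## Collar charts -/

theorem collarChart_apply (z : X) :
    G.collarChart ψ z = (Real.log (G.collar z).1, ψ (G.collar z).2) := rfl

theorem mem_collarChart_source {z : X} :
    z ∈ (G.collarChart ψ).source ↔ z ∈ G.collar.source ∧ (G.collar z).2 ∈ ψ.source := by
  simp only [collarChart, OpenPartialHomeomorph.trans_source, Set.mem_inter_iff, Set.mem_preimage,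
    OpenPartialHomeomorph.prod_source, Set.mem_prod, OpenPartialHomeomorph.symm_source,
    Real.expPartialHomeomorph_target, Set.mem_Ioi]
  constructor
  · rintro ⟨h1, -, h2⟩; exact ⟨h1, h2⟩
  · rintro ⟨h1, h2⟩
    exact ⟨h1, by rw [G.collar_fst z h1]; exact G.x_pos z, h2⟩

theorem mem_collarChart_target {u : Model d} :
    u ∈ (G.collarChart ψ).target ↔ Real.exp u.1 < G.ε ∧ u.2 ∈ ψ.target := by
  simp only [collarChart, OpenPartialHomeomorph.trans_target, Set.mem_inter_iff, Set.mem_preimage,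
    OpenPartialHomeomorph.prod_target, Set.mem_prod, OpenPartialHomeomorph.symm_target,
    Real.expPartialHomeomorph_source, Set.mem_univ, true_and, G.collar_target]
  constructor
  · rintro ⟨h1, h2⟩
    exact ⟨h2.1.2, h1⟩
  · rintro ⟨h1, h2⟩
    exact ⟨h2, ⟨Real.exp_pos u.1, h1⟩, Set.mem_univ (ψ.symm u.2)⟩

theorem collarChart_fst {z : X} (hz : z ∈ G.collar.source) :
    (G.collarChart ψ z).1 = Real.log (G.x z) := by
  rw [collarChart_apply, G.collar_fst z hz]

theorem exp_collarChart_fst {z : X} (hz : z ∈ G.collar.source) :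
    Real.exp (G.collarChart ψ z).1 = G.x z := by
  rw [collarChart_fst hz, Real.exp_log (G.x_pos z)]

theorem x_collarChart_symm {u : Model d} (hu : u ∈ (G.collarChart ψ).target) :
    G.x ((G.collarChart ψ).symm u) = Real.exp u.1 := by
  have h1 := (G.collarChart ψ).map_target hu
  have h2 := (G.collarChart ψ).right_inv hu
  rw [← exp_collarChart_fst (ψ := ψ) (mem_collarChart_source.1 h1).1, h2]

theorem mem_image_collarSet {r : ℝ} {L : Set S} (hr : r ∈ Set.Ioo 0 G.ε) (hL : L ⊆ ψ.source)
    {u : Model d} : u ∈ G.collarChart ψ '' G.collarSet r L ↔ u.1 ≤ Real.log r ∧ u.2 ∈ ψ '' L := by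
  constructor
  · rintro ⟨z, ⟨h1, h2, h3⟩, rfl⟩
    refine ⟨?_, ⟨_, h3, rfl⟩⟩
    rw [collarChart_fst h1]
    exact Real.log_le_log (G.x_pos z) h2
  · rintro ⟨h1, y, hy, h2⟩
    have ht : u ∈ (G.collarChart ψ).target := by
      rw [mem_collarChart_target, ← h2]
      refine ⟨?_, ψ.map_source (hL hy)⟩
      exact ((Real.le_log_iff_exp_le hr.1).1 h1).trans_lt hr.2
    have hs := (G.collarChart ψ).map_target ht
    refine ⟨(G.collarChart ψ).symm u, ⟨(mem_collarChart_source.1 hs).1, ?_, ?_⟩,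
      (G.collarChart ψ).right_inv ht⟩
    · rw [x_collarChart_symm ht]
      exact (Real.le_log_iff_exp_le hr.1).1 h1
    · have h3 : ψ (G.collar ((G.collarChart ψ).symm u)).2 = u.2 :=
        congrArg Prod.snd ((G.collarChart ψ).right_inv ht)
      rw [← h2] at h3
      rwa [ψ.injOn (mem_collarChart_source.1 hs).2 (hL hy) h3]

theorem collarSet_subset {r : ℝ} {L : Set S} (hL : L ⊆ ψ.source) :
    G.collarSet r L ⊆ (G.collarChart ψ).source :=
  fun _ hz => mem_collarChart_source.2 ⟨hz.1, hL hz.2.2⟩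

theorem IsPiece.subset_source {φ : OpenPartialHomeomorph X (Model d)} {P : Set X}
    (h : G.IsPiece φ P) : P ⊆ φ.source := by
  cases h with
  | interior _ _ _ _ hPφ => exact hPφ
  | collar ψ L r _ _ hLψ _ => exact collarSet_subset hLψ

/-- Multiplying `x` by a constant, where it is small. -/
theorem IsPiece.exists_move {φ : OpenPartialHomeomorph X (Model d)} {P : Set X}
    (h : G.IsPiece φ P) : ∃ r₀ > 0, ∃ X₀ : ℝ, (∀ z ∈ P, G.x z ≤ X₀) ∧
      ∀ u ∈ φ '' P, ∀ t : ℝ, 0 ≤ t → Real.exp t * G.x (φ.symm u) ≤ r₀ →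
        u + t • (1, 0) ∈ φ '' P ∧ G.x (φ.symm (u + t • (1, 0))) = Real.exp t * G.x (φ.symm u) := by
  cases h with
  | interior _ _ hφ hP hPφ =>
    rcases P.eq_empty_or_nonempty with rfl | hne
    · exact ⟨1, one_pos, 0, by simp, by simp⟩
    obtain ⟨z₀, hz₀, hmin⟩ := hP.exists_isMinOn hne G.x_smooth.continuous.continuousOn
    obtain ⟨z₁, hz₁, hmax⟩ := hP.exists_isMaxOn hne G.x_smooth.continuous.continuousOn
    -- On a compact piece x is bounded below; with r₀ half its minimum, the smallness condition on x
    -- is never met.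
    refine ⟨G.x z₀ / 2, half_pos (G.x_pos z₀), G.x z₁, fun z hz => hmax hz, ?_⟩
    rintro _ ⟨z, hz, rfl⟩ t ht hle
    rw [φ.left_inv (hPφ hz)] at hle
    have h1 : G.x z₀ ≤ G.x z := hmin hz
    have h2 : G.x z ≤ Real.exp t * G.x z :=
      le_mul_of_one_le_left (G.x_pos z).le (Real.one_le_exp ht)
    linarith [G.x_pos z₀]
  | collar ψ L r hψ hL hLψ hr =>
    refine ⟨r, hr.1, r, fun z hz => hz.2.1, ?_⟩
    intro u hu t ht hle
    have hsub : ∀ {u : Model d}, u ∈ G.collarChart ψ '' G.collarSet r L →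
        u ∈ (G.collarChart ψ).target := by
      rintro _ ⟨z, hz, rfl⟩
      exact (G.collarChart ψ).map_source (collarSet_subset hLψ hz)
    rw [x_collarChart_symm (hsub hu), ← Real.exp_add] at hle
    have hu' := (mem_image_collarSet hr hLψ).1 hu
    have hm : u + t • ((1, 0) : Model d) ∈ G.collarChart ψ '' G.collarSet r L := by
      rw [mem_image_collarSet hr hLψ]
      constructor
      · simp only [Prod.fst_add, Prod.smul_fst, smul_eq_mul, mul_one]
        rw [Real.le_log_iff_exp_le hr.1, add_comm]
        exact hle
      · simpa using hu'.2
    refine ⟨hm, ?_⟩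
    rw [x_collarChart_symm (hsub hm), x_collarChart_symm (hsub hu), ← Real.exp_add]
    simp [add_comm]

theorem IsPiece.x_symm_le {φ : OpenPartialHomeomorph X (Model d)} {P : Set X}
    (h : G.IsPiece φ P) {X₀ : ℝ} (hX : ∀ z ∈ P, G.x z ≤ X₀) {u : Model d} (hu : u ∈ φ '' P) :
    G.x (φ.symm u) ≤ X₀ := by
  obtain ⟨z, hz, rfl⟩ := hu
  rw [φ.left_inv (h.subset_source hz)]
  exact hX z hz

/-- The constant choice ν = 1 makes min 1 (scRatio + ν) equal to 1, the value of `scSize` in these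
coordinates. -/
theorem exists_movable_sepCoords {k₀ : ℝ} (hk₀ : 0 < k₀)
    {φ φ' : OpenPartialHomeomorph X (Model d)} {P P' : Set X} (h : G.IsPiece φ P)
    (h' : G.IsPiece φ' P') :
    ∃ r₀ X₀, (sepCoords k₀ φ P φ' P').Movable G.x k₀ r₀ X₀ (fun _ => 1) := by
  obtain ⟨r, hr, X₀, hX, hmv⟩ := h.exists_move
  obtain ⟨r', hr', X₀', hX', hmv'⟩ := h'.exists_move
  refine ⟨min r r', max X₀ X₀', hk₀, lt_min hr hr', ?_, fun _ => G.x_pos _, fun _ => G.x_pos _,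
    ?_, ?_, fun _ => zero_le_one, ?_, ?_, ?_⟩
  · rintro p ⟨hp, -⟩
    rwa [← Real.lt_log_iff_exp_lt hk₀]
  · rintro p ⟨-, hp, -⟩
    exact (h.x_symm_le hX hp).trans (le_max_left _ _)
  · rintro p ⟨-, -, hp⟩
    exact (h'.x_symm_le hX' hp).trans (le_max_right _ _)
  · intro p
    have : 0 ≤ (sepCoords k₀ φ P φ' P').scRatio G.x p :=
      div_nonneg (add_pos (G.x_pos _) (G.x_pos _)).le
        (add_pos (add_pos (Real.exp_pos _) (G.x_pos _)) (G.x_pos _)).le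
    rw [min_eq_left (by linarith)]
    rfl
  · intro p _
    simp [sepCoords]
  · intro a b p hp t ht hk ha hb
    obtain ⟨h1, h2, h3⟩ := hp
    have e1 : (p + t • (sepCoords k₀ φ P φ' P').field a b).1 = p.1 + t := by
      cases a <;> cases b <;> simp [BlowupCoords.field, sepCoords]
    have e2 : (p + t • (sepCoords k₀ φ P φ' P').field a b).2.1 =
        if a then p.2.1 + t • (1, 0) else p.2.1 := by
      cases a <;> cases b <;> simp [BlowupCoords.field, sepCoords]
    have e3 : (p + t • (sepCoords k₀ φ P φ' P').field a b).2.2 =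
        if b then p.2.2 + t • (1, 0) else p.2.2 := by
      cases a <;> cases b <;> simp [BlowupCoords.field, sepCoords]
    refine ⟨⟨?_, ?_, ?_⟩, ?_, ?_, e1, fun _ _ => rfl⟩
    · rw [e1, Real.lt_log_iff_exp_lt hk₀, Real.exp_add, mul_comm]; exact hk
    · rw [e2]; split_ifs with hh
      · exact (hmv _ h2 t ht ((ha hh).trans (min_le_left _ _))).1
      · exact h2
    · rw [e3]; split_ifs with hh
      · exact (hmv' _ h3 t ht ((hb hh).trans (min_le_right _ _))).1
      · exact h3
    · change G.x (φ.symm (p + t • (sepCoords k₀ φ P φ' P').field a b).2.1) = _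
      rw [e2]; split_ifs with hh
      · exact (hmv _ h2 t ht ((ha hh).trans (min_le_left _ _))).2
      · exact (one_mul _).symm
    · change G.x (φ'.symm (p + t • (sepCoords k₀ φ P φ' P').field a b).2.2) = _
      rw [e3]; split_ifs with hh
      · exact (hmv' _ h3 t ht ((hb hh).trans (min_le_right _ _))).2
      · exact (one_mul _).symm

theorem exists_movable_diagCoords {k₀ : ℝ} (hk₀ : 0 < k₀)
    {φ : OpenPartialHomeomorph X (Model d)} {P : Set X} (h : G.IsPiece φ P) :
    ∃ r₀ X₀, (G.diagCoords k₀ φ P).Movable G.x k₀ r₀ X₀ (fun p => ‖p.2.2‖) := by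
  obtain ⟨r, hr, X₀, hX, hmv⟩ := h.exists_move
  refine ⟨r, X₀, hk₀, hr, ?_, fun _ => G.x_pos _, fun _ => G.x_pos _,
    ?_, ?_, fun _ => norm_nonneg _, fun p => rfl, ?_, ?_⟩
  · rintro p ⟨hp, -⟩
    rwa [← Real.lt_log_iff_exp_lt hk₀]
  · rintro p ⟨-, hp, -⟩
    exact h.x_symm_le hX hp
  · rintro p ⟨-, -, hp⟩
    exact h.x_symm_le hX hp
  · intro p _
    have h1 : (((G.diagCoords k₀ φ P).eL + (G.diagCoords k₀ φ P).eR).2.2) = 0 := by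
      simp [diagCoords]
    rw [h1, norm_zero]
    refine le_min zero_le_one (add_nonneg ?_ (norm_nonneg _))
    exact div_nonneg (add_pos (G.x_pos _) (G.x_pos _)).le
        (add_pos (add_pos (Real.exp_pos _) (G.x_pos _)) (G.x_pos _)).le
  · intro a b p hp t ht hk ha hb
    obtain ⟨h1, h2, h3⟩ := hp
    have e1 : (p + t • (G.diagCoords k₀ φ P).field a b).1 = p.1 + t := by
      cases a <;> cases b <;> simp [BlowupCoords.field, diagCoords]
    have e2 : (p + t • (G.diagCoords k₀ φ P).field a b).2.1 =
        if a then p.2.1 + t • (1, 0) else p.2.1 := by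
      cases a <;> cases b <;> simp [BlowupCoords.field, diagCoords]
    have e3 : (p + t • (G.diagCoords k₀ φ P).field a b).2.1 +
        (p + t • (G.diagCoords k₀ φ P).field a b).2.2 =
        if b then (p.2.1 + p.2.2) + t • (1, 0) else p.2.1 + p.2.2 := by
      cases a <;> cases b <;> ext <;> simp [BlowupCoords.field, diagCoords] <;> ring
    have e4 : a = b → a = true → (p + t • (G.diagCoords k₀ φ P).field a b).2.2 = p.2.2 := by
      rintro rfl rfl
      simp [BlowupCoords.field, diagCoords]
    refine ⟨⟨?_, ?_, ?_⟩, ?_, ?_, e1, fun hab ha => by simp only [e4 hab ha]⟩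
    · rw [e1, Real.lt_log_iff_exp_lt hk₀, Real.exp_add, mul_comm]; exact hk
    · rw [e2]; split_ifs with hh
      · exact (hmv _ h2 t ht (ha hh)).1
      · exact h2
    · rw [e3]; split_ifs with hh
      · exact (hmv _ h3 t ht (hb hh)).1
      · exact h3
    · change G.x (φ.symm (p + t • (G.diagCoords k₀ φ P).field a b).2.1) = _
      rw [e2]; split_ifs with hh
      · exact (hmv _ h2 t ht (ha hh)).2
      · exact (one_mul _).symm
    · change G.x (φ.symm ((p + t • (G.diagCoords k₀ φ P).field a b).2.1 +
        (p + t • (G.diagCoords k₀ φ P).field a b).2.2)) = _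
      rw [e3]; split_ifs with hh
      · exact (hmv _ h3 t ht (hb hh)).2
      · exact (one_mul _).symm

end AsymptoticallyConic
end LowEnergy
end

/-! ### Pointwise bounds for polyhomogeneous kernels, near `sc` and away from it. -/

noncomputable section
namespace LowEnergy
namespace AsymptoticallyConic

variable {d : ℕ} {X S : Type*}
  [TopologicalSpace X] [ChartedSpace (Model d) X] [IsManifold 𝓘(ℝ, Model d) ∞ X]
  [TopologicalSpace S] [ChartedSpace (EuclideanSpace ℝ (Fin d)) S]
  [IsManifold 𝓘(ℝ, EuclideanSpace ℝ (Fin d)) ∞ S]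
  {G : AsymptoticallyConic d X S} {ψ : OpenPartialHomeomorph S (EuclideanSpace ℝ (Fin d))}

/-! ## The flow at the front face of the lifted diagonal -/

/-- The exactly homogeneous version of the boundary defining function of `sc`. -/
def scDist (p : Pt d) : ℝ := Real.exp p.2.1.1 / Real.exp p.1 + ‖p.2.2‖

/-- A neighbourhood of `sc` in the coordinates of the diagonal. -/
def scRegion (k₀ δ : ℝ) (ψ : OpenPartialHomeomorph S (EuclideanSpace ℝ (Fin d))) (L : Set S) :
    Set (Pt d) := {p | p.1 < Real.log k₀ ∧ p.2.1.2 ∈ ψ '' L ∧ scDist p ≤ δ}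

theorem exp_bounds {t : ℝ} (ht : |t| ≤ 1 / 4) : 1 / 2 ≤ Real.exp t ∧ Real.exp t ≤ 2 := by
  have h := abs_le.1 ht
  have h1 := Real.add_one_le_exp t
  have h2 := Real.add_one_le_exp (-t)
  refine ⟨by linarith, ?_⟩
  rw [Real.exp_neg] at h2
  have h3 : (1 / 2 : ℝ) ≤ (Real.exp t)⁻¹ := by linarith
  rw [one_div] at h3
  exact (inv_le_inv₀ (by norm_num) (Real.exp_pos t)).1 h3

section

variable {k₀ r δ η : ℝ} {L L₁ : Set S}

/-- |log(x'/x)| is at most ‖v‖ ≤ 1/4 for the difference v of the coordinates, so x and x' agree up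
to a factor 2. -/
theorem scRegion_bounds {p : Pt d} (hδ : δ ≤ 1 / 4) (hp : p ∈ scRegion k₀ δ ψ L₁) :
    Real.exp p.2.1.1 ≤ δ * Real.exp p.1 ∧ ‖p.2.2‖ ≤ δ ∧
      Real.exp p.2.1.1 ≤ 2 * Real.exp (p.2.1 + p.2.2).1 ∧
      Real.exp (p.2.1 + p.2.2).1 ≤ 2 * Real.exp p.2.1.1 := by
  obtain ⟨h1, h2, h3⟩ := hp
  unfold scDist at h3
  have h4 : 0 < Real.exp p.2.1.1 / Real.exp p.1 := by positivity
  have h5 : Real.exp p.2.1.1 / Real.exp p.1 ≤ δ := by linarith [norm_nonneg p.2.2]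
  have h6 : ‖p.2.2‖ ≤ δ := by linarith
  have h7 : |p.2.2.1| ≤ 1 / 4 := (norm_fst_le p.2.2).trans (h6.trans hδ)
  obtain ⟨h8, h9⟩ := exp_bounds h7
  have h10 := Real.exp_pos p.2.1.1
  refine ⟨(div_le_iff₀ (Real.exp_pos _)).1 h5, h6, ?_, ?_⟩ <;>
  · rw [Prod.fst_add, Real.exp_add]; nlinarith

/-- The second point may leave L₁, and the margin η keeps it in the larger compact set L; the bound
on 2δk₀ keeps x and x' below r. -/
theorem scRegion_subset (hk₀ : 0 < k₀) (hr : r ∈ Set.Ioo 0 G.ε) (hL : L ⊆ ψ.source)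
    (hη : ∀ y ∈ ψ '' L₁, ∀ w : EuclideanSpace ℝ (Fin d), ‖w‖ ≤ η → y + w ∈ ψ '' L)
    (hδ : δ ≤ 1 / 4) (hδη : δ ≤ η) (hδr : 2 * δ * k₀ ≤ r) :
    scRegion k₀ δ ψ L₁ ⊆ (G.diagCoords k₀ (G.collarChart ψ) (G.collarSet r L)).region := by
  intro p hp
  obtain ⟨b1, b2, b3, b4⟩ := scRegion_bounds hδ hp
  have hk : Real.exp p.1 < k₀ := (Real.lt_log_iff_exp_lt hk₀).1 hp.1
  have hδ0 : 0 ≤ δ := (norm_nonneg _).trans b2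
  have hx : 2 * Real.exp p.2.1.1 ≤ r := by nlinarith
  refine ⟨hp.1, (mem_image_collarSet hr hL).2 ⟨?_, ?_⟩, (mem_image_collarSet hr hL).2 ⟨?_, ?_⟩⟩
  · rw [Real.le_log_iff_exp_le hr.1]; linarith [Real.exp_pos p.2.1.1]
  · simpa using hη _ hp.2.1 0 (by simpa using hδ0.trans hδη)
  · rw [Real.le_log_iff_exp_le hr.1]; linarith
  · exact hη _ hp.2.1 _ ((norm_snd_le _).trans (b2.trans hδη))

/-- The boundary defining functions near `sc`. -/
theorem bdf_of_mem_region (hr : r ∈ Set.Ioo 0 G.ε) (hL : L ⊆ ψ.source) {p : Pt d}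
    (hp : p ∈ (G.diagCoords k₀ (G.collarChart ψ) (G.collarSet r L)).region) :
    G.x ((G.diagCoords k₀ (G.collarChart ψ) (G.collarSet r L)).left p) = Real.exp p.2.1.1 ∧
    G.x ((G.diagCoords k₀ (G.collarChart ψ) (G.collarSet r L)).right p) =
      Real.exp (p.2.1 + p.2.2).1 := by
  have hsub : ∀ {u : Model d}, u ∈ G.collarChart ψ '' G.collarSet r L →
      u ∈ (G.collarChart ψ).target := by
    rintro _ ⟨z, hz, rfl⟩
    exact (G.collarChart ψ).map_source (collarSet_subset hL hz)
  exact ⟨x_collarChart_symm (hsub hp.2.1), x_collarChart_symm (hsub hp.2.2)⟩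

theorem scSize_diagCoords (hr : r ∈ Set.Ioo 0 G.ε) (hL : L ⊆ ψ.source) {p : Pt d}
    (hp : p ∈ (G.diagCoords k₀ (G.collarChart ψ) (G.collarSet r L)).region) :
    (G.diagCoords k₀ (G.collarChart ψ) (G.collarSet r L)).scSize p =
      min 1 ((Real.exp p.2.1.1 + Real.exp (p.2.1 + p.2.2).1) /
        (Real.exp p.1 + Real.exp p.2.1.1 + Real.exp (p.2.1 + p.2.2).1) + ‖p.2.2‖) := by
  obtain ⟨h1, h2⟩ := bdf_of_mem_region hr hL hp
  rw [← h1, ← h2]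
  rfl

theorem scSize_comparable (hk₀ : 0 < k₀) (hr : r ∈ Set.Ioo 0 G.ε) (hL : L ⊆ ψ.source)
    (hη : ∀ y ∈ ψ '' L₁, ∀ w : EuclideanSpace ℝ (Fin d), ‖w‖ ≤ η → y + w ∈ ψ '' L)
    (hδ : δ ≤ 1 / 4) (hδη : δ ≤ η) (hδr : 2 * δ * k₀ ≤ r) {p : Pt d}
    (hp : p ∈ scRegion k₀ δ ψ L₁) :
    Comparable 4 ((G.diagCoords k₀ (G.collarChart ψ) (G.collarSet r L)).scSize p) (scDist p) := by
  obtain ⟨b1, b2, b3, b4⟩ := scRegion_bounds hδ hp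
  rw [scSize_diagCoords hr hL (scRegion_subset hk₀ hr hL hη hδ hδη hδr hp)]
  have hm := hp.2.2
  unfold scDist at hm ⊢
  have e1 := Real.exp_pos p.1
  have e2 := Real.exp_pos p.2.1.1
  have e3 := Real.exp_pos (p.2.1 + p.2.2).1
  have e4 := norm_nonneg p.2.2
  set k := Real.exp p.1
  set x := Real.exp p.2.1.1
  set x' := Real.exp (p.2.1 + p.2.2).1
  have hxk : x ≤ k / 4 := by nlinarith
  have q1 : (x + x') / (k + x + x') ≤ 3 * (x / k) := by
    rw [mul_div_assoc', div_le_div_iff₀ (by positivity) e1]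
    nlinarith [mul_pos e2 e2, mul_pos e2 e3]
  have q2 : x / k ≤ 2 * ((x + x') / (k + x + x')) := by
    rw [mul_div_assoc', div_le_div_iff₀ e1 (by positivity)]
    nlinarith [mul_pos e2 e2, mul_pos e2 e3]
  have q0 : 0 < x / k := by positivity
  rw [min_eq_right (by linarith)]
  exact ⟨by linarith, by linarith⟩

theorem scFlow_diagCoords (φ : OpenPartialHomeomorph X (Model d)) (P : Set X) (t : ℝ) (p : Pt d) :
    (G.diagCoords k₀ φ P).scFlow t p = (p.1, p.2.1 + (t, 0), Real.exp t • p.2.2) := by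
  unfold BlowupCoords.scFlow
  ext <;> simp [diagCoords] <;> ring

theorem scDist_scFlow (φ : OpenPartialHomeomorph X (Model d)) (P : Set X) (t : ℝ) (p : Pt d) :
    scDist ((G.diagCoords k₀ φ P).scFlow t p) = Real.exp t * scDist p := by
  rw [scFlow_diagCoords]
  simp only [scDist, Prod.fst_add, Real.exp_add, norm_smul, Real.norm_eq_abs, Real.abs_exp]
  ring

set_option maxHeartbeats 400000 in
theorem scFlowsOut_diagCoords (hk₀ : 0 < k₀) (hr : r ∈ Set.Ioo 0 G.ε) (hL : L ⊆ ψ.source)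
    (hη : ∀ y ∈ ψ '' L₁, ∀ w : EuclideanSpace ℝ (Fin d), ‖w‖ ≤ η → y + w ∈ ψ '' L)
    (hδ0 : 0 < δ) (hδ : δ ≤ 1 / 4) (hδη : δ ≤ η) (hδr : 2 * δ * k₀ ≤ r) :
    (G.diagCoords k₀ (G.collarChart ψ) (G.collarSet r L)).ScFlowsOut G.x (scRegion k₀ δ ψ L₁)
      scDist δ (16 ^ 4) := by
  have hsub := scRegion_subset (L₁ := L₁) hk₀ hr hL hη hδ hδη hδr
  have hmem : ∀ p ∈ scRegion k₀ δ ψ L₁, ∀ t : ℝ, 0 ≤ t → Real.exp t * scDist p ≤ δ →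
      (G.diagCoords k₀ (G.collarChart ψ) (G.collarSet r L)).scFlow t p ∈ scRegion k₀ δ ψ L₁ := by
    intro p hp t ht hle
    refine ⟨?_, ?_, ?_⟩
    · rw [scFlow_diagCoords]; exact hp.1
    · rw [scFlow_diagCoords]; simpa using hp.2.1
    · rwa [scDist_scFlow]
  have hpos : ∀ p : Pt d, 0 < scDist p := fun p => by unfold scDist; positivity
  have hcomp := fun p (hp : p ∈ scRegion k₀ δ ψ L₁) =>
    scSize_comparable hk₀ hr hL hη hδ hδη hδr hp
  have hss : ∀ p ∈ scRegion k₀ δ ψ L₁,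
      0 < (G.diagCoords k₀ (G.collarChart ψ) (G.collarSet r L)).scSize p := fun p hp => by
    have := (hcomp p hp).2
    linarith [hpos p]
  refine ⟨hδ0, by norm_num, hsub, by simp [diagCoords], fun p _ => hpos p, fun p hp => hp.2.2,
    fun p hp => (hcomp p hp).mono (by norm_num) (hss p hp).le (hpos p).le, hmem,
    fun p _ t _ _ => scDist_scFlow _ _ t p, ?_, ?_⟩
  · intro p hp t ht hle H hH
    have hq := hmem p hp t ht hle
    have f1 := scFlow_diagCoords (G := G) (k₀ := k₀) (G.collarChart ψ) (G.collarSet r L) t p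
    set c := G.diagCoords k₀ (G.collarChart ψ) (G.collarSet r L) with hc
    set q := c.scFlow t p with hqdef
    obtain ⟨l1, r1⟩ := bdf_of_mem_region hr hL (hsub hp)
    obtain ⟨l2, r2⟩ := bdf_of_mem_region hr hL (hsub hq)
    obtain ⟨b1, b2, b3, b4⟩ := scRegion_bounds hδ hp
    obtain ⟨d1, d2, d3, d4⟩ := scRegion_bounds hδ hq
    have s1 := hcomp p hp
    have s2 := hcomp q hq
    rw [scDist_scFlow] at s2
    have et := Real.one_le_exp ht
    have e0 := Real.exp_pos t
    have hqk : Real.exp q.1 = Real.exp p.1 := by rw [f1]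
    have hqx : Real.exp q.2.1.1 = Real.exp t * Real.exp p.2.1.1 := by
      rw [f1, Prod.fst_add, Real.exp_add, mul_comm]
    -- The flow scales log(x'/x) too, so x' is not multiplied by exp t exactly. Before and after the
    -- flow it is within a factor 2 of x, which is.
    have hqx' : Comparable 4 (Real.exp (q.2.1 + q.2.2).1)
        (Real.exp t * Real.exp (p.2.1 + p.2.2).1) := by
      rw [hqx] at d3 d4
      constructor <;> nlinarith [Real.exp_pos (p.2.1 + p.2.2).1]
    have s3 : Comparable 16 (c.scSize q) (Real.exp t * c.scSize p) := by
      have := s2.trans (s1.mul_left e0.le).symm (by norm_num) (by norm_num)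
      norm_num at this
      exact this
    have e1 := Real.exp_pos p.1
    have e2 := Real.exp_pos p.2.1.1
    have e3 := Real.exp_pos (p.2.1 + p.2.2).1
    have e4 := Real.exp_pos (q.2.1 + q.2.2).1
    have e5 := Real.exp_pos q.2.1.1
    have key := rho_comparable (B := 16) (f₁ := 1) (f₂ := Real.exp t) (f₃ := Real.exp t) (f₄ := 1)
      (f₅ := 1) (f₆ := Real.exp t) (f₇ := 1) (f₈ := Real.exp t) (by norm_num) (hss p hp) e1 e2 e3
      (hss q hq) (Real.exp_pos q.1) e5 e4
      one_pos e0 e0 one_pos one_pos e0 one_pos e0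
      (by rw [hqk, one_mul]; exact Comparable.refl (by norm_num) e1.le)
      (by rw [hqx]; exact Comparable.refl (by norm_num) (by positivity))
      (hqx'.mono (by norm_num) e4.le (by positivity))
      (by rw [hqk] at d1 ⊢; constructor <;> nlinarith)
      (by rw [hqk] at d1 ⊢; constructor <;> nlinarith)
      (by
        have m1 := mul_pos e0 e2
        have m2 := mul_pos e0 e3
        have m3 := hqx'.1
        have m4 := hqx'.2
        rw [hqx]
        constructor
        · rw [mul_add (Real.exp t)]; linarith
        · rw [mul_add (Real.exp t)]; linarith)
      (by rw [hqk] at d1 ⊢; constructor <;> nlinarith)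
      s3 H
    unfold BlowupCoords.bdf
    rw [l1, r1, l2, r2]
    convert! key using 1
    cases H <;> first | exact absurd rfl hH | (simp only []; field_simp)
  · intro p hp
    have h1 : ‖p.2.2‖ ≤ (G.diagCoords k₀ (G.collarChart ψ) (G.collarSet r L)).scSize p := by
      rw [scSize_diagCoords hr hL (hsub hp)]
      obtain ⟨b1, b2, b3, b4⟩ := scRegion_bounds hδ hp
      exact le_min (b2.trans (hδ.trans (by norm_num))) (le_add_of_nonneg_left (by positivity))
    rw [div_le_iff₀ (hss p hp)]
    nlinarith [hss p hp]

/-! ## Pointwise bounds for polyhomogeneous kernels -/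

/-- The size of a kernel away from the diagonal. -/
def sepSize (τ lam mu k x x' : ℝ) : ℝ :=
  k ^ (τ - 1) * ((x / (x + x')) ^ lam * (x' / (x + x')) ^ mu)

theorem sepSize_nonneg {τ lam mu k x x' : ℝ} (hk : 0 ≤ k) (hx : 0 ≤ x) (hx' : 0 ≤ x') :
    0 ≤ sepSize τ lam mu k x x' := by unfold sepSize; positivity

variable {τ lam mu ε : ℝ} {𝓔 : Face → IndexSet} {w : Face → ℝ} {K : ℝ → X → X → ℂ}

theorem _root_.LowEnergy.BlowupCoords.Movable.exists_le_sepSize {c : BlowupCoords d X}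
    {x : X → ℝ} {r₀ X₀ : ℝ} {ν : Pt d → ℝ} (h : c.Movable x k₀ r₀ X₀ ν) (hK : c.IsPhg x 𝓔 w K)
    (hlb : (𝓔 .lb).carrier = ∅) (hrb : (𝓔 .rb).carrier = ∅) (hbf : (𝓔 .bf).carrier = ∅)
    (hε : 0 < ε)
    (he : ∀ N s, ∀ H ≠ Face.sc, ∀ z ∈ (𝓔 H).carrier, orders τ lam mu N s H + ε < z.1.re)
    {R : Set (Pt d)} (hR : R ⊆ c.region) {σ₀ : ℝ} (hσ₀ : 0 < σ₀) (hσ : ∀ p ∈ R, σ₀ ≤ c.scSize p) :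
    ∃ C : ℝ, 0 ≤ C ∧ ∀ p ∈ R, ‖c.pull K p‖ ≤
      C * sepSize τ lam mu (Real.exp p.1) (x (c.left p)) (x (c.right p)) := by
  -- Away from `sc` its defining function is bounded below, so the order there may be declared to be
  -- N, which makes the factor σ^(s - N) equal to 1.
  set N := |lam| + |mu|
  obtain ⟨w', hw', hle⟩ := h.exists_weights hK hlb hrb hbf
    (e := fun H => orders τ lam mu N N H + ε) (fun H hH z hz => he N N H hH z hz) hε
  obtain ⟨C, hC⟩ := hw' 0
  obtain ⟨B, hB0, hB⟩ := h.bdfLE.exists_weight_le hR (w := w') (w' := orders τ lam mu N N)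
    (fun H => by
      by_cases hH : H = .sc
      · subst hH; exact .inr ⟨σ₀, hσ₀, hσ⟩
      · exact .inl (by linarith [hle H hH]))
  refine ⟨|C| * B, by positivity, fun p hp => ?_⟩
  have h1 := hC p (hR hp) Fin.elim0
  simp only [iteratedFDeriv_zero_apply, Finset.univ_eq_empty, Finset.prod_empty, mul_one] at h1
  have h2 := h.bdfLE.weight_pos w' (hR hp)
  have h3 := prod_rho_le (τ := τ) (lam := lam) (mu := mu) (s := N) (N := N) (h.scSize_pos p)
    (Real.exp_pos p.1) (h.left_pos p) (h.right_pos p) le_rfl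
  rw [sub_self, Real.rpow_zero, mul_one] at h3
  calc ‖c.pull K p‖ ≤ C * c.weight x w' p := h1
    _ ≤ |C| * (B * c.weight x (orders τ lam mu N N) p) := by
        gcongr
        · exact le_abs_self C
        · exact hB p hp
    _ ≤ |C| * (B * sepSize τ lam mu (Real.exp p.1) (x (c.left p)) (x (c.right p))) := by
        gcongr; exact h3
    _ = _ := by ring

theorem exists_le_sepSize_of_sepCoords (hk₀ : 0 < k₀)
    {φ φ' : OpenPartialHomeomorph X (Model d)} {P P' : Set X} (hP : G.IsPiece φ P)
    (hP' : G.IsPiece φ' P') (hK : (sepCoords k₀ φ P φ' P').IsPhg G.x 𝓔 w K)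
    (hlb : (𝓔 .lb).carrier = ∅) (hrb : (𝓔 .rb).carrier = ∅) (hbf : (𝓔 .bf).carrier = ∅)
    (hε : 0 < ε)
    (he : ∀ N s, ∀ H ≠ Face.sc, ∀ z ∈ (𝓔 H).carrier, orders τ lam mu N s H + ε < z.1.re) :
    ∃ C : ℝ, 0 ≤ C ∧ ∀ k ∈ Set.Ioo 0 k₀, ∀ z ∈ P, ∀ z' ∈ P',
      ‖K k z z'‖ ≤ C * sepSize τ lam mu k (G.x z) (G.x z') := by
  obtain ⟨r₀, X₀, h⟩ := exists_movable_sepCoords hk₀ hP hP'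
  obtain ⟨C, hC0, hC⟩ := h.exists_le_sepSize hK hlb hrb hbf hε he subset_rfl one_pos
    (fun p _ => le_refl (1 : ℝ))
  refine ⟨C, hC0, fun k hk z hz z' hz' => ?_⟩
  have := hC (Real.log k, φ z, φ' z') ⟨Real.log_lt_log hk.1 hk.2, ⟨z, hz, rfl⟩, ⟨z', hz', rfl⟩⟩
  simpa only [BlowupCoords.pull, sepCoords, Real.exp_log hk.1, φ.left_inv (hP.subset_source hz),
    φ'.left_inv (hP'.subset_source hz')] using this

/-- The size of a kernel at the diagonal, at distance `v` from it. -/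
def diagSize (d : ℕ) (τ k x v : ℝ) : ℝ :=
  k ^ (τ - 1) * ((k / x) ^ ((d : ℝ) + 1) * (1 + k / x * v) ^ (-((d : ℝ) + 2)))

/-- With y = x/k and m = y + v = y(1 + v/y), the order N at `bf` contributes y^N, and y^N m^(-n-N) =
y^(-n) (1 + v/y)^(-n-N). Thus rapid vanishing at `bf` is what gives decay along the fibres of `sc`,
and N ≥ 1 makes it integrable in v. -/
theorem rpow_scRatio_mul_rpow_le {d : ℕ} {k x x' v σ N : ℝ} (hk : 0 < k) (hx : 0 < x)
    (hx' : 0 < x') (hv : 0 ≤ v) (hxx : x' ≤ 2 * x) (hσ : x / k + v ≤ 4 * σ) (hN : 1 ≤ N) :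
    ((x + x') / (k + x + x')) ^ N * σ ^ (-((d : ℝ) + 1) - N) ≤
      3 ^ N * 4 ^ ((d : ℝ) + 1 + N) *
        ((k / x) ^ ((d : ℝ) + 1) * (1 + k / x * v) ^ (-((d : ℝ) + 2))) := by
  have hd : (0 : ℝ) ≤ d := Nat.cast_nonneg d
  have hy : 0 < x / k := by positivity
  set m := x / k + v with hm
  have hm0 : 0 < m := by positivity
  have h1 : σ ^ (-((d : ℝ) + 1) - N) ≤ 4 ^ ((d : ℝ) + 1 + N) * m ^ (-((d : ℝ) + 1 + N)) := by
    have : σ ^ (-((d : ℝ) + 1) - N) ≤ (m / 4) ^ (-((d : ℝ) + 1) - N) :=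
      Real.rpow_le_rpow_of_nonpos (by positivity) (by linarith) (by linarith)
    refine this.trans (le_of_eq ?_)
    rw [show -((d : ℝ) + 1) - N = -((d : ℝ) + 1 + N) by ring, Real.div_rpow hm0.le (by norm_num),
      Real.rpow_neg (by norm_num : (0 : ℝ) ≤ 4), div_inv_eq_mul, mul_comm]
  have h2 : ((x + x') / (k + x + x')) ^ N ≤ 3 ^ N * (x / k) ^ N := by
    rw [← Real.mul_rpow (by norm_num) (by positivity)]
    refine Real.rpow_le_rpow (by positivity) ?_ (by linarith)
    rw [mul_div_assoc', div_le_div_iff₀ (by positivity) hk]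
    nlinarith [mul_pos hx hx, mul_pos hx hx']
  have h3 : (x / k) ^ N * m ^ (-((d : ℝ) + 1 + N)) ≤
      (k / x) ^ ((d : ℝ) + 1) * (1 + k / x * v) ^ (-((d : ℝ) + 2)) := by
    have hmy : m = x / k * (1 + k / x * v) := by rw [hm]; field_simp
    have h1 : 1 ≤ 1 + k / x * v := le_add_of_nonneg_right (by positivity)
    rw [hmy, Real.mul_rpow hy.le (by linarith), ← mul_assoc, ← Real.rpow_add hy]
    have : (x / k) ^ (N + -((d : ℝ) + 1 + N)) = (k / x) ^ ((d : ℝ) + 1) := by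
      rw [show N + -((d : ℝ) + 1 + N) = -((d : ℝ) + 1) by ring, Real.rpow_neg hy.le,
        ← Real.inv_rpow hy.le, inv_div]
    rw [this]
    refine mul_le_mul_of_nonneg_left ?_ (by positivity)
    exact Real.rpow_le_rpow_of_exponent_le h1 (by linarith)
  have hm1 : 0 ≤ m ^ (-((d : ℝ) + 1 + N)) := by positivity
  calc ((x + x') / (k + x + x')) ^ N * σ ^ (-((d : ℝ) + 1) - N) ≤
        (3 ^ N * (x / k) ^ N) * (4 ^ ((d : ℝ) + 1 + N) * m ^ (-((d : ℝ) + 1 + N))) :=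
        mul_le_mul h2 h1 (Real.rpow_nonneg (by linarith) _) (by positivity)
    _ = 3 ^ N * 4 ^ ((d : ℝ) + 1 + N) * ((x / k) ^ N * m ^ (-((d : ℝ) + 1 + N))) := by ring
    _ ≤ _ := mul_le_mul_of_nonneg_left h3 (by positivity)

set_option maxHeartbeats 400000 in
theorem exists_le_diagSize_of_diagCoords (hk₀ : 0 < k₀) (hr : r ∈ Set.Ioo 0 G.ε)
    (hψ : ψ ∈ IsManifold.maximalAtlas 𝓘(ℝ, EuclideanSpace ℝ (Fin d)) ∞ S) (hLc : IsCompact L)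
    (hL : L ⊆ ψ.source)
    (hη0 : 0 < η)
    (hη : ∀ y ∈ ψ '' L₁, ∀ w : EuclideanSpace ℝ (Fin d), ‖w‖ ≤ η → y + w ∈ ψ '' L)
    (hK : (G.diagCoords k₀ (G.collarChart ψ) (G.collarSet r L)).IsPhg G.x 𝓔 w K)
    (hlb : (𝓔 .lb).carrier = ∅) (hrb : (𝓔 .rb).carrier = ∅) (hbf : (𝓔 .bf).carrier = ∅)
    (hsc : (𝓔 .sc).Ge (-((d : ℝ) + 1))) (hε : 0 < ε)
    (he : ∀ N s, ∀ H ≠ Face.sc, ∀ z ∈ (𝓔 H).carrier, orders τ lam mu N s H + ε < z.1.re)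
    (hL₁ : L₁ ⊆ L) :
    ∃ C : ℝ, 0 ≤ C ∧ ∀ k ∈ Set.Ioo 0 k₀, ∀ z ∈ G.collarSet r L₁, ∀ z' ∈ G.collarSet r L₁,
      ‖K k z z'‖ ≤ C * sepSize τ lam mu k (G.x z) (G.x z') ∨
      (‖G.collarChart ψ z' - G.collarChart ψ z‖ ≤ 1 ∧ G.x z ≤ k ∧
        ‖K k z z'‖ ≤ C * diagSize d τ k (G.x z) ‖G.collarChart ψ z' - G.collarChart ψ z‖) := by
  have hpiece := IsPiece.collar (G := G) ψ L r hψ hLc hL hr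
  set c := G.diagCoords k₀ (G.collarChart ψ) (G.collarSet r L) with hcdef
  obtain ⟨r₀, X₀, h⟩ := exists_movable_diagCoords hk₀ hpiece
  rw [← hcdef] at h
  set δ := min (min (1 / 4) η) (r / (2 * k₀)) with hδdef
  have hr0 := hr.1
  have hδ0 : 0 < δ := by positivity
  have hδ : δ ≤ 1 / 4 := (min_le_left _ _).trans (min_le_left _ _)
  have hδη : δ ≤ η := (min_le_left _ _).trans (min_le_right _ _)
  have hδr : 2 * δ * k₀ ≤ r := by
    have : δ ≤ r / (2 * k₀) := min_le_right _ _
    rw [le_div_iff₀ (by positivity)] at this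
    linarith
  have hf : c.ScFlowsOut G.x (scRegion k₀ δ ψ L₁) scDist δ (16 ^ 4) :=
    scFlowsOut_diagCoords hk₀ hr hL hη hδ0 hδ hδη hδr
  -- away from `sc`
  obtain ⟨C₁, hC₁0, hC₁⟩ := h.exists_le_sepSize hK hlb hrb hbf hε he
    (R := {p | p ∈ c.region ∧ δ / 3 ≤ c.scSize p}) (fun p hp => hp.1) (by positivity : 0 < δ / 3)
    (fun p hp => hp.2)
  -- near `sc`
  set N := |lam| + |mu| + 1 with hN
  have hN0 : 0 ≤ N := by positivity
  obtain ⟨w', hw', hle⟩ := h.exists_weights hK hlb hrb hbf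
    (e := fun H => orders τ lam mu N (-((d : ℝ) + 1)) H + ε) (fun H hH z hz => he N _ H hH z hz)
    (half_pos hε)
  obtain ⟨C₂, hC₂0, hC₂⟩ := hf.improve h.bdfLE hsc hK.1 (hK.phgAt .sc) hw' (half_pos hε)
  obtain ⟨B, hB0, hB⟩ := h.bdfLE.exists_weight_le hf.subset
    (w := Function.update (fun H => w' H - ε / 2) .sc (-((d : ℝ) + 1)))
    (w' := orders τ lam mu N (-((d : ℝ) + 1))) (fun H => .inl (by
      by_cases hH : H = .sc
      · subst hH; simp [orders]
      · rw [Function.update_of_ne hH]; linarith [hle H hH]))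
  set C₃ := C₂ * (B * (2 ^ |lam| * 2 ^ |mu| * (3 ^ N * 4 ^ ((d : ℝ) + 1 + N)))) with hC₃
  have hC₃0 : 0 ≤ C₃ := by positivity
  refine ⟨C₁ + C₃, by positivity, fun k hk z hz z' hz' => ?_⟩
  have hz1 := collarSet_subset hL ⟨hz.1, hz.2.1, hL₁ hz.2.2⟩
  have hz2 := collarSet_subset hL ⟨hz'.1, hz'.2.1, hL₁ hz'.2.2⟩
  set u := G.collarChart ψ z with hu
  set v := G.collarChart ψ z' - u with hv
  set p : Pt d := (Real.log k, u, v) with hp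
  have huv : u + v = G.collarChart ψ z' := by rw [hv]; abel
  have hxz := G.x_pos z
  have hxz' := G.x_pos z'
  have hpr : p ∈ c.region := ⟨Real.log_lt_log hk.1 hk.2,
    ⟨z, ⟨hz.1, hz.2.1, hL₁ hz.2.2⟩, rfl⟩, ⟨z', ⟨hz'.1, hz'.2.1, hL₁ hz'.2.2⟩, huv.symm⟩⟩
  have hleft : c.left p = z := (G.collarChart ψ).left_inv hz1
  have hright : c.right p = z' := by
    change (G.collarChart ψ).symm (u + v) = z'
    rw [huv, (G.collarChart ψ).left_inv hz2]
  have hkp : Real.exp p.1 = k := Real.exp_log hk.1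
  have hpull : c.pull K p = K k z z' := by
    unfold BlowupCoords.pull
    rw [hleft, hright, hkp]
  have hx1 : Real.exp p.2.1.1 = G.x z := exp_collarChart_fst hz.1
  have hd : scDist p = G.x z / k + ‖v‖ := by
    unfold scDist; rw [hkp, hx1]
  have hk0 := hk.1
  have hq := h.scSize_eq p
  have hq' : c.scRatio G.x p = (G.x z + G.x z') / (k + G.x z + G.x z') := by
    unfold BlowupCoords.scRatio; rw [hkp, hleft, hright]
  rcases le_or_gt (scDist p) δ with hle' | hgt
  · right
    have hpR : p ∈ scRegion k₀ δ ψ L₁ :=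
      ⟨Real.log_lt_log hk.1 hk.2, ⟨_, hz.2.2, rfl⟩, hle'⟩
    obtain ⟨b1, b2, b3, b4⟩ := scRegion_bounds hδ hpR
    have hx2 : Real.exp (p.2.1 + p.2.2).1 = G.x z' := by
      change Real.exp (u + v).1 = _
      rw [huv, exp_collarChart_fst hz'.1]
    rw [hx1, hkp] at b1
    rw [hx1, hx2] at b3 b4
    refine ⟨b2.trans (hδ.trans (by norm_num)), by nlinarith, ?_⟩
    have g1 := hC₂ p hpR
    have g2 := hB p hpR
    have g3 := prod_rho_le_of_add_le (τ := τ) (lam := lam) (mu := mu) (s := -((d : ℝ) + 1))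
      (N := N) (h.scSize_pos p) hk.1 hxz hxz' hN0 (by nlinarith)
    have g4 : c.weight G.x (orders τ lam mu N (-((d : ℝ) + 1))) p =
        ∏ H, rho (c.scSize p) k (G.x z) (G.x z') H ^ orders τ lam mu N (-((d : ℝ) + 1)) H := by
      unfold BlowupCoords.weight BlowupCoords.bdf
      rw [hkp, hleft, hright]
    have g5 := (scSize_comparable (G := G) hk₀ hr hL hη hδ hδη hδr hpR).2
    rw [← hcdef, hd] at g5
    set m := G.x z / k + ‖v‖ with hm
    have hm0 : 0 < m := by positivity
    have g6 := rpow_scRatio_mul_rpow_le (d := d) (N := N) (σ := c.scSize p) hk.1 hxz hxz'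
      (norm_nonneg v) b4 g5 (by rw [hN]; linarith [abs_nonneg lam, abs_nonneg mu])
    rw [hpull] at g1
    calc ‖K k z z'‖ ≤ C₂ * (B * (2 ^ |lam| * 2 ^ |mu| * k ^ (τ - 1) *
          (3 ^ N * 4 ^ ((d : ℝ) + 1 + N) * ((k / G.x z) ^ ((d : ℝ) + 1) *
            (1 + k / G.x z * ‖v‖) ^ (-((d : ℝ) + 2)))))) := by
          refine g1.trans (mul_le_mul_of_nonneg_left (g2.trans
            (mul_le_mul_of_nonneg_left ?_ hB0)) hC₂0)
          rw [g4]
          exact g3.trans (mul_le_mul_of_nonneg_left g6 (by positivity))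
      _ = C₃ * diagSize d τ k (G.x z) ‖v‖ := by
          rw [hC₃]; unfold diagSize; ring
      _ ≤ (C₁ + C₃) * diagSize d τ k (G.x z) ‖v‖ :=
          mul_le_mul_of_nonneg_right (le_add_of_nonneg_left hC₁0)
            (by unfold diagSize; positivity)
  · left
    -- If x/k + ‖v‖ exceeds δ, then ‖v‖ ≥ δ/3 or x/k > 2δ/3, and either puts the point at distance
    -- at least δ/3 from `sc`.
    have hs : δ / 3 ≤ c.scSize p := by
      rw [hq, hq']
      refine le_min (by linarith) ?_
      change δ / 3 ≤ _ + ‖v‖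
      rw [hd] at hgt
      rcases le_or_gt (δ / 3) ‖v‖ with hv' | hv'
      · have : 0 < (G.x z + G.x z') / (k + G.x z + G.x z') := by positivity
        linarith
      · have h1 : δ * 2 / 3 < G.x z / k := by linarith
        rw [lt_div_iff₀ hk0] at h1
        have : δ / 3 ≤ (G.x z + G.x z') / (k + G.x z + G.x z') := by
          rw [le_div_iff₀ (by positivity)]
          nlinarith
        linarith [norm_nonneg v]
    have := hC₁ p ⟨hpr, hs⟩
    rw [hpull, hkp, hleft, hright] at this
    refine this.trans ?_
    have := sepSize_nonneg (τ := τ) (lam := lam) (mu := mu) hk0.le hxz.le hxz'.le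
    gcongr
    linarith

end

end AsymptoticallyConic
end LowEnergy
end

/-! ### Pointwise bounds for conormal distributions of order -1. -/

noncomputable section
namespace LowEnergy

/-! ## Fourier transforms on the model space -/

section Fourier

open MeasureTheory Complex FourierTransform

variable {d : ℕ}

instance : (volume : Measure (Model d)).IsAddHaarMeasure :=
  inferInstanceAs ((volume : Measure ℝ).prod
    (volume : Measure (EuclideanSpace ℝ (Fin d)))).IsAddHaarMeasure

theorem finrank_model : Module.finrank ℝ (Model d) = d + 1 := by
  rw [Module.finrank_prod]; simp [add_comm]

/-- The inner product of the model space. -/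
def pairing (W ξ : Model d) : ℝ := W.1 * ξ.1 + inner ℝ W.2 ξ.2

theorem pairing_add_right (W ξ η : Model d) : pairing W (ξ + η) = pairing W ξ + pairing W η := by
  simp [pairing, inner_add_right]; ring

theorem pairing_smul_right (W ξ : Model d) (t : ℝ) : pairing W (t • ξ) = t * pairing W ξ := by
  simp [pairing, inner_smul_right]; ring

theorem continuous_pairing_left (ξ : Model d) : Continuous fun W : Model d => pairing W ξ := by
  unfold pairing; fun_prop

theorem continuous_pairing_right (W : Model d) : Continuous fun ξ : Model d => pairing W ξ := by
  unfold pairing; fun_prop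

theorem abs_pairing_le (W ξ : Model d) : |pairing W ξ| ≤ 2 * ‖W‖ * ‖ξ‖ := by
  have h1 : |W.1 * ξ.1| ≤ ‖W‖ * ‖ξ‖ := by
    rw [abs_mul]
    exact mul_le_mul (norm_fst_le W) (norm_fst_le ξ) (abs_nonneg _) (norm_nonneg _)
  have h2 : |(inner ℝ W.2 ξ.2 : ℝ)| ≤ ‖W‖ * ‖ξ‖ :=
    (abs_real_inner_le_norm _ _).trans
      (mul_le_mul (norm_snd_le W) (norm_snd_le ξ) (norm_nonneg _) (norm_nonneg _))
  exact (abs_add_le _ _).trans (by linarith)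

/-- Every vector has a unit vector in its direction, for the maximum norm. -/
theorem exists_pairing_eq_norm (W : Model d) (hW : W ≠ 0) :
    ∃ e : Model d, ‖e‖ = 1 ∧ |pairing W e| = ‖W‖ := by
  rcases le_total ‖W.2‖ ‖W.1‖ with h | h
  · exact ⟨(1, 0), by simp [Prod.norm_def], by simp [pairing, Prod.norm_def] at h ⊢; exact h⟩
  · have hW2 : W.2 ≠ 0 := by
      intro h0
      rw [h0, norm_zero] at h
      exact hW (Prod.ext (norm_le_zero_iff.1 h) h0)
    refine ⟨(0, ‖W.2‖⁻¹ • W.2), ?_, ?_⟩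
    · simp [Prod.norm_def, norm_smul, hW2]
    · simp only [pairing, mul_zero, zero_add, inner_smul_right, real_inner_self_eq_norm_sq,
        Prod.norm_def, max_eq_right h]
      rw [pow_two, inv_mul_cancel_left₀ (norm_ne_zero_iff.2 hW2), abs_norm]

theorem norm_exp_neg_I_mul (t : ℝ) : ‖exp (-I * (t : ℂ))‖ = 1 := by
  rw [show -I * (t : ℂ) = ((-t : ℝ) : ℂ) * I by push_cast; ring, norm_exp_ofReal_mul_I]

/-- The Fourier transform of a function on the model space. -/
def fourier (F : Model d → ℂ) (ξ : Model d) : ℂ := ∫ W, exp (-I * (pairing W ξ : ℂ)) * F W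

theorem integrable_exp_mul {F : Model d → ℂ} (hF : Integrable F) (ξ : Model d) :
    Integrable fun W => exp (-I * (pairing W ξ : ℂ)) * F W := by
  refine hF.bdd_mul (c := 1) ?_ (.of_forall fun W => (norm_exp_neg_I_mul _).le)
  have := continuous_pairing_left ξ
  exact (by fun_prop : Continuous fun W : Model d =>
    exp (-I * (pairing W ξ : ℂ))).aestronglyMeasurable

theorem continuous_fourier {F : Model d → ℂ} (hF : Integrable F) : Continuous (fourier F) := by
  refine continuous_of_dominated (bound := fun W => ‖F W‖)
    (fun ξ => (integrable_exp_mul hF ξ).aestronglyMeasurable)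
    (fun ξ => .of_forall fun W => ?_) hF.norm (.of_forall fun W => ?_)
  · rw [norm_mul, norm_exp_neg_I_mul, one_mul]
  · have := continuous_pairing_right W
    fun_prop

/-- Fourier inversion. -/
theorem norm_le_integral_fourier {F : Model d → ℂ} (hF : Integrable F)
    (hF' : Integrable fun ξ => fourier F ((2 * Real.pi) • ξ)) {W : Model d}
    (hc : ContinuousAt F W) : ‖F W‖ ≤ ∫ ξ, ‖fourier F ((2 * Real.pi) • ξ)‖ := by
  -- The model space carries the maximum norm; Fourier inversion is applied on its Euclidean
  -- version, which has the same measure. The dilations by 2π come from the normalization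
  -- exp(-2πi⟨v, w⟩) used there.
  have hmp := WithLp.volume_preserving_ofLp ℝ (EuclideanSpace ℝ (Fin d))
  have hemb : MeasurableEmbedding (@WithLp.ofLp 2 (Model d)) :=
    (MeasurableEquiv.toLp 2 (Model d)).symm.measurableEmbedding
  set f : WithLp 2 (Model d) → ℂ := fun w => F (WithLp.ofLp w) with hf
  have h1 : Integrable f := (hmp.integrable_comp_emb hemb).2 hF
  have h2 : 𝓕 f = fun w => fourier F ((2 * Real.pi) • WithLp.ofLp w) := by
    funext w
    rw [Real.fourier_eq', fourier, ← hmp.integral_comp hemb]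
    refine integral_congr_ae (.of_forall fun v => ?_)
    simp only [smul_eq_mul, hf, pairing_smul_right]
    congr 2
    simp only [WithLp.prod_inner_apply, pairing]
    push_cast
    simp
    ring
  have h3 : Integrable (𝓕 f) := by
    rw [h2]
    exact (hmp.integrable_comp_emb hemb).2 hF'
  have h4 : ContinuousAt f (WithLp.toLp 2 W) :=
    ContinuousAt.comp (f := @WithLp.ofLp 2 (Model d)) (by exact hc)
      (WithLp.prod_continuous_ofLp 2 _ _).continuousAt
  have h5 := h1.fourierInv_fourier_eq h3 h4
  have h6 : F W = f (WithLp.toLp 2 W) := rfl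
  rw [h6, ← h5, Real.fourierInv_eq', ← hmp.integral_comp hemb, h2]
  refine (norm_integral_le_integral_norm _).trans (le_of_eq ?_)
  refine integral_congr_ae (.of_forall fun v => ?_)
  simp only [norm_smul, norm_exp_ofReal_mul_I, one_mul]

/-- The Fourier transform of `U` times the `j`-th power of a linear function. -/
def fourierDeriv (U : Model d → ℂ) (e : Model d) (j : ℕ) : Model d → ℂ :=
  fourier fun W => (-I * (pairing W e : ℂ)) ^ j * U W

variable {U : Model d → ℂ} {R : ℝ}

/-- Bounded support makes all moments integrable, so that the transform can be differentiated under
the integral sign. -/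
theorem integrable_pow_mul (hU : Integrable U) (hR : ∀ W, R < ‖W‖ → U W = 0) (e : Model d)
    (j : ℕ) : Integrable fun W => (-I * (pairing W e : ℂ)) ^ j * U W := by
  have h1 := continuous_pairing_left e
  have h2 : Continuous fun W : Model d => (-I * (pairing W e : ℂ)) ^ j := by fun_prop
  refine (hU.norm.const_mul ((2 * |R| * ‖e‖) ^ j)).mono'
    (h2.aestronglyMeasurable.mul hU.aestronglyMeasurable) (.of_forall fun W => ?_)
  by_cases hW : R < ‖W‖
  · simp [hR W hW]
  · rw [norm_mul, norm_pow, norm_mul, norm_neg, norm_I, one_mul, norm_real, Real.norm_eq_abs]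
    gcongr
    refine (abs_pairing_le W e).trans ?_
    gcongr
    exact (not_lt.1 hW).trans (le_abs_self R)

theorem hasDerivAt_fourierDeriv (hU : Integrable U) (hR : ∀ W, R < ‖W‖ → U W = 0) (e : Model d)
    (j : ℕ) (ξ : Model d) (t : ℝ) :
    HasDerivAt (fun t : ℝ => fourierDeriv U e j (ξ + t • e))
      (fourierDeriv U e (j + 1) (ξ + t • e)) t := by
  have h1 := integrable_pow_mul hU hR e j
  have h2 := integrable_pow_mul hU hR e (j + 1)
  have hd : ∀ (W : Model d) (s : ℝ), HasDerivAt (fun s : ℝ => exp (-I * (pairing W (ξ + s • e) : ℂ)) *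
      ((-I * (pairing W e : ℂ)) ^ j * U W)) (exp (-I * (pairing W (ξ + s • e) : ℂ)) *
      ((-I * (pairing W e : ℂ)) ^ (j + 1) * U W)) s := by
    intro W s
    have e0 : HasDerivAt (fun s : ℝ => pairing W (ξ + s • e)) (pairing W e) s := by
      simp only [pairing_add_right, pairing_smul_right]
      simpa using ((hasDerivAt_id s).mul_const (pairing W e)).const_add (pairing W ξ)
    have e1 : HasDerivAt (fun s : ℝ => -I * (pairing W (ξ + s • e) : ℂ))
        (-I * (pairing W e : ℂ)) s := e0.ofReal_comp.const_mul (-I)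
    refine (e1.cexp.mul_const ((-I * (pairing W e : ℂ)) ^ j * U W)).congr_deriv ?_
    ring
  have key := hasDerivAt_integral_of_dominated_loc_of_deriv_le (μ := volume) (x₀ := t)
    (s := Set.univ)
    (F := fun (t : ℝ) (W : Model d) => exp (-I * (pairing W (ξ + t • e) : ℂ)) *
      ((-I * (pairing W e : ℂ)) ^ j * U W))
    (bound := fun W => ‖(-I * (pairing W e : ℂ)) ^ (j + 1) * U W‖)
    (F' := fun t W => exp (-I * (pairing W (ξ + t • e) : ℂ)) *
      ((-I * (pairing W e : ℂ)) ^ (j + 1) * U W)) Filter.univ_mem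
    (.of_forall fun s => (integrable_exp_mul h1 _).aestronglyMeasurable)
    (integrable_exp_mul h1 _) (integrable_exp_mul h2 _).aestronglyMeasurable
    (.of_forall fun W s _ => by rw [norm_mul, norm_exp_neg_I_mul, one_mul]) h2.norm
    (.of_forall fun W s _ => hd W s)
  unfold fourierDeriv fourier
  exact key.2

/-- The modulus of continuity of a symbol of order `-(d + 1)`. -/
theorem norm_sub_le_of_symbol {J J' : Model d → ℂ} {e : Model d} (he : ‖e‖ = 1)
    (hJ : ∀ ξ (t : ℝ), HasDerivAt (fun t : ℝ => J (ξ + t • e)) (J' (ξ + t • e)) t) {C : ℝ}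
    (hC : 0 ≤ C) (h0 : ∀ ξ, ‖J ξ‖ ≤ C * (1 + ‖ξ‖) ^ (-((d : ℝ) + 1)))
    (h1 : ∀ ξ, ‖J' ξ‖ ≤ C * (1 + ‖ξ‖) ^ (-((d : ℝ) + 2))) (s : ℝ) (ξ : Model d) :
    ‖J (ξ + s • e) - J ξ‖ ≤ C * 2 ^ ((d : ℝ) + 2) * (1 + 3 * |s|) ^ (1 / 2 : ℝ) *
      ((1 + ‖ξ‖) ^ (-((d : ℝ) + 3 / 2)) + (1 + ‖ξ + s • e‖) ^ (-((d : ℝ) + 3 / 2))) := by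
  have hd : (0 : ℝ) ≤ d := Nat.cast_nonneg d
  have hse : ‖s • e‖ = |s| := by rw [norm_smul, he, mul_one, Real.norm_eq_abs]
  have h2 : (1 : ℝ) ≤ 2 ^ ((d : ℝ) + 2) := Real.one_le_rpow (by norm_num) (by linarith)
  -- For ‖ξ‖ < 2|s| the two values are estimated separately and half a power of 1 + 3|s| is given
  -- away; for larger ‖ξ‖ the mean value theorem applies, with |s| bounded by a product of two
  -- square roots. The exponent d + 3/2 lies halfway between d + 1, which is not integrable in
  -- dimension d + 1, and d + 2.
  rcases lt_or_ge ‖ξ‖ (2 * |s|) with h | h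
  · have key : ∀ η : Model d, ‖η‖ ≤ 3 * |s| → ‖J η‖ ≤
        C * 2 ^ ((d : ℝ) + 2) * (1 + 3 * |s|) ^ (1 / 2 : ℝ) * (1 + ‖η‖) ^ (-((d : ℝ) + 3 / 2)) := by
      intro η hη
      have hpos : 0 < 1 + ‖η‖ := by positivity
      calc ‖J η‖ ≤ C * (1 + ‖η‖) ^ (-((d : ℝ) + 1)) := h0 η
        _ = C * 1 * (1 + ‖η‖) ^ (1 / 2 : ℝ) * (1 + ‖η‖) ^ (-((d : ℝ) + 3 / 2)) := by
            rw [mul_one, mul_assoc, ← Real.rpow_add hpos]; ring_nf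
        _ ≤ _ := by gcongr
    have k1 := key ξ (by linarith [abs_nonneg s])
    have k2 := key (ξ + s • e) ((norm_add_le _ _).trans (by rw [hse]; linarith))
    exact (norm_sub_le _ _).trans (by rw [mul_add]; linarith)
  · have hpos : 0 < 1 + ‖ξ‖ := by positivity
    have hder : ∀ t ∈ Set.Icc (0 : ℝ) 1, HasDerivWithinAt (fun t : ℝ => J (ξ + (t * s) • e))
        ((s : ℂ) * J' (ξ + (t * s) • e)) (Set.Icc 0 1) t := by
      intro t _
      have := (hJ ξ (t * s)).scomp t ((hasDerivAt_id t).mul_const s)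
      refine (this.congr_deriv ?_).hasDerivWithinAt
      simp
    have hbd : ∀ t ∈ Set.Ico (0 : ℝ) 1, ‖(s : ℂ) * J' (ξ + (t * s) • e)‖ ≤
        |s| * (C * (2 ^ ((d : ℝ) + 2) * (1 + ‖ξ‖) ^ (-((d : ℝ) + 2)))) := by
      intro t ht
      rw [norm_mul, norm_real, Real.norm_eq_abs]
      refine mul_le_mul_of_nonneg_left ((h1 _).trans (mul_le_mul_of_nonneg_left ?_ hC))
        (abs_nonneg s)
      have e1 : ‖(t * s) • e‖ ≤ |s| := by
        rw [norm_smul, he, mul_one, Real.norm_eq_abs, abs_mul, abs_of_nonneg ht.1]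
        nlinarith [abs_nonneg s, ht.2]
      have e2 : (1 + ‖ξ‖) / 2 ≤ 1 + ‖ξ + (t * s) • e‖ := by
        have := norm_sub_le (ξ + (t * s) • e) ((t * s) • e)
        rw [add_sub_cancel_right] at this
        linarith
      calc (1 + ‖ξ + (t * s) • e‖) ^ (-((d : ℝ) + 2)) ≤ ((1 + ‖ξ‖) / 2) ^ (-((d : ℝ) + 2)) :=
            Real.rpow_le_rpow_of_nonpos (by positivity) e2 (by linarith)
        _ = _ := by
            rw [Real.div_rpow hpos.le (by norm_num), Real.rpow_neg (by norm_num : (0 : ℝ) ≤ 2),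
              div_inv_eq_mul, mul_comm]
    have hmv := norm_image_sub_le_of_norm_deriv_le_segment_01' hder hbd
    simp only [one_mul, zero_mul, zero_smul, add_zero] at hmv
    have hs : |s| ≤ (1 + 3 * |s|) ^ (1 / 2 : ℝ) * (1 + ‖ξ‖) ^ (1 / 2 : ℝ) := by
      calc |s| = |s| ^ (1 / 2 : ℝ) * |s| ^ (1 / 2 : ℝ) := by
            rw [← Real.mul_rpow (abs_nonneg s) (abs_nonneg s), ← pow_two, ← Real.sqrt_eq_rpow,
              Real.sqrt_sq (abs_nonneg s)]
        _ ≤ _ := by gcongr <;> linarith [abs_nonneg s]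
    calc ‖J (ξ + s • e) - J ξ‖ ≤ |s| * (C * (2 ^ ((d : ℝ) + 2) * (1 + ‖ξ‖) ^ (-((d : ℝ) + 2)))) :=
          hmv
      _ ≤ ((1 + 3 * |s|) ^ (1 / 2 : ℝ) * (1 + ‖ξ‖) ^ (1 / 2 : ℝ)) *
            (C * (2 ^ ((d : ℝ) + 2) * (1 + ‖ξ‖) ^ (-((d : ℝ) + 2)))) := by gcongr
      _ = C * 2 ^ ((d : ℝ) + 2) * (1 + 3 * |s|) ^ (1 / 2 : ℝ) *
            (1 + ‖ξ‖) ^ (-((d : ℝ) + 3 / 2)) := by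
          rw [show -((d : ℝ) + 3 / 2) = 1 / 2 + -((d : ℝ) + 2) by ring, Real.rpow_add hpos]; ring
      _ ≤ _ := by
          refine mul_le_mul_of_nonneg_left ?_ (by positivity)
          have : 0 ≤ (1 + ‖ξ + s • e‖) ^ (-((d : ℝ) + 3 / 2)) := by positivity
          linarith

/-- The integral of the bracket to the power `-(d + 3 / 2)`. -/
def bracketIntegral (d : ℕ) : ℝ := ∫ ξ : Model d, (1 + ‖ξ‖) ^ (-((d : ℝ) + 3 / 2))

theorem integrable_bracket : Integrable fun ξ : Model d => (1 + ‖ξ‖) ^ (-((d : ℝ) + 3 / 2)) := by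
  refine integrable_one_add_norm ?_
  rw [finrank_model]
  push_cast
  linarith

theorem bracketIntegral_nonneg : 0 ≤ bracketIntegral d :=
  integral_nonneg fun ξ => by positivity

/-- A function whose Fourier transform is a symbol of order `-1` is
`O(|W| ^ (-d) (1 + 1 / |W|) ^ (1 / 2))`. -/
theorem norm_le_of_symbol (hU : Integrable U) (hR : ∀ W, R < ‖W‖ → U W = 0) {C : ℝ} (hC : 0 ≤ C)
    (h0 : ∀ e : Model d, ‖e‖ = 1 → ∀ ξ, ‖fourierDeriv U e d ξ‖ ≤ C * (1 + ‖ξ‖) ^ (-((d : ℝ) + 1)))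
    (h1 : ∀ e : Model d, ‖e‖ = 1 → ∀ ξ,
      ‖fourierDeriv U e (d + 1) ξ‖ ≤ C * (1 + ‖ξ‖) ^ (-((d : ℝ) + 2)))
    {W : Model d} (hW : W ≠ 0) (hc : ContinuousAt U W) :
    ‖U W‖ ≤ C * (2 ^ ((d : ℝ) + 2) * bracketIntegral d) *
      ((1 + 3 * (Real.pi / ‖W‖)) ^ (1 / 2 : ℝ) * ‖W‖ ^ (-(d : ℝ))) := by
  obtain ⟨e, he, hWe⟩ := exists_pairing_eq_norm W hW
  have hWn : 0 < ‖W‖ := norm_pos_iff.2 hW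
  have hp0 : pairing W e ≠ 0 := by
    intro h; rw [h, abs_zero] at hWe; exact hWn.ne hWe
  -- Translating the transform by s e multiplies the function by exp(-i s⟨·, e⟩), which is -1 at W.
  -- Hence the difference of the translated and the original symbol is the transform of a function F
  -- with |F(W)| = 2 |W|^d |U(W)|. This difference is integrable, although the bound of order d + 1
  -- does not make either term so.
  set s := Real.pi / pairing W e with hs
  have hsabs : |s| = Real.pi / ‖W‖ := by rw [hs, abs_div, hWe, abs_of_pos Real.pi_pos]
  set F : Model d → ℂ := fun V =>
    exp (-I * (pairing V (s • e) : ℂ)) * ((-I * (pairing V e : ℂ)) ^ d * U V) -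
      (-I * (pairing V e : ℂ)) ^ d * U V with hF
  have hFd := integrable_pow_mul hU hR e d
  have hFi : Integrable F := (integrable_exp_mul hFd _).sub hFd
  have hFF : ∀ ξ, fourier F ξ = fourierDeriv U e d (ξ + s • e) - fourierDeriv U e d ξ := by
    intro ξ
    unfold fourierDeriv fourier
    rw [← integral_sub (integrable_exp_mul hFd _) (integrable_exp_mul hFd _)]
    refine integral_congr_ae (.of_forall fun V => ?_)
    simp only [hF, pairing_add_right]
    push_cast
    rw [mul_add, Complex.exp_add]
    ring
  set D := C * 2 ^ ((d : ℝ) + 2) * (1 + 3 * |s|) ^ (1 / 2 : ℝ) with hD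
  have hD0 : 0 ≤ D := by positivity
  set β : Model d → ℝ := fun ξ => (1 + ‖ξ‖) ^ (-((d : ℝ) + 3 / 2)) with hβ
  set h' : Model d := ((2 * Real.pi)⁻¹ * s) • e with hh'
  have h2pi : 1 ≤ 2 * Real.pi := by linarith [Real.pi_gt_three]
  have hmono : ∀ ξ : Model d, β ((2 * Real.pi) • ξ) ≤ β ξ := by
    intro ξ
    have hd : (0 : ℝ) ≤ d := Nat.cast_nonneg d
    refine Real.rpow_le_rpow_of_nonpos (by positivity) ?_ (by linarith)
    rw [norm_smul, Real.norm_of_nonneg (by linarith)]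
    nlinarith [norm_nonneg ξ]
  have hbd : ∀ ξ, ‖fourier F ((2 * Real.pi) • ξ)‖ ≤ D * (β ξ + β (ξ + h')) := by
    intro ξ
    rw [hFF]
    refine (norm_sub_le_of_symbol he (fun ξ t => hasDerivAt_fourierDeriv hU hR e d ξ t) hC
      (h0 e he) (h1 e he) s _).trans ?_
    refine mul_le_mul_of_nonneg_left (add_le_add (hmono ξ) ?_) hD0
    have : (2 * Real.pi) • ξ + s • e = (2 * Real.pi) • (ξ + h') := by
      rw [smul_add, hh', smul_smul, ← mul_assoc, mul_inv_cancel₀ (by positivity), one_mul]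
    rw [this]
    exact hmono _
  have hβi : Integrable β := integrable_bracket
  have hβi' : Integrable fun ξ => D * (β ξ + β (ξ + h')) :=
    (hβi.add (hβi.comp_add_right h')).const_mul D
  have hFi' : Integrable fun ξ => fourier F ((2 * Real.pi) • ξ) := by
    refine hβi'.mono' ?_ (.of_forall hbd)
    exact ((continuous_fourier hFi).comp (continuous_const_smul _)).aestronglyMeasurable
  have hcF : ContinuousAt F W := by
    have c1 := (continuous_pairing_left (d := d) e)
    have c2 := (continuous_pairing_left (d := d) (s • e))
    have c3 : ContinuousAt (fun V : Model d => (-I * (pairing V e : ℂ)) ^ d * U V) W :=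
      ((by fun_prop : Continuous fun V : Model d =>
        (-I * (pairing V e : ℂ)) ^ d).continuousAt).mul hc
    exact (((by fun_prop : Continuous fun V : Model d =>
      exp (-I * (pairing V (s • e) : ℂ))).continuousAt).mul c3).sub c3
  have hinv := norm_le_integral_fourier hFi hFi' hcF
  have hFW : ‖F W‖ = 2 * (‖W‖ ^ d * ‖U W‖) := by
    have : pairing W (s • e) = Real.pi := by
      rw [pairing_smul_right, hs, div_mul_cancel₀ _ hp0]
    have h2 : exp (-I * (Real.pi : ℂ)) = -1 := by
      rw [show -I * (Real.pi : ℂ) = -(Real.pi * I) by ring, Complex.exp_neg, exp_pi_mul_I]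
      norm_num
    simp only [hF, this, h2]
    rw [show ∀ z : ℂ, -1 * z - z = -2 * z by intro z; ring, norm_mul, norm_mul, norm_pow, norm_mul,
      norm_neg, norm_neg, norm_I, one_mul, norm_real, Real.norm_eq_abs, hWe]
    norm_num
  have hint : ∫ ξ, ‖fourier F ((2 * Real.pi) • ξ)‖ ≤ D * (2 * bracketIntegral d) := by
    refine (integral_mono hFi'.norm hβi' hbd).trans (le_of_eq ?_)
    rw [integral_const_mul, integral_add hβi (hβi.comp_add_right h'),
      integral_add_right_eq_self (μ := volume) β h']
    rw [two_mul]
    rfl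
  rw [hFW] at hinv
  have hfin : ‖W‖ ^ d * ‖U W‖ ≤ D * bracketIntegral d := by linarith
  rw [Real.rpow_neg hWn.le, Real.rpow_natCast]
  have hWd : 0 < ‖W‖ ^ d := by positivity
  calc ‖U W‖ = (‖W‖ ^ d * ‖U W‖) * (‖W‖ ^ d)⁻¹ := by field_simp
    _ ≤ D * bracketIntegral d * (‖W‖ ^ d)⁻¹ := by gcongr
    _ = _ := by rw [hD, hsabs]; ring

/-! ## Conormal distributions -/

/-- Directional derivatives along the fibre of the Fourier transform. -/
theorem iteratedFDeriv_eq_fourierDeriv {E : Type*} [NormedAddCommGroup E] [NormedSpace ℝ E]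
    {a : E × Model d → ℂ} {b : E} (ha : ∀ ξ, ContDiffAt ℝ ∞ a (b, ξ)) (hU : Integrable U)
    (hR : ∀ W, R < ‖W‖ → U W = 0) (haU : ∀ ξ, a (b, ξ) = fourier U ξ) (e : Model d) (j : ℕ) :
    ∀ ξ, iteratedFDeriv ℝ j a (b, ξ) (fun _ => (0, e)) = fourierDeriv U e j ξ := by
  induction j with
  | zero =>
    intro ξ
    simp [fourierDeriv, haU]
  | succ j ih =>
    intro ξ
    have hle : ∀ m : ℕ, ContDiffAt ℝ m a (b, ξ) := fun m => (ha ξ).of_le (by exact_mod_cast le_top)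
    have h1 : HasDerivAt (fun t : ℝ => ((b, ξ + t • e) : E × Model d)) (0, e) 0 := by
      have : HasDerivAt (fun t : ℝ => ξ + t • e) e 0 := by
        simpa using ((hasDerivAt_id (0 : ℝ)).smul_const e).const_add ξ
      exact (hasDerivAt_const (0 : ℝ) b).prodMk this
    have h2 := contDiffAt_iteratedFDeriv_apply (m := 1) (N := j) (hle _)
      (fun _ => ((0, e) : E × Model d))
    have h2' : HasFDerivAt (fun q => iteratedFDeriv ℝ j a q fun _ => ((0, e) : E × Model d))
        (fderiv ℝ (fun q => iteratedFDeriv ℝ j a q fun _ => ((0, e) : E × Model d)) (b, ξ))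
        (b, ξ + (0 : ℝ) • e) := by
      rw [zero_smul, add_zero]
      exact (h2.differentiableAt (by simp)).hasFDerivAt
    have h3 := h2'.comp_hasDerivAt (0 : ℝ) h1
    have h4 : HasDerivAt (fun t : ℝ => fourierDeriv U e j (ξ + t • e))
        (fderiv ℝ (fun q => iteratedFDeriv ℝ j a q fun _ => ((0, e) : E × Model d)) (b, ξ) (0, e))
        0 := by
      refine h3.congr_of_eventuallyEq (.of_forall fun t => ?_)
      exact (ih (ξ + t • e)).symm
    have h5 := h4.unique (hasDerivAt_fourierDeriv hU hR e j ξ 0)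
    rw [zero_smul, add_zero, fderiv_iteratedFDeriv_apply (hle _)] at h5
    rw [← h5, iteratedFDeriv_succ_apply_left]
    rfl

/-- Conormal distributions of order `-1` are bounded by this function of the distance. -/
def conormalSize (d : ℕ) (v : ℝ) : ℝ :=
  (1 + 3 * (Real.pi / v)) ^ (1 / 2 : ℝ) * v ^ (-(d : ℝ))

/-- Only fibre derivatives of orders d and d + 1 of the amplitude enter, with constants independent
of b. Openness of B makes the amplitude smooth in a full neighbourhood of each point, so that these
are derivatives along the fibre of the transform. -/
theorem exists_le_conormalSize {B : Set (ℝ × Model d)} (hB : IsOpen B)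
    {U : ℝ × Model d → Model d → ℂ} {a : (ℝ × Model d) × Model d → ℂ}
    (hUs : ContDiffOn ℝ ∞ (fun q : (ℝ × Model d) × Model d => U q.1 q.2) (B ×ˢ {0}ᶜ))
    (hUi : ∀ b ∈ B, Integrable (U b))
    (haU : ∀ b ∈ B, ∀ ξ : Model d, a (b, ξ) =
      ∫ W : Model d, exp (-I * ((W.1 * ξ.1 + inner ℝ W.2 ξ.2 : ℝ) : ℂ)) * U b W)
    (ha : ContDiffOn ℝ ∞ a (B ×ˢ Set.univ))
    (had : DerivBound a (B ×ˢ Set.univ) (fun q => (1 + ‖q.2‖) ^ (-1 : ℝ))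
      (fun q η => ‖η.1‖ + ‖η.2‖ / (1 + ‖q.2‖)))
    (hR : ∀ b ∈ B, ∀ W, W ≠ 0 → R < ‖W‖ → U b W = 0) :
    ∃ C : ℝ, 0 ≤ C ∧ ∀ b ∈ B, ∀ W, W ≠ 0 → ‖U b W‖ ≤ C * conormalSize d ‖W‖ := by
  obtain ⟨C₀, hC₀⟩ := had d
  obtain ⟨C₁, hC₁⟩ := had (d + 1)
  refine ⟨(|C₀| + |C₁|) * (2 ^ ((d : ℝ) + 2) * bracketIntegral d),
    mul_nonneg (by positivity) (mul_nonneg (by positivity) bracketIntegral_nonneg),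
    fun b hb W hW => ?_⟩
  have hopen : IsOpen (B ×ˢ (Set.univ : Set (Model d))) := hB.prod isOpen_univ
  have hat : ∀ ξ, ContDiffAt ℝ ∞ a (b, ξ) := fun ξ =>
    ha.contDiffAt (hopen.mem_nhds ⟨hb, Set.mem_univ _⟩)
  have hR' : ∀ W, |R| < ‖W‖ → U b W = 0 := fun W hW =>
    hR b hb W (norm_pos_iff.1 ((abs_nonneg R).trans_lt hW)) ((le_abs_self R).trans_lt hW)
  have hcont : ContinuousAt (U b) W := by
    have h1 : ContinuousAt (fun q : (ℝ × Model d) × Model d => U q.1 q.2) (b, W) :=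
      (hUs.contDiffAt ((hB.prod isOpen_compl_singleton).mem_nhds
        (Set.mk_mem_prod hb (Set.mem_compl_singleton_iff.2 hW)))).continuousAt
    exact ContinuousAt.comp (f := fun W : Model d => (b, W)) h1
      (continuous_const.prodMk continuous_id).continuousAt
  have hpow : ∀ (N : ℕ) (ξ : Model d), (1 + ‖ξ‖) ^ (-1 : ℝ) * (1 / (1 + ‖ξ‖)) ^ N =
      (1 + ‖ξ‖) ^ (-((N : ℝ) + 1)) := by
    intro N ξ
    have : 0 < 1 + ‖ξ‖ := by positivity
    rw [one_div, ← Real.rpow_natCast, Real.inv_rpow this.le, ← Real.rpow_neg this.le,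
      ← Real.rpow_add this]
    ring_nf
  have hbound : ∀ (N : ℕ) (C : ℝ), (∀ p ∈ B ×ˢ (Set.univ : Set (Model d)),
      ∀ ξ : Fin N → (ℝ × Model d) × Model d, ‖iteratedFDeriv ℝ N a p ξ‖ ≤
        C * (1 + ‖p.2‖) ^ (-1 : ℝ) * ∏ i, (‖(ξ i).1‖ + ‖(ξ i).2‖ / (1 + ‖p.2‖))) →
      ∀ e : Model d, ‖e‖ = 1 → ∀ ξ,
        ‖fourierDeriv (U b) e N ξ‖ ≤ |C| * (1 + ‖ξ‖) ^ (-((N : ℝ) + 1)) := by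
    intro N C hC e he ξ
    rw [← iteratedFDeriv_eq_fourierDeriv hat (hUi b hb) hR' (fun ξ => haU b hb ξ) e N ξ]
    have := hC (b, ξ) ⟨hb, Set.mem_univ _⟩ (fun _ => (0, e))
    simp only [norm_zero, zero_add, he, Finset.prod_const, Finset.card_univ, Fintype.card_fin] at this
    rw [mul_assoc, hpow] at this
    refine this.trans ?_
    gcongr
    exact le_abs_self C
  refine norm_le_of_symbol (hUi b hb) hR' (by positivity) (fun e he ξ => ?_) (fun e he ξ => ?_)
    hW hcont
  · refine (hbound d C₀ hC₀ e he ξ).trans ?_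
    gcongr
    linarith [abs_nonneg C₁]
  · have := hbound (d + 1) C₁ hC₁ e he ξ
    push_cast at this
    rw [show (d : ℝ) + 1 + 1 = d + 2 by ring] at this
    refine this.trans ?_
    gcongr
    linarith [abs_nonneg C₀]

end Fourier

end LowEnergy
end

/-! ### The Riemannian measure in a chart. -/

noncomputable section
namespace LowEnergy

/-- `modelBasis` as a basis. -/
def modelBasis' (d : ℕ) : Module.Basis (Fin (d + 1)) ℝ (Model d) :=
  basisOfLinearIndependentOfCardEqFinrank (b := modelBasis d) (by
    rw [Fintype.linearIndependent_iff]
    intro g hg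
    rw [Fin.sum_univ_succ] at hg
    simp only [modelBasis, Fin.cons_zero, Fin.cons_succ] at hg
    have h1 := congrArg Prod.fst hg
    have h2 := congrArg Prod.snd hg
    simp only [Prod.fst_add, Prod.smul_fst, Prod.fst_sum, mul_zero, Finset.sum_const_zero,
      smul_eq_mul, mul_one, add_zero, Prod.fst_zero] at h1
    simp only [Prod.snd_add, Prod.smul_snd, Prod.snd_sum, smul_zero, zero_add, Prod.snd_zero] at h2
    intro i
    induction i using Fin.cases with
    | zero => exact h1
    | succ j =>
      have := congrArg (fun v : EuclideanSpace ℝ (Fin d) => v j) h2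
      simpa [Pi.single_apply] using this) (by rw [Fintype.card_fin, finrank_model])

@[simp] theorem modelBasis'_apply (d : ℕ) (i : Fin (d + 1)) : modelBasis' d i = modelBasis d i := by
  simp [modelBasis']

namespace AsymptoticallyConic

open MeasureTheory IsManifold

variable {d : ℕ} {X S : Type*}
  [TopologicalSpace X] [ChartedSpace (Model d) X] [IsManifold 𝓘(ℝ, Model d) ∞ X]
  [TopologicalSpace S] [ChartedSpace (EuclideanSpace ℝ (Fin d)) S]
  [IsManifold 𝓘(ℝ, EuclideanSpace ℝ (Fin d)) ∞ S]
  (G : AsymptoticallyConic d X S)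

/-! ## The Riemannian measure -/

/-- The metric in a chart. -/
def chartForm (φ : OpenPartialHomeomorph X (Model d)) (u : Model d) :
    LinearMap.BilinForm ℝ (Model d) :=
  LinearMap.mk₂ ℝ (fun v w : Model d => G.g.inner (φ.symm u)
      (mfderiv 𝓘(ℝ, Model d) 𝓘(ℝ, Model d) φ.symm u v)
      (mfderiv 𝓘(ℝ, Model d) 𝓘(ℝ, Model d) φ.symm u w))
    (fun v v' w => by erw [map_add, map_add]; rfl)
    (fun c v w => by erw [map_smul, map_smul]; rfl)
    (fun v w w' => by erw [map_add, map_add])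
    (fun c v w => by erw [map_smul, map_smul])

theorem chartDensity_eq (φ : OpenPartialHomeomorph X (Model d)) (u : Model d) :
    G.chartDensity φ u =
      Real.sqrt (LinearMap.BilinForm.toMatrix (modelBasis' d) (G.chartForm φ u)).det := by
  unfold chartDensity
  congr 2
  ext i j
  rw [LinearMap.BilinForm.toMatrix_apply, modelBasis'_apply, modelBasis'_apply]
  rfl

variable {φ φ' : OpenPartialHomeomorph X (Model d)}

theorem mdifferentiableAt_symm (hφ : φ ∈ maximalAtlas 𝓘(ℝ, Model d) ∞ X) {u : Model d}
    (hu : u ∈ φ.target) : MDifferentiableAt 𝓘(ℝ, Model d) 𝓘(ℝ, Model d) φ.symm u :=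
  (contMDiffAt_symm_of_mem_maximalAtlas hφ hu).mdifferentiableAt (by simp)

theorem differentiableAt_transition (hφ : φ ∈ maximalAtlas 𝓘(ℝ, Model d) ∞ X)
    (hφ' : φ' ∈ maximalAtlas 𝓘(ℝ, Model d) ∞ X) {u : Model d} (hu : u ∈ φ'.target)
    (hu' : φ'.symm u ∈ φ.source) : DifferentiableAt ℝ (fun u => φ (φ'.symm u)) u := by
  rw [← mdifferentiableAt_iff_differentiableAt]
  exact ((contMDiffAt_of_mem_maximalAtlas hφ hu').mdifferentiableAt (by simp)).comp u
    (mdifferentiableAt_symm hφ' hu)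

theorem chartForm_eq_comp (hφ : φ ∈ maximalAtlas 𝓘(ℝ, Model d) ∞ X)
    (hφ' : φ' ∈ maximalAtlas 𝓘(ℝ, Model d) ∞ X) {u : Model d} (hu : u ∈ φ'.target)
    (hu' : φ'.symm u ∈ φ.source) :
    G.chartForm φ' u = (G.chartForm φ (φ (φ'.symm u))).comp
      (fderiv ℝ (fun u => φ (φ'.symm u)) u).toLinearMap
      (fderiv ℝ (fun u => φ (φ'.symm u)) u).toLinearMap := by
  set f : Model d → Model d := fun u => φ (φ'.symm u) with hf
  have hfd : DifferentiableAt ℝ f u := differentiableAt_transition hφ hφ' hu hu'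
  have hev : (φ'.symm : Model d → X) =ᶠ[nhds u] (φ.symm : Model d → X) ∘ f := by
    filter_upwards [φ'.symm.continuousAt hu (φ.open_source.mem_nhds hu')] with v hv
    exact (φ.left_inv hv).symm
  have hft : f u ∈ φ.target := φ.map_source hu'
  have hz : φ'.symm u = φ.symm (f u) := hev.eq_of_nhds
  have h1 : (mfderiv 𝓘(ℝ, Model d) 𝓘(ℝ, Model d) φ'.symm u : Model d → Model d) =
      fun v => (mfderiv 𝓘(ℝ, Model d) 𝓘(ℝ, Model d) φ.symm (f u) : Model d → Model d)
        (fderiv ℝ f u v) := by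
    have e1 := hev.mfderiv_eq (I := 𝓘(ℝ, Model d)) (I' := 𝓘(ℝ, Model d))
    have e2 := mfderiv_comp u (mdifferentiableAt_symm hφ hft)
      (mdifferentiableAt_iff_differentiableAt.2 hfd)
    rw [mfderiv_eq_fderiv] at e2
    have e3 := e1.trans e2
    funext v
    exact congrArg (fun A : Model d →L[ℝ] Model d => A v) e3
  set Q : X → Model d → Model d → ℝ := fun z v w => G.g.inner z v w with hQ
  refine LinearMap.ext fun v => LinearMap.ext fun w => ?_
  change Q (φ'.symm u) ((mfderiv 𝓘(ℝ, Model d) 𝓘(ℝ, Model d) φ'.symm u : Model d → Model d) v)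
    ((mfderiv 𝓘(ℝ, Model d) 𝓘(ℝ, Model d) φ'.symm u : Model d → Model d) w) =
    Q (φ.symm (f u)) ((mfderiv 𝓘(ℝ, Model d) 𝓘(ℝ, Model d) φ.symm (f u) : Model d → Model d)
        (fderiv ℝ f u v))
      ((mfderiv 𝓘(ℝ, Model d) 𝓘(ℝ, Model d) φ.symm (f u) : Model d → Model d) (fderiv ℝ f u w))
  exact (congrFun (congrFun (congrArg Q hz) _) _).trans
    (congrArg₂ (Q (φ.symm (f u))) (congrFun h1 v) (congrFun h1 w))

/-- The Gram matrix is multiplied by the Jacobian matrix on one side and by its transpose on the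
other, so the root of its determinant acquires |det|, as in the change of variables formula. -/
theorem chartDensity_transition (hφ : φ ∈ maximalAtlas 𝓘(ℝ, Model d) ∞ X)
    (hφ' : φ' ∈ maximalAtlas 𝓘(ℝ, Model d) ∞ X) {u : Model d} (hu : u ∈ φ'.target)
    (hu' : φ'.symm u ∈ φ.source) :
    G.chartDensity φ' u =
      |(fderiv ℝ (fun u => φ (φ'.symm u)) u).det| * G.chartDensity φ (φ (φ'.symm u)) := by
  rw [chartDensity_eq, chartDensity_eq, G.chartForm_eq_comp hφ hφ' hu hu',
    LinearMap.BilinForm.toMatrix_comp (modelBasis' d) (modelBasis' d), Matrix.det_mul,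
    Matrix.det_mul, Matrix.det_transpose, LinearMap.det_toMatrix, mul_comm (LinearMap.det _),
    mul_assoc, mul_comm, ← pow_two, Real.sqrt_mul (sq_nonneg _), Real.sqrt_sq_eq_abs]

section

variable [MeasurableSpace X] [BorelSpace X]

theorem aemeasurable_symm (φ : OpenPartialHomeomorph X (Model d)) :
    AEMeasurable φ.symm (volume.restrict φ.target) :=
  φ.continuousOn_symm.aemeasurable φ.open_target.measurableSet

theorem chartVolume_apply (φ : OpenPartialHomeomorph X (Model d)) {A : Set X}
    (hA : MeasurableSet A) :
    G.chartVolume φ A = ∫⁻ u in φ.target ∩ φ.symm ⁻¹' A, ENNReal.ofReal (G.chartDensity φ u) := by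
  have h1 := aemeasurable_symm φ
  have h2 : NullMeasurableSet (φ.symm ⁻¹' A) (volume.restrict φ.target) :=
    h1.nullMeasurableSet_preimage hA
  rw [chartVolume, Measure.map_apply_of_aemeasurable
    (h1.mono_ac (withDensity_absolutelyContinuous _ _)) hA,
    withDensity_apply₀ _ h2, Measure.restrict_restrict₀ h2, Set.inter_comm]

theorem measurableSet_target_inter (φ : OpenPartialHomeomorph X (Model d)) {A : Set X}
    (hA : MeasurableSet A) : MeasurableSet (φ.target ∩ φ.symm ⁻¹' A) := by
  have h : Measurable (φ.target.domRestrict φ.symm) :=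
    (continuousOn_iff_continuous_domRestrict.1 φ.continuousOn_symm).measurable
  have := φ.open_target.measurableSet.subtype_image (h hA)
  convert! this using 1
  ext u
  simp [Set.domRestrict, and_comm]

/-- The measures `chartVolume` agree where chart domains overlap. -/
theorem chartVolume_eq_of_subset (hφ : φ ∈ maximalAtlas 𝓘(ℝ, Model d) ∞ X)
    (hφ' : φ' ∈ maximalAtlas 𝓘(ℝ, Model d) ∞ X) {A : Set X} (hA : MeasurableSet A)
    (h : A ⊆ φ.source) (h' : A ⊆ φ'.source) : G.chartVolume φ' A = G.chartVolume φ A := by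
  rw [chartVolume_apply G φ hA, chartVolume_apply G φ' hA]
  set f : Model d → Model d := fun u => φ (φ'.symm u) with hf
  set s := φ'.target ∩ φ'.symm ⁻¹' A with hs
  have himg : φ.target ∩ φ.symm ⁻¹' A = f '' s := by
    ext u
    constructor
    · rintro ⟨h1, h2⟩
      refine ⟨φ' (φ.symm u), ⟨φ'.map_source (h' h2), ?_⟩, ?_⟩
      · rw [Set.mem_preimage, φ'.left_inv (h' h2)]; exact h2
      · simp only [hf]
        rw [φ'.left_inv (h' h2), φ.right_inv h1]
    · rintro ⟨v, ⟨h1, h2⟩, rfl⟩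
      refine ⟨φ.map_source (h h2), ?_⟩
      rw [Set.mem_preimage, φ.left_inv (h h2)]; exact h2
  have hinj : Set.InjOn f s := by
    intro v hv w hw hvw
    exact φ'.symm.injOn hv.1 hw.1 (φ.injOn (h hv.2) (h hw.2) hvw)
  rw [himg, lintegral_image_eq_lintegral_abs_det_fderiv_mul volume
    (measurableSet_target_inter φ' hA) (f' := fun u => fderiv ℝ f u)
    (fun u hu => (differentiableAt_transition hφ hφ' hu.1 (h hu.2)).hasFDerivAt.hasFDerivWithinAt)
    hinj]
  refine setLIntegral_congr_fun (measurableSet_target_inter φ' hA) fun u hu => ?_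
  rw [G.chartDensity_transition hφ hφ' hu.1 (h hu.2), ENNReal.ofReal_mul (abs_nonneg _)]

theorem chartVolume_compl_source (φ : OpenPartialHomeomorph X (Model d)) :
    G.chartVolume φ φ.sourceᶜ = 0 := by
  rw [chartVolume_apply G φ φ.open_source.measurableSet.compl]
  have : φ.target ∩ φ.symm ⁻¹' φ.sourceᶜ = ∅ := by
    ext u
    simp only [Set.mem_inter_iff, Set.mem_preimage, Set.mem_compl_iff, Set.mem_empty_iff_false,
      iff_false, not_and, not_not]
    exact fun hu => φ.map_target hu
  rw [this]
  simp

/-- In a chart, the Riemannian measure is given by the Riemannian density. -/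
theorem vol_restrict_le (hφ : φ ∈ maximalAtlas 𝓘(ℝ, Model d) ∞ X) :
    G.vol.restrict φ.source ≤ G.chartVolume φ := by
  have hm := φ.open_source.measurableSet
  -- The right side bounds every member of the supremum: inside `φ.source` each `chartVolume` agrees
  -- with that of φ where the two domains overlap, and outside it is at most `vol`. An upper bound
  -- is all that the Schur estimates need.
  have key : G.vol ≤ (G.chartVolume φ).restrict φ.source + G.vol.restrict φ.sourceᶜ := by
    refine iSup_le fun φ' => Measure.le_iff.2 fun A hA => ?_
    rw [Measure.add_apply, Measure.restrict_apply hA, Measure.restrict_apply hA,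
      ← measure_inter_add_sdiff A hm]
    refine add_le_add ?_ ?_
    · have h1 : G.chartVolume φ'.1 (A ∩ φ.source) = G.chartVolume φ'.1
          (A ∩ φ.source ∩ φ'.1.source) := by
        rw [← measure_inter_add_sdiff (A ∩ φ.source) φ'.1.open_source.measurableSet,
          measure_mono_null (Set.sdiff_subset_compl _ _) (chartVolume_compl_source G φ'.1),
          add_zero]
      rw [h1, G.chartVolume_eq_of_subset hφ φ'.2
        ((hA.inter hm).inter φ'.1.open_source.measurableSet)
        (Set.inter_subset_left.trans Set.inter_subset_right) Set.inter_subset_right]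
      exact measure_mono Set.inter_subset_left
    · exact le_iSup (fun φ : maximalAtlas 𝓘(ℝ, Model d) ∞ X => G.chartVolume φ.1) φ' _
  refine Measure.le_iff.2 fun A hA => ?_
  rw [Measure.restrict_apply hA]
  refine (key _).trans ?_
  rw [Measure.add_apply, Measure.restrict_apply (hA.inter hm), Measure.restrict_apply (hA.inter hm),
    Set.inter_assoc A φ.source φ.sourceᶜ, Set.inter_compl_self, Set.inter_empty, measure_empty,
    add_zero]
  exact measure_mono (Set.inter_subset_left.trans Set.inter_subset_left)

end

/-! ### Bounds for the density -/

theorem continuousOn_chartForm (hφ : φ ∈ maximalAtlas 𝓘(ℝ, Model d) ∞ X) (v w : Model d) :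
    ContinuousOn (fun u => G.chartForm φ u v w) φ.target := by
  intro u hu
  have hsm := contMDiffAt_symm_of_mem_maximalAtlas hφ hu
  have hsec : ∀ v : Model d, ContMDiffWithinAt 𝓘(ℝ, Model d) (𝓘(ℝ, Model d).prod 𝓘(ℝ, Model d)) 0
      (fun u => Bundle.TotalSpace.mk' (Model d) (E := fun z : X => TangentSpace 𝓘(ℝ, Model d) z)
        (φ.symm u) (mfderiv 𝓘(ℝ, Model d) 𝓘(ℝ, Model d) φ.symm u v)) φ.target u := by
    intro v
    have h1 := ((contMDiffOn_symm_of_mem_maximalAtlas hφ).of_le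
      (by exact_mod_cast le_top : (1 : WithTop ℕ∞) ≤ ∞)).contMDiffOn_tangentMapWithin
      (m := 0) (by simp) φ.open_target.uniqueMDiffOn
    have h2 : ContMDiff 𝓘(ℝ, Model d) 𝓘(ℝ, Model d).tangent 0
        (fun u : Model d => (⟨u, v⟩ : TangentBundle 𝓘(ℝ, Model d) (Model d))) := fun u =>
      contMDiffAt_vectorSpace_iff_contDiffAt.2 contDiffAt_const
    have h3 := (h1 ⟨u, v⟩ hu).comp u (h2 u).contMDiffWithinAt (fun u' hu' => hu')
    refine h3.congr_of_mem (fun u' hu' => ?_) hu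
    simp only [Function.comp_apply, tangentMapWithin, mfderivWithin_of_isOpen φ.open_target hu']
  have : ContMDiffWithinAt 𝓘(ℝ, Model d) (𝓘(ℝ, Model d).prod 𝓘(ℝ)) 0
      (fun u => Bundle.TotalSpace.mk' ℝ (E := Bundle.Trivial X ℝ) (φ.symm u)
        (G.g.inner (φ.symm u) (mfderiv 𝓘(ℝ, Model d) 𝓘(ℝ, Model d) φ.symm u v)
          (mfderiv 𝓘(ℝ, Model d) 𝓘(ℝ, Model d) φ.symm u w))) φ.target u := by
    apply ContMDiffWithinAt.clm_bundle_apply₂ (F₁ := Model d) (F₂ := Model d)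
    · exact ContMDiffAt.comp_contMDiffWithinAt u
        ((G.g.contMDiff.of_le (by simp)).contMDiffAt)
        ((hsm.of_le (by simp)).contMDiffWithinAt)
    · exact hsec v
    · exact hsec w
  simp only [Bundle.contMDiffWithinAt_totalSpace] at this
  exact this.2.continuousWithinAt

end AsymptoticallyConic
end LowEnergy
end

/-! ### The density near infinity, and basic properties of the measure. -/

noncomputable section
namespace LowEnergy
namespace AsymptoticallyConic

open MeasureTheory IsManifold

variable {d : ℕ} {X S : Type*}
  [TopologicalSpace X] [ChartedSpace (Model d) X] [IsManifold 𝓘(ℝ, Model d) ∞ X]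
  [TopologicalSpace S] [ChartedSpace (EuclideanSpace ℝ (Fin d)) S]
  [IsManifold 𝓘(ℝ, EuclideanSpace ℝ (Fin d)) ∞ S]
  (G : AsymptoticallyConic d X S)

/-! ### Collar charts are charts -/

theorem contMDiffOn_collarChart {ψ : OpenPartialHomeomorph S (EuclideanSpace ℝ (Fin d))}
    (hψ : ψ ∈ maximalAtlas 𝓘(ℝ, EuclideanSpace ℝ (Fin d)) ∞ S) :
    ContMDiffOn 𝓘(ℝ, Model d) 𝓘(ℝ, Model d) ∞ (G.collarChart ψ) (G.collarChart ψ).source := by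
  have hs : (G.collarChart ψ).source ⊆ G.collar.source := fun z hz => (mem_collarChart_source.1 hz).1
  have h1 := G.collar_smooth.mono hs
  refine ContMDiffOn.prodMk_space ?_ ?_
  · intro z hz
    have h2 := (contMDiff_fst (I := 𝓘(ℝ, ℝ)) (J := 𝓘(ℝ, EuclideanSpace ℝ (Fin d)))).contMDiffAt.comp_contMDiffWithinAt z (h1 z hz)
    have hpos : 0 < (G.collar z).1 := by rw [G.collar_fst z (hs hz)]; exact G.x_pos z
    have h3 : ContMDiffAt 𝓘(ℝ, ℝ) 𝓘(ℝ, ℝ) ∞ Real.log (G.collar z).1 :=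
      (Real.contDiffAt_log.2 hpos.ne').contMDiffAt
    exact h3.comp_contMDiffWithinAt z h2
  · intro z hz
    have h2 := (contMDiff_snd (I := 𝓘(ℝ, ℝ)) (J := 𝓘(ℝ, EuclideanSpace ℝ (Fin d)))).contMDiffAt.comp_contMDiffWithinAt z (h1 z hz)
    exact (contMDiffAt_of_mem_maximalAtlas hψ (mem_collarChart_source.1 hz).2).comp_contMDiffWithinAt
      z h2

theorem contMDiffOn_collarChart_symm {ψ : OpenPartialHomeomorph S (EuclideanSpace ℝ (Fin d))}
    (hψ : ψ ∈ maximalAtlas 𝓘(ℝ, EuclideanSpace ℝ (Fin d)) ∞ S) :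
    ContMDiffOn 𝓘(ℝ, Model d) 𝓘(ℝ, Model d) ∞ (G.collarChart ψ).symm (G.collarChart ψ).target := by
  intro u hu
  have ht := mem_collarChart_target.1 hu
  have h1 : ContMDiffAt 𝓘(ℝ, Model d) 𝓘(ℝ, ℝ) ∞ (fun u : Model d => Real.exp u.1) u :=
    (Real.contDiff_exp.comp contDiff_fst).contMDiff.contMDiffAt
  have h2 : ContMDiffAt 𝓘(ℝ, Model d) 𝓘(ℝ, EuclideanSpace ℝ (Fin d)) ∞
      (fun u : Model d => ψ.symm u.2) u :=
    (contMDiffAt_symm_of_mem_maximalAtlas hψ ht.2).comp u contDiff_snd.contMDiff.contMDiffAt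
  have hm : (Real.exp u.1, ψ.symm u.2) ∈ G.collar.target := by
    rw [G.collar_target]; exact ⟨⟨Real.exp_pos _, ht.1⟩, Set.mem_univ _⟩
  have h3 := (G.collar_symm_smooth _ hm).contMDiffAt (G.collar.open_target.mem_nhds hm)
  exact (ContMDiffAt.comp u (f := fun u : Model d => (Real.exp u.1, ψ.symm u.2)) h3
    (h1.prodMk h2)).contMDiffWithinAt

theorem collarChart_mem_maximalAtlas {ψ : OpenPartialHomeomorph S (EuclideanSpace ℝ (Fin d))}
    (hψ : ψ ∈ maximalAtlas 𝓘(ℝ, EuclideanSpace ℝ (Fin d)) ∞ S) :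
    G.collarChart ψ ∈ maximalAtlas 𝓘(ℝ, Model d) ∞ X :=
  OpenPartialHomeomorph.mem_maximalAtlas_of_contMDiffOn _ (contMDiffOn_collarChart G hψ)
    (contMDiffOn_collarChart_symm G hψ)

theorem IsPiece.mem_maximalAtlas {φ : OpenPartialHomeomorph X (Model d)} {P : Set X}
    (h : G.IsPiece φ P) : φ ∈ maximalAtlas 𝓘(ℝ, Model d) ∞ X := by
  cases h with
  | interior _ _ hφ _ _ => exact hφ
  | collar ψ _ _ hψ _ _ _ => exact collarChart_mem_maximalAtlas G hψ

/-- As dx/x = d(log x), in the coordinates (log x, y) the metric is x⁻² times (d log x)² + h(x), a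
form which stays bounded as x tends to 0. -/
theorem chartForm_collarChart {ψ : OpenPartialHomeomorph S (EuclideanSpace ℝ (Fin d))}
    (hψ : ψ ∈ maximalAtlas 𝓘(ℝ, EuclideanSpace ℝ (Fin d)) ∞ S) {u : Model d}
    (hu : u ∈ (G.collarChart ψ).target) (v w : Model d) :
    G.chartForm (G.collarChart ψ) u v w = (v.1 * w.1 + G.h (Real.exp u.1) (ψ.symm u.2)
      (mfderiv 𝓘(ℝ, EuclideanSpace ℝ (Fin d)) 𝓘(ℝ, EuclideanSpace ℝ (Fin d)) ψ.symm u.2 v.2)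
      (mfderiv 𝓘(ℝ, EuclideanSpace ℝ (Fin d)) 𝓘(ℝ, EuclideanSpace ℝ (Fin d)) ψ.symm u.2 w.2)) /
        Real.exp u.1 ^ 2 := by
  set Φ := G.collarChart ψ with hΦ
  have ht := mem_collarChart_target.1 hu
  set z := Φ.symm u with hz
  have hzs : z ∈ Φ.source := Φ.map_target hu
  have hzc : z ∈ G.collar.source := (mem_collarChart_source.1 hzs).1
  have hxz : G.x z = Real.exp u.1 := x_collarChart_symm hu
  have hsd := mdifferentiableAt_symm (collarChart_mem_maximalAtlas G hψ) hu
  have hcz : ∀ u' ∈ Φ.target, G.collar (Φ.symm u') = (Real.exp u'.1, ψ.symm u'.2) := by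
    intro u' hu'
    have ht' := mem_collarChart_target.1 hu'
    have hm : (Real.exp u'.1, ψ.symm u'.2) ∈ G.collar.target := by
      rw [G.collar_target]; exact ⟨⟨Real.exp_pos _, ht'.1⟩, Set.mem_univ _⟩
    exact G.collar.right_inv hm
  have hdx : ∀ v : Model d, scalarDiff G.x z (mfderiv 𝓘(ℝ, Model d) 𝓘(ℝ, Model d) Φ.symm u v) =
      Real.exp u.1 * v.1 := by
    intro v
    have e1 := mfderiv_comp u (G.x_smooth.contMDiffAt.mdifferentiableAt (by simp)) hsd
    have e2 : (G.x ∘ Φ.symm) =ᶠ[nhds u] fun u' : Model d => Real.exp u'.1 := by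
      filter_upwards [Φ.open_target.mem_nhds hu] with u' hu'
      exact x_collarChart_symm hu'
    have e3 := e2.mfderiv_eq (I := 𝓘(ℝ, Model d)) (I' := 𝓘(ℝ, ℝ))
    have e4 : HasFDerivAt (fun u' : Model d => Real.exp u'.1)
        (Real.exp u.1 • ContinuousLinearMap.fst ℝ ℝ (EuclideanSpace ℝ (Fin d))) u :=
      (hasFDerivAt_fst (𝕜 := ℝ)).exp
    have e5 := (e1.symm.trans e3).trans (mfderiv_eq_fderiv.trans e4.fderiv)
    exact congrArg (fun A : Model d →L[ℝ] ℝ => A v) e5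
  have hdy : ∀ v : Model d,
      (mfderiv 𝓘(ℝ, Model d) 𝓘(ℝ, EuclideanSpace ℝ (Fin d)) (fun z' => (G.collar z').2) z
        (mfderiv 𝓘(ℝ, Model d) 𝓘(ℝ, Model d) Φ.symm u v) : EuclideanSpace ℝ (Fin d)) =
      (mfderiv 𝓘(ℝ, EuclideanSpace ℝ (Fin d)) 𝓘(ℝ, EuclideanSpace ℝ (Fin d)) ψ.symm u.2 v.2 :
        EuclideanSpace ℝ (Fin d)) := by
    intro v
    have d1 : MDifferentiableAt 𝓘(ℝ, Model d) 𝓘(ℝ, EuclideanSpace ℝ (Fin d))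
        (fun z' => (G.collar z').2) z :=
      ((contMDiff_snd (I := 𝓘(ℝ, ℝ)) (J := 𝓘(ℝ, EuclideanSpace ℝ (Fin d))) (n := ∞)).contMDiffAt.comp z
        ((G.collar_smooth z hzc).contMDiffAt (G.collar.open_source.mem_nhds hzc))).mdifferentiableAt
        (by simp)
    have e1 := mfderiv_comp u d1 hsd
    have e2 : ((fun z' => (G.collar z').2) ∘ Φ.symm) =ᶠ[nhds u] ψ.symm ∘ (Prod.snd : Model d → _) := by
      filter_upwards [Φ.open_target.mem_nhds hu] with u' hu'
      exact congrArg Prod.snd (hcz u' hu')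
    have e3 := e2.mfderiv_eq (I := 𝓘(ℝ, Model d)) (I' := 𝓘(ℝ, EuclideanSpace ℝ (Fin d)))
    have d2 : MDifferentiableAt 𝓘(ℝ, EuclideanSpace ℝ (Fin d)) 𝓘(ℝ, EuclideanSpace ℝ (Fin d))
        ψ.symm u.2 := (contMDiffAt_symm_of_mem_maximalAtlas hψ ht.2).mdifferentiableAt (by simp)
    have d3 : HasFDerivAt (Prod.snd : Model d → EuclideanSpace ℝ (Fin d))
        (ContinuousLinearMap.snd ℝ ℝ (EuclideanSpace ℝ (Fin d))) u := hasFDerivAt_snd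
    have e4 := mfderiv_comp u d2 (mdifferentiableAt_iff_differentiableAt.2 d3.differentiableAt)
    rw [mfderiv_eq_fderiv (f := (Prod.snd : Model d → EuclideanSpace ℝ (Fin d))), d3.fderiv] at e4
    have e5 := (e1.symm.trans e3).trans e4
    exact congrArg (fun A : Model d →L[ℝ] EuclideanSpace ℝ (Fin d) => A v) e5
  have hm := G.metric_eq z hzc (mfderiv 𝓘(ℝ, Model d) 𝓘(ℝ, Model d) Φ.symm u v)
    (mfderiv 𝓘(ℝ, Model d) 𝓘(ℝ, Model d) Φ.symm u w)
  set Q : ℝ → S → EuclideanSpace ℝ (Fin d) → EuclideanSpace ℝ (Fin d) → ℝ :=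
    fun t y v w => G.h t y v w with hQ
  have hy : (G.collar z).2 = ψ.symm u.2 := congrArg Prod.snd (hcz u hu)
  have hQe : Q (G.x z) (G.collar z).2
      (mfderiv 𝓘(ℝ, Model d) 𝓘(ℝ, EuclideanSpace ℝ (Fin d)) (fun z' => (G.collar z').2) z
        (mfderiv 𝓘(ℝ, Model d) 𝓘(ℝ, Model d) Φ.symm u v) : EuclideanSpace ℝ (Fin d))
      (mfderiv 𝓘(ℝ, Model d) 𝓘(ℝ, EuclideanSpace ℝ (Fin d)) (fun z' => (G.collar z').2) z
        (mfderiv 𝓘(ℝ, Model d) 𝓘(ℝ, Model d) Φ.symm u w) : EuclideanSpace ℝ (Fin d)) =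
      Q (Real.exp u.1) (ψ.symm u.2)
      (mfderiv 𝓘(ℝ, EuclideanSpace ℝ (Fin d)) 𝓘(ℝ, EuclideanSpace ℝ (Fin d)) ψ.symm u.2 v.2 :
        EuclideanSpace ℝ (Fin d))
      (mfderiv 𝓘(ℝ, EuclideanSpace ℝ (Fin d)) 𝓘(ℝ, EuclideanSpace ℝ (Fin d)) ψ.symm u.2 w.2 :
        EuclideanSpace ℝ (Fin d)) :=
    (congrArg₂ (Q (G.x z) (G.collar z).2) (hdy v) (hdy w)).trans
      (congrFun (congrFun (congrArg₂ Q hxz hy) _) _)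
  rw [hdx, hdx] at hm
  refine hm.trans ?_
  have hpos := Real.exp_pos u.1
  change _ + Q _ _ _ _ / _ = (_ + Q _ _ _ _) / _
  rw [hQe, hxz]
  field_simp

variable {G} {φ : OpenPartialHomeomorph X (Model d)} {P : Set X}

theorem modelBasis_snd (i : Fin (d + 1)) :
    (modelBasis d i).2 = 0 ∨ ∃ j, (modelBasis d i).2 = EuclideanSpace.single j 1 := by
  induction i using Fin.cases with
  | zero => left; simp [modelBasis]
  | succ j => right; exact ⟨j, by simp [modelBasis]⟩

theorem abs_modelBasis_fst_le (i : Fin (d + 1)) : |(modelBasis d i).1| ≤ 1 := by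
  induction i using Fin.cases with
  | zero => simp [modelBasis]
  | succ j => simp [modelBasis]

theorem IsPiece.exists_chartForm_le (h : G.IsPiece φ P) :
    ∃ C : ℝ, 0 ≤ C ∧ ∀ u ∈ φ '' P, ∀ i j,
      |G.chartForm φ u (modelBasis d i) (modelBasis d j)| ≤ C * (G.x (φ.symm u) ^ 2)⁻¹ := by
  cases h with
  | interior _ _ hφ hP hPφ =>
    have himg : IsCompact (φ '' P) := hP.image_of_continuousOn (φ.continuousOn.mono hPφ)
    have hsub : φ '' P ⊆ φ.target := by
      rintro _ ⟨z, hz, rfl⟩; exact φ.map_source (hPφ hz)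
    have : ∀ i j, ∃ C : ℝ, ∀ u ∈ φ '' P,
        |G.chartForm φ u (modelBasis d i) (modelBasis d j)| ≤ C := fun i j =>
      himg.exists_bound_of_continuousOn ((continuousOn_chartForm G hφ _ _).mono hsub)
    choose C hC using this
    obtain ⟨X₀, hX₀⟩ := hP.exists_bound_of_continuousOn G.x_smooth.continuous.continuousOn
    refine ⟨(∑ i, ∑ j, |C i j|) * X₀ ^ 2, by positivity, fun u hu i j => ?_⟩
    have h1 : |C i j| ≤ ∑ i, ∑ j, |C i j| :=
      (Finset.single_le_sum (f := fun j => |C i j|) (fun _ _ => abs_nonneg _)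
        (Finset.mem_univ j)).trans
      (Finset.single_le_sum (f := fun i => ∑ j, |C i j|)
        (fun _ _ => Finset.sum_nonneg fun _ _ => abs_nonneg _) (Finset.mem_univ i))
    have h2 : G.x (φ.symm u) ≤ X₀ := by
      obtain ⟨z, hz, rfl⟩ := hu
      rw [φ.left_inv (hPφ hz)]
      exact (le_abs_self _).trans (hX₀ z hz)
    have h3 := G.x_pos (φ.symm u)
    calc _ ≤ C i j := hC i j u hu
      _ ≤ (∑ i, ∑ j, |C i j|) * 1 := by rw [mul_one]; exact (le_abs_self _).trans h1
      _ ≤ (∑ i, ∑ j, |C i j|) * (X₀ ^ 2 * (G.x (φ.symm u) ^ 2)⁻¹) := by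
          gcongr
          rw [← div_eq_mul_inv, one_le_div (by positivity)]
          gcongr
      _ = _ := by ring
  | collar ψ L r hψ hL hLψ hr =>
    -- The interval includes x = 0, where h is still continuous; this makes the bound uniform up to
    -- infinity in X.
    have himg : IsCompact (Set.Icc 0 r ×ˢ (ψ '' L)) :=
      isCompact_Icc.prod (hL.image_of_continuousOn (ψ.continuousOn.mono hLψ))
    have hsub : Set.Icc 0 r ×ˢ (ψ '' L) ⊆ Set.Ico 0 G.ε ×ˢ ψ.target := by
      rintro ⟨t, _⟩ ⟨⟨h0, h1⟩, y, hy, rfl⟩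
      exact ⟨⟨h0, h1.trans_lt hr.2⟩, ψ.map_source (hLψ hy)⟩
    choose C hC using fun i j =>
      himg.exists_bound_of_continuousOn ((G.h_smooth ψ hψ i j).continuousOn.mono hsub)
    refine ⟨1 + ∑ i, ∑ j, |C i j|, by positivity, fun u hu i j => ?_⟩
    have hut : u ∈ (G.collarChart ψ).target := by
      obtain ⟨z, hz, rfl⟩ := hu
      exact (G.collarChart ψ).map_source (collarSet_subset hLψ hz)
    have hu' := (mem_image_collarSet hr hLψ).1 hu
    have hq : (Real.exp u.1, u.2) ∈ Set.Icc 0 r ×ˢ (ψ '' L) :=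
      ⟨⟨(Real.exp_pos _).le, (Real.le_log_iff_exp_le hr.1).1 hu'.1⟩, hu'.2⟩
    rw [chartForm_collarChart G hψ hut, x_collarChart_symm hut, abs_div, abs_of_nonneg
      (sq_nonneg (Real.exp u.1)), div_eq_mul_inv]
    gcongr
    refine (abs_add_le _ _).trans (add_le_add ?_ ?_)
    · rw [abs_mul]
      exact mul_le_one₀ (abs_modelBasis_fst_le i) (abs_nonneg _) (abs_modelBasis_fst_le j)
    · have hsum : 0 ≤ ∑ i, ∑ j, |C i j| := by positivity
      rcases modelBasis_snd i with h0 | ⟨i', hi⟩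
      · rw [h0]
        erw [map_zero, map_zero]
        simpa using hsum
      rcases modelBasis_snd j with h0 | ⟨j', hj⟩
      · rw [h0]
        erw [map_zero, map_zero]
        simpa using hsum
      rw [hi, hj]
      refine (hC i' j' _ hq).trans ((le_abs_self _).trans ?_)
      exact (Finset.single_le_sum (f := fun j => |C i' j|) (fun _ _ => abs_nonneg _)
          (Finset.mem_univ j')).trans
        (Finset.single_le_sum (f := fun i => ∑ j, |C i j|)
          (fun _ _ => Finset.sum_nonneg fun _ _ => abs_nonneg _) (Finset.mem_univ i'))

/-- The determinant of an n × n matrix with entries O(x⁻²) is O(x^(-2n)), and the density is its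
square root. -/
theorem IsPiece.exists_chartDensity_le (h : G.IsPiece φ P) :
    ∃ C : ℝ, 0 ≤ C ∧ ∀ u ∈ φ '' P,
      G.chartDensity φ u ≤ C * G.x (φ.symm u) ^ (-((d : ℝ) + 1)) := by
  obtain ⟨C, hC0, hC⟩ := h.exists_chartForm_le
  refine ⟨Real.sqrt ((d + 1).factorial * C ^ (d + 1)), by positivity, fun u hu => ?_⟩
  have hx := G.x_pos (φ.symm u)
  rw [chartDensity_eq]
  have h1 := Matrix.det_le (abv := IsAbsoluteValue.toAbsoluteValue (abs : ℝ → ℝ))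
    (A := LinearMap.BilinForm.toMatrix (modelBasis' d) (G.chartForm φ u))
    (x := C * (G.x (φ.symm u) ^ 2)⁻¹) (fun i j => by
      rw [LinearMap.BilinForm.toMatrix_apply, modelBasis'_apply, modelBasis'_apply]
      exact hC u hu i j)
  rw [Fintype.card_fin, nsmul_eq_mul] at h1
  have h2 : G.x (φ.symm u) ^ (-((d : ℝ) + 1)) = (G.x (φ.symm u) ^ (d + 1))⁻¹ := by
    rw [Real.rpow_neg hx.le, ← Nat.cast_add_one, Real.rpow_natCast]
  calc Real.sqrt _ ≤ Real.sqrt ((d + 1).factorial * (C * (G.x (φ.symm u) ^ 2)⁻¹) ^ (d + 1)) :=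
        Real.sqrt_le_sqrt ((le_abs_self _).trans h1)
    _ = Real.sqrt ((d + 1).factorial * C ^ (d + 1) * ((G.x (φ.symm u) ^ (d + 1))⁻¹) ^ 2) := by
        congr 1
        rw [mul_pow, inv_pow, inv_pow, ← pow_mul, ← pow_mul, mul_comm 2, mul_assoc]
    _ = _ := by
        rw [Real.sqrt_mul (by positivity), Real.sqrt_sq (by positivity), h2]

theorem continuousOn_chartDensity (hφ : φ ∈ maximalAtlas 𝓘(ℝ, Model d) ∞ X) :
    ContinuousOn (G.chartDensity φ) φ.target := by
  have h1 : ContinuousOn (fun u => (LinearMap.BilinForm.toMatrix (modelBasis' d)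
      (G.chartForm φ u))) φ.target := by
    refine continuousOn_pi.2 fun i => continuousOn_pi.2 fun j => ?_
    simp only [LinearMap.BilinForm.toMatrix_apply]
    exact continuousOn_chartForm G hφ _ _
  have h2 : ContinuousOn (fun u => Real.sqrt (LinearMap.BilinForm.toMatrix (modelBasis' d)
      (G.chartForm φ u)).det) φ.target :=
    (Real.continuous_sqrt.comp continuous_id.matrix_det).comp_continuousOn h1
  exact h2.congr fun u _ => chartDensity_eq G φ u

section

variable [MeasurableSpace X] [BorelSpace X]

/-- Integrals over a piece, in its chart. -/
theorem IsPiece.exists_lintegral_le (h : G.IsPiece φ P) (hP : MeasurableSet P) :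
    ∃ C : NNReal, ∀ f : X → ENNReal, ∫⁻ z in P, f z ∂G.vol ≤
      C * ∫⁻ u in φ '' P, f (φ.symm u) *
        ENNReal.ofReal (G.x (φ.symm u) ^ (-((d : ℝ) + 1))) := by
  obtain ⟨C, hC0, hC⟩ := h.exists_chartDensity_le
  have hφ := h.mem_maximalAtlas
  refine ⟨C.toNNReal, fun f₀ => ?_⟩
  -- An arbitrary f₀ is replaced by a measurable minorant with the same integral, so that no
  -- measurability of kernels has to be carried through the estimates.
  obtain ⟨f, hf, hff, hfe⟩ := exists_measurable_le_lintegral_eq (μ := G.vol.restrict P) f₀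
  suffices hs : ∫⁻ z in P, f z ∂G.vol ≤ C.toNNReal * ∫⁻ u in φ '' P, f (φ.symm u) *
      ENNReal.ofReal (G.x (φ.symm u) ^ (-((d : ℝ) + 1))) by
    rw [hfe]
    refine hs.trans ?_
    gcongr
    exact hff _
  have himg : φ '' P = φ.target ∩ φ.symm ⁻¹' P := by
    rw [φ.image_eq_target_inter_inv_preimage h.subset_source]
  have hPm : MeasurableSet (φ '' P) := himg ▸ measurableSet_target_inter φ hP
  have h1 : G.vol.restrict P ≤ (G.chartVolume φ).restrict P := by
    rw [← Set.inter_eq_left.2 h.subset_source, ← Measure.restrict_restrict hP,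
      Set.inter_eq_left.2 h.subset_source]
    exact Measure.restrict_mono subset_rfl (vol_restrict_le G hφ)
  have hae := aemeasurable_symm φ
  have hd : AEMeasurable (fun u => ENNReal.ofReal (G.chartDensity φ u))
      (volume.restrict φ.target) :=
    ENNReal.measurable_ofReal.comp_aemeasurable
      ((continuousOn_chartDensity hφ).aemeasurable φ.open_target.measurableSet)
  have hind : Measurable (P.indicator f) := hf.indicator hP
  calc ∫⁻ z in P, f z ∂G.vol ≤ ∫⁻ z in P, f z ∂G.chartVolume φ := lintegral_mono' h1 le_rfl
    _ = ∫⁻ z, P.indicator f z ∂G.chartVolume φ := (lintegral_indicator hP f).symm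
    _ = ∫⁻ u in φ.target, ENNReal.ofReal (G.chartDensity φ u) * P.indicator f (φ.symm u) := by
        rw [chartVolume, lintegral_map' hind.aemeasurable
          (hae.mono_ac (withDensity_absolutelyContinuous _ _))]
        exact lintegral_withDensity_eq_lintegral_mul₀ hd (hind.comp_aemeasurable hae)
    _ = ∫⁻ u in φ.target, (φ '' P).indicator
          (fun u => ENNReal.ofReal (G.chartDensity φ u) * f (φ.symm u)) u := by
        refine setLIntegral_congr_fun φ.open_target.measurableSet fun u hu => ?_
        by_cases hP' : φ.symm u ∈ P
        · rw [Set.indicator_of_mem hP', Set.indicator_of_mem (himg ▸ ⟨hu, hP'⟩)]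
        · rw [Set.indicator_of_notMem hP', Set.indicator_of_notMem, mul_zero]
          rw [himg]; exact fun h => hP' h.2
    _ = ∫⁻ u in φ '' P, ENNReal.ofReal (G.chartDensity φ u) * f (φ.symm u) := by
        rw [lintegral_indicator hPm, Measure.restrict_restrict hPm, Set.inter_eq_left.2]
        rw [himg]; exact Set.inter_subset_left
    _ ≤ ∫⁻ u in φ '' P, (C.toNNReal : ENNReal) * (f (φ.symm u) *
          ENNReal.ofReal (G.x (φ.symm u) ^ (-((d : ℝ) + 1)))) := by
        refine setLIntegral_mono' hPm fun u hu => ?_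
        rw [mul_left_comm, mul_comm]
        gcongr
        refine (ENNReal.ofReal_le_ofReal (hC u hu)).trans (le_of_eq ?_)
        rw [ENNReal.ofReal_mul hC0]
        rfl
    _ = _ := lintegral_const_mul' _ _ ENNReal.coe_ne_top

/-- Points being null, the values of a kernel on the diagonal do not affect the operator. -/
theorem vol_singleton (z : X) [T2Space X] : G.vol {z} = 0 := by
  have hp : G.IsPiece (chartAt (Model d) z) {z} :=
    .interior _ _ (chart_mem_maximalAtlas z) isCompact_singleton
      (Set.singleton_subset_iff.2 (mem_chart_source _ z))
  obtain ⟨C, hC⟩ := hp.exists_lintegral_le (measurableSet_singleton z)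
  have := hC (fun _ => 1)
  rw [lintegral_const, one_mul, Measure.restrict_apply_univ, Set.image_singleton,
    Measure.restrict_singleton, measure_singleton (chartAt (Model d) z z), zero_smul,
    lintegral_zero_measure, mul_zero] at this
  exact le_antisymm this bot_le

variable [T2Space X] [CompactSpace S]

theorem sigmaCompactSpace (G : AsymptoticallyConic d X S) : SigmaCompactSpace X := by
  have hε := G.ε_pos
  refine SigmaCompactSpace.of_countable
    (Set.range fun m : ℕ => {z | z ∈ G.collar.source → G.ε / (m + 2) ≤ G.x z})
    (Set.countable_range _) ?_ ?_
  · rintro _ ⟨m, rfl⟩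
    refine G.isCompact_core _ ⟨by positivity, ?_⟩
    rw [div_lt_iff₀ (by positivity)]
    nlinarith [(Nat.cast_nonneg m : (0 : ℝ) ≤ m)]
  · refine Set.eq_univ_of_forall fun z => ?_
    obtain ⟨m, hm⟩ := exists_nat_gt (G.ε / G.x z)
    refine Set.mem_sUnion.2 ⟨_, ⟨m, rfl⟩, fun _ => ?_⟩
    rw [div_lt_iff₀ (G.x_pos z)] at hm
    rw [div_le_iff₀ (by positivity)]
    nlinarith [G.x_pos z]

theorem secondCountableTopology (G : AsymptoticallyConic d X S) : SecondCountableTopology X :=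
  haveI := sigmaCompactSpace G
  ChartedSpace.secondCountable_of_sigmaCompact (Model d) X

theorem isLocallyFiniteMeasure_vol (G : AsymptoticallyConic d X S) :
    IsLocallyFiniteMeasure G.vol := by
  have := ChartedSpace.locallyCompactSpace (Model d) X
  refine ⟨fun z => ?_⟩
  obtain ⟨K, hK, hKz, hKc⟩ := exists_mem_nhds_isCompact_mapsTo (f := id) continuous_id
    ((chartAt (Model d) z).open_source.mem_nhds (mem_chart_source _ z))
  refine ⟨K, hK, ?_⟩
  have hp : G.IsPiece (chartAt (Model d) z) K := .interior _ _ (chart_mem_maximalAtlas z) hKz hKc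
  obtain ⟨C, hC⟩ := hp.exists_lintegral_le hKz.measurableSet
  have := hC (fun _ => 1)
  simp only [lintegral_const, one_mul, Measure.restrict_apply_univ] at this
  refine this.trans_lt (ENNReal.mul_lt_top ENNReal.coe_lt_top ?_)
  have himg : IsCompact (chartAt (Model d) z '' K) :=
    hKz.image_of_continuousOn ((chartAt (Model d) z).continuousOn.mono hKc)
  have hsub : chartAt (Model d) z '' K ⊆ (chartAt (Model d) z).target := by
    rintro _ ⟨z', hz', rfl⟩; exact (chartAt (Model d) z).map_source (hKc hz')
  have hcont : ContinuousOn (fun u => G.x ((chartAt (Model d) z).symm u) ^ (-((d : ℝ) + 1)))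
      (chartAt (Model d) z '' K) :=
    (G.x_smooth.continuous.comp_continuousOn
      ((chartAt (Model d) z).continuousOn_symm.mono hsub)).rpow_const
      fun u _ => .inl (G.x_pos _).ne'
  exact (hcont.integrableOn_compact himg).lintegral_lt_top

theorem sigmaFinite_vol (G : AsymptoticallyConic d X S) : SigmaFinite G.vol :=
  haveI := secondCountableTopology G
  haveI := isLocallyFiniteMeasure_vol G
  inferInstance

theorem measurableSet_collarSet [T2Space S] {r : ℝ} {L : Set S} (hL : IsCompact L) :
    MeasurableSet (G.collarSet r L) := by
  have h1 : MeasurableSet (G.collar.source ∩ G.collar ⁻¹' (Set.univ ×ˢ Lᶜ)) :=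
    (G.collar.continuousOn.isOpen_inter_preimage G.collar.open_source
      (isOpen_univ.prod hL.isClosed.isOpen_compl)).measurableSet
  have h2 : MeasurableSet {z | G.x z ≤ r} :=
    (isClosed_le G.x_smooth.continuous continuous_const).measurableSet
  have : G.collarSet r L =
      (G.collar.source \ (G.collar.source ∩ G.collar ⁻¹' (Set.univ ×ˢ Lᶜ))) ∩ {z | G.x z ≤ r} := by
    ext z
    simp [collarSet]
    tauto
  rw [this]
  exact (G.collar.open_source.measurableSet.diff h1).inter h2

theorem IsPiece.measurableSet [T2Space S] (h : G.IsPiece φ P) : MeasurableSet P := by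
  cases h with
  | interior _ _ _ hP _ => exact hP.measurableSet
  | collar ψ L r _ hL _ _ => exact measurableSet_collarSet hL

end

end AsymptoticallyConic
end LowEnergy
end

/-! ### Schur bounds for the two model sizes. -/

noncomputable section
namespace LowEnergy

open MeasureTheory

/-! ## Integrals on the model space -/

theorem lintegral_scale {d : ℕ} {Φ : ℝ → ℝ} (hΦ : Measurable Φ) {c : ℝ} (hc : 0 < c)
    (u₀ : Model d) : ∫⁻ u : Model d, ENNReal.ofReal (c ^ (d + 1) * Φ (c * ‖u - u₀‖)) =
      ∫⁻ W : Model d, ENNReal.ofReal (Φ ‖W‖) := by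
  have h1 : ∫⁻ u : Model d, ENNReal.ofReal (c ^ (d + 1) * Φ (c * ‖u - u₀‖)) =
      ∫⁻ u : Model d, ENNReal.ofReal (c ^ (d + 1) * Φ (c * ‖u‖)) :=
    lintegral_sub_right_eq_self (μ := (volume : Measure (Model d)))
      (fun u : Model d => ENNReal.ofReal (c ^ (d + 1) * Φ (c * ‖u‖))) u₀
  have hm : Measurable fun W : Model d => ENNReal.ofReal (Φ ‖W‖) :=
    ENNReal.measurable_ofReal.comp (hΦ.comp measurable_norm)
  have h2 : ∫⁻ W : Model d, ENNReal.ofReal (Φ ‖W‖) ∂(Measure.map (c • ·) volume) =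
      ∫⁻ W : Model d, ENNReal.ofReal (Φ ‖c • W‖) := lintegral_map hm (measurable_const_smul c)
  rw [Measure.map_addHaar_smul _ hc.ne', lintegral_smul_measure, finrank_model,
    abs_of_nonneg (by positivity)] at h2
  have h3 : ∀ u : Model d, ENNReal.ofReal (c ^ (d + 1) * Φ (c * ‖u‖)) =
      ENNReal.ofReal (c ^ (d + 1)) * ENNReal.ofReal (Φ ‖c • u‖) := by
    intro u
    rw [ENNReal.ofReal_mul (by positivity), norm_smul, Real.norm_of_nonneg hc.le]
  rw [h1]
  simp only [h3]
  rw [lintegral_const_mul' _ _ ENNReal.ofReal_ne_top, ← h2, smul_eq_mul, ← mul_assoc,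
    ← ENNReal.ofReal_mul (by positivity), mul_inv_cancel₀ (by positivity), ENNReal.ofReal_one,
    one_mul]

theorem exp_neg_mul_le {η y : ℝ} (hη : 0 < η) (hy : 0 ≤ y) :
    Real.exp (-η * y) ≤ (1 + 2 / η) ^ 2 * (1 + y) ^ (-2 : ℝ) := by
  have h1 : 1 + y ≤ (1 + 2 / η) * Real.exp (η * y / 2) := by
    have h2 := Real.add_one_le_exp (η * y / 2)
    calc 1 + y ≤ (1 + 2 / η) * (η * y / 2 + 1) := by
          have : 2 / η * (η * y / 2) = y := by field_simp
          have h3 : 0 ≤ η * y / 2 := by positivity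
          have h4 : 0 ≤ 2 / η := by positivity
          nlinarith
      _ ≤ _ := by gcongr
  have h2 : (1 + y) ^ 2 ≤ (1 + 2 / η) ^ 2 * Real.exp (η * y) := by
    calc (1 + y) ^ 2 ≤ ((1 + 2 / η) * Real.exp (η * y / 2)) ^ 2 := by gcongr
      _ = _ := by rw [mul_pow, ← Real.exp_nat_mul]; congr 2; push_cast; ring
  rw [neg_mul, Real.exp_neg, Real.rpow_neg (by positivity), show (2 : ℝ) = (2 : ℕ) by norm_num,
    Real.rpow_natCast, ← div_eq_mul_inv, inv_eq_one_div, div_le_div_iff₀ (Real.exp_pos _)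
    (by positivity), one_mul]
  push_cast
  exact h2

theorem exists_lintegral_exp_le {η : ℝ} (hη : 0 < η) :
    ∃ C : NNReal, ∀ s : ℝ, ∫⁻ t : ℝ, ENNReal.ofReal (Real.exp (-η * |s - t|)) ≤ C := by
  have h1 : Integrable fun t : ℝ => (1 + 2 / η) ^ 2 * (1 + ‖t‖) ^ (-2 : ℝ) :=
    (integrable_one_add_norm (by norm_num)).const_mul _
  have h2 := h1.lintegral_lt_top
  refine ⟨(∫⁻ t : ℝ, ENNReal.ofReal ((1 + 2 / η) ^ 2 * (1 + ‖t‖) ^ (-2 : ℝ))).toNNReal,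
    fun s => ?_⟩
  rw [ENNReal.coe_toNNReal h2.ne,
    ← lintegral_sub_left_eq_self (fun t : ℝ =>
      ENNReal.ofReal ((1 + 2 / η) ^ 2 * (1 + ‖t‖) ^ (-2 : ℝ))) s]
  refine lintegral_mono fun t => ENNReal.ofReal_le_ofReal ?_
  exact exp_neg_mul_le hη (abs_nonneg _)

/-- One of the two ratios is at most exp(-|log x - log x'|), and the other at most 1. -/
theorem rpow_ratio_le {x x' a b : ℝ} (hx : 0 < x) (hx' : 0 < x') (ha : 0 < a) (hb : 0 < b) :
    (x / (x + x')) ^ a * (x' / (x + x')) ^ b ≤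
      Real.exp (-(min a b) * |Real.log x - Real.log x'|) := by
  have hη : 0 < min a b := lt_min ha hb
  set r := x / (x + x') with hr
  set r' := x' / (x + x') with hr'
  have r0 : 0 < r := by positivity
  have r0' : 0 < r' := by positivity
  have r1 : r ≤ 1 := by rw [hr, div_le_one (by positivity)]; linarith
  have r1' : r' ≤ 1 := by rw [hr', div_le_one (by positivity)]; linarith
  have hmin : r * r' ≤ Real.exp (-|Real.log x - Real.log x'|) := by
    rw [← Real.log_div hx.ne' hx'.ne']
    rcases abs_cases (Real.log (x / x')) with ⟨h, -⟩ | ⟨h, -⟩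
    · rw [h, Real.exp_neg, Real.exp_log (by positivity), inv_div]
      calc r * r' ≤ 1 * r' := by gcongr
        _ ≤ x' / x := by rw [one_mul, hr']; gcongr; linarith
    · rw [h, neg_neg, Real.exp_log (by positivity)]
      calc r * r' ≤ r * 1 := by gcongr
        _ ≤ x / x' := by rw [mul_one, hr]; gcongr; linarith
  calc r ^ a * r' ^ b ≤ r ^ min a b * r' ^ min a b := by
        refine mul_le_mul (Real.rpow_le_rpow_of_exponent_ge r0 r1 (min_le_left _ _))
          (Real.rpow_le_rpow_of_exponent_ge r0' r1' (min_le_right _ _)) (by positivity)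
          (by positivity)
    _ = (r * r') ^ min a b := (Real.mul_rpow r0.le r0'.le).symm
    _ ≤ Real.exp (-|Real.log x - Real.log x'|) ^ min a b :=
        Real.rpow_le_rpow (by positivity) hmin hη.le
    _ = _ := by rw [← Real.exp_mul]; ring_nf

namespace AsymptoticallyConic

variable {d : ℕ} {X S : Type*}
  [TopologicalSpace X] [ChartedSpace (Model d) X] [IsManifold 𝓘(ℝ, Model d) ∞ X]
  [TopologicalSpace S] [ChartedSpace (EuclideanSpace ℝ (Fin d)) S]
  [IsManifold 𝓘(ℝ, EuclideanSpace ℝ (Fin d)) ∞ S]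
  {G : AsymptoticallyConic d X S} {φ φ' : OpenPartialHomeomorph X (Model d)} {P P' : Set X}
  [MeasurableSpace X] [BorelSpace X]

/-- The measure `x ^ n dg` on a piece, in its chart. -/
theorem IsPiece.exists_lintegral_mul_le (h : G.IsPiece φ P) (hP : MeasurableSet P) :
    ∃ C : NNReal, ∀ f : X → ENNReal,
      ∫⁻ z in P, f z * ENNReal.ofReal (G.x z ^ ((d : ℝ) + 1)) ∂G.vol ≤
        C * ∫⁻ u in φ '' P, f (φ.symm u) := by
  obtain ⟨C, hC⟩ := h.exists_lintegral_le hP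
  refine ⟨C, fun f => (hC _).trans (le_of_eq ?_)⟩
  congr 1
  refine lintegral_congr fun u => ?_
  have hx := G.x_pos (φ.symm u)
  rw [mul_assoc, ← ENNReal.ofReal_mul (by positivity), ← Real.rpow_add hx, add_neg_cancel,
    Real.rpow_zero, ENNReal.ofReal_one, mul_one]

/-- In a collar chart x^n dg is at most a multiple of d(log x) dy with y in a compact set, so the
bound comes from a translation-invariant integral over the line and does not depend on t. -/
theorem IsPiece.exists_lintegral_exp_le (h : G.IsPiece φ P) (hP : MeasurableSet P) {η : ℝ}
    (hη : 0 < η) : ∃ C : NNReal, ∀ t : ℝ,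
      ∫⁻ z in P, ENNReal.ofReal (Real.exp (-η * |t - Real.log (G.x z)|)) *
        ENNReal.ofReal (G.x z ^ ((d : ℝ) + 1)) ∂G.vol ≤ C := by
  obtain ⟨C, hC⟩ := h.exists_lintegral_mul_le hP
  suffices hs : ∃ C' : NNReal, ∀ t : ℝ, ∫⁻ u in φ '' P,
      ENNReal.ofReal (Real.exp (-η * |t - Real.log (G.x (φ.symm u))|)) ≤ C' by
    obtain ⟨C', hC'⟩ := hs
    refine ⟨C * C', fun t => (hC _).trans ?_⟩
    push_cast
    gcongr
    exact hC' t
  cases h with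
  | interior _ _ hφ hPc hPφ =>
    have himg : IsCompact (φ '' P) := hPc.image_of_continuousOn (φ.continuousOn.mono hPφ)
    refine ⟨(volume (φ '' P)).toNNReal, fun t => ?_⟩
    rw [ENNReal.coe_toNNReal himg.measure_lt_top.ne, ← setLIntegral_one]
    refine lintegral_mono fun u => ?_
    rw [← ENNReal.ofReal_one]
    refine ENNReal.ofReal_le_ofReal (Real.exp_le_one_iff.2 ?_)
    nlinarith [abs_nonneg (t - Real.log (G.x (φ.symm u)))]
  | collar ψ L r hψ hL hLψ hr =>
    have himg : IsCompact (ψ '' L) := hL.image_of_continuousOn (ψ.continuousOn.mono hLψ)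
    obtain ⟨C', hC'⟩ := LowEnergy.exists_lintegral_exp_le hη
    refine ⟨C' * (volume (ψ '' L)).toNNReal, fun t => ?_⟩
    have hPm : MeasurableSet (G.collarChart ψ '' G.collarSet r L) := by
      rw [(G.collarChart ψ).image_eq_target_inter_inv_preimage (collarSet_subset hLψ)]
      exact measurableSet_target_inter _ hP
    calc ∫⁻ u in G.collarChart ψ '' G.collarSet r L,
          ENNReal.ofReal (Real.exp (-η * |t - Real.log (G.x ((G.collarChart ψ).symm u))|))
        = ∫⁻ u in G.collarChart ψ '' G.collarSet r L,
          ENNReal.ofReal (Real.exp (-η * |t - u.1|)) := by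
          refine setLIntegral_congr_fun hPm fun u hu => ?_
          have hut : u ∈ (G.collarChart ψ).target := by
            obtain ⟨z, hz, rfl⟩ := hu
            exact (G.collarChart ψ).map_source (collarSet_subset hLψ hz)
          rw [x_collarChart_symm hut, Real.log_exp]
      _ ≤ ∫⁻ u in Set.univ ×ˢ (ψ '' L), ENNReal.ofReal (Real.exp (-η * |t - u.1|)) := by
          refine lintegral_mono_set fun u hu => ⟨Set.mem_univ _, ?_⟩
          exact ((mem_image_collarSet hr hLψ).1 hu).2
      _ = (∫⁻ y : ℝ, ENNReal.ofReal (Real.exp (-η * |t - y|))) * volume (ψ '' L) := by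
          rw [Measure.volume_eq_prod, ← Measure.prod_restrict, Measure.restrict_univ]
          have hm : Measurable fun y : ℝ => ENNReal.ofReal (Real.exp (-η * |t - y|)) := by
            fun_prop
          have := lintegral_prod_mul (μ := (volume : Measure ℝ))
            (ν := (volume : Measure (EuclideanSpace ℝ (Fin d))).restrict (ψ '' L))
            hm.aemeasurable (g := fun _ => 1) aemeasurable_const
          simpa using this
      _ ≤ _ := by
          push_cast
          rw [ENNReal.coe_toNNReal himg.measure_lt_top.ne]
          gcongr
          exact hC' t

/-- Points of a piece at bounded distance have comparable `x`. -/
theorem IsPiece.exists_x_le (h : G.IsPiece φ P) (R : ℝ) :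
    ∃ B : ℝ, 1 ≤ B ∧ ∀ z ∈ P, ∀ z' ∈ P, ‖φ z' - φ z‖ ≤ R → G.x z ≤ B * G.x z' := by
  cases h with
  | interior _ _ hφ hP hPφ =>
    rcases P.eq_empty_or_nonempty with rfl | hne
    · exact ⟨1, le_rfl, by simp⟩
    obtain ⟨z₀, hz₀, hmin⟩ := hP.exists_isMinOn hne G.x_smooth.continuous.continuousOn
    obtain ⟨z₁, hz₁, hmax⟩ := hP.exists_isMaxOn hne G.x_smooth.continuous.continuousOn
    have h0 := G.x_pos z₀
    refine ⟨G.x z₁ / G.x z₀, ?_, fun z hz z' hz' _ => ?_⟩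
    · rw [one_le_div h0]; exact hmin hz₁
    · have h1 : G.x z₀ ≤ G.x z' := hmin hz'
      have h2 : G.x z ≤ G.x z₁ := hmax hz
      have h3 := G.x_pos z₁
      calc G.x z ≤ G.x z₁ / G.x z₀ * G.x z₀ := by rwa [div_mul_cancel₀ _ h0.ne']
        _ ≤ _ := by gcongr
  | collar ψ L r hψ hL hLψ hr =>
    refine ⟨Real.exp |R|, Real.one_le_exp (abs_nonneg R), fun z hz z' hz' hR => ?_⟩
    have h1 : |(G.collarChart ψ z' - G.collarChart ψ z).1| ≤ R := (norm_fst_le _).trans hR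
    rw [Prod.fst_sub, collarChart_fst hz.1, collarChart_fst hz'.1] at h1
    have h2 := neg_le_of_abs_le h1
    rw [← Real.exp_log (G.x_pos z), ← Real.exp_log (G.x_pos z'), ← Real.exp_add]
    apply Real.exp_le_exp.2
    linarith [le_abs_self R]

/-! ## Schur bounds -/

/-- Bounds for the integrals over rows and columns of a kernel, for each `k`. -/
def SchurBound (G : AsymptoticallyConic d X S) (k₀ s τ : ℝ) (P P' : Set X)
    (N : ℝ → X → X → ENNReal) : Prop :=
  ∃ C : NNReal, ∀ k ∈ Set.Ioo 0 k₀,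
    (∀ z ∈ P, ∫⁻ z' in P', N k z z' * ENNReal.ofReal ((G.x z / G.x z') ^ s) *
      ENNReal.ofReal (G.x z' ^ ((d : ℝ) + 1)) ∂G.vol ≤ C * ENNReal.ofReal (k ^ (τ - 1))) ∧
    (∀ z' ∈ P', ∫⁻ z in P, N k z z' * ENNReal.ofReal ((G.x z / G.x z') ^ s) *
      ENNReal.ofReal (G.x z ^ ((d : ℝ) + 1)) ∂G.vol ≤ C * ENNReal.ofReal (k ^ (τ - 1)))

variable {k₀ s τ : ℝ} {N : ℝ → X → X → ENNReal}

theorem SchurBound.mono {N' : ℝ → X → X → ENNReal} (h : G.SchurBound k₀ s τ P P' N)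
    (hP : MeasurableSet P) (hP' : MeasurableSet P')
    (hN : ∀ k ∈ Set.Ioo 0 k₀, ∀ z ∈ P, ∀ z' ∈ P', N' k z z' ≤ N k z z') :
    G.SchurBound k₀ s τ P P' N' := by
  obtain ⟨C, hC⟩ := h
  refine ⟨C, fun k hk => ⟨fun z hz => ((setLIntegral_mono' hP' fun z' hz' => ?_)).trans
    ((hC k hk).1 z hz), fun z' hz' => ((setLIntegral_mono' hP fun z hz => ?_)).trans
    ((hC k hk).2 z' hz')⟩⟩ <;>
  · gcongr
    exact hN k hk z hz z' hz'

theorem SchurBound.add {N' : ℝ → X → X → ENNReal} (h : G.SchurBound k₀ s τ P P' N)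
    (h' : G.SchurBound k₀ s τ P P' N') (hm : ∀ k ∈ Set.Ioo 0 k₀, ∀ z, Measurable (N k z))
    (hm' : ∀ k ∈ Set.Ioo 0 k₀, ∀ z', Measurable fun z => N k z z') :
    G.SchurBound k₀ s τ P P' (fun k z z' => N k z z' + N' k z z') := by
  obtain ⟨C, hC⟩ := h
  obtain ⟨C', hC'⟩ := h'
  have hx : Measurable G.x := G.x_smooth.continuous.measurable
  refine ⟨C + C', fun k hk => ⟨fun z hz => ?_, fun z' hz' => ?_⟩⟩
  · simp only [add_mul]
    rw [lintegral_add_left]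
    · push_cast
      rw [add_mul]
      exact add_le_add ((hC k hk).1 z hz) ((hC' k hk).1 z hz)
    · have := hm k hk z
      fun_prop
  · simp only [add_mul]
    rw [lintegral_add_left]
    · push_cast
      rw [add_mul]
      exact add_le_add ((hC k hk).2 z' hz') ((hC' k hk).2 z' hz')
    · have := hm' k hk z'
      fun_prop

theorem SchurBound.of_le {τ' : ℝ} (h : G.SchurBound k₀ s τ P P' N) (hk₀ : 0 < k₀) (hτ : τ' ≤ τ) :
    G.SchurBound k₀ s τ' P P' N := by
  obtain ⟨C, hC⟩ := h
  have key : ∀ k ∈ Set.Ioo 0 k₀, (C : ENNReal) * ENNReal.ofReal (k ^ (τ - 1)) ≤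
      (C * (k₀ ^ (τ - τ')).toNNReal : NNReal) * ENNReal.ofReal (k ^ (τ' - 1)) := by
    intro k hk
    push_cast
    rw [mul_assoc]
    gcongr
    change _ ≤ ENNReal.ofReal _ * _
    rw [← ENNReal.ofReal_mul (by positivity)]
    refine ENNReal.ofReal_le_ofReal ?_
    have hk0 := hk.1
    calc k ^ (τ - 1) = k ^ (τ - τ') * k ^ (τ' - 1) := by rw [← Real.rpow_add hk.1]; ring_nf
      _ ≤ _ := by
        exact mul_le_mul_of_nonneg_right (Real.rpow_le_rpow hk0.le hk.2.le (by linarith))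
          (by positivity)
  exact ⟨_, fun k hk => ⟨fun z hz => ((hC k hk).1 z hz).trans (key k hk),
    fun z' hz' => ((hC k hk).2 z' hz').trans (key k hk)⟩⟩

theorem SchurBound.subset {Q Q' : Set X} (h : G.SchurBound k₀ s τ P P' N) (hQ : Q ⊆ P)
    (hQ' : Q' ⊆ P') : G.SchurBound k₀ s τ Q Q' N := by
  obtain ⟨C, hC⟩ := h
  exact ⟨C, fun k hk => ⟨fun z hz => (lintegral_mono_set hQ').trans ((hC k hk).1 z (hQ hz)),
    fun z' hz' => (lintegral_mono_set hQ).trans ((hC k hk).2 z' (hQ' hz'))⟩⟩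

theorem SchurBound.union_left {Q : Set X} (h : G.SchurBound k₀ s τ P P' N)
    (h' : G.SchurBound k₀ s τ Q P' N) : G.SchurBound k₀ s τ (P ∪ Q) P' N := by
  obtain ⟨C, hC⟩ := h
  obtain ⟨C', hC'⟩ := h'
  refine ⟨C + C', fun k hk => ⟨?_, fun z' hz' => ?_⟩⟩
  · rintro z (hz | hz)
    · exact ((hC k hk).1 z hz).trans (mul_le_mul_left (by push_cast; exact le_self_add) _)
    · exact ((hC' k hk).1 z hz).trans (mul_le_mul_left (by push_cast; exact le_add_self) _)
  · push_cast
    rw [add_mul]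
    exact (lintegral_union_le _ _ _).trans (add_le_add ((hC k hk).2 z' hz') ((hC' k hk).2 z' hz'))

theorem SchurBound.union_right {Q : Set X} (h : G.SchurBound k₀ s τ P P' N)
    (h' : G.SchurBound k₀ s τ P Q N) : G.SchurBound k₀ s τ P (P' ∪ Q) N := by
  obtain ⟨C, hC⟩ := h
  obtain ⟨C', hC'⟩ := h'
  refine ⟨C + C', fun k hk => ⟨fun z hz => ?_, ?_⟩⟩
  · push_cast
    rw [add_mul]
    exact (lintegral_union_le _ _ _).trans (add_le_add ((hC k hk).1 z hz) ((hC' k hk).1 z hz))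
  · rintro z (hz | hz)
    · exact ((hC k hk).2 z hz).trans (mul_le_mul_left (by push_cast; exact le_self_add) _)
    · exact ((hC' k hk).2 z hz).trans (mul_le_mul_left (by push_cast; exact le_add_self) _)

theorem SchurBound.empty_left : G.SchurBound k₀ s τ ∅ P' N :=
  ⟨0, fun k _ => ⟨by simp, by simp⟩⟩

theorem SchurBound.empty_right : G.SchurBound k₀ s τ P ∅ N :=
  ⟨0, fun k _ => ⟨by simp, by simp⟩⟩

theorem SchurBound.of_support (h : G.SchurBound k₀ s τ P P' N) (hP : MeasurableSet P)
    (hP' : MeasurableSet P')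
    (hN : ∀ k ∈ Set.Ioo 0 k₀, ∀ z z', N k z z' ≠ 0 → z ∈ P ∧ z' ∈ P') :
    G.SchurBound k₀ s τ Set.univ Set.univ N := by
  have h0 : ∀ {Q Q' : Set X}, (∀ k ∈ Set.Ioo 0 k₀, ∀ z ∈ Q, ∀ z' ∈ Q', N k z z' = 0) →
      MeasurableSet Q → MeasurableSet Q' → G.SchurBound k₀ s τ Q Q' N := by
    refine fun hQ hm hm' => ⟨0, fun k hk => ⟨fun z hz => ?_, fun z' hz' => ?_⟩⟩
    · rw [setLIntegral_congr_fun (g := fun _ => 0) hm' fun z' hz' => by simp [hQ k hk z hz z' hz']]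
      simp
    · rw [setLIntegral_congr_fun (g := fun _ => 0) hm fun z hz => by simp [hQ k hk z hz z' hz']]
      simp
  have h1 : G.SchurBound k₀ s τ (P ∪ Pᶜ) (P' ∪ P'ᶜ) N := by
    refine SchurBound.union_left ?_ (h0 (fun k hk z hz z' _ => ?_) hP.compl ?_)
    · refine h.union_right (h0 (fun k hk z _ z' hz' => ?_) hP hP'.compl)
      by_contra hne
      exact hz' (hN k hk z z' hne).2
    · by_contra hne
      exact hz (hN k hk z z' hne).1
    · rw [Set.union_compl_self]; exact MeasurableSet.univ
  rwa [Set.union_compl_self, Set.union_compl_self] at h1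

/-- The weight (x/x')^s turns the exponents lam and mu into lam + s and mu - s. Both are positive,
and the kernel decays exponentially in |log x - log x'|. -/
theorem SchurBound.of_sepSize {lam mu C : ℝ} (hP : G.IsPiece φ P) (hP' : G.IsPiece φ' P')
    (hm : MeasurableSet P) (hm' : MeasurableSet P') (hC : 0 ≤ C) (h1 : 0 < lam + s)
    (h2 : 0 < mu - s) (hN : ∀ k ∈ Set.Ioo 0 k₀, ∀ z ∈ P, ∀ z' ∈ P',
      N k z z' ≤ ENNReal.ofReal (C * sepSize τ lam mu k (G.x z) (G.x z'))) :
    G.SchurBound k₀ s τ P P' N := by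
  obtain ⟨C₁, hC₁⟩ := hP.exists_lintegral_exp_le hm (lt_min h1 h2)
  obtain ⟨C₂, hC₂⟩ := hP'.exists_lintegral_exp_le hm' (lt_min h1 h2)
  have key : ∀ k ∈ Set.Ioo 0 k₀, ∀ z ∈ P, ∀ z' ∈ P',
      N k z z' * ENNReal.ofReal ((G.x z / G.x z') ^ s) ≤
        (C.toNNReal : ENNReal) * ENNReal.ofReal (k ^ (τ - 1)) * ENNReal.ofReal
          (Real.exp (-(min (lam + s) (mu - s)) * |Real.log (G.x z) - Real.log (G.x z')|)) := by
    intro k hk z hz z' hz'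
    have hx := G.x_pos z
    have hx' := G.x_pos z'
    have hk0 := hk.1
    change _ ≤ ENNReal.ofReal C * _ * _
    rw [← ENNReal.ofReal_mul hC, ← ENNReal.ofReal_mul (by positivity)]
    refine (mul_le_mul_left (hN k hk z hz z' hz') _).trans ?_
    rw [← ENNReal.ofReal_mul (by
      have := sepSize_nonneg (τ := τ) (lam := lam) (mu := mu) hk0.le hx.le hx'.le
      positivity)]
    refine ENNReal.ofReal_le_ofReal ?_
    have e1 : (G.x z / G.x z') ^ s =
        (G.x z / (G.x z + G.x z')) ^ s * (G.x z' / (G.x z + G.x z')) ^ (-s) := by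
      rw [Real.rpow_neg (by positivity), ← Real.inv_rpow (by positivity),
        ← Real.mul_rpow (by positivity) (by positivity)]
      congr 1
      field_simp
    have e2 := rpow_ratio_le hx hx' h1 h2
    unfold sepSize
    rw [e1]
    calc _ = C * k ^ (τ - 1) * ((G.x z / (G.x z + G.x z')) ^ (lam + s) *
          (G.x z' / (G.x z + G.x z')) ^ (mu - s)) := by
          rw [sub_eq_add_neg mu s, Real.rpow_add (by positivity), Real.rpow_add (by positivity)]
          ring
      _ ≤ _ := by gcongr
  refine ⟨C.toNNReal * (C₁ + C₂), fun k hk => ⟨fun z hz => ?_, fun z' hz' => ?_⟩⟩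
  · calc _ ≤ ∫⁻ z' in P', (C.toNNReal : ENNReal) * ENNReal.ofReal (k ^ (τ - 1)) * (ENNReal.ofReal
          (Real.exp (-(min (lam + s) (mu - s)) * |Real.log (G.x z) - Real.log (G.x z')|)) *
            ENNReal.ofReal (G.x z' ^ ((d : ℝ) + 1))) ∂G.vol := by
          refine setLIntegral_mono' hm' fun z' hz' => ?_
          rw [← mul_assoc]
          exact mul_le_mul_left (key k hk z hz z' hz') _
      _ ≤ (C.toNNReal : ENNReal) * ENNReal.ofReal (k ^ (τ - 1)) * C₂ := by
          rw [lintegral_const_mul' _ _ (ENNReal.mul_ne_top ENNReal.coe_ne_top ENNReal.ofReal_ne_top)]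
          gcongr
          exact hC₂ _
      _ ≤ _ := by
          push_cast
          rw [mul_right_comm]
          gcongr
          exact le_add_self
  · calc _ ≤ ∫⁻ z in P, (C.toNNReal : ENNReal) * ENNReal.ofReal (k ^ (τ - 1)) * (ENNReal.ofReal
          (Real.exp (-(min (lam + s) (mu - s)) * |Real.log (G.x z') - Real.log (G.x z)|)) *
            ENNReal.ofReal (G.x z ^ ((d : ℝ) + 1))) ∂G.vol := by
          refine setLIntegral_mono' hm fun z hz => ?_
          rw [← mul_assoc, abs_sub_comm]
          exact mul_le_mul_left (key k hk z hz z' hz') _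
      _ ≤ (C.toNNReal : ENNReal) * ENNReal.ofReal (k ^ (τ - 1)) * C₁ := by
          rw [lintegral_const_mul' _ _ (ENNReal.mul_ne_top ENNReal.coe_ne_top ENNReal.ofReal_ne_top)]
          gcongr
          exact hC₁ _
      _ ≤ _ := by
          push_cast
          rw [mul_right_comm]
          gcongr
          exact le_self_add

/-- In rows the substitution W = Λ(φ(z') - φ(z)) absorbs Λ^(d+1). In columns Λ depends on the
variable of integration, but on the support x and x' are comparable, so Λ may be frozen at x' up to
the factor B because Φ is decreasing. -/
theorem SchurBound.of_diag {R C : ℝ} {Φ : ℝ → ℝ} {Λ : ℝ → ℝ → ℝ} (hP : G.IsPiece φ P)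
    (hm : MeasurableSet P) (hC : 0 ≤ C) (hΦm : Measurable Φ) (hΦ0 : ∀ v, 0 ≤ Φ v)
    (hΦa : AntitoneOn Φ (Set.Ioi 0)) (hΦi : ∫⁻ W : Model d, ENNReal.ofReal (Φ ‖W‖) ≠ ⊤)
    (hΛ0 : ∀ k x, 0 < k → 0 < x → 0 < Λ k x)
    (hΛ : ∀ k x x' B, 0 < k → 0 < x → 0 < x' → 1 ≤ B → x' ≤ B * x → Λ k x ≤ B * Λ k x')
    (hN : ∀ k ∈ Set.Ioo 0 k₀, ∀ z ∈ P, ∀ z' ∈ P, N k z z' ≠ 0 → z ≠ z' ∧ ‖φ z' - φ z‖ ≤ R ∧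
      N k z z' ≤ ENNReal.ofReal (C * (k ^ (τ - 1) *
        (Λ k (G.x z) ^ (d + 1) * Φ (Λ k (G.x z) * ‖φ z' - φ z‖))))) :
    G.SchurBound k₀ s τ P P N := by
  obtain ⟨B, hB1, hB⟩ := hP.exists_x_le R
  obtain ⟨A, hA⟩ := hP.exists_lintegral_mul_le hm
  set I := ∫⁻ W : Model d, ENNReal.ofReal (Φ ‖W‖) with hI
  have hB0 : 0 < B := by linarith
  -- B^|s| bounds (x/x')^s. The power 2(d + 1) comes from Λ(x) ≤ B Λ(x') = B² (Λ(x')/B).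
  set D := C * B ^ |s| * B ^ (2 * (d + 1)) with hD
  have hD0 : 0 ≤ D := by positivity
  have hPm : MeasurableSet (φ '' P) := by
    rw [φ.image_eq_target_inter_inv_preimage hP.subset_source]
    exact measurableSet_target_inter _ hm
  have hinv : ∀ u ∈ φ '' P, φ.symm u ∈ P ∧ φ (φ.symm u) = u := by
    rintro _ ⟨z, hz, rfl⟩
    rw [φ.left_inv (hP.subset_source hz)]
    exact ⟨hz, rfl⟩
  -- the kernel is bounded by functions of the distance, in both variables
  have key : ∀ k ∈ Set.Ioo 0 k₀, ∀ z ∈ P, ∀ z' ∈ P,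
      N k z z' * ENNReal.ofReal ((G.x z / G.x z') ^ s) ≤
        ENNReal.ofReal (D * k ^ (τ - 1)) * ENNReal.ofReal
          (Λ k (G.x z) ^ (d + 1) * Φ (Λ k (G.x z) * ‖φ z' - φ z‖)) ∧
      N k z z' * ENNReal.ofReal ((G.x z / G.x z') ^ s) ≤
        ENNReal.ofReal (D * k ^ (τ - 1)) * ENNReal.ofReal
          ((Λ k (G.x z') / B) ^ (d + 1) * Φ (Λ k (G.x z') / B * ‖φ z - φ z'‖)) := by
    intro k hk z hz z' hz'
    rcases eq_or_ne (N k z z') 0 with h0 | h0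
    · rw [h0, zero_mul]; exact ⟨zero_le, zero_le⟩
    obtain ⟨hne, hR, hle⟩ := hN k hk z hz z' hz' h0
    have hx := G.x_pos z
    have hx' := G.x_pos z'
    have hk0 := hk.1
    have b1 := hB z hz z' hz' hR
    have b2 := hB z' hz' z hz (by rwa [norm_sub_rev])
    have hv : 0 < ‖φ z' - φ z‖ := by
      rw [norm_pos_iff, sub_ne_zero]
      exact fun h => hne (φ.injOn (hP.subset_source hz) (hP.subset_source hz') h.symm)
    have hω : (G.x z / G.x z') ^ s ≤ B ^ |s| := by
      have : Comparable B (G.x z / G.x z') 1 := by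
        refine ⟨?_, ?_⟩
        · rw [mul_one, div_le_iff₀ hx']; exact b1
        · rw [mul_div_assoc', one_le_div hx']; exact b2
      simpa using this.rpow_le hB0 (by positivity) one_pos s
    have l0 := hΛ0 k _ hk0 hx
    have l0' := hΛ0 k _ hk0 hx'
    have l1 := hΛ k _ _ B hk0 hx hx' hB1 b2
    have l2 := hΛ k _ _ B hk0 hx' hx hB1 b1
    have hBp : (1 : ℝ) ≤ B ^ (2 * (d + 1)) := one_le_pow₀ hB1
    have f0 := hΦ0 (Λ k (G.x z) * ‖φ z' - φ z‖)
    have hfirst : N k z z' * ENNReal.ofReal ((G.x z / G.x z') ^ s) ≤ ENNReal.ofReal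
        (C * B ^ |s| * k ^ (τ - 1) *
          (Λ k (G.x z) ^ (d + 1) * Φ (Λ k (G.x z) * ‖φ z' - φ z‖))) := by
      refine (mul_le_mul_left hle _).trans ?_
      rw [← ENNReal.ofReal_mul (by positivity)]
      refine ENNReal.ofReal_le_ofReal ?_
      calc _ ≤ C * (k ^ (τ - 1) *
        (Λ k (G.x z) ^ (d + 1) * Φ (Λ k (G.x z) * ‖φ z' - φ z‖))) * B ^ |s| := by gcongr
        _ = _ := by ring
    constructor
    · refine hfirst.trans ?_
      rw [← ENNReal.ofReal_mul (by positivity)]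
      refine ENNReal.ofReal_le_ofReal ?_
      gcongr
      rw [hD]
      exact le_mul_of_one_le_right (by positivity) hBp
    · refine hfirst.trans ?_
      rw [← ENNReal.ofReal_mul (by positivity)]
      refine ENNReal.ofReal_le_ofReal ?_
      have m1 : Φ (Λ k (G.x z) * ‖φ z' - φ z‖) ≤ Φ (Λ k (G.x z') / B * ‖φ z - φ z'‖) := by
        rw [norm_sub_rev (φ z)]
        refine hΦa (Set.mem_Ioi.2 (by positivity)) (Set.mem_Ioi.2 (by positivity)) ?_
        gcongr
        rw [div_le_iff₀ hB0]
        linarith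
      have m2 : Λ k (G.x z) ^ (d + 1) ≤ B ^ (2 * (d + 1)) * (Λ k (G.x z') / B) ^ (d + 1) := by
        rw [pow_mul, ← mul_pow]
        gcongr
        calc Λ k (G.x z) ≤ B * Λ k (G.x z') := l1
          _ = _ := by field_simp
      have f1 := hΦ0 (Λ k (G.x z') / B * ‖φ z - φ z'‖)
      calc _ ≤ C * B ^ |s| * k ^ (τ - 1) * ((B ^ (2 * (d + 1)) * (Λ k (G.x z') / B) ^ (d + 1)) *
            Φ (Λ k (G.x z') / B * ‖φ z - φ z'‖)) := by gcongr
        _ = _ := by rw [hD]; ring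
  have hfin : ∀ k ∈ Set.Ioo 0 k₀, (A : ENNReal) * (ENNReal.ofReal (D * k ^ (τ - 1)) * I) =
      (A * (D.toNNReal * I.toNNReal) : NNReal) * ENNReal.ofReal (k ^ (τ - 1)) := by
    intro k hk
    push_cast
    rw [ENNReal.coe_toNNReal hΦi, ENNReal.ofReal_mul hD0]
    change _ = _ * (ENNReal.ofReal D * _) * _
    ring
  refine ⟨A * (D.toNNReal * I.toNNReal), fun k hk => ⟨fun z hz => ?_, fun z' hz' => ?_⟩⟩
  · refine (hA _).trans ?_
    rw [← hfin k hk]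
    gcongr
    calc _ ≤ ∫⁻ u in φ '' P, ENNReal.ofReal (D * k ^ (τ - 1)) * ENNReal.ofReal
          (Λ k (G.x z) ^ (d + 1) * Φ (Λ k (G.x z) * ‖u - φ z‖)) := by
          refine setLIntegral_mono' hPm fun u hu => ?_
          have := (key k hk z hz _ (hinv u hu).1).1
          rwa [(hinv u hu).2] at this
      _ ≤ ∫⁻ u : Model d, ENNReal.ofReal (D * k ^ (τ - 1)) * ENNReal.ofReal
          (Λ k (G.x z) ^ (d + 1) * Φ (Λ k (G.x z) * ‖u - φ z‖)) := setLIntegral_le_lintegral _ _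
      _ = _ := by
          rw [lintegral_const_mul' _ _ ENNReal.ofReal_ne_top,
            lintegral_scale hΦm (hΛ0 k _ hk.1 (G.x_pos z))]
  · refine (hA _).trans ?_
    rw [← hfin k hk]
    gcongr
    calc _ ≤ ∫⁻ u in φ '' P, ENNReal.ofReal (D * k ^ (τ - 1)) * ENNReal.ofReal
          ((Λ k (G.x z') / B) ^ (d + 1) * Φ (Λ k (G.x z') / B * ‖u - φ z'‖)) := by
          refine setLIntegral_mono' hPm fun u hu => ?_
          have := (key k hk _ (hinv u hu).1 z' hz').2
          rwa [(hinv u hu).2] at this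
      _ ≤ ∫⁻ u : Model d, ENNReal.ofReal (D * k ^ (τ - 1)) * ENNReal.ofReal
          ((Λ k (G.x z') / B) ^ (d + 1) * Φ (Λ k (G.x z') / B * ‖u - φ z'‖)) :=
          setLIntegral_le_lintegral _ _
      _ = _ := by
          rw [lintegral_const_mul' _ _ ENNReal.ofReal_ne_top,
            lintegral_scale hΦm (div_pos (hΛ0 k _ hk.1 (G.x_pos z')) hB0)]

end AsymptoticallyConic
end LowEnergy
end

/-! ### Gluing local Schur bounds. -/

noncomputable section
namespace LowEnergy
namespace AsymptoticallyConic

open MeasureTheory IsManifold Topology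

variable {d : ℕ} {X S : Type*}
  [TopologicalSpace X] [ChartedSpace (Model d) X] [IsManifold 𝓘(ℝ, Model d) ∞ X]
  [TopologicalSpace S] [ChartedSpace (EuclideanSpace ℝ (Fin d)) S]
  [IsManifold 𝓘(ℝ, EuclideanSpace ℝ (Fin d)) ∞ S]
  {G : AsymptoticallyConic d X S} {φ φ' : OpenPartialHomeomorph X (Model d)} {P P' : Set X}
  [MeasurableSpace X] [BorelSpace X] {k₀ s τ : ℝ} {N : ℝ → X → X → ENNReal}

/-! ## Localization of Schur bounds -/

theorem SchurBound.of_local_left (hP : IsCompact P)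
    (h : ∀ z ∈ P, ∃ U ∈ 𝓝 z, G.SchurBound k₀ s τ U P' N) : G.SchurBound k₀ s τ P P' N :=
  hP.induction_on (p := fun U => G.SchurBound k₀ s τ U P' N) SchurBound.empty_left
    (fun _ _ hst ht => ht.subset hst le_rfl) (fun _ _ h1 h2 => h1.union_left h2)
    fun z hz => by
      obtain ⟨U, hU, h⟩ := h z hz
      exact ⟨U, mem_nhdsWithin_of_mem_nhds hU, h⟩

theorem SchurBound.of_local_right (hP : IsCompact P')
    (h : ∀ z ∈ P', ∃ U ∈ 𝓝 z, G.SchurBound k₀ s τ P U N) : G.SchurBound k₀ s τ P P' N :=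
  hP.induction_on (p := fun U => G.SchurBound k₀ s τ P U N) SchurBound.empty_right
    (fun _ _ hst ht => ht.subset le_rfl hst) (fun _ _ h1 h2 => h1.union_right h2)
    fun z hz => by
      obtain ⟨U, hU, h⟩ := h z hz
      exact ⟨U, mem_nhdsWithin_of_mem_nhds hU, h⟩

omit [MeasurableSpace X] [BorelSpace X] in
theorem collarSet_mono {r : ℝ} {L L' : Set S} (h : L ⊆ L') : G.collarSet r L ⊆ G.collarSet r L' :=
  fun _ hz => ⟨hz.1, hz.2.1, h hz.2.2⟩

omit [MeasurableSpace X] [BorelSpace X] in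
theorem collarSet_union {r : ℝ} {L L' : Set S} :
    G.collarSet r (L ∪ L') = G.collarSet r L ∪ G.collarSet r L' := by
  ext z
  simp only [collarSet, Set.mem_union, Set.mem_ofPred_eq]
  tauto

omit [MeasurableSpace X] [BorelSpace X] in
theorem collarSet_empty {r : ℝ} : G.collarSet r ∅ = ∅ := by
  ext z
  simp [collarSet]

theorem SchurBound.of_local_collar_left [CompactSpace S] {r : ℝ}
    (h : ∀ y, ∃ L ∈ 𝓝 y, G.SchurBound k₀ s τ (G.collarSet r L) P' N) :
    G.SchurBound k₀ s τ (G.collarSet r Set.univ) P' N :=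
  isCompact_univ.induction_on (p := fun L => G.SchurBound k₀ s τ (G.collarSet r L) P' N)
    (by rw [collarSet_empty]; exact SchurBound.empty_left)
    (fun _ _ hst ht => ht.subset (collarSet_mono hst) le_rfl)
    (fun _ _ h1 h2 => by rw [collarSet_union]; exact h1.union_left h2)
    fun y _ => by
      obtain ⟨L, hL, h⟩ := h y
      exact ⟨L, mem_nhdsWithin_of_mem_nhds hL, h⟩

theorem SchurBound.of_local_collar_right [CompactSpace S] {r : ℝ}
    (h : ∀ y, ∃ L ∈ 𝓝 y, G.SchurBound k₀ s τ P (G.collarSet r L) N) :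
    G.SchurBound k₀ s τ P (G.collarSet r Set.univ) N :=
  isCompact_univ.induction_on (p := fun L => G.SchurBound k₀ s τ P (G.collarSet r L) N)
    (by rw [collarSet_empty]; exact SchurBound.empty_right)
    (fun _ _ hst ht => ht.subset le_rfl (collarSet_mono hst))
    (fun _ _ h1 h2 => by rw [collarSet_union]; exact h1.union_right h2)
    fun y _ => by
      obtain ⟨L, hL, h⟩ := h y
      exact ⟨L, mem_nhdsWithin_of_mem_nhds hL, h⟩

/-- Local Schur bounds on a collar: it is enough to consider products of small neighbourhoods. -/
theorem SchurBound.of_local_collar [CompactSpace S] {r : ℝ}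
    (h : ∀ y y', ∃ L ∈ 𝓝 y, ∃ L' ∈ 𝓝 y',
      G.SchurBound k₀ s τ (G.collarSet r L) (G.collarSet r L') N) :
    G.SchurBound k₀ s τ (G.collarSet r Set.univ) (G.collarSet r Set.univ) N := by
  refine SchurBound.of_local_collar_left fun y => ?_
  refine isCompact_univ.induction_on
    (p := fun L' => ∃ L ∈ 𝓝 y, G.SchurBound k₀ s τ (G.collarSet r L) (G.collarSet r L') N)
    ⟨Set.univ, Filter.univ_mem, by rw [collarSet_empty]; exact SchurBound.empty_right⟩
    (fun _ _ hst ⟨L, hL, ht⟩ => ⟨L, hL, ht.subset le_rfl (collarSet_mono hst)⟩) ?_ ?_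
  · rintro s t ⟨L, hL, h1⟩ ⟨L', hL', h2⟩
    refine ⟨L ∩ L', Filter.inter_mem hL hL', ?_⟩
    rw [collarSet_union]
    exact (h1.subset (collarSet_mono Set.inter_subset_left) le_rfl).union_right
      (h2.subset (collarSet_mono Set.inter_subset_right) le_rfl)
  · intro y' _
    obtain ⟨L, hL, L', hL', h⟩ := h y y'
    exact ⟨L', mem_nhdsWithin_of_mem_nhds hL', L, hL, h⟩

omit [MeasurableSpace X] [BorelSpace X] in
variable (G) in
theorem exists_interior_piece (z : X) : ∃ φ, ∃ P ∈ 𝓝 z, IsCompact P ∧ G.IsPiece φ P := by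
  have := ChartedSpace.locallyCompactSpace (Model d) X
  obtain ⟨P, hP, hPs, hPc⟩ := local_compact_nhds (chart_source_mem_nhds (Model d) z)
  exact ⟨chartAt (Model d) z, P, hP, hPc,
    .interior _ _ (chart_mem_maximalAtlas z) hPc hPs⟩

omit [MeasurableSpace X] [BorelSpace X] in
variable (G) in
theorem exists_collar_piece {r : ℝ} (hr : r ∈ Set.Ioo 0 G.ε) {y : S} {V : Set S} (hV : V ∈ 𝓝 y) :
    ∃ φ, ∃ L ∈ 𝓝 y, L ⊆ V ∧ G.IsPiece φ (G.collarSet r L) := by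
  have := ChartedSpace.locallyCompactSpace (EuclideanSpace ℝ (Fin d)) S
  obtain ⟨L, hL, hLs, hLc⟩ := local_compact_nhds
    (Filter.inter_mem hV (chart_source_mem_nhds (EuclideanSpace ℝ (Fin d)) y))
  exact ⟨_, L, hL, fun z hz => (hLs hz).1, .collar _ L r (chart_mem_maximalAtlas y) hLc
    (fun z hz => (hLs hz).2) hr⟩

/-- Schur bounds on pairs of pieces away from `sc`, and on collar pieces near `sc`, give Schur
bounds. -/
theorem SchurBound.of_pieces [T2Space S] [CompactSpace S]
    (hsep : ∀ φ P φ' P', G.IsPiece φ P → G.IsPiece φ' P' →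
      (IsCompact P ∨ IsCompact P' ∨ Disjoint P P') → G.SchurBound k₀ s τ P P' N)
    (hdiag : ∀ ψ ∈ maximalAtlas 𝓘(ℝ, EuclideanSpace ℝ (Fin d)) ∞ S, ∀ L L₁ : Set S, ∀ η > 0,
      IsCompact L → IsCompact L₁ → L ⊆ ψ.source → L₁ ⊆ L →
      (∀ y ∈ ψ '' L₁, ∀ w : EuclideanSpace ℝ (Fin d), ‖w‖ ≤ η → y + w ∈ ψ '' L) →
      ∀ r ∈ Set.Ioo 0 G.ε, G.SchurBound k₀ s τ (G.collarSet r L₁) (G.collarSet r L₁) N) :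
    G.SchurBound k₀ s τ Set.univ Set.univ N := by
  set r := G.ε / 2 with hrdef
  have hr : r ∈ Set.Ioo 0 G.ε := ⟨half_pos G.ε_pos, half_lt_self G.ε_pos⟩
  -- X is the union of a compact core and a collar over the compact S. Products that involve the
  -- core stay away from `sc`; only pairs of equal points of S in the collar need the diagonal
  -- coordinates.
  set core := {z | z ∈ G.collar.source → r ≤ G.x z} with hcore
  have hcc : IsCompact core := G.isCompact_core r hr
  have hcov : (Set.univ : Set X) = core ∪ G.collarSet r Set.univ := by
    refine (Set.eq_univ_of_forall fun z => ?_).symm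
    by_cases hz : z ∈ G.collar.source
    · rcases le_total r (G.x z) with h | h
      · exact .inl fun _ => h
      · exact .inr ⟨hz, h, trivial⟩
    · exact .inl fun h => absurd h hz
  have hcc' : G.SchurBound k₀ s τ core core N := by
    refine SchurBound.of_local_left hcc fun z _ => ?_
    obtain ⟨φ, P, hP, hPc, hp⟩ := G.exists_interior_piece z
    refine ⟨P, hP, SchurBound.of_local_right hcc fun z' _ => ?_⟩
    obtain ⟨φ', P', hP', hPc', hp'⟩ := G.exists_interior_piece z'
    exact ⟨P', hP', hsep _ _ _ _ hp hp' (.inl hPc)⟩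
  have h12 : G.SchurBound k₀ s τ core (G.collarSet r Set.univ) N := by
    refine SchurBound.of_local_left hcc fun z _ => ?_
    obtain ⟨φ, P, hP, hPc, hp⟩ := G.exists_interior_piece z
    refine ⟨P, hP, SchurBound.of_local_collar_right fun y => ?_⟩
    obtain ⟨φ', L, hL, -, hp'⟩ := G.exists_collar_piece hr (y := y) Filter.univ_mem
    exact ⟨L, hL, hsep _ _ _ _ hp hp' (.inl hPc)⟩
  have h21 : G.SchurBound k₀ s τ (G.collarSet r Set.univ) core N := by
    refine SchurBound.of_local_collar_left fun y => ?_
    obtain ⟨φ', L, hL, -, hp'⟩ := G.exists_collar_piece hr (y := y) Filter.univ_mem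
    refine ⟨L, hL, SchurBound.of_local_right hcc fun z _ => ?_⟩
    obtain ⟨φ, P, hP, hPc, hp⟩ := G.exists_interior_piece z
    exact ⟨P, hP, hsep _ _ _ _ hp' hp (.inr (.inl hPc))⟩
  have h22 : G.SchurBound k₀ s τ (G.collarSet r Set.univ) (G.collarSet r Set.univ) N := by
    refine SchurBound.of_local_collar fun y y' => ?_
    rcases eq_or_ne y y' with rfl | hne
    -- Concentric balls of radii η/2 and η in the chart supply the margin that the flow at `sc`
    -- requires.
    · set ψ := chartAt (EuclideanSpace ℝ (Fin d)) y with hψ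
      have hy : y ∈ ψ.source := mem_chart_source _ y
      obtain ⟨η, hη, hball⟩ := Metric.nhds_basis_closedBall.mem_iff.1
        (ψ.open_target.mem_nhds (ψ.map_source hy))
      have hη2 : η / 2 ≤ η := by linarith
      set L := ψ.symm '' Metric.closedBall (ψ y) η with hL
      set L₁ := ψ.symm '' Metric.closedBall (ψ y) (η / 2) with hL₁
      have hb1 : Metric.closedBall (ψ y) (η / 2) ⊆ ψ.target :=
        (Metric.closedBall_subset_closedBall hη2).trans hball
      have hLc : IsCompact L :=
        (isCompact_closedBall _ _).image_of_continuousOn (ψ.continuousOn_symm.mono hball)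
      have hLc₁ : IsCompact L₁ :=
        (isCompact_closedBall _ _).image_of_continuousOn (ψ.continuousOn_symm.mono hb1)
      have hn : L₁ ∈ 𝓝 y := by
        have := ψ.symm.image_mem_nhds (ψ.map_source hy) (Metric.closedBall_mem_nhds (ψ y)
          (half_pos hη))
        rwa [ψ.left_inv hy] at this
      refine ⟨L₁, hn, L₁, hn, hdiag ψ (chart_mem_maximalAtlas y) L L₁ (η / 2) (half_pos hη) hLc
        hLc₁ ?_ (Set.image_mono (Metric.closedBall_subset_closedBall hη2)) ?_ r hr⟩
      · rintro _ ⟨u, hu, rfl⟩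
        exact ψ.map_target (hball hu)
      · rintro _ ⟨_, ⟨u, hu, rfl⟩, rfl⟩ w hw
        rw [ψ.right_inv (hb1 hu)]
        have huw : u + w ∈ Metric.closedBall (ψ y) η := by
          rw [mem_closedBall_iff_norm] at hu ⊢
          calc ‖u + w - ψ y‖ = ‖(u - ψ y) + w‖ := by congr 1; abel
            _ ≤ _ := (norm_add_le _ _).trans (by linarith)
        exact ⟨_, ⟨_, huw, rfl⟩, ψ.right_inv (hball huw)⟩
    · obtain ⟨V, V', hV, hV', hd⟩ := t2_separation_nhds hne
      obtain ⟨φ, L, hL, hLV, hp⟩ := G.exists_collar_piece hr hV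
      obtain ⟨φ', L', hL', hLV', hp'⟩ := G.exists_collar_piece hr hV'
      refine ⟨L, hL, L', hL', hsep _ _ _ _ hp hp' (.inr (.inr ?_))⟩
      rw [Set.disjoint_left]
      exact fun z hz hz' => Set.disjoint_left.1 hd (hLV hz.2.2) (hLV' hz'.2.2)
  rw [hcov]
  exact (hcc'.union_right h12).union_left (h21.union_right h22)

end AsymptoticallyConic
end LowEnergy
end

/-! ### Size and measurability of conormal pieces. -/

noncomputable section
namespace LowEnergy

open MeasureTheory

/-! ## Size of conormal pieces -/

/-- Conormal pieces are supported in bounded fibres; truncating the profile keeps it decreasing on v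
> 0 and makes it integrable, as `SchurBound.of_diag` requires. -/
def conormalCutoff (d : ℕ) (R v : ℝ) : ℝ := if v ∈ Set.Ioc 0 R then conormalSize d v else 0

theorem conormalSize_nonneg {d : ℕ} {v : ℝ} (hv : 0 < v) : 0 ≤ conormalSize d v := by
  unfold conormalSize
  positivity

theorem conormalCutoff_nonneg (d : ℕ) (R v : ℝ) : 0 ≤ conormalCutoff d R v := by
  unfold conormalCutoff
  split_ifs with h
  · exact conormalSize_nonneg h.1
  · exact le_rfl

theorem measurable_conormalCutoff (d : ℕ) (R : ℝ) : Measurable (conormalCutoff d R) := by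
  refine Measurable.ite measurableSet_Ioc ?_ measurable_const
  unfold conormalSize
  fun_prop

theorem antitoneOn_conormalCutoff (d : ℕ) (R : ℝ) :
    AntitoneOn (conormalCutoff d R) (Set.Ioi 0) := by
  intro v hv w hw hvw
  have hv0 : 0 < v := hv
  by_cases hwR : w ≤ R
  · have h1 : v ∈ Set.Ioc 0 R := ⟨hv, hvw.trans hwR⟩
    have h2 : w ∈ Set.Ioc 0 R := ⟨hw, hwR⟩
    have hw0 : 0 < w := hw
    rw [conormalCutoff, conormalCutoff, if_pos h1, if_pos h2]
    unfold conormalSize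
    refine mul_le_mul (Real.rpow_le_rpow (by positivity) (by gcongr) (by norm_num))
      (Real.rpow_le_rpow_of_nonpos hv0 hvw (by simp)) (by positivity) (by positivity)
  · rw [conormalCutoff, if_neg fun h => hwR h.2]
    exact conormalCutoff_nonneg _ _ _

/-- In polar coordinates the factor y^d cancels the singularity y^(-d), and what remains is
O(y^(-1/2)) on the bounded interval. -/
theorem lintegral_conormalCutoff_ne_top (d : ℕ) {R : ℝ} (hR : 0 ≤ R) :
    ∫⁻ W : Model d, ENNReal.ofReal (conormalCutoff d R ‖W‖) ≠ ⊤ := by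
  suffices h : Integrable fun W : Model d => conormalCutoff d R ‖W‖ from h.lintegral_lt_top.ne
  rw [integrable_fun_norm_addHaar (volume : Measure (Model d)), finrank_model]
  have h1 : IntegrableOn (fun y : ℝ => (R + 3 * Real.pi) ^ (1 / 2 : ℝ) * y ^ (-(1 / 2) : ℝ))
      (Set.Ioc 0 R) :=
    ((intervalIntegrable_iff_integrableOn_Ioc_of_le hR).1
      (intervalIntegral.intervalIntegrable_rpow' (by norm_num))).const_mul _
  have h2 : Integrable ((Set.Ioc 0 R).indicator
      fun y : ℝ => (R + 3 * Real.pi) ^ (1 / 2 : ℝ) * y ^ (-(1 / 2) : ℝ)) :=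
    (integrable_indicator_iff measurableSet_Ioc).2 h1
  refine h2.integrableOn.mono' ?_ ?_
  · have := measurable_conormalCutoff d R
    fun_prop
  · refine (ae_restrict_iff' measurableSet_Ioi).2 (Filter.Eventually.of_forall fun y hy => ?_)
    have hy0 : 0 < y := hy
    by_cases hyR : y ∈ Set.Ioc 0 R
    · rw [Set.indicator_of_mem hyR, conormalCutoff, if_pos hyR, smul_eq_mul, Nat.add_sub_cancel,
        Real.norm_of_nonneg (mul_nonneg (by positivity) (conormalSize_nonneg hy0))]
      unfold conormalSize
      have e1 : y ^ d * y ^ (-(d : ℝ)) = 1 := by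
        rw [Real.rpow_neg hy0.le, Real.rpow_natCast, mul_inv_cancel₀ (by positivity)]
      calc _ = (1 + 3 * (Real.pi / y)) ^ (1 / 2 : ℝ) * (y ^ d * y ^ (-(d : ℝ))) := by ring
        _ = (1 + 3 * (Real.pi / y)) ^ (1 / 2 : ℝ) := by rw [e1, mul_one]
        _ ≤ ((R + 3 * Real.pi) * y⁻¹) ^ (1 / 2 : ℝ) := by
            refine Real.rpow_le_rpow (by positivity) ?_ (by norm_num)
            rw [← div_eq_mul_inv, le_div_iff₀ hy0]
            have : (1 + 3 * (Real.pi / y)) * y = y + 3 * Real.pi := by field_simp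
            linarith [hyR.2]
        _ = _ := by
            rw [Real.mul_rpow (by positivity) (by positivity), Real.rpow_neg hy0.le,
              Real.inv_rpow hy0.le]
    · rw [Set.indicator_of_notMem hyR, conormalCutoff, if_neg hyR]
      simp

open Classical in
/-- The kernel cut off to `0 < k < k₀` and set to zero on the diagonal. -/
def offDiag {X : Type*} (k₀ : ℝ) (K : ℝ → X → X → ℂ) (k : ℝ) (z z' : X) : ℂ :=
  if k ∈ Set.Ioo 0 k₀ ∧ z ≠ z' then K k z z' else 0

theorem offDiag_of_mem {X : Type*} {k₀ : ℝ} {K : ℝ → X → X → ℂ} {k : ℝ} {z z' : X}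
    (hk : k ∈ Set.Ioo 0 k₀) (h : z ≠ z') : offDiag k₀ K k z z' = K k z z' :=
  if_pos ⟨hk, h⟩

theorem mem_of_offDiag_ne_zero {X : Type*} {k₀ : ℝ} {K : ℝ → X → X → ℂ} {k : ℝ} {z z' : X}
    (h : offDiag k₀ K k z z' ≠ 0) : k ∈ Set.Ioo 0 k₀ ∧ z ≠ z' := by
  by_contra hne
  exact h (if_neg hne)

/-- A kernel which is continuous off the diagonal on an open set and vanishes outside is
measurable. -/
theorem measurable_offDiag {X : Type*} [TopologicalSpace X] [T2Space X] [MeasurableSpace X]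
    [BorelSpace X] [SecondCountableTopology X] {k₀ : ℝ} {K : ℝ → X → X → ℂ} {D : Set X}
    (hD : IsOpen D)
    (hc : ContinuousOn (fun q : ℝ × X × X => K q.1 q.2.1 q.2.2)
      {q | q.1 ∈ Set.Ioo 0 k₀ ∧ q.2.1 ∈ D ∧ q.2.2 ∈ D ∧ q.2.1 ≠ q.2.2})
    (h0 : ∀ k ∈ Set.Ioo 0 k₀, ∀ z z', z ≠ z' → ¬ (z ∈ D ∧ z' ∈ D) → K k z z' = 0) :
    Measurable fun q : ℝ × X × X => offDiag k₀ K q.1 q.2.1 q.2.2 := by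
  classical
  set O : Set (ℝ × X × X) := {q | q.1 ∈ Set.Ioo 0 k₀ ∧ q.2.1 ∈ D ∧ q.2.2 ∈ D ∧ q.2.1 ≠ q.2.2}
    with hO
  have hOo : IsOpen O :=
    (isOpen_Ioo.preimage continuous_fst).inter
      ((hD.preimage (continuous_fst.comp continuous_snd)).inter
        ((hD.preimage (continuous_snd.comp continuous_snd)).inter
          (isOpen_ne_fun (continuous_fst.comp continuous_snd) (continuous_snd.comp continuous_snd))))
  have := hc.measurable_piecewise (g := fun _ => 0) continuousOn_const hOo.measurableSet
  convert this using 1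
  funext q
  by_cases hq : q ∈ O
  · rw [Set.piecewise_eq_of_mem _ _ _ hq, offDiag_of_mem hq.1 hq.2.2.2]
  · rw [Set.piecewise_eq_of_notMem _ _ _ hq]
    by_contra hne
    obtain ⟨hk, hz⟩ := mem_of_offDiag_ne_zero hne
    rw [offDiag_of_mem hk hz] at hne
    exact hne (h0 _ hk _ _ hz fun h => hq ⟨hk, h.1, h.2, hz⟩)

namespace AsymptoticallyConic

open IsManifold Topology

variable {d : ℕ} {X S : Type*}
  [TopologicalSpace X] [ChartedSpace (Model d) X] [IsManifold 𝓘(ℝ, Model d) ∞ X]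
  [TopologicalSpace S] [ChartedSpace (EuclideanSpace ℝ (Fin d)) S]
  [IsManifold 𝓘(ℝ, EuclideanSpace ℝ (Fin d)) ∞ S]
  {G : AsymptoticallyConic d X S} {φ : OpenPartialHomeomorph X (Model d)} {P : Set X}
  {k₀ : ℝ} {Q : Set (ℝ × X × X)} {base : ℝ → X → ℝ × Model d} {weight : ℝ → X → ℝ}
  {Λ : ℝ → ℝ → ℝ} {κ : ℝ → X → X → ℂ}

theorem IsConormalPiece.exists_le {R : ℝ}
    (h : IsConormalPiece k₀ (-1) φ.source Q base
      (fun k z z' => Λ k (G.x z) • (φ z' - φ z)) weight κ)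
    (hB : IsOpen {b | ∃ k ∈ Set.Ioo 0 k₀, ∃ z ∈ φ.source, base k z = b})
    (hΛ : ∀ k x, 0 < k → 0 < x → 0 < Λ k x)
    (hQ : ∀ k ∈ Set.Ioo 0 k₀, ∀ z z', (k, z, z') ∈ Q → Λ k (G.x z) * ‖φ z' - φ z‖ ≤ R) :
    ∃ C : ℝ, 0 ≤ C ∧ ∀ k ∈ Set.Ioo 0 k₀, ∀ z z', z ≠ z' → κ k z z' ≠ 0 →
      (k, z, z') ∈ Q ∧
      ‖κ k z z'‖ ≤ |weight k z| * (C * conormalCutoff d R (Λ k (G.x z) * ‖φ z' - φ z‖)) := by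
  obtain ⟨U, B, a, rfl, hUs, hUi, haU, ha, had, hsupp, hK⟩ := h
  have hnorm : ∀ k ∈ Set.Ioo 0 k₀, ∀ z z', ‖Λ k (G.x z) • (φ z' - φ z)‖ =
      Λ k (G.x z) * ‖φ z' - φ z‖ := fun k hk z z' => by
    rw [norm_smul, Real.norm_of_nonneg (hΛ k _ hk.1 (G.x_pos z)).le]
  obtain ⟨C, hC, hle⟩ := exists_le_conormalSize (R := R) hB hUs hUi haU ha had (by
    rintro _ ⟨k, hk, z, hz, rfl⟩ W hW hRW
    by_contra hne
    obtain ⟨z', hz', rfl, hq⟩ := hsupp k hk z hz W hW hne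
    rw [hnorm k hk] at hRW
    exact absurd (hQ k hk z z' hq) (not_le.2 hRW))
  refine ⟨C, hC, fun k hk z z' hne hκ => ?_⟩
  obtain ⟨h1, h2⟩ := hK k hk z z' hne
  have hD : z ∈ φ.source ∧ z' ∈ φ.source := by
    by_contra hD
    exact hκ (h2 hD)
  have hl := hΛ k _ hk.1 (G.x_pos z)
  have hv : φ z' - φ z ≠ 0 := by
    rw [sub_ne_zero]
    exact fun h => hne (φ.injOn hD.1 hD.2 h.symm)
  have hW : Λ k (G.x z) • (φ z' - φ z) ≠ 0 := smul_ne_zero hl.ne' hv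
  rw [h1 hD.1 hD.2] at hκ ⊢
  -- The support condition yields some point with the same fibre coordinate; injectivity of the
  -- chart shows that it is z', which places (k, z, z') in Q.
  obtain ⟨z'', hz'', hfib, hq⟩ := hsupp k hk z hD.1 _ hW (right_ne_zero_of_mul hκ)
  have hzz : z'' = z' := by
    have h3 := smul_right_injective (Model d) hl.ne' hfib
    exact φ.injOn hz'' hD.2 (sub_left_injective h3)
  rw [hzz] at hq
  refine ⟨hq, ?_⟩
  rw [norm_mul, Complex.norm_real, Real.norm_eq_abs]
  gcongr
  have h4 := hle (base k z) ⟨k, hk, z, hD.1, rfl⟩ _ hW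
  rw [hnorm k hk] at h4
  rwa [conormalCutoff, if_pos ⟨mul_pos hl (norm_pos_iff.2 hv), hQ k hk z z' hq⟩]

/-- The weight may be as large as k^(τ-1) times Λ^(d+1), the Jacobian of the fibre coordinate W =
Λ(φ(z') - φ(z)). -/
theorem IsConormalPiece.schurBound [MeasurableSpace X] [BorelSpace X] {R R' C₀ s τ : ℝ}
    (h : IsConormalPiece k₀ (-1) φ.source Q base
      (fun k z z' => Λ k (G.x z) • (φ z' - φ z)) weight κ)
    (hB : IsOpen {b | ∃ k ∈ Set.Ioo 0 k₀, ∃ z ∈ φ.source, base k z = b})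
    (hP : G.IsPiece φ P) (hm : MeasurableSet P) (hR : 0 ≤ R) (hC₀ : 0 ≤ C₀)
    (hΛ0 : ∀ k x, 0 < k → 0 < x → 0 < Λ k x)
    (hΛ : ∀ k x x' B, 0 < k → 0 < x → 0 < x' → 1 ≤ B → x' ≤ B * x → Λ k x ≤ B * Λ k x')
    (hQ : ∀ k ∈ Set.Ioo 0 k₀, ∀ z z', (k, z, z') ∈ Q → z ∈ P ∧ z' ∈ P ∧
      Λ k (G.x z) * ‖φ z' - φ z‖ ≤ R ∧ ‖φ z' - φ z‖ ≤ R' ∧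
      |weight k z| ≤ C₀ * (k ^ (τ - 1) * Λ k (G.x z) ^ (d + 1))) :
    G.SchurBound k₀ s τ Set.univ Set.univ (fun k z z' => ‖offDiag k₀ κ k z z'‖ₑ) := by
  obtain ⟨C, hC, hle⟩ := h.exists_le (G := G) hB hΛ0 fun k hk z z' hq => (hQ k hk z z' hq).2.2.1
  have hne : ∀ {k z z'}, ‖offDiag k₀ κ k z z'‖ₑ ≠ 0 → z ≠ z' ∧ κ k z z' ≠ 0 := by
    intro k z z' hn
    have hn' : offDiag k₀ κ k z z' ≠ 0 := by simpa using hn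
    obtain ⟨hk, hz⟩ := mem_of_offDiag_ne_zero hn'
    rw [offDiag_of_mem hk hz] at hn'
    exact ⟨hz, hn'⟩
  refine SchurBound.of_support (P := P) (P' := P) ?_ hm hm fun k hk z z' hn => ?_
  · refine SchurBound.of_diag (R := R') (C := C₀ * C) (Φ := conormalCutoff d R) (Λ := Λ) hP hm
      (by positivity)
      (measurable_conormalCutoff d R) (conormalCutoff_nonneg d R) (antitoneOn_conormalCutoff d R)
      (lintegral_conormalCutoff_ne_top d hR) hΛ0 hΛ fun k hk z _ z' _ hn => ?_
    obtain ⟨hz, hκ⟩ := hne hn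
    obtain ⟨hq, hb⟩ := hle k hk z z' hz hκ
    obtain ⟨-, -, -, hR', hw⟩ := hQ k hk z z' hq
    refine ⟨hz, hR', ?_⟩
    rw [offDiag_of_mem hk hz, ← ofReal_norm]
    refine ENNReal.ofReal_le_ofReal (hb.trans ?_)
    have := conormalCutoff_nonneg d R (Λ k (G.x z) * ‖φ z' - φ z‖)
    calc _ ≤ C₀ * (k ^ (τ - 1) * Λ k (G.x z) ^ (d + 1)) *
          (C * conormalCutoff d R (Λ k (G.x z) * ‖φ z' - φ z‖)) := by gcongr
      _ = _ := by ring
  · obtain ⟨hz, hκ⟩ := hne hn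
    obtain ⟨hq, -⟩ := hle k hk z z' hz hκ
    exact ⟨(hQ k hk z z' hq).1, (hQ k hk z z' hq).2.1⟩

theorem IsConormalPiece.measurable_offDiag [T2Space X] [MeasurableSpace X] [BorelSpace X]
    [SecondCountableTopology X]
    (h : IsConormalPiece k₀ (-1) φ.source Q base
      (fun k z z' => Λ k (G.x z) • (φ z' - φ z)) weight κ)
    (hΛ0 : ∀ k x, 0 < k → 0 < x → 0 < Λ k x)
    (hbase : ContinuousOn (fun q : ℝ × X => base q.1 q.2) (Set.Ioo 0 k₀ ×ˢ φ.source))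
    (hΛc : ContinuousOn (fun q : ℝ × X => Λ q.1 (G.x q.2)) (Set.Ioo 0 k₀ ×ˢ φ.source))
    (hw : ContinuousOn (fun q : ℝ × X => weight q.1 q.2) (Set.Ioo 0 k₀ ×ˢ φ.source)) :
    Measurable fun q : ℝ × X × X => offDiag k₀ κ q.1 q.2.1 q.2.2 := by
  obtain ⟨U, B, a, rfl, hUs, hUi, haU, ha, had, hsupp, hK⟩ := h
  refine LowEnergy.measurable_offDiag φ.open_source ?_ fun k hk z z' hz hD => (hK k hk z z' hz).2 hD
  set O : Set (ℝ × X × X) := {q | q.1 ∈ Set.Ioo 0 k₀ ∧ q.2.1 ∈ φ.source ∧ q.2.2 ∈ φ.source ∧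
    q.2.1 ≠ q.2.2}
  have hp : ContinuousOn (fun q : ℝ × X × X => (q.1, q.2.1)) O := by fun_prop
  have hpm : Set.MapsTo (fun q : ℝ × X × X => (q.1, q.2.1)) O (Set.Ioo 0 k₀ ×ˢ φ.source) :=
    fun q hq => ⟨hq.1, hq.2.1⟩
  have hb' := hbase.comp hp hpm
  have hΛ' := hΛc.comp hp hpm
  have hw' := hw.comp hp hpm
  have hφ1 : ContinuousOn (fun q : ℝ × X × X => φ q.2.1) O :=
    φ.continuousOn.comp (by fun_prop) fun q hq => hq.2.1
  have hφ2 : ContinuousOn (fun q : ℝ × X × X => φ q.2.2) O :=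
    φ.continuousOn.comp (by fun_prop) fun q hq => hq.2.2.1
  have hU : ContinuousOn (fun q : ℝ × X × X =>
      U (base q.1 q.2.1) (Λ q.1 (G.x q.2.1) • (φ q.2.2 - φ q.2.1))) O := by
    refine hUs.continuousOn.comp (f := fun q : ℝ × X × X =>
      (base q.1 q.2.1, Λ q.1 (G.x q.2.1) • (φ q.2.2 - φ q.2.1)))
      (hb'.prodMk (hΛ'.smul (hφ2.sub hφ1))) fun q hq => ⟨⟨q.1, hq.1, q.2.1, hq.2.1, rfl⟩, ?_⟩
    refine smul_ne_zero (hΛ0 _ _ hq.1.1 (G.x_pos _)).ne' ?_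
    rw [sub_ne_zero]
    exact fun h => hq.2.2.2 (φ.injOn hq.2.1 hq.2.2.1 h.symm)
  refine ((Complex.continuous_ofReal.comp_continuousOn hw').mul hU).congr fun q hq => ?_
  exact (hK q.1 hq.1 q.2.1 q.2.2 hq.2.2.2).1 hq.2.1 hq.2.2.1

end AsymptoticallyConic
end LowEnergy
end

/-! ### Schur bounds for the two parts of a kernel in the calculus. -/

noncomputable section
namespace LowEnergy
namespace AsymptoticallyConic

open MeasureTheory IsManifold Topology

variable {d : ℕ} {X S : Type*}
  [TopologicalSpace X] [ChartedSpace (Model d) X] [IsManifold 𝓘(ℝ, Model d) ∞ X]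
  [TopologicalSpace S] [ChartedSpace (EuclideanSpace ℝ (Fin d)) S]
  [IsManifold 𝓘(ℝ, EuclideanSpace ℝ (Fin d)) ∞ S]
  {G : AsymptoticallyConic d X S} {ψ : OpenPartialHomeomorph S (EuclideanSpace ℝ (Fin d))}
  {k₀ a : ℝ} {κ : ℝ → X → X → ℂ}

/-! ## Kernels conormal at the diagonal -/

theorem exists_collar_eq {t : ℝ} (ht : t ∈ Set.Ioo 0 G.ε) {y : EuclideanSpace ℝ (Fin d)}
    (hy : y ∈ ψ.target) :
    ∃ z ∈ (G.collarChart ψ).source, G.x z = t ∧ ψ (G.collar z).2 = y := by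
  have ht' : (t, ψ.symm y) ∈ G.collar.target := by
    rw [G.collar_target]
    exact ⟨ht, trivial⟩
  have hz := G.collar.map_target ht'
  have he := G.collar.right_inv ht'
  refine ⟨G.collar.symm (t, ψ.symm y), mem_collarChart_source.2 ⟨hz, ?_⟩, ?_, ?_⟩
  · rw [he]; exact ψ.map_target hy
  · rw [← G.collar_fst _ hz, he]
  · rw [he]; exact ψ.right_inv hy

theorem x_mem_of_mem_collarChart_source {z : X} (hz : z ∈ (G.collarChart ψ).source) :
    G.x z ∈ Set.Ioo 0 G.ε ∧ ψ (G.collar z).2 ∈ ψ.target := by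
  obtain ⟨h1, h2⟩ := mem_collarChart_source.1 hz
  have h3 := G.collar.map_source h1
  rw [G.collar_target] at h3
  rw [← G.collar_fst z h1]
  exact ⟨h3.1, ψ.map_source h2⟩

theorem isOpen_base_interior (φ : OpenPartialHomeomorph X (Model d)) :
    IsOpen {b : ℝ × Model d | ∃ k ∈ Set.Ioo 0 k₀, ∃ z ∈ φ.source, (k, φ z) = b} := by
  convert isOpen_Ioo (a := (0 : ℝ)) (b := k₀) |>.prod φ.open_target using 1
  ext ⟨k, u⟩
  constructor
  · rintro ⟨k, hk, z, hz, h⟩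
    rw [← h]
    exact ⟨hk, φ.map_source hz⟩
  · rintro ⟨hk, hu⟩
    exact ⟨k, hk, φ.symm u, φ.map_target hu, by rw [φ.right_inv hu]⟩

theorem isOpen_base_nearZf :
    IsOpen {b : ℝ × Model d | ∃ k ∈ Set.Ioo 0 k₀, ∃ z ∈ (G.collarChart ψ).source,
      (k / G.x z, G.x z, ψ (G.collar z).2) = b} := by
  have ho : IsOpen {b : ℝ × Model d | b.1 * b.2.1 ∈ Set.Ioo 0 k₀ ∧ b.2.1 ∈ Set.Ioo 0 G.ε ∧
      b.2.2 ∈ ψ.target} :=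
    (isOpen_Ioo.preimage (by fun_prop : Continuous fun b : ℝ × Model d => b.1 * b.2.1)).inter
      ((isOpen_Ioo.preimage (by fun_prop : Continuous fun b : ℝ × Model d => b.2.1)).inter
        (ψ.open_target.preimage (by fun_prop : Continuous fun b : ℝ × Model d => b.2.2)))
  convert ho using 1
  ext ⟨σ, t, y⟩
  constructor
  · rintro ⟨k, hk, z, hz, h⟩
    rw [← h]
    refine ⟨?_, x_mem_of_mem_collarChart_source hz⟩
    change k / G.x z * G.x z ∈ _
    rwa [div_mul_cancel₀ _ (G.x_pos z).ne']
  · rintro ⟨hk, ht, hy⟩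
    obtain ⟨z, hz, hx, hy'⟩ := exists_collar_eq (G := G) ht hy
    refine ⟨σ * t, hk, z, hz, ?_⟩
    rw [hx, hy', mul_div_cancel_right₀ _ (ne_of_gt ht.1)]

theorem isOpen_base_nearSc :
    IsOpen {b : ℝ × Model d | ∃ k ∈ Set.Ioo 0 k₀, ∃ z ∈ (G.collarChart ψ).source,
      (G.x z / k, k, ψ (G.collar z).2) = b} := by
  have ho : IsOpen {b : ℝ × Model d | b.2.1 ∈ Set.Ioo 0 k₀ ∧ b.1 * b.2.1 ∈ Set.Ioo 0 G.ε ∧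
      b.2.2 ∈ ψ.target} :=
    (isOpen_Ioo.preimage (by fun_prop : Continuous fun b : ℝ × Model d => b.2.1)).inter
      ((isOpen_Ioo.preimage (by fun_prop : Continuous fun b : ℝ × Model d => b.1 * b.2.1)).inter
        (ψ.open_target.preimage (by fun_prop : Continuous fun b : ℝ × Model d => b.2.2)))
  convert ho using 1
  ext ⟨σ, k, y⟩
  constructor
  · rintro ⟨k, hk, z, hz, h⟩
    rw [← h]
    refine ⟨hk, ?_⟩
    change G.x z / k * k ∈ _ ∧ _
    rw [div_mul_cancel₀ _ (ne_of_gt hk.1)]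
    exact x_mem_of_mem_collarChart_source hz
  · rintro ⟨hk, ht, hy⟩
    obtain ⟨z, hz, hx, hy'⟩ := exists_collar_eq (G := G) ht hy
    refine ⟨k, hk, z, hz, ?_⟩
    rw [hx, hy']
    congr 1
    exact mul_div_cancel_right₀ _ (ne_of_gt hk.1)

theorem continuousOn_collar_snd :
    ContinuousOn (fun z => ψ (G.collar z).2) (G.collarChart ψ).source := by
  refine ψ.continuousOn.comp ?_ fun z hz => (mem_collarChart_source.1 hz).2
  exact continuous_snd.comp_continuousOn
    (G.collar.continuousOn.mono fun z hz => (mem_collarChart_source.1 hz).1)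

theorem IsConormalLocal.measurable_offDiag [T2Space X] [MeasurableSpace X] [BorelSpace X]
    [SecondCountableTopology X] (h : G.IsConormalLocal k₀ (-1) a 0 0 κ) :
    Measurable fun q : ℝ × X × X => offDiag k₀ κ q.1 q.2.1 q.2.2 := by
  have hx := G.x_smooth.continuous
  have hxn : ∀ z, G.x z ≠ 0 := fun z => (G.x_pos z).ne'
  cases h with
  | interior φ P hφ hP hPφ hK =>
    refine IsConormalPiece.measurable_offDiag (G := G) (φ := φ) (Λ := fun _ _ => 1)
      (base := fun k z => (k, φ z)) (weight := fun k _ => k ^ (0 : ℝ)) (by simpa using hK)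
      (fun _ _ _ _ => one_pos) ?_ continuousOn_const ?_
    · exact continuousOn_fst.prodMk (φ.continuousOn.comp continuousOn_snd fun q hq => hq.2)
    · simpa using continuousOn_const
  | nearZf ψ L r c R hψ hL hLψ hr hK =>
    refine IsConormalPiece.measurable_offDiag (G := G) (φ := G.collarChart ψ) (Λ := fun _ _ => 1)
      (base := fun k z => (k / G.x z, G.x z, ψ (G.collar z).2))
      (weight := fun k z => G.x z ^ a * (k / G.x z) ^ (0 : ℝ)) (by simpa using hK)
      (fun _ _ _ _ => one_pos) ?_ continuousOn_const ?_
    · refine ContinuousOn.prodMk ?_ (ContinuousOn.prodMk (by fun_prop)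
        (continuousOn_collar_snd.comp continuousOn_snd fun q hq => hq.2))
      exact continuousOn_fst.div (by fun_prop) fun q _ => hxn q.2
    · simp only [Real.rpow_zero, mul_one]
      exact ContinuousOn.rpow_const (by fun_prop) fun q _ => .inl (hxn q.2)
  | nearSc ψ L r c R hψ hL hLψ hr hK =>
    refine IsConormalPiece.measurable_offDiag (G := G) (φ := G.collarChart ψ)
      (Λ := fun k x => k / x) (base := fun k z => (G.x z / k, k, ψ (G.collar z).2))
      (weight := fun k z => k ^ a * (G.x z / k) ^ ((0 : ℝ) - ((d : ℝ) + 1))) hK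
      (fun _ _ hk hx => div_pos hk hx) ?_ ?_ ?_
    · refine ContinuousOn.prodMk ?_ (ContinuousOn.prodMk (by fun_prop)
        (continuousOn_collar_snd.comp continuousOn_snd fun q hq => hq.2))
      exact ContinuousOn.div (by fun_prop) continuousOn_fst fun q hq => hq.1.1.ne'
    · exact continuousOn_fst.div (by fun_prop) fun q _ => hxn q.2
    · refine ContinuousOn.mul
        (ContinuousOn.rpow_const continuousOn_fst fun q hq => .inl hq.1.1.ne')
        (ContinuousOn.rpow_const ?_ fun q hq => .inl (div_pos (G.x_pos _) hq.1.1).ne')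
      exact ContinuousOn.div (by fun_prop) continuousOn_fst fun q hq => hq.1.1.ne'

theorem IsConormalLocal.schurBound [T2Space X] [T2Space S] [CompactSpace S] [MeasurableSpace X] [BorelSpace X]
    {s τ : ℝ} (h : G.IsConormalLocal k₀ (-1) a 0 0 κ) (hk₀ : 0 < k₀) (hτ : τ ≤ 1)
    (hτa : τ ≤ 1 + a) :
    G.SchurBound k₀ s τ Set.univ Set.univ (fun k z z' => ‖offDiag k₀ κ k z z'‖ₑ) := by
  have hone : ∀ k x x' B : ℝ, 0 < k → 0 < x → 0 < x' → 1 ≤ B → x' ≤ B * x →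
      (1 : ℝ) ≤ B * 1 := fun _ _ _ B _ _ _ hB _ => by linarith
  cases h with
  | interior φ P hφ hP hPφ hK =>
    have hp : G.IsPiece φ P := .interior φ P hφ hP hPφ
    have hb : Bornology.IsBounded (φ '' P) :=
      (hP.image_of_continuousOn (φ.continuousOn.mono hPφ)).isBounded
    have hd : ∀ z ∈ P, ∀ z' ∈ P, ‖φ z' - φ z‖ ≤ Metric.diam (φ '' P) := fun z hz z' hz' => by
      rw [← dist_eq_norm]
      exact Metric.dist_le_diam_of_mem hb ⟨z', hz', rfl⟩ ⟨z, hz, rfl⟩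
    refine SchurBound.of_le (τ := 1) ?_ hk₀ hτ
    refine IsConormalPiece.schurBound (G := G) (φ := φ) (Λ := fun _ _ => 1)
      (base := fun k z => (k, φ z)) (weight := fun k _ => k ^ (0 : ℝ)) (C₀ := 1)
      (R := Metric.diam (φ '' P)) (R' := Metric.diam (φ '' P))
      (Q := {q | q.2.1 ∈ P ∧ q.2.2 ∈ P}) (by simpa using hK)
      (isOpen_base_interior φ) hp hP.measurableSet Metric.diam_nonneg zero_le_one
      (fun _ _ _ _ => one_pos) hone fun k hk z z' hq => ⟨hq.1, hq.2, ?_, hd z hq.1 z' hq.2, ?_⟩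
    · rw [one_mul]; exact hd z hq.1 z' hq.2
    · simp
  | nearZf ψ L r c R hψ hL hLψ hr hK =>
    have hp : G.IsPiece (G.collarChart ψ) (G.collarSet r L) := .collar ψ L r hψ hL hLψ hr
    have hr0 := hr.1
    -- Near `zf` the weight is x^a with k/c ≤ x ≤ r: it is at most r^a for a ≥ 0, and at most a
    -- multiple of k^a for a ≤ 0.
    refine SchurBound.of_le (τ := 1 + min a 0) ?_ hk₀ (by
      rcases min_cases a 0 with ⟨h, -⟩ | ⟨h, -⟩ <;> rw [h] <;> linarith)
    refine IsConormalPiece.schurBound (G := G) (φ := G.collarChart ψ) (Λ := fun _ _ => 1)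
      (base := fun k z => (k / G.x z, G.x z, ψ (G.collar z).2))
      (weight := fun k z => G.x z ^ a * (k / G.x z) ^ (0 : ℝ)) (R := |R|) (R' := |R|)
      (C₀ := r ^ a + |c| ^ (-a))
      (Q := {q | q.2.1 ∈ G.collarSet r L ∧ q.2.2 ∈ G.collarSet r L ∧ q.1 ≤ c * G.x q.2.1 ∧
        ‖G.collarChart ψ q.2.2 - G.collarChart ψ q.2.1‖ ≤ R}) (by simpa using hK)
      isOpen_base_nearZf hp hp.measurableSet (abs_nonneg R) (by positivity)
      (fun _ _ _ _ => one_pos) hone fun k hk z z' hq =>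
        ⟨hq.1, hq.2.1, ?_, hq.2.2.2.trans (le_abs_self R), ?_⟩
    · rw [one_mul]; exact hq.2.2.2.trans (le_abs_self R)
    · have hx := G.x_pos z
      have hk0 := hk.1
      have hxr : G.x z ≤ r := hq.1.2.1
      have hkc : k ≤ c * G.x z := hq.2.2.1
      have hc : 0 < c := pos_of_mul_pos_left (hk0.trans_le hkc) hx.le
      rw [Real.rpow_zero, mul_one, abs_of_nonneg (by positivity), one_pow, mul_one,
        add_sub_cancel_left, abs_of_pos hc]
      rcases le_total 0 a with ha | ha
      · rw [min_eq_right ha, Real.rpow_zero, mul_one]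
        have := Real.rpow_le_rpow hx.le hxr ha
        have h2 : 0 ≤ c ^ (-a) := by positivity
        linarith
      · rw [min_eq_left ha]
        calc G.x z ^ a ≤ (k / c) ^ a := by
              refine Real.rpow_le_rpow_of_nonpos (by positivity) ?_ ha
              rw [div_le_iff₀ hc]; linarith
          _ = c ^ (-a) * k ^ a := by
              rw [Real.div_rpow hk0.le hc.le, Real.rpow_neg hc.le]; field_simp
          _ ≤ _ := by
              gcongr
              exact le_add_of_nonneg_left (by positivity)
  | nearSc ψ L r c R hψ hL hLψ hr hK =>
    have hp : G.IsPiece (G.collarChart ψ) (G.collarSet r L) := .collar ψ L r hψ hL hLψ hr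
    -- Near `sc` the weight k^a (x/k)^(-n) is exactly k^a Λ^(d+1) with Λ = k/x. The undilated
    -- distance is (x/k)|W| ≤ c|R|, the value of R' below.
    refine SchurBound.of_le (τ := 1 + a) ?_ hk₀ hτa
    refine IsConormalPiece.schurBound (G := G) (φ := G.collarChart ψ)
      (Λ := fun k x => k / x) (base := fun k z => (G.x z / k, k, ψ (G.collar z).2))
      (weight := fun k z => k ^ a * (G.x z / k) ^ ((0 : ℝ) - ((d : ℝ) + 1)))
      (R := |R|) (R' := |R| * c) (C₀ := 1) hK
      isOpen_base_nearSc hp hp.measurableSet (abs_nonneg R) zero_le_one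
      (fun _ _ hk hx => div_pos hk hx) ?_ fun k hk z z' hq => ?_
    · intro k x x' B hk hx hx' hB hle
      rw [mul_div_assoc', div_le_div_iff₀ hx hx']
      nlinarith
    · have hx := G.x_pos z
      have hk0 := hk.1
      obtain ⟨h1, h2, hxc, hv⟩ := hq
      change G.x z ≤ c * k at hxc
      change ‖(k / G.x z) • (G.collarChart ψ z' - G.collarChart ψ z)‖ ≤ R at hv
      rw [norm_smul, Real.norm_of_nonneg (by positivity)] at hv
      have hv' := hv.trans (le_abs_self R)
      refine ⟨h1, h2, hv', ?_, ?_⟩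
      · have h3 : ‖G.collarChart ψ z' - G.collarChart ψ z‖ ≤ |R| * (G.x z / k) := by
          rw [mul_div_assoc', le_div_iff₀ hk0]
          rw [div_mul_eq_mul_div, div_le_iff₀ hx] at hv'
          linarith
        refine h3.trans ?_
        gcongr
        rwa [div_le_iff₀ hk0]
      · rw [abs_of_nonneg (by positivity), one_mul, add_sub_cancel_left]
        refine le_of_eq ?_
        congr 1
        rw [zero_sub, Real.rpow_neg (by positivity), ← Real.inv_rpow (by positivity), inv_div]
        exact_mod_cast Real.rpow_natCast (k / G.x z) (d + 1)

/-! ## Polyhomogeneous kernels -/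

/-- A single point is a compact piece, so the smoothness required on products of pieces applies at
every interior point, the diagonal included. -/
theorem IsPolyhomogeneous.continuousAt {𝓔 : Face → IndexSet} (h : G.IsPolyhomogeneous k₀ 𝓔 κ)
    {k : ℝ} (hk : k ∈ Set.Ioo 0 k₀) (z z' : X) :
    ContinuousAt (fun q : ℝ × X × X => κ q.1 q.2.1 q.2.2) (k, z, z') := by
  obtain ⟨w, h, -⟩ := h
  have hp : ∀ z : X, G.IsPiece (chartAt (Model d) z) {z} := fun z =>
    .interior _ _ (chart_mem_maximalAtlas z) isCompact_singleton
      (Set.singleton_subset_iff.2 (mem_chart_source _ z))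
  have h1 := (h _ _ _ _ (hp z) (hp z') (.inl isCompact_singleton)).1
  have hk0 := hk.1
  set φ := chartAt (Model d) z
  set φ' := chartAt (Model d) z'
  have hz : z ∈ φ.source := mem_chart_source _ z
  have hz' : z' ∈ φ'.source := mem_chart_source _ z'
  have h2 : ContinuousAt ((sepCoords k₀ φ {z} φ' {z'}).pull κ) (Real.log k, φ z, φ' z') :=
    (h1 (Real.log k, φ z, φ' z') ⟨Real.log_lt_log hk0 hk.2, ⟨z, rfl, rfl⟩, ⟨z', rfl, rfl⟩⟩).continuousAt
  have h3 : ContinuousAt (fun q : ℝ × X × X => (Real.log q.1, φ q.2.1, φ' q.2.2)) (k, z, z') := by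
    refine ContinuousAt.prodMk ?_ (ContinuousAt.prodMk ?_ ?_)
    · exact continuousAt_fst.log hk0.ne'
    · exact ContinuousAt.comp (f := fun q : ℝ × X × X => q.2.1) (φ.continuousAt hz) (by fun_prop)
    · exact ContinuousAt.comp (f := fun q : ℝ × X × X => q.2.2) (φ'.continuousAt hz') (by fun_prop)
  refine (ContinuousAt.comp (f := fun q : ℝ × X × X => (Real.log q.1, φ q.2.1, φ' q.2.2))
    h2 h3).congr ?_
  have e1 : ∀ᶠ q : ℝ × X × X in 𝓝 (k, z, z'), 0 < q.1 :=
    continuousAt_fst.eventually_const_lt hk0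
  have e2 : ∀ᶠ q : ℝ × X × X in 𝓝 (k, z, z'), q.2.1 ∈ φ.source :=
    ContinuousAt.preimage_mem_nhds (f := fun q : ℝ × X × X => q.2.1) (by fun_prop)
      (φ.open_source.mem_nhds hz)
  have e3 : ∀ᶠ q : ℝ × X × X in 𝓝 (k, z, z'), q.2.2 ∈ φ'.source :=
    ContinuousAt.preimage_mem_nhds (f := fun q : ℝ × X × X => q.2.2) (by fun_prop)
      (φ'.open_source.mem_nhds hz')
  filter_upwards [e1, e2, e3] with q hq1 hq2 hq3
  change κ (Real.exp (Real.log q.1)) (φ.symm (φ q.2.1)) (φ'.symm (φ' q.2.2)) = _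
  rw [Real.exp_log hq1, φ.left_inv hq2, φ'.left_inv hq3]

theorem IsPolyhomogeneous.measurable_offDiag [T2Space X] [MeasurableSpace X] [BorelSpace X]
    [SecondCountableTopology X] {𝓔 : Face → IndexSet} (h : G.IsPolyhomogeneous k₀ 𝓔 κ) :
    Measurable fun q : ℝ × X × X => offDiag k₀ κ q.1 q.2.1 q.2.2 := by
  refine LowEnergy.measurable_offDiag (D := Set.univ) isOpen_univ (fun q hq => ?_)
    fun k hk z z' _ hD => absurd ⟨trivial, trivial⟩ hD
  exact (h.continuousAt hq.1 q.2.1 q.2.2).continuousWithinAt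

theorem lintegral_rpow_neg_ne_top :
    ∫⁻ W : Model d, ENNReal.ofReal ((1 + |‖W‖|) ^ (-((d : ℝ) + 2))) ≠ ⊤ := by
  have h : Integrable fun W : Model d => (1 + |‖W‖|) ^ (-((d : ℝ) + 2)) := by
    simp only [abs_norm]
    exact integrable_one_add_norm (by rw [finrank_model]; push_cast; linarith)
  exact h.lintegral_lt_top.ne

theorem IsPolyhomogeneous.schurBound [T2Space X] [T2Space S] [CompactSpace S] [MeasurableSpace X]
    [BorelSpace X] {𝓔 : Face → IndexSet} {s τ lam mu ε : ℝ} (h : G.IsPolyhomogeneous k₀ 𝓔 κ)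
    (hk₀ : 0 < k₀) (hlb : (𝓔 .lb).carrier = ∅) (hrb : (𝓔 .rb).carrier = ∅)
    (hbf : (𝓔 .bf).carrier = ∅) (hsc : (𝓔 .sc).Ge (-((d : ℝ) + 1))) (hε : 0 < ε)
    (he : ∀ N s, ∀ H ≠ Face.sc, ∀ z ∈ (𝓔 H).carrier, orders τ lam mu N s H + ε < z.1.re)
    (h1 : 0 < lam + s) (h2 : 0 < mu - s) :
    G.SchurBound k₀ s τ Set.univ Set.univ (fun k z z' => ‖offDiag k₀ κ k z z'‖ₑ) := by
  classical
  have hoff : ∀ k z z', ‖offDiag k₀ κ k z z'‖ₑ ≤ ENNReal.ofReal ‖κ k z z'‖ := fun k z z' => by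
    rw [ofReal_norm]
    unfold offDiag
    split_ifs
    · exact le_rfl
    · simp
  obtain ⟨w, hs, hd⟩ := h
  refine SchurBound.of_pieces (fun φ P φ' P' hP hP' hor => ?_)
    fun ψ hψ L L₁ η hη hLc hLc₁ hL hL₁ hball r hr => ?_
  · obtain ⟨C, hC, hb⟩ := exists_le_sepSize_of_sepCoords hk₀ hP hP' (hs φ P φ' P' hP hP' hor)
      hlb hrb hbf hε he
    exact SchurBound.of_sepSize hP hP' hP.measurableSet hP'.measurableSet hC h1 h2
      fun k hk z hz z' hz' =>
        (hoff k z z').trans (ENNReal.ofReal_le_ofReal (hb k hk z hz z' hz'))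
  · obtain ⟨C, hC, hb⟩ := exists_le_diagSize_of_diagCoords hk₀ hr hψ hLc hL hη hball
      (hd ψ hψ L hLc hL r hr) hlb hrb hbf hsc hε he hL₁
    have hp : G.IsPiece (G.collarChart ψ) (G.collarSet r L₁) :=
      .collar ψ L₁ r hψ hLc₁ (hL₁.trans hL) hr
    set φ := G.collarChart ψ
    -- N₁ and N₂ dominate the kernel in the two alternatives of `exists_le_diagSize_of_diagCoords`;
    -- N₂ also records the support condition and z ≠ z' for `SchurBound.of_diag`.
    set N₁ : ℝ → X → X → ENNReal := fun k z z' =>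
      ENNReal.ofReal (C * sepSize τ lam mu k (G.x z) (G.x z')) with hN₁
    set N₂ : ℝ → X → X → ENNReal := fun k z z' => if z ≠ z' ∧ ‖φ z' - φ z‖ ≤ 1 then
      ENNReal.ofReal (C * diagSize d τ k (G.x z) ‖φ z' - φ z‖) else 0 with hN₂
    have b1 : G.SchurBound k₀ s τ (G.collarSet r L₁) (G.collarSet r L₁) N₁ :=
      SchurBound.of_sepSize hp hp hp.measurableSet hp.measurableSet hC h1 h2
        fun k hk z hz z' hz' => le_rfl
    have b2 : G.SchurBound k₀ s τ (G.collarSet r L₁) (G.collarSet r L₁) N₂ := by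
      refine SchurBound.of_diag (R := 1) (C := C) (Φ := fun v => (1 + |v|) ^ (-((d : ℝ) + 2)))
        (Λ := fun k x => k / x) hp hp.measurableSet hC (by fun_prop) (fun v => by positivity)
        ?_ lintegral_rpow_neg_ne_top (fun _ _ hk hx => div_pos hk hx) ?_ fun k hk z hz z' hz' hn => ?_
      · intro v hv w hw hvw
        have hv0 : 0 < v := hv
        have hw0 : 0 < w := hw
        exact Real.rpow_le_rpow_of_nonpos (by positivity)
          (by rw [abs_of_pos hv0, abs_of_pos hw0]; linarith) (by linarith [(d.cast_nonneg : (0 : ℝ) ≤ d)])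
      · intro k x x' B hk hx hx' hB hle
        rw [mul_div_assoc', div_le_div_iff₀ hx hx']
        nlinarith
      · have hcond : z ≠ z' ∧ ‖φ z' - φ z‖ ≤ 1 := by
          by_contra hc
          exact hn (if_neg hc)
        refine ⟨hcond.1, hcond.2, ?_⟩
        rw [hN₂]
        simp only [if_pos hcond]
        refine ENNReal.ofReal_le_ofReal (le_of_eq ?_)
        have := hk.1
        have := G.x_pos z
        rw [diagSize, abs_of_nonneg (by positivity)]
        congr 3
        exact_mod_cast Real.rpow_natCast (k / G.x z) (d + 1)
    have hx : Measurable G.x := G.x_smooth.continuous.measurable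
    refine (b1.add b2 (fun k _ z => ?_) fun k _ z' => ?_).mono hp.measurableSet hp.measurableSet
      fun k hk z hz z' hz' => ?_
    · simp only [hN₁]
      unfold sepSize
      fun_prop
    · simp only [hN₁]
      unfold sepSize
      fun_prop
    · rcases eq_or_ne z z' with rfl | hne
      · rw [show offDiag k₀ κ k z z = 0 from if_neg fun h => h.2 rfl]
        simp
      refine (hoff k z z').trans ?_
      rcases hb k hk z hz z' hz' with hb | ⟨hv, -, hb⟩
      · exact (ENNReal.ofReal_le_ofReal hb).trans le_self_add
      · refine le_add_of_nonneg_of_le zero_le ?_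
        simp only [hN₂]
        rw [if_pos ⟨hne, hv⟩]
        exact ENNReal.ofReal_le_ofReal hb

end AsymptoticallyConic
end LowEnergy
end

/-! ### The Schur test, and sums of kernels. -/

noncomputable section
namespace LowEnergy

open MeasureTheory

/-! ## The Schur test -/

/-- Write T f = (T^(1/p) w⁻¹ f)(T^(1/q) w). Hölder's inequality and the row bound leave w(z)^p times
an integral of T (w⁻¹ f)^p; exchanging the integrals, the column bound cancels the weights. -/
theorem lintegral_rpow_le_of_schur {X : Type*} [MeasurableSpace X] {μ : Measure X} [SFinite μ]
    {T : X → X → ENNReal} (hT : Measurable (Function.uncurry T)) {w f : X → ENNReal}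
    (hw : Measurable w) (hw0 : ∀ z, w z ≠ 0) (hw1 : ∀ z, w z ≠ ⊤) (hf : AEMeasurable f μ)
    {p q : ℝ} (hpq : p.HolderConjugate q) {C : ENNReal}
    (hrow : ∀ z, ∫⁻ z', T z z' * w z' ^ q ∂μ ≤ C * w z ^ q)
    (hcol : ∀ z', ∫⁻ z, T z z' * w z ^ p ∂μ ≤ C * w z' ^ p) :
    ∫⁻ z, (∫⁻ z', T z z' * f z' ∂μ) ^ p ∂μ ≤ C ^ p * ∫⁻ z, f z ^ p ∂μ := by
  have hp := hpq.pos
  have hq := hpq.symm.pos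
  have hT1 : ∀ z, Measurable (T z) := fun z => hT.comp measurable_prodMk_left
  have h1 : ∀ z, (∫⁻ z', T z z' * f z' ∂μ) ^ p ≤
      C ^ (p / q) * (w z ^ p * ∫⁻ z', T z z' * ((w z')⁻¹ * f z') ^ p ∂μ) := by
    intro z
    have hsplit : ∀ z', T z z' * f z' =
        (T z z' ^ (1 / p) * ((w z')⁻¹ * f z')) * (T z z' ^ (1 / q) * w z') := by
      intro z'
      have e1 : T z z' ^ (1 / p) * T z z' ^ (1 / q) = T z z' := by
        rw [← ENNReal.rpow_add_of_nonneg _ _ (by positivity) (by positivity), one_div, one_div,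
          hpq.inv_add_inv_eq_one, ENNReal.rpow_one]
      calc T z z' * f z' = (T z z' ^ (1 / p) * T z z' ^ (1 / q)) * ((w z')⁻¹ * w z') * f z' := by
            rw [e1, ENNReal.inv_mul_cancel (hw0 z') (hw1 z'), mul_one]
        _ = _ := by ring
    have hH := ENNReal.lintegral_mul_le_Lp_mul_Lq μ hpq
      (f := fun z' => T z z' ^ (1 / p) * ((w z')⁻¹ * f z'))
      (g := fun z' => T z z' ^ (1 / q) * w z')
      (((hT1 z).pow_const _).aemeasurable.mul (hw.inv.aemeasurable.mul hf))
      (((hT1 z).pow_const _).mul hw).aemeasurable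
    have hr : ∀ {r : ℝ}, 0 < r → ∀ z', (T z z' ^ (1 / r)) ^ r = T z z' := fun hr z' => by
      rw [← ENNReal.rpow_mul, one_div, inv_mul_cancel₀ hr.ne', ENNReal.rpow_one]
    have e2 : ∀ z', (T z z' ^ (1 / p) * ((w z')⁻¹ * f z')) ^ p =
        T z z' * ((w z')⁻¹ * f z') ^ p := fun z' => by
      rw [ENNReal.mul_rpow_of_nonneg _ _ hp.le, hr hp]
    have e3 : ∀ z', (T z z' ^ (1 / q) * w z') ^ q = T z z' * w z' ^ q := fun z' => by
      rw [ENNReal.mul_rpow_of_nonneg _ _ hq.le, hr hq]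
    simp only [Pi.mul_apply, ← hsplit, e2, e3] at hH
    calc (∫⁻ z', T z z' * f z' ∂μ) ^ p
        ≤ ((∫⁻ z', T z z' * ((w z')⁻¹ * f z') ^ p ∂μ) ^ (1 / p) *
          (C * w z ^ q) ^ (1 / q)) ^ p := by
          refine ENNReal.rpow_le_rpow (hH.trans ?_) hp.le
          gcongr
          exact hrow z
      _ = _ := by
          rw [ENNReal.mul_rpow_of_nonneg _ _ hp.le, ← ENNReal.rpow_mul, one_div,
            inv_mul_cancel₀ hp.ne', ENNReal.rpow_one, ← ENNReal.rpow_mul,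
            ENNReal.mul_rpow_of_nonneg _ _ (by positivity), ← ENNReal.rpow_mul]
          have : q * (1 / q * p) = p := by field_simp
          rw [this, one_div_mul_eq_div]
          ring
  calc ∫⁻ z, (∫⁻ z', T z z' * f z' ∂μ) ^ p ∂μ
      ≤ ∫⁻ z, C ^ (p / q) * (w z ^ p * ∫⁻ z', T z z' * ((w z')⁻¹ * f z') ^ p ∂μ) ∂μ :=
        lintegral_mono h1
    _ ≤ C ^ (p / q) * ∫⁻ z, (w z ^ p * ∫⁻ z', T z z' * ((w z')⁻¹ * f z') ^ p ∂μ) ∂μ := by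
        refine (lintegral_const_mul'' _ ?_).le
        refine (hw.pow_const p).aemeasurable.mul ?_
        refine AEMeasurable.lintegral_prod_right' (f := fun v : X × X =>
          T v.1 v.2 * ((w v.2)⁻¹ * f v.2) ^ p) ?_
        exact hT.aemeasurable.mul ((hw.inv.aemeasurable.mul hf).comp_snd.pow_const p)
    _ = C ^ (p / q) * ∫⁻ z', ((w z')⁻¹ * f z') ^ p * ∫⁻ z, T z z' * w z ^ p ∂μ ∂μ := by
        congr 1
        have e4 : ∀ z, w z ^ p * ∫⁻ z', T z z' * ((w z')⁻¹ * f z') ^ p ∂μ =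
            ∫⁻ z', w z ^ p * (T z z' * ((w z')⁻¹ * f z') ^ p) ∂μ := fun z =>
          (lintegral_const_mul'' _ ((hT1 z).aemeasurable.mul
            ((hw.inv.aemeasurable.mul hf).pow_const p))).symm
        simp only [e4]
        rw [lintegral_lintegral_swap]
        · refine lintegral_congr fun z' => ?_
          have hm : Measurable fun z => T z z' * w z ^ p :=
            Measurable.mul (hT.comp (measurable_prodMk_right : Measurable fun z : X => (z, z')))
              (hw.pow_const p)
          rw [← lintegral_const_mul _ hm]
          refine lintegral_congr fun z => ?_
          ring
        · exact (hw.comp measurable_fst).aemeasurable.pow_const p |>.mul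
            (hT.aemeasurable.mul ((hw.inv.aemeasurable.mul hf).comp_snd.pow_const p))
    _ ≤ C ^ (p / q) * ∫⁻ z', C * f z' ^ p ∂μ := by
        refine mul_le_mul_right (lintegral_mono fun z' => ?_) _
        calc _ ≤ ((w z')⁻¹ * f z') ^ p * (C * w z' ^ p) := by gcongr; exact hcol z'
          _ = C * (((w z')⁻¹ * w z') * f z') ^ p := by
              rw [mul_left_comm, ← ENNReal.mul_rpow_of_nonneg _ _ hp.le]
              congr 2
              ring
          _ = _ := by rw [ENNReal.inv_mul_cancel (hw0 z') (hw1 z'), one_mul]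
    _ = C ^ p * ∫⁻ z, f z ^ p ∂μ := by
        rw [lintegral_const_mul'' _ (hf.pow_const p), ← mul_assoc]
        congr 1
        conv_lhs => rw [← ENNReal.rpow_one C, ← ENNReal.rpow_mul,
          ← ENNReal.rpow_add_of_nonneg _ _ (by positivity) (by norm_num)]
        congr 1
        have := hpq.inv_add_inv_eq_one
        field_simp at this ⊢
        linarith

theorem lintegral_rpow_sub_one_ne_top {k₀ τ : ℝ} (hk₀ : 0 < k₀) (hτ : 0 < τ) :
    ∫⁻ k in Set.Ioo 0 k₀, ENNReal.ofReal (k ^ (τ - 1)) ≠ ⊤ := by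
  have h : IntegrableOn (fun k : ℝ => k ^ (τ - 1)) (Set.Ioo 0 k₀) :=
    ((intervalIntegrable_iff_integrableOn_Ioc_of_le hk₀.le).1
      (intervalIntegral.intervalIntegrable_rpow' (by linarith))).mono_set Set.Ioo_subset_Ioc_self
  exact h.lintegral_lt_top.ne

/-! ## Combining kernels -/

namespace AsymptoticallyConic

variable {d : ℕ} {X S : Type*}
  [TopologicalSpace X] [ChartedSpace (Model d) X] [IsManifold 𝓘(ℝ, Model d) ∞ X]
  [TopologicalSpace S] [ChartedSpace (EuclideanSpace ℝ (Fin d)) S]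
  [IsManifold 𝓘(ℝ, EuclideanSpace ℝ (Fin d)) ∞ S]
  {G : AsymptoticallyConic d X S} [MeasurableSpace X] {k₀ s τ : ℝ} {K K' : ℝ → X → X → ℂ}

/-- A measurable kernel with Schur bounds, off the diagonal. -/
def IsSchurKernel (G : AsymptoticallyConic d X S) (k₀ s τ : ℝ) (K : ℝ → X → X → ℂ) : Prop :=
  (Measurable fun q : ℝ × X × X => offDiag k₀ K q.1 q.2.1 q.2.2) ∧
    G.SchurBound k₀ s τ Set.univ Set.univ (fun k z z' => ‖offDiag k₀ K k z z'‖ₑ)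

theorem IsSchurKernel.congr (h : G.IsSchurKernel k₀ s τ K)
    (hK : ∀ k ∈ Set.Ioo 0 k₀, ∀ z z', z ≠ z' → K' k z z' = K k z z') :
    G.IsSchurKernel k₀ s τ K' := by
  have he : offDiag k₀ K' = offDiag k₀ K := by
    funext k z z'
    unfold offDiag
    split_ifs with hk
    · exact hK k hk.1 z z' hk.2
    · rfl
  unfold IsSchurKernel
  rwa [he]

theorem IsSchurKernel.add [BorelSpace X] (h : G.IsSchurKernel k₀ s τ K)
    (h' : G.IsSchurKernel k₀ s τ K') :
    G.IsSchurKernel k₀ s τ (fun k z z' => K k z z' + K' k z z') := by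
  have he : ∀ k z z', offDiag k₀ (fun k z z' => K k z z' + K' k z z') k z z' =
      offDiag k₀ K k z z' + offDiag k₀ K' k z z' := by
    intro k z z'
    unfold offDiag
    split_ifs <;> simp
  refine ⟨?_, ?_⟩
  · simp only [he]
    exact h.1.add h'.1
  · refine (h.2.add h'.2 (fun k _ z => ?_) fun k _ z' => ?_).mono MeasurableSet.univ
      MeasurableSet.univ fun k _ z _ z' _ => ?_
    · exact (h.1.comp (measurable_prodMk_left.comp measurable_prodMk_left :
        Measurable fun z' : X => (k, z, z'))).enorm
    · exact (h.1.comp (measurable_prodMk_left.comp measurable_prodMk_right :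
        Measurable fun z : X => (k, z, z'))).enorm
    · rw [he]
      exact enorm_add_le _ _

theorem IsSchurKernel.list_sum [BorelSpace X] (l : List (ℝ → X → X → ℂ))
    (h : ∀ κ ∈ l, G.IsSchurKernel k₀ s τ κ) :
    G.IsSchurKernel k₀ s τ (fun k z z' => (l.map fun κ => κ k z z').sum) := by
  induction l with
  | nil =>
    have he : offDiag k₀ (fun (_ : ℝ) (_ _ : X) => (0 : ℂ)) = fun _ _ _ => 0 := by
      funext k z z'
      simp [offDiag]
    simp only [List.map_nil, List.sum_nil]
    unfold IsSchurKernel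
    rw [he]
    exact ⟨measurable_const, 0, fun k _ => by simp⟩
  | cons κ l ih =>
    simp only [List.map_cons, List.sum_cons]
    exact (h κ (by simp)).add (ih fun κ' hκ' => h κ' (by simp [hκ']))

theorem IsInCalculus.isSchurKernel [T2Space X] [BorelSpace X] [T2Space S] [CompactSpace S]
    {a lam mu ε : ℝ} {𝓐 : Face → IndexSet} (h : G.IsInCalculus k₀ (-1) a 0 0 𝓐 K)
    (hk₀ : 0 < k₀) (hτ : τ ≤ 1) (hτa : τ ≤ 1 + a) (hsc : (𝓐 .sc).Ge 0) (hε : 0 < ε)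
    (he : ∀ N s, ∀ H ≠ Face.sc, ∀ z ∈ (𝓐 H).carrier, orders τ lam mu N s H + ε < z.1.re)
    (h1 : 0 < lam + s) (h2 : 0 < mu - s) : G.IsSchurKernel k₀ s τ K := by
  have := secondCountableTopology G
  obtain ⟨hbf, hlb, hrb, -, -, -, K₁, K₂, ⟨l, hl, hK₁⟩, hK₂, hK⟩ := h
  have i1 : G.IsSchurKernel k₀ s τ K₁ :=
    (IsSchurKernel.list_sum l fun κ hκ =>
      ⟨(hl κ hκ).measurable_offDiag, (hl κ hκ).schurBound hk₀ hτ hτa⟩).congr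
      fun k _ z z' _ => hK₁ k z z'
  have i2 : G.IsSchurKernel k₀ s τ K₂ := by
    refine ⟨hK₂.measurable_offDiag, hK₂.schurBound hk₀ ?_ ?_ ?_ ?_ hε (fun N s H hH => ?_) h1 h2⟩
    · simpa using hlb
    · simpa using hrb
    · simpa using hbf
    -- The index set of K₂ at `sc` is that of the half-density shifted by -n, so order at least 0
    -- becomes order at least -n, with the absence of logarithms preserved.
    · intro e he
      rw [Function.update_self] at he
      obtain ⟨h3, h4⟩ := hsc _ he
      simp only [Complex.sub_re, Complex.ofReal_re] at h3 h4
      exact ⟨by linarith, fun h5 => h4 (by linarith)⟩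
    · rw [Function.update_of_ne hH]
      exact he N s H hH
  exact (i1.add i2).congr hK

end AsymptoticallyConic
end LowEnergy
end

/-! ### From Schur bounds at fixed k to the integrated operator. -/

noncomputable section
namespace LowEnergy

open MeasureTheory

theorem measurable_comp_three {X Ω : Type*} [MeasurableSpace X] [MeasurableSpace Ω]
    (B : ℝ → X → X → ℂ) (h : Measurable fun q : ℝ × X × X => B q.1 q.2.1 q.2.2) {a : Ω → ℝ}
    {b c : Ω → X} (ha : Measurable a) (hb : Measurable b) (hc : Measurable c) :
    Measurable fun v => B (a v) (b v) (c v) :=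
  h.comp (ha.prodMk (hb.prodMk hc))

namespace AsymptoticallyConic

variable {d : ℕ} {X S : Type*}
  [TopologicalSpace X] [ChartedSpace (Model d) X] [IsManifold 𝓘(ℝ, Model d) ∞ X]
  [TopologicalSpace S] [ChartedSpace (EuclideanSpace ℝ (Fin d)) S]
  [IsManifold 𝓘(ℝ, EuclideanSpace ℝ (Fin d)) ∞ S]
  {G : AsymptoticallyConic d X S} {k₀ s τ : ℝ} {K : ℝ → X → X → ℂ}

/-! ## Boundedness of the integrated operator -/

theorem scKernel_offDiag_of_mem {k : ℝ} (hk : k ∈ Set.Ioo 0 k₀) {z z' : X} (h : z ≠ z') :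
    G.scKernel (offDiag k₀ K) k z z' = G.scKernel K k z z' := by
  rw [scKernel, scKernel, offDiag_of_mem hk h]

theorem enorm_scKernel (k : ℝ) (z z' : X) : ‖G.scKernel K k z z'‖ₑ =
    ‖K k z z'‖ₑ * ENNReal.ofReal ((G.x z * G.x z') ^ (((d : ℝ) + 1) / 2)) := by
  have := G.x_pos z
  have := G.x_pos z'
  rw [scKernel, enorm_mul, mul_comm]
  congr 1
  rw [← ofReal_norm, Complex.norm_real, Real.norm_of_nonneg (by positivity)]

variable [MeasurableSpace X]

theorem ae_ne [T2Space X] [BorelSpace X] [CompactSpace S] (G : AsymptoticallyConic d X S) (z : X) :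
    ∀ᵐ z' ∂G.vol, z ≠ z' := by
  rw [ae_iff]
  simpa [eq_comm] using vol_singleton (G := G) z

theorem op_offDiag [T2Space X] [BorelSpace X] [CompactSpace S] {k : ℝ} (hk : k ∈ Set.Ioo 0 k₀)
    (f : X → ℂ) (z : X) : G.op (offDiag k₀ K) k f z = G.op K k f z := by
  refine integral_congr_ae ?_
  filter_upwards [ae_ne G z] with z' hz'
  rw [scKernel_offDiag_of_mem hk hz']

/-- The Schur bounds for the kernel with respect to `dg`. -/
theorem SchurBound.exists_lintegral_le {e : ℝ}
    (h : G.SchurBound k₀ (((d : ℝ) + 1) / 2 - e) τ Set.univ Set.univ (fun k z z' => ‖K k z z'‖ₑ)) :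
    ∃ C : NNReal, ∀ k ∈ Set.Ioo 0 k₀,
      (∀ z, ∫⁻ z', ‖G.scKernel K k z z'‖ₑ * ENNReal.ofReal (G.x z' ^ e) ∂G.vol ≤
        C * ENNReal.ofReal (k ^ (τ - 1)) * ENNReal.ofReal (G.x z ^ e)) ∧
      (∀ z', ∫⁻ z, ‖G.scKernel K k z z'‖ₑ * ENNReal.ofReal (G.x z ^ ((d : ℝ) + 1 - e)) ∂G.vol ≤
        C * ENNReal.ofReal (k ^ (τ - 1)) * ENNReal.ofReal (G.x z' ^ ((d : ℝ) + 1 - e))) := by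
  obtain ⟨C, hC⟩ := h
  refine ⟨C, fun k hk => ⟨fun z => ?_, fun z' => ?_⟩⟩
  · have h1 := (hC k hk).1 z trivial
    rw [Measure.restrict_univ] at h1
    refine le_trans (le_of_eq ?_) (mul_le_mul_left h1 (ENNReal.ofReal (G.x z ^ e)))
    rw [← lintegral_mul_const' _ _ ENNReal.ofReal_ne_top]
    refine lintegral_congr fun z' => ?_
    have hx := G.x_pos z
    have hx' := G.x_pos z'
    rw [enorm_scKernel, mul_assoc, mul_assoc, mul_assoc, ← ENNReal.ofReal_mul (by positivity),
      ← ENNReal.ofReal_mul (by positivity), ← ENNReal.ofReal_mul (by positivity)]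
    congr 2
    -- The identity is (x x')^(n/2) x'^e = (x/x')^(n/2 - e) x'^n x^e, which explains the exponent s
    -- = n/2 - e.
    rw [Real.mul_rpow hx.le hx'.le, Real.div_rpow hx.le hx'.le, mul_assoc, ← Real.rpow_add hx',
      div_mul_eq_mul_div, mul_comm (G.x z' ^ ((d : ℝ) + 1)), ← mul_assoc, ← Real.rpow_add hx,
      mul_div_assoc, ← Real.rpow_sub hx']
    ring_nf
  · have h1 := (hC k hk).2 z' trivial
    rw [Measure.restrict_univ] at h1
    refine le_trans (le_of_eq ?_)
      (mul_le_mul_left h1 (ENNReal.ofReal (G.x z' ^ ((d : ℝ) + 1 - e))))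
    rw [← lintegral_mul_const' _ _ ENNReal.ofReal_ne_top]
    refine lintegral_congr fun z => ?_
    have hx := G.x_pos z
    have hx' := G.x_pos z'
    rw [enorm_scKernel, mul_assoc, mul_assoc, mul_assoc, ← ENNReal.ofReal_mul (by positivity),
      ← ENNReal.ofReal_mul (by positivity), ← ENNReal.ofReal_mul (by positivity)]
    congr 2
    rw [Real.mul_rpow hx.le hx'.le, Real.div_rpow hx.le hx'.le, mul_right_comm,
      ← Real.rpow_add hx, div_mul_eq_mul_div, ← mul_assoc, ← Real.rpow_add hx, mul_div_assoc,
      ← Real.rpow_sub hx']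
    ring_nf

theorem measurable_scKernel [BorelSpace X]
    (h : Measurable fun q : ℝ × X × X => K q.1 q.2.1 q.2.2) :
    Measurable fun q : ℝ × X × X => G.scKernel K q.1 q.2.1 q.2.2 := by
  have hx : Measurable G.x := G.x_smooth.continuous.measurable
  refine Measurable.mul (Complex.measurable_ofReal.comp ?_) h
  fun_prop

/-- The absolute integral of the kernel over `k`. -/
def totalKernel (G : AsymptoticallyConic d X S) (k₀ : ℝ) (K : ℝ → X → X → ℂ) (z z' : X) :
    ENNReal :=
  ∫⁻ k in Set.Ioo 0 k₀, ‖G.scKernel K k z z'‖ₑ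

theorem measurable_totalKernel [BorelSpace X]
    (h : Measurable fun q : ℝ × X × X => K q.1 q.2.1 q.2.2) :
    Measurable (Function.uncurry (G.totalKernel k₀ K)) := by
  refine Measurable.lintegral_prod_right (f := fun (v : X × X) (k : ℝ) =>
    ‖G.scKernel K k v.1 v.2‖ₑ) ?_
  exact (measurable_comp_three (G.scKernel K) (measurable_scKernel h) measurable_snd
    measurable_fst.fst measurable_fst.snd).enorm

/-- After exchanging the order of integration, the bounds at fixed k are integrated against k^(τ-1),
whose integral is finite because τ > 0. -/
theorem exists_totalKernel_le [BorelSpace X] [SFinite G.vol] {e : ℝ} (hk₀ : 0 < k₀) (hτ : 0 < τ)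
    (hm : Measurable fun q : ℝ × X × X => K q.1 q.2.1 q.2.2)
    (h : G.SchurBound k₀ (((d : ℝ) + 1) / 2 - e) τ Set.univ Set.univ (fun k z z' => ‖K k z z'‖ₑ)) :
    ∃ C : NNReal,
      (∀ z, ∫⁻ z', G.totalKernel k₀ K z z' * ENNReal.ofReal (G.x z' ^ e) ∂G.vol ≤
        C * ENNReal.ofReal (G.x z ^ e)) ∧
      (∀ z', ∫⁻ z, G.totalKernel k₀ K z z' * ENNReal.ofReal (G.x z ^ ((d : ℝ) + 1 - e)) ∂G.vol ≤
        C * ENNReal.ofReal (G.x z' ^ ((d : ℝ) + 1 - e))) := by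
  obtain ⟨C, hC⟩ := h.exists_lintegral_le
  set I := ∫⁻ k in Set.Ioo 0 k₀, ENNReal.ofReal (k ^ (τ - 1)) with hI
  have hItop : I ≠ ⊤ := lintegral_rpow_sub_one_ne_top hk₀ hτ
  have hx : Measurable G.x := G.x_smooth.continuous.measurable
  have hsc := measurable_scKernel (G := G) hm
  have hfin : ∀ {c : ENNReal}, c ≠ ⊤ → ∫⁻ k in Set.Ioo 0 k₀,
      (C : ENNReal) * ENNReal.ofReal (k ^ (τ - 1)) * c = (C * I.toNNReal : NNReal) * c := by
    intro c hc
    rw [lintegral_mul_const' _ _ hc, lintegral_const_mul' _ _ ENNReal.coe_ne_top]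
    push_cast
    rw [ENNReal.coe_toNNReal hItop]
  refine ⟨C * I.toNNReal, fun z => ?_, fun z' => ?_⟩
  · rw [← hfin ENNReal.ofReal_ne_top]
    calc _ = ∫⁻ z', (∫⁻ k in Set.Ioo 0 k₀,
          ‖G.scKernel K k z z'‖ₑ * ENNReal.ofReal (G.x z' ^ e)) ∂G.vol := by
          refine lintegral_congr fun z' => ?_
          exact (lintegral_mul_const' _ _ ENNReal.ofReal_ne_top).symm
      _ = ∫⁻ k in Set.Ioo 0 k₀, ∫⁻ z',
          ‖G.scKernel K k z z'‖ₑ * ENNReal.ofReal (G.x z' ^ e) ∂G.vol := by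
          refine lintegral_lintegral_swap ?_
          have : Measurable fun v : X × ℝ => G.scKernel K v.2 z v.1 :=
            measurable_comp_three (G.scKernel K) hsc measurable_snd measurable_const measurable_fst
          exact Measurable.aemeasurable (Measurable.mul this.enorm (by fun_prop))
      _ ≤ _ := setLIntegral_mono' measurableSet_Ioo fun k hk => (hC k hk).1 z
  · rw [← hfin ENNReal.ofReal_ne_top]
    calc _ = ∫⁻ z, (∫⁻ k in Set.Ioo 0 k₀,
          ‖G.scKernel K k z z'‖ₑ * ENNReal.ofReal (G.x z ^ ((d : ℝ) + 1 - e))) ∂G.vol := by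
          refine lintegral_congr fun z => ?_
          exact (lintegral_mul_const' _ _ ENNReal.ofReal_ne_top).symm
      _ = ∫⁻ k in Set.Ioo 0 k₀, ∫⁻ z,
          ‖G.scKernel K k z z'‖ₑ * ENNReal.ofReal (G.x z ^ ((d : ℝ) + 1 - e)) ∂G.vol := by
          refine lintegral_lintegral_swap ?_
          have : Measurable fun v : X × ℝ => G.scKernel K v.2 v.1 z' :=
            measurable_comp_three (G.scKernel K) hsc measurable_snd measurable_fst measurable_const
          exact Measurable.aemeasurable (Measurable.mul this.enorm (by fun_prop))
      _ ≤ _ := setLIntegral_mono' measurableSet_Ioo fun k hk => (hC k hk).2 z'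

/-- The weight w = x^(n/(pq)) has w^q = x^(n/p) and w^p = x^(n/q) = x^(n - n/p); these are the
powers in the row and column bounds for e = n/p. -/
theorem exists_lintegral_totalKernel_rpow_le [BorelSpace X] [SFinite G.vol] {p : ℝ} (hp : 1 < p)
    (hk₀ : 0 < k₀) (hτ : 0 < τ) (hm : Measurable fun q : ℝ × X × X => K q.1 q.2.1 q.2.2)
    (h : G.SchurBound k₀ (((d : ℝ) + 1) / 2 - ((d : ℝ) + 1) / p) τ Set.univ Set.univ
      (fun k z z' => ‖K k z z'‖ₑ)) :
    ∃ C : NNReal, ∀ f : X → ENNReal, AEMeasurable f G.vol →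
      ∫⁻ z, (∫⁻ z', G.totalKernel k₀ K z z' * f z' ∂G.vol) ^ p ∂G.vol ≤
        (C : ENNReal) ^ p * ∫⁻ z, f z ^ p ∂G.vol := by
  obtain ⟨C, hrow, hcol⟩ := exists_totalKernel_le hk₀ hτ hm h
  have hpq := Real.HolderConjugate.conjExponent hp
  set q := p.conjExponent
  have hp0 := hpq.pos
  have hq0 := hpq.symm.pos
  have hx : Measurable G.x := G.x_smooth.continuous.measurable
  refine ⟨C, fun f hf => lintegral_rpow_le_of_schur (measurable_totalKernel hm)
    (w := fun z => ENNReal.ofReal (G.x z ^ (((d : ℝ) + 1) / (p * q)))) (by fun_prop)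
    (fun z => ?_) (fun z => ENNReal.ofReal_ne_top) hf hpq ?_ ?_⟩
  · have := G.x_pos z
    exact (ENNReal.ofReal_pos.2 (by positivity)).ne'
  · have e1 : ∀ z, ENNReal.ofReal (G.x z ^ (((d : ℝ) + 1) / (p * q))) ^ q =
        ENNReal.ofReal (G.x z ^ (((d : ℝ) + 1) / p)) := fun z => by
      have := G.x_pos z
      rw [ENNReal.ofReal_rpow_of_nonneg (by positivity) hq0.le, ← Real.rpow_mul this.le]
      congr 2
      field_simp
    simpa only [e1] using hrow
  · have e1 : ∀ z, ENNReal.ofReal (G.x z ^ (((d : ℝ) + 1) / (p * q))) ^ p =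
        ENNReal.ofReal (G.x z ^ ((d : ℝ) + 1 - ((d : ℝ) + 1) / p)) := fun z => by
      have := G.x_pos z
      rw [ENNReal.ofReal_rpow_of_nonneg (by positivity) hp0.le, ← Real.rpow_mul this.le]
      congr 2
      have h1 := hpq.inv_add_inv_eq_one
      have h2 : ((d : ℝ) + 1) / (p * q) * p = ((d : ℝ) + 1) * q⁻¹ := by field_simp
      rw [h2, eq_sub_of_add_eq' h1]
      ring
    simpa only [e1] using hcol

theorem lintegral_lintegral_enorm [BorelSpace X] [SFinite G.vol] {f : X → ℂ}
    (hm : Measurable fun q : ℝ × X × X => K q.1 q.2.1 q.2.2)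
    (hf : AEStronglyMeasurable f G.vol) (z : X) :
    ∫⁻ k in Set.Ioo 0 k₀, ∫⁻ z', ‖G.scKernel K k z z' * f z'‖ₑ ∂G.vol =
      ∫⁻ z', G.totalKernel k₀ K z z' * ‖f z'‖ₑ ∂G.vol := by
  have : Measurable fun v : ℝ × X => G.scKernel K v.1 z v.2 :=
    measurable_comp_three (G.scKernel K) (measurable_scKernel hm) measurable_fst measurable_const
      measurable_snd
  rw [lintegral_lintegral_swap]
  · refine lintegral_congr fun z' => ?_
    simp only [enorm_mul]
    exact lintegral_mul_const' _ _ enorm_ne_top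
  · have h2 : AEStronglyMeasurable (fun v : ℝ × X => G.scKernel K v.1 z v.2 * f v.2)
        ((volume.restrict (Set.Ioo 0 k₀)).prod G.vol) :=
      this.aestronglyMeasurable.mul hf.comp_snd
    exact h2.enorm

theorem IsSchurKernel.exists_eLpNorm_le [T2Space X] [BorelSpace X] [CompactSpace S] {p : ℝ}
    (hp : 1 < p) (hk₀ : 0 < k₀) (hτ : 0 < τ)
    (h : G.IsSchurKernel k₀ (((d : ℝ) + 1) / 2 - ((d : ℝ) + 1) / p) τ K) :
    ∃ C : NNReal, ∀ f : X → ℂ, MemLp f (ENNReal.ofReal p) G.vol →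
      (∀ᵐ z ∂G.vol, Integrable (fun q : ℝ × X => G.scKernel K q.1 z q.2 * f q.2)
        ((volume.restrict (Set.Ioo 0 k₀)).prod G.vol)) ∧
      MemLp (fun z => ∫ k in (0 : ℝ)..k₀, G.op K k f z) (ENNReal.ofReal p) G.vol ∧
      eLpNorm (fun z => ∫ k in (0 : ℝ)..k₀, G.op K k f z) (ENNReal.ofReal p) G.vol
        ≤ C * eLpNorm f (ENNReal.ofReal p) G.vol := by
  have := sigmaFinite_vol G
  obtain ⟨hm, hS⟩ := h
  obtain ⟨C, hC⟩ := exists_lintegral_totalKernel_rpow_le hp hk₀ hτ hm hS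
  have hp0 : 0 < p := by linarith
  have hpE : ENNReal.ofReal p ≠ 0 := (ENNReal.ofReal_pos.2 hp0).ne'
  have hsc := measurable_scKernel (G := G) hm
  set B : ℝ → X → X → ℂ := G.scKernel (offDiag k₀ K) with hB
  refine ⟨C, fun f hf => ?_⟩
  have hfm := hf.1
  have hbound := hC (fun z => ‖f z‖ₑ) hfm.enorm
  have hnorm : ∀ g : X → ℂ, eLpNorm g (ENNReal.ofReal p) G.vol =
      (∫⁻ z, ‖g z‖ₑ ^ p ∂G.vol) ^ (1 / p) := fun g => by
    rw [eLpNorm_eq_lintegral_rpow_enorm_toReal hpE ENNReal.ofReal_ne_top,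
      ENNReal.toReal_ofReal hp0.le]
  have hfin : ∫⁻ z, ‖f z‖ₑ ^ p ∂G.vol ≠ ⊤ := by
    have h1 := hf.2
    rw [hnorm] at h1
    exact (ENNReal.rpow_lt_top_iff_of_pos (by positivity)).1 h1 |>.ne
  -- the operator in terms of the kernel off the diagonal
  have hF : ∀ z, ∫ k in (0 : ℝ)..k₀, G.op K k f z =
      ∫ k in Set.Ioo 0 k₀, ∫ z', B k z z' * f z' ∂G.vol := fun z => by
    rw [intervalIntegral.integral_of_le hk₀.le, integral_Ioc_eq_integral_Ioo]
    exact setIntegral_congr_fun measurableSet_Ioo fun k hk => (op_offDiag hk f z).symm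
  have hle : ∀ z, ‖∫ k in (0 : ℝ)..k₀, G.op K k f z‖ₑ ≤
      ∫⁻ z', G.totalKernel k₀ (offDiag k₀ K) z z' * ‖f z'‖ₑ ∂G.vol := fun z => by
    rw [hF, ← lintegral_lintegral_enorm hm hfm]
    exact (enorm_integral_le_lintegral_enorm _).trans
      (lintegral_mono fun k => enorm_integral_le_lintegral_enorm _)
  have hmeas : AEStronglyMeasurable (fun z => ∫ k in (0 : ℝ)..k₀, G.op K k f z) G.vol := by
    simp only [hF]
    -- Replacing f by a strongly measurable representative leaves the inner integrals unchanged and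
    -- makes the iterated integral measurable in z.
    obtain ⟨g, hg, hfg⟩ := hfm
    have hint : ∀ k z, ∫ z', B k z z' * f z' ∂G.vol = ∫ z', B k z z' * g z' ∂G.vol := fun k z =>
      integral_congr_ae (by filter_upwards [hfg] with z' hz'; rw [hz'])
    simp only [hint]
    refine StronglyMeasurable.aestronglyMeasurable ?_
    refine StronglyMeasurable.integral_prod_right (f := fun (z : X) (k : ℝ) =>
      ∫ z', B k z z' * g z' ∂G.vol) ?_
    refine StronglyMeasurable.integral_prod_right (f := fun (v : X × ℝ) (z' : X) =>
      B v.2 v.1 z' * g z') ?_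
    refine Measurable.stronglyMeasurable ?_
    exact Measurable.mul (measurable_comp_three B hsc measurable_fst.snd measurable_fst.fst
      measurable_snd) (hg.measurable.comp measurable_snd)
  have hn : eLpNorm (fun z => ∫ k in (0 : ℝ)..k₀, G.op K k f z) (ENNReal.ofReal p) G.vol
      ≤ C * eLpNorm f (ENNReal.ofReal p) G.vol := by
    rw [hnorm, hnorm]
    calc _ ≤ ((C : ENNReal) ^ p * ∫⁻ z, ‖f z‖ₑ ^ p ∂G.vol) ^ (1 / p) := by
          refine ENNReal.rpow_le_rpow ((lintegral_mono fun z => ?_).trans hbound) (by positivity)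
          exact ENNReal.rpow_le_rpow (hle z) hp0.le
      _ = _ := by
          rw [ENNReal.mul_rpow_of_nonneg _ _ (by positivity), ← ENNReal.rpow_mul,
            mul_one_div_cancel hp0.ne', ENNReal.rpow_one]
  refine ⟨?_, ⟨hmeas, hn.trans_lt (ENNReal.mul_lt_top ENNReal.coe_lt_top hf.2)⟩, hn⟩
  -- The Schur estimate already bounds the integral with absolute values, so its p-th power is
  -- integrable and hence finite almost everywhere; this is the asserted absolute convergence.
  have hlt : ∀ᵐ z ∂G.vol,
      (∫⁻ z', G.totalKernel k₀ (offDiag k₀ K) z z' * ‖f z'‖ₑ ∂G.vol) ^ p < ⊤ := by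
    refine ae_lt_top' ?_ (hbound.trans_lt (ENNReal.mul_lt_top
      (ENNReal.rpow_lt_top_of_nonneg hp0.le ENNReal.coe_ne_top) hfin.lt_top)).ne
    refine AEMeasurable.pow_const ?_ p
    refine AEMeasurable.lintegral_prod_right' (f := fun v : X × X =>
      G.totalKernel k₀ (offDiag k₀ K) v.1 v.2 * ‖f v.2‖ₑ) ?_
    exact (measurable_totalKernel hm).aemeasurable.mul hfm.enorm.comp_snd
  filter_upwards [hlt] with z hz
  rw [ENNReal.rpow_lt_top_iff_of_pos hp0, ← lintegral_lintegral_enorm hm hfm] at hz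
  have hBz : Measurable fun v : ℝ × X => B v.1 z v.2 :=
    measurable_comp_three B hsc measurable_fst measurable_const measurable_snd
  have hBf : AEStronglyMeasurable (fun v : ℝ × X => B v.1 z v.2 * f v.2)
      ((volume.restrict (Set.Ioo 0 k₀)).prod G.vol) :=
    hBz.aestronglyMeasurable.mul hfm.comp_snd
  have hint : Integrable (fun v : ℝ × X => B v.1 z v.2 * f v.2)
      ((volume.restrict (Set.Ioo 0 k₀)).prod G.vol) := by
    refine ⟨hBf, ?_⟩
    rw [hasFiniteIntegral_iff_enorm, lintegral_prod _ hBf.enorm]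
    exact hz
  refine hint.congr ?_
  have a1 : ∀ᵐ v ∂((volume.restrict (Set.Ioo 0 k₀)).prod G.vol), v.1 ∈ Set.Ioo 0 k₀ :=
    Measure.quasiMeasurePreserving_fst.ae (ae_restrict_mem measurableSet_Ioo)
  have a2 : ∀ᵐ v ∂((volume.restrict (Set.Ioo 0 k₀)).prod G.vol), z ≠ v.2 :=
    Measure.quasiMeasurePreserving_snd.ae (ae_ne G z)
  filter_upwards [a1, a2] with v h1 h2
  rw [hB, scKernel_offDiag_of_mem h1 h2]

end AsymptoticallyConic
end LowEnergy
end

theorem mainTheorem5 (d : ℕ) {X S : Type*}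
    [TopologicalSpace X] [T2Space X] [ChartedSpace (LowEnergy.Model d) X]
    [IsManifold 𝓘(ℝ, LowEnergy.Model d) ∞ X] [MeasurableSpace X] [BorelSpace X]
    [TopologicalSpace S] [T2Space S] [CompactSpace S]
    [ChartedSpace (EuclideanSpace ℝ (Fin d)) S]
    [IsManifold 𝓘(ℝ, EuclideanSpace ℝ (Fin d)) ∞ S]
    (G : LowEnergy.AsymptoticallyConic d X S) (k₀ : ℝ) (hk₀ : 0 < k₀)
    (α β : ℝ) (hα : 0 < α) (hβ : 0 < β) (hβn : β < (d : ℝ) + 1)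
    (a : ℝ) (𝓐 : LowEnergy.Face → LowEnergy.IndexSet) (A : ℝ → X → X → ℂ)
    (hA : G.IsInCalculus k₀ (-1) a 0 0 𝓐 A)
    (hbf0 : (𝓐 .bf0).Gt (-1)) (hsc : (𝓐 .sc).Ge 0) (hzf : (𝓐 .zf).Gt (-1))
    (hrb0 : (𝓐 .rb0).Ge (((d : ℝ) + 1) / 2 - 1 - α))
    (hlb0 : (𝓐 .lb0).Ge (((d : ℝ) + 1) / 2 - 1 - β))
    (p : ℝ) (hp1 : ((d : ℝ) + 1) / ((d : ℝ) + 1 - β) < p) (hp2 : p < ((d : ℝ) + 1) / α) :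
    ∃ C : NNReal, ∀ f : X → ℂ, MeasureTheory.MemLp f (ENNReal.ofReal p) G.vol →
      (∀ᵐ z ∂G.vol, MeasureTheory.Integrable
        (fun q : ℝ × X => G.scKernel A q.1 z q.2 * f q.2)
        ((MeasureTheory.volume.restrict (Set.Ioo 0 k₀)).prod G.vol)) ∧
      MeasureTheory.MemLp (fun z => ∫ k in (0 : ℝ)..k₀, G.op A k f z) (ENNReal.ofReal p) G.vol ∧
      MeasureTheory.eLpNorm (fun z => ∫ k in (0 : ℝ)..k₀, G.op A k f z)
          (ENNReal.ofReal p) G.vol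
        ≤ C * MeasureTheory.eLpNorm f (ENNReal.ofReal p) G.vol := by
  have hn : (0 : ℝ) < (d : ℝ) + 1 := by positivity
  have hnβ : 0 < (d : ℝ) + 1 - β := by linarith
  have hp : 1 < p := by
    refine lt_trans ?_ hp1
    rw [one_lt_div hnβ]
    linarith
  have hp0 : 0 < p := by linarith
  -- In terms of e = n/p the range of p reads α < e < n - β.
  set e := ((d : ℝ) + 1) / p with he
  have he1 : α < e := by
    rw [lt_div_iff₀ hα] at hp2
    rw [he, lt_div_iff₀ hp0]
    linarith
  have he2 : e < (d : ℝ) + 1 - β := by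
    rw [div_lt_iff₀ hnβ] at hp1
    rw [he, div_lt_iff₀ hp0]
    linarith
  obtain ⟨ε₀, hε₀, hbf0⟩ := hbf0
  obtain ⟨ε₁, hε₁, hzf⟩ := hzf
  have ha : -1 + ε₀ ≤ a := by
    have h1 := (hbf0 _ (hA.2.2.2.1 ⟨0, rfl⟩)).1
    simpa using h1
  obtain ⟨hbf, hlb, hrb, -⟩ := id hA
  -- Half of each gap is spent on lowering lam and mu below the critical orders, and half remains:
  -- lam + s = δ₁ and mu - s = δ₂.
  set δ₁ := ((d : ℝ) + 1 - e - β) / 2 with hδ₁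
  set δ₂ := (e - α) / 2 with hδ₂
  have hδ₁0 : 0 < δ₁ := by rw [hδ₁]; linarith
  have hδ₂0 : 0 < δ₂ := by rw [hδ₂]; linarith
  obtain ⟨m, hm0, hm1, hmε₀, hmε₁, hmδ₁, hmδ₂⟩ :
      ∃ m : ℝ, 0 < m ∧ m ≤ 1 ∧ m ≤ ε₀ ∧ m ≤ ε₁ ∧ m ≤ δ₁ ∧ m ≤ δ₂ :=
    ⟨min 1 (min ε₀ (min ε₁ (min δ₁ δ₂))), by positivity, by simp, by simp, by simp, by simp,
      by simp⟩
  -- τ and the loss ε are both m/3, so together they use 2m/3 < m, which is strictly less than the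
  -- room available at each of `zf`, `bf0`, `lb0` and `rb0`.
  have hK : G.IsSchurKernel k₀ (((d : ℝ) + 1) / 2 - e) (m / 3) A := by
    refine hA.isSchurKernel (lam := ((d : ℝ) + 1) / 2 - (β + δ₁))
      (mu := ((d : ℝ) + 1) / 2 - (α + δ₂)) (ε := m / 3) hk₀ (by linarith) (by linarith) hsc
      (by positivity) (fun N s H hH z hz => ?_) (by linarith) (by linarith)
    cases H with
    | zf => have := (hzf z hz).1; simp only [LowEnergy.orders]; linarith
    | bf0 => have := (hbf0 z hz).1; simp only [LowEnergy.orders]; linarith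
    | lb0 => have := (hlb0 z hz).1; simp only [LowEnergy.orders]; linarith
    | rb0 => have := (hrb0 z hz).1; simp only [LowEnergy.orders]; linarith
    | lb => rw [hlb] at hz; exact hz.elim
    | rb => rw [hrb] at hz; exact hz.elim
    | bf => rw [hbf] at hz; exact hz.elim
    | sc => exact absurd rfl hH
  exact hK.exists_eLpNorm_le hp hk₀ (by positivity)
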